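/- All manifolds, maps and tensor fields are smooth. Let $m\ge 1$, let $(M^m,g)$ be a Riemannian manifold and let $(C^{m+1},h)$ be a conformally flat space: $C$ is covered by the domains $U_k$ of charts $\psi_k:U_k\to\mathbb R^{m+1}$ with smooth functions (conformal factors) $\sigma_k:U_k\to\mathbb R$ such that $h=e^{-2\sigma_k}\bar h$ on $U_k$, where the flat metric $\bar h=\psi_k^*\langle\cdot,\cdot\rangle$ is the pull-back of the Euclidean metric. Let $\varphi:(M^m,g)\to(C^{m+1},h)$ be an isometric immersion, let $\{V_i\}$ be an open cover of $M$, let $\xi_i$ be a smooth unit normal vector field along $\varphi$ on $V_i$, and let $H_i$ be the mean curvature function on $V_i$, i.e. the mean curvature vector $\eta=\frac1m\operatorname{Trace}_g\nabla d\varphi$ equals $H_i\xi_i$ on $V_i$. (If the hypersurface has a global unit normal field $\xi$, or if $h=e^{-2\sigma}\bar h$ with a globally defined $\sigma$ and a flat metric $\bar h$, one may take all $\xi_i=\xi$, or all $\sigma_k=\sigma$.) The map $\varphi$ is called biharmonic if for every compact $\Omega\subset M$ it is a critical point of the bienergy $E^2(\varphi,\Omega)=\frac12\int_\Omega|\tau(\varphi)|^2\,dv_g$,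 where $\tau(\varphi)=\operatorname{Trace}_g\nabla d\varphi$ is the tension field: $\frac{d}{dt}\big|_{t=0}E^2(\varphi_t,\Omega)=0$ for every smooth variation $(\varphi_t)_{t\in\mathbb R}$ of $\varphi_0=\varphi$ with $\varphi_t=\varphi$ outside $\Omega$. Then $\varphi$ is biharmonic if and only if, for all $i,k$, with $\xi=\xi_i$, $H=H_i$, $\sigma=\sigma_k$, the following two equations hold at every point of $V_i\cap\varphi^{-1}(U_k)$: $$\Delta^M H-H|A|^2+H\left\{\Delta_h\sigma+(m-1)\left[\operatorname{Hess}_h(\sigma)(\xi,\xi)-(\xi\sigma)^2+|\operatorname{grad}_h\sigma|_h^2\right]\right\}=0,$$ $$2A(\operatorname{grad}_gH)+\frac m2\operatorname{grad}_gH^2-2(m-1)H\left[\operatorname{grad}_g(\xi\sigma)-(\xi\sigma)\operatorname{grad}_g\sigma+A(\operatorname{grad}_g\sigma)\right]=0.$$ Here $A$ is the shape operator with respect to $\xi$, $g(Av,w)=-h(\nabla^\varphi_v\xi,d\varphi(w))$, where $\nabla^\varphi$ is the pull-back of the Levi-Civita connection of $h$; $\operatorname{grad}_h,\operatorname{Hess}_h,\Delta_h=\operatorname{Trace}_h\operatorname{Hess}_h$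 are the gradient, Hessian and Laplacian of $(C,h)$; $\operatorname{grad}_g,\Delta^M=\operatorname{Trace}_g\operatorname{Hess}_g$ those of $(M,g)$; and $\operatorname{grad}_g\sigma$ means $\operatorname{grad}_g(\sigma\circ\varphi)$. -/

import Mathlib

open scoped Manifold ContDiff
open MeasureTheory

noncomputable section

namespace HypersurfaceGeometry

/-- A smooth Riemannian metric on an `m`-dimensional smooth manifold. -/
abbrev SmoothMetric (m : ℕ) (M : Type*) [TopologicalSpace M]
    [ChartedSpace (EuclideanSpace ℝ (Fin m)) M] [IsManifold (𝓡 m) ∞ M] :=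
  Bundle.ContMDiffRiemannianMetric (𝓡 m) ∞ (EuclideanSpace ℝ (Fin m))
    (fun x : M => TangentSpace (𝓡 m) x)

section OneManifold

variable {m : ℕ} {M : Type*} [TopologicalSpace M]
  [ChartedSpace (EuclideanSpace ℝ (Fin m)) M] [IsManifold (𝓡 m) ∞ M]

/-- The metric at `p` as a bilinear form on `T_pM`. -/
def bilin (g : SmoothMetric m M) (p : M) :
    LinearMap.BilinForm ℝ (TangentSpace (𝓡 m) p) :=
  LinearMap.mk₂ ℝ (fun v w => g.inner p v w)
    (fun _ _ _ => by simp) (fun _ _ _ => by simp) (fun _ _ _ => by simp) (fun _ _ _ => by simp)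

theorem bilin_nondegenerate (g : SmoothMetric m M) (p : M) : (bilin g p).Nondegenerate := by
  constructor
  · intro v hv
    by_contra hne
    exact (g.pos p v hne).ne' (hv v)
  · intro v hv
    by_contra hne
    exact (g.pos p v hne).ne' (hv v)

instance finiteDimensional_tangentSpace (p : M) :
    FiniteDimensional ℝ (TangentSpace (𝓡 m) p) :=
  inferInstanceAs (FiniteDimensional ℝ (EuclideanSpace ℝ (Fin m)))

/-- Musical isomorphism: `sharp g p ℓ` is the vector with `g(sharp ℓ, w) = ℓ w` for all `w`. -/
def sharp (g : SmoothMetric m M) (p : M) (l : TangentSpace (𝓡 m) p →L[ℝ] ℝ) :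
    TangentSpace (𝓡 m) p :=
  ((bilin g p).toDual (bilin_nondegenerate g p)).symm l.toLinearMap

theorem inner_sharp (g : SmoothMetric m M) (p : M) (l : TangentSpace (𝓡 m) p →L[ℝ] ℝ)
    (w : TangentSpace (𝓡 m) p) : g.inner p (sharp g p l) w = l w :=
  LinearMap.BilinForm.apply_toDual_symm_apply (hB := bilin_nondegenerate g p) l.toLinearMap w

/-- The coordinate frame of the preferred chart at `p`: `coordFrame p y u = ∑ i, u_i ∂_i|_y`. -/
def coordFrame (p y : M) : EuclideanSpace ℝ (Fin m) →L[ℝ] TangentSpace (𝓡 m) y :=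
  (trivializationAt (EuclideanSpace ℝ (Fin m)) (TangentSpace (𝓡 m)) p).symmL ℝ y

/-- Components of tangent vectors at `y` in the coordinate frame of the preferred chart at `p`. -/
def coords (p y : M) : TangentSpace (𝓡 m) y →L[ℝ] EuclideanSpace ℝ (Fin m) :=
  (trivializationAt (EuclideanSpace ℝ (Fin m)) (TangentSpace (𝓡 m)) p).continuousLinearMapAt ℝ y

/-- Trace over `T_pM` with respect to the metric: `∑ i j, g^{ij} B(∂_i, ∂_j)`, with the `∂_i` the
coordinate vectors at `p` of the preferred chart at `p` and `sharp (dx^i) = ∑ j, g^{ij} ∂_j`. -/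
def metricTrace {W : Type*} [AddCommGroup W] (g : SmoothMetric m M) (p : M)
    (B : TangentSpace (𝓡 m) p → TangentSpace (𝓡 m) p → W) : W :=
  ∑ i : Fin m, B (coordFrame p p (EuclideanSpace.single i 1))
    (sharp g p ((EuclideanSpace.proj i : EuclideanSpace ℝ (Fin m) →L[ℝ] ℝ).comp (coords p p)))

/-- The components `g_{ij}(y)` of the metric in the preferred chart at `p`, as a bilinear form. -/
def metricInCoords (g : SmoothMetric m M) (p y : M) :
    EuclideanSpace ℝ (Fin m) →L[ℝ] EuclideanSpace ℝ (Fin m) →L[ℝ] ℝ :=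
  (ContinuousLinearMap.precomp ℝ (coordFrame p y)).comp ((g.inner y).comp (coordFrame p y))

/-- First derivatives at `p` of the metric components: for a tangent vector `u` at `p`,
`metricDeriv g p u a b = ∑ j k, a_j b_k u(g_{jk})`. -/
def metricDeriv (g : SmoothMetric m M) (p : M) :
    TangentSpace (𝓡 m) p →L[ℝ] EuclideanSpace ℝ (Fin m) →L[ℝ]
      EuclideanSpace ℝ (Fin m) →L[ℝ] ℝ :=
  mvfderiv (𝓡 m) (fun y : M => metricInCoords g p y) p

/-- The linear form `w ↦ (∂_u g(v, w) + ∂_v g(u, w) - ∂_w g(u, v)) / 2` on `T_pM`, in the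
preferred chart at `p`. -/
def koszulForm (g : SmoothMetric m M) (p : M) (u v : TangentSpace (𝓡 m) p) :
    TangentSpace (𝓡 m) p →L[ℝ] ℝ :=
  (1 / 2 : ℝ) • ((metricDeriv g p u (coords p p v)).comp (coords p p)
    + (metricDeriv g p v (coords p p u)).comp (coords p p)
    - (ContinuousLinearMap.apply ℝ ℝ (coords p p v)).comp
        ((ContinuousLinearMap.apply ℝ (EuclideanSpace ℝ (Fin m) →L[ℝ] ℝ) (coords p p u)).comp
          (metricDeriv g p)))

/-- Christoffel symbols at `p` of the Levi-Civita connection, in the preferred chart at `p`: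
`christoffel g p u v = ∑ i j k, u^i v^j Γ^k_{ij} ∂_k`. -/
def christoffel (g : SmoothMetric m M) (p : M) (u v : TangentSpace (𝓡 m) p) :
    TangentSpace (𝓡 m) p :=
  sharp g p (koszulForm g p u v)

/-- The Riemannian volume of the domain of the preferred chart at `p`: the measure
`√(det g_{ij}) dx^1 ⋯ dx^m`, transported to `M`. -/
def chartVolume [MeasurableSpace M] (g : SmoothMetric m M) (p : M) : Measure M :=
  ((volume.restrict (chartAt (EuclideanSpace ℝ (Fin m)) p).target).withDensity
    (fun u => ENNReal.ofReal (Real.sqrt (Matrix.of fun i j : Fin m =>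
      metricInCoords g p ((chartAt (EuclideanSpace ℝ (Fin m)) p).symm u)
        (EuclideanSpace.single i 1) (EuclideanSpace.single j 1)).det))).map
    (chartAt (EuclideanSpace ℝ (Fin m)) p).symm

/-- The Riemannian volume measure. The measures `chartVolume g p` agree on overlaps of chart
domains, so the smallest measure above all of them is the one that restricts to each of them. -/
def riemannianVolume [MeasurableSpace M] (g : SmoothMetric m M) : Measure M :=
  ⨆ p : M, chartVolume g p

/-- The gradient of a function. -/
def grad (g : SmoothMetric m M) (f : M → ℝ) (p : M) : TangentSpace (𝓡 m) p :=
  sharp g p (mvfderiv (𝓡 m) f p)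

end OneManifold

section TwoManifolds

variable {m n : ℕ} {M N : Type*} [TopologicalSpace M] [TopologicalSpace N]
  [ChartedSpace (EuclideanSpace ℝ (Fin m)) M] [IsManifold (𝓡 m) ∞ M]
  [ChartedSpace (EuclideanSpace ℝ (Fin n)) N] [IsManifold (𝓡 n) ∞ N]

/-- The covariant derivative `∇^φ_v V` at `x` of a vector field `V` along `φ : M → N`, for the
pull-back by `φ` of the Levi-Civita connection of `(N, h)`. In the preferred chart at `φ x`,
`(∇^φ_v V)^k = v(V^k) + Γ^k_{ij} (dφ v)^i V^j`. -/
def covAlong (h : SmoothMetric n N) (φ : M → N) (V : (x : M) → TangentSpace (𝓡 n) (φ x))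
    (x : M) (v : TangentSpace (𝓡 m) x) : TangentSpace (𝓡 n) (φ x) :=
  coordFrame (φ x) (φ x) (mvfderiv (𝓡 m) (fun y : M => coords (φ x) (φ y) (V y)) x v)
    + christoffel h (φ x) (mfderiv (𝓡 m) (𝓡 n) φ x v) (V x)

/-- The Levi-Civita covariant derivative `∇_v X` at `p`. -/
def leviCivita (h : SmoothMetric n N) (X : (p : N) → TangentSpace (𝓡 n) p)
    (p : N) (v : TangentSpace (𝓡 n) p) : TangentSpace (𝓡 n) p :=
  covAlong h (id : N → N) X p v

/-- The Hessian `Hess f (v, w) = h(∇_v grad f, w)`. -/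
def hess (h : SmoothMetric n N) (f : N → ℝ) (p : N) (v w : TangentSpace (𝓡 n) p) : ℝ :=
  h.inner p (leviCivita h (grad h f) p v) w

/-- The Laplacian, the trace of the Hessian. -/
def laplacian (h : SmoothMetric n N) (f : N → ℝ) (p : N) : ℝ :=
  metricTrace h p (hess h f p)

/-- The second fundamental form `∇dφ(v, w) = ∇^φ_v (dφ(W)) - dφ(∇_v W)` of a map at `x`, where
`W` is the field with `W x = w` that has constant components in the preferred chart at `x`. -/
def secondFundamentalForm (g : SmoothMetric m M) (h : SmoothMetric n N) (φ : M → N) (x : M)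
    (v w : TangentSpace (𝓡 m) x) : TangentSpace (𝓡 n) (φ x) :=
  covAlong h φ (fun y => mfderiv (𝓡 m) (𝓡 n) φ y (coordFrame x y (coords x x w))) x v
    - mfderiv (𝓡 m) (𝓡 n) φ x (leviCivita g (fun y => coordFrame x y (coords x x w)) x v)

/-- The tension field `τ(φ) = Trace_g ∇dφ`. -/
def tension (g : SmoothMetric m M) (h : SmoothMetric n N) (φ : M → N) (x : M) :
    TangentSpace (𝓡 n) (φ x) :=
  metricTrace g x (secondFundamentalForm g h φ x)

/-- The bienergy `E²(φ, Ω) = (1/2) ∫_Ω |τ(φ)|² dv_g`. -/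
def bienergy [MeasurableSpace M] (g : SmoothMetric m M) (h : SmoothMetric n N) (φ : M → N)
    (Ω : Set M) : ℝ :=
  (1 / 2) * ∫ x in Ω, h.inner (φ x) (tension g h φ x) (tension g h φ x) ∂(riemannianVolume g)

/-- `φ` is biharmonic: for every compact `Ω`, it is a critical point of the bienergy on `Ω` under
all smooth variations `Φ_t` of `φ` that are supported in `Ω`. -/
def IsBiharmonic [MeasurableSpace M] (g : SmoothMetric m M) (h : SmoothMetric n N)
    (φ : M → N) : Prop :=
  ∀ (Ω : Set M) (Φ : ℝ → M → N), IsCompact Ω →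
    ContMDiff (𝓘(ℝ, ℝ).prod (𝓡 m)) (𝓡 n) ∞ (fun p : ℝ × M => Φ p.1 p.2) →
    Φ 0 = φ → (∀ t, ∀ x ∉ Ω, Φ t x = φ x) →
    HasDerivAt (fun t => bienergy g h (Φ t) Ω) 0 0

/-- `φ : (M, g) → (N, h)` is a smooth isometric immersion. -/
structure IsIsometricImmersion (g : SmoothMetric m M) (h : SmoothMetric n N)
    (φ : M → N) : Prop where
  contMDiff : ContMDiff (𝓡 m) (𝓡 n) ∞ φ
  inner_mfderiv : ∀ (x : M) (v w : TangentSpace (𝓡 m) x),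
    h.inner (φ x) (mfderiv (𝓡 m) (𝓡 n) φ x v) (mfderiv (𝓡 m) (𝓡 n) φ x w) = g.inner x v w

/-- `ξ` is, on the set `V`, a smooth unit normal vector field along `φ`. -/
structure IsUnitNormalOn (h : SmoothMetric n N) (φ : M → N) (V : Set M)
    (ξ : (x : M) → TangentSpace (𝓡 n) (φ x)) : Prop where
  contMDiffOn : ContMDiffOn (𝓡 m) (𝓡 n).tangent ∞
    (fun x => (⟨φ x, ξ x⟩ : TangentBundle (𝓡 n) N)) V
  unit : ∀ x ∈ V, h.inner (φ x) (ξ x) (ξ x) = 1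
  normal : ∀ x ∈ V, ∀ v : TangentSpace (𝓡 m) x,
    h.inner (φ x) (ξ x) (mfderiv (𝓡 m) (𝓡 n) φ x v) = 0

/-- The mean curvature vector `η = (1/m) Trace_g B` of an isometric immersion, whose second
fundamental form `B` is `∇dφ`. -/
def meanCurvatureVector (g : SmoothMetric m M) (h : SmoothMetric n N) (φ : M → N) (x : M) :
    TangentSpace (𝓡 n) (φ x) :=
  (1 / (m : ℝ)) • metricTrace g x (secondFundamentalForm g h φ x)

/-- The shape operator with respect to `ξ`, `dφ(A v) = -(∇^φ_v ξ)^⊤`, that is,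
`g(A v, w) = -h(∇^φ_v ξ, dφ w)`. -/
def shapeOperator (g : SmoothMetric m M) (h : SmoothMetric n N) (φ : M → N)
    (ξ : (x : M) → TangentSpace (𝓡 n) (φ x)) (x : M) (v : TangentSpace (𝓡 m) x) :
    TangentSpace (𝓡 m) x :=
  sharp g x (-((h.inner (φ x) (covAlong h φ ξ x v)).comp (mfderiv (𝓡 m) (𝓡 n) φ x)))

/-- The squared norm `|A|²` of the shape operator. -/
def shapeNormSq (g : SmoothMetric m M) (h : SmoothMetric n N) (φ : M → N)
    (ξ : (x : M) → TangentSpace (𝓡 n) (φ x)) (x : M) : ℝ :=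
  metricTrace g x fun v w =>
    g.inner x (shapeOperator g h φ ξ x v) (shapeOperator g h φ ξ x w)

/-- The function `ξσ` on the hypersurface. -/
def normalDeriv (φ : M → N) (ξ : (x : M) → TangentSpace (𝓡 n) (φ x)) (σ : N → ℝ) (x : M) : ℝ :=
  mvfderiv (𝓡 n) σ (φ x) (ξ x)

/-- `ψ` is a conformally flat chart of `(N, h)` with conformal factor `σ`: on its domain,
`h = e^{-2σ} h̄`, where the flat metric `h̄` is the pull-back by `ψ` of the Euclidean metric. -/
structure IsConformallyFlatChart (h : SmoothMetric n N)
    (ψ : OpenPartialHomeomorph N (EuclideanSpace ℝ (Fin n))) (σ : N → ℝ) : Prop where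
  mem_maximalAtlas : ψ ∈ IsManifold.maximalAtlas (𝓡 n) ∞ N
  contMDiffOn : ContMDiffOn (𝓡 n) 𝓘(ℝ, ℝ) ∞ σ ψ.source
  inner_eq : ∀ q ∈ ψ.source, ∀ v w : TangentSpace (𝓡 n) q,
    h.inner q v w = Real.exp (-2 * σ q) *
      inner ℝ (mvfderiv (𝓡 n) ψ q v) (mvfderiv (𝓡 n) ψ q w)

end TwoManifolds

end HypersurfaceGeometry

end

/-! The bitension field is computed in charts. Let f be φ in charts, e^{-2s}⟨·,·⟩ the metric h,
g^{ij} the inverse of g and w = √det g. In divergence form the tension field is wτ = ∇_i(w g^{ij}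
∂_j f). Along a variation, ∂_t kills w and g^{ij}, ∇_t ∂_j f = ∇_j V for the variation field V = ∂_t
f, and exchanging ∇_t and ∇_i costs a curvature term. Moving derivatives from V to τ shows that w
∂_t(½|τ|²) is a divergence plus ⟨V, ∇_i(w g^{ij} ∇_j τ)⟩ + w g^{ij}⟨R(V, ∂_i f)∂_j f, τ⟩
(`first_variation_tension`). The last two terms are the Euler-Lagrange form `bitensionForm`.

For a hypersurface τ = mHξ. The rough Laplacian of Hξ is split along ξ and the tangent space: the
normal part of that of ξ is -|A|², and by the Codazzi equation its tangential part is -m grad H plus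
a Ricci term (`metric_laplacian_normal_normal`, `metric_laplacian_normal_partial`). Conformal
flatness enters through the curvature: it is the Kulkarni-Nomizu product of the Euclidean metric
with S = D²s + ds⊗ds - ½|∇s|²⟨·,·⟩ (`inner_curvCoord_confGamma`). Because R(v, ξ, ξ, ξ) = 0,
tangential traces of the curvature are full traces, which S determines. Translating S(ξ, ξ), its
trace and S(∂_k f, ξ) into Hess_h σ, Δ_h σ, grad_h σ, ξσ and A gives m times the first equation in
the direction ξ and -m times the second in tangential directions (`bitensionForm_normalPart`,
`bitensionForm_tangentialPart`). Since ξ and the ∂_k f span, the form vanishes exactly when both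
equations hold (`bitensionForm_eq_zero_iff`).

It remains to compare biharmonicity with the vanishing of the form. The t-derivative of the energy
density is integrated over a compact Ω with a finite family ρ_j whose sum is 1 on Ω and at most 1
everywhere. If X is the boundary current, then ρ_j div X = div(ρ_j X) - X·dρ_j. At each point of Ω
the sum of the ρ_j is maximal, so the terms X·dρ_j add up to zero. Each div(ρ_j X) has compact
support inside a chart and integrates to zero (`setIntegral_weakDensity`,
`setIntegral_deriv_varDensity`). Hence vanishing of the form implies biharmonicity. Conversely,
variations supported in a chart with V = δχa there (`exists_variation`), the fundamental lemma of
the calculus of variations and continuity force the form to vanish at each point. -/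

noncomputable section

set_option maxSynthPendingDepth 3
set_option linter.unusedSectionVars false

namespace HypersurfaceGeometry

/-! ### Covariant derivatives along maps between vector spaces -/

section CoordinateConnection

variable {Z F : Type*} [NormedAddCommGroup Z] [NormedSpace ℝ Z]
  [NormedAddCommGroup F] [NormedSpace ℝ F]

/-- The covariant derivative in the direction `w` of a vector field `V` along `f : Z → F`, for the
connection on `F` with connection coefficients `Γ`. -/
def covCoord (Γ : F → F →L[ℝ] F →L[ℝ] F) (f V : Z → F) (w z : Z) : F :=
  fderiv ℝ V z w + Γ (f z) (fderiv ℝ f z w) (V z)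

/-- The curvature tensor of the connection with coefficients `Γ`. -/
def curvCoord (Γ : F → F →L[ℝ] F →L[ℝ] F) (y a b c : F) : F :=
  fderiv ℝ Γ y a b c - fderiv ℝ Γ y b a c + Γ y a (Γ y b c) - Γ y b (Γ y a c)

theorem two_le_infty : (2 : WithTop ℕ∞) ≤ ∞ := WithTop.coe_le_coe.2 le_top

theorem contDiffAt_fderiv_apply {f : Z → F} {z : Z} (hf : ContDiffAt ℝ ∞ f z) (w : Z) :
    ContDiffAt ℝ ∞ (fun z => fderiv ℝ f z w) z :=
  (hf.fderiv_right (m := ∞) (by simp)).clm_apply contDiffAt_const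

theorem contDiffAt_covCoord {Γ : F → F →L[ℝ] F →L[ℝ] F} {f V : Z → F} {z : Z}
    (hΓ : ContDiffAt ℝ ∞ Γ (f z)) (hf : ContDiffAt ℝ ∞ f z) (hV : ContDiffAt ℝ ∞ V z) (w : Z) :
    ContDiffAt ℝ ∞ (covCoord Γ f V w) z :=
  (contDiffAt_fderiv_apply hV w).add
    (((hΓ.comp z hf).clm_apply (contDiffAt_fderiv_apply hf w)).clm_apply hV)

theorem covCoord_congr {Γ : F → F →L[ℝ] F →L[ℝ] F} {f V W : Z → F} {z : Z}
    (h : V =ᶠ[nhds z] W) (w : Z) : covCoord Γ f V w z = covCoord Γ f W w z := by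
  rw [covCoord, covCoord, h.fderiv_eq, h.eq_of_nhds]

theorem covCoord_smul (Γ : F → F →L[ℝ] F →L[ℝ] F) (f : Z → F) {a : Z → ℝ} {V : Z → F} {z : Z}
    (ha : DifferentiableAt ℝ a z) (hV : DifferentiableAt ℝ V z) (w : Z) :
    covCoord Γ f (fun z => a z • V z) w z
      = fderiv ℝ a z w • V z + a z • covCoord Γ f V w z := by
  simp only [covCoord, fderiv_fun_smul ha hV, add_apply, ContinuousLinearMap.smulRight_apply,
    smul_apply, map_smul, smul_add]
  abel

theorem covCoord_sum (Γ : F → F →L[ℝ] F →L[ℝ] F) (f : Z → F) {ι : Type*} (S : Finset ι)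
    {V : ι → Z → F} {z : Z} (hV : ∀ i ∈ S, DifferentiableAt ℝ (V i) z) (w : Z) :
    covCoord Γ f (fun z => ∑ i ∈ S, V i z) w z = ∑ i ∈ S, covCoord Γ f (V i) w z := by
  simp only [covCoord, fderiv_fun_sum hV, Finset.sum_add_distrib, map_sum]
  simp

/-- Torsion-freeness: the second derivative of f is symmetric, and so is Γ at f z. -/
theorem covCoord_fderiv_comm {Γ : F → F →L[ℝ] F →L[ℝ] F} {f : Z → F} {z : Z}
    (hΓ : ∀ a b, Γ (f z) a b = Γ (f z) b a) (hf : ContDiffAt ℝ ∞ f z) (w w' : Z) :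
    covCoord Γ f (fun z => fderiv ℝ f z w') w z = covCoord Γ f (fun z => fderiv ℝ f z w) w' z := by
  have hd : DifferentiableAt ℝ (fderiv ℝ f) z :=
    (hf.fderiv_right (m := ∞) (by simp)).differentiableAt (by simp)
  have hs := (hf.isSymmSndFDerivAt (by simpa using two_le_infty)).eq w w'
  simp only [covCoord]
  rw [fderiv_clm_apply hd (by fun_prop), fderiv_clm_apply hd (by fun_prop)]
  simp [hs, hΓ (fderiv ℝ f z w)]

/-- In the iterated derivative (`key`) the second derivatives of V and of f are symmetric in the two
directions, and the mixed terms in Γ and DV match after the exchange. Only the derivative of Γ and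
the products of two Γ survive. -/
theorem covCoord_comm {Γ : F → F →L[ℝ] F →L[ℝ] F} {f V : Z → F} {z : Z}
    (hΓ : ContDiffAt ℝ ∞ Γ (f z)) (hf : ContDiffAt ℝ ∞ f z) (hV : ContDiffAt ℝ ∞ V z)
    (w w' : Z) :
    covCoord Γ f (covCoord Γ f V w') w z = covCoord Γ f (covCoord Γ f V w) w' z
      + curvCoord Γ (f z) (fderiv ℝ f z w) (fderiv ℝ f z w') (V z) := by
  have key : ∀ w w' : Z, fderiv ℝ (covCoord Γ f V w') z w
      = fderiv ℝ (fderiv ℝ V) z w w'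
        + (fderiv ℝ Γ (f z) (fderiv ℝ f z w) (fderiv ℝ f z w') (V z)
          + Γ (f z) (fderiv ℝ (fderiv ℝ f) z w w') (V z)
          + Γ (f z) (fderiv ℝ f z w') (fderiv ℝ V z w)) := by
    intro w w'
    have hdf : DifferentiableAt ℝ (fderiv ℝ f) z :=
      (hf.fderiv_right (m := ∞) (by simp)).differentiableAt (by simp)
    have hdV : DifferentiableAt ℝ (fderiv ℝ V) z :=
      (hV.fderiv_right (m := ∞) (by simp)).differentiableAt (by simp)
    have hfd := hf.differentiableAt (n := ∞) (by simp)
    have hVd := hV.differentiableAt (n := ∞) (by simp)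
    have hΓd := hΓ.differentiableAt (n := ∞) (by simp)
    have hΓf : DifferentiableAt ℝ (fun z => Γ (f z)) z := hΓd.comp z hfd
    have e1 : fderiv ℝ (fun z => Γ (f z)) z = (fderiv ℝ Γ (f z)).comp (fderiv ℝ f z) :=
      fderiv_comp z hΓd hfd
    have h1 : DifferentiableAt ℝ (fun z => fderiv ℝ f z w') z := hdf.clm_apply (by fun_prop)
    have h1V : DifferentiableAt ℝ (fun z => fderiv ℝ V z w') z := hdV.clm_apply (by fun_prop)
    have h2 : DifferentiableAt ℝ (fun z => Γ (f z) (fderiv ℝ f z w')) z := hΓf.clm_apply h1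
    unfold covCoord
    rw [fderiv_fun_add h1V (h2.clm_apply hVd), fderiv_clm_apply h2 hVd, fderiv_clm_apply hΓf h1,
      fderiv_clm_apply hdf (by fun_prop), fderiv_clm_apply hdV (by fun_prop), e1]
    simp
    abel
  have hsV := (hV.isSymmSndFDerivAt (by simpa using two_le_infty)).eq w w'
  have hsf := (hf.isSymmSndFDerivAt (by simpa using two_le_infty)).eq w w'
  rw [covCoord, covCoord.eq_1 Γ f (covCoord Γ f V w), key, key, hsV, hsf, curvCoord]
  simp only [covCoord, map_add]
  abel

/-- Chain and product rule; compatibility of Γ with B is needed at the image point only. -/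
theorem fderiv_metric_apply {Γ : F → F →L[ℝ] F →L[ℝ] F} {B : F → F →L[ℝ] F →L[ℝ] ℝ}
    {f V W : Z → F} {z : Z} (hB : DifferentiableAt ℝ B (f z))
    (hΓB : ∀ a b c, fderiv ℝ B (f z) a b c = B (f z) (Γ (f z) a b) c + B (f z) b (Γ (f z) a c))
    (hf : DifferentiableAt ℝ f z) (hV : DifferentiableAt ℝ V z) (hW : DifferentiableAt ℝ W z)
    (w : Z) :
    fderiv ℝ (fun z => B (f z) (V z) (W z)) z w
      = B (f z) (covCoord Γ f V w z) (W z) + B (f z) (V z) (covCoord Γ f W w z) := by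
  have hBf : DifferentiableAt ℝ (fun z => B (f z)) z :=
    DifferentiableAt.comp (G := F →L[ℝ] F →L[ℝ] ℝ) z hB hf
  have e1 : fderiv ℝ (fun z => B (f z)) z = (fderiv ℝ B (f z)).comp (fderiv ℝ f z) :=
    fderiv_comp (G := F →L[ℝ] F →L[ℝ] ℝ) z hB hf
  rw [fderiv_clm_apply (hBf.clm_apply hV) hW, fderiv_clm_apply hBf hV, e1]
  simp [covCoord, hΓB]
  abel

end CoordinateConnection

/-! ### The connection and curvature of e^{-2s}⟨·,·⟩ -/

section Conformal

variable {F : Type*} [NormedAddCommGroup F] [InnerProductSpace ℝ F] [CompleteSpace F]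

/-- The inner product as a continuous bilinear map. -/
def innerBilin (F : Type*) [NormedAddCommGroup F] [InnerProductSpace ℝ F] : F →L[ℝ] F →L[ℝ] ℝ :=
  LinearMap.mkContinuous₂ (innerₗ F) 1 fun a b => by simpa using norm_inner_le_norm (𝕜 := ℝ) a b

@[simp]
theorem innerBilin_apply (a b : F) : innerBilin F a b = inner ℝ a b := rfl

/-- The conformally flat metric `e^{-2s} ⟨·, ·⟩`. -/
def confMetric (s : F → ℝ) (y : F) : F →L[ℝ] F →L[ℝ] ℝ :=
  Real.exp (-2 * s y) • innerBilin F

/-- The connection coefficients of the Levi-Civita connection of `e^{-2s} ⟨·, ·⟩`. -/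
def confGamma (s : F → ℝ) (y : F) : F →L[ℝ] F →L[ℝ] F :=
  -((fderiv ℝ s y).smulRight (ContinuousLinearMap.id ℝ F)
    + ContinuousLinearMap.smulRightL ℝ F F (fderiv ℝ s y)
    - ((ContinuousLinearMap.smulRightL ℝ F F).flip (gradient s y)).comp (innerBilin F))

/-- The tensor `D²s + ds ⊗ ds - ½ |∇s|² ⟨·, ·⟩` which determines the curvature of
`e^{-2s} ⟨·, ·⟩`. -/
def confSchouten (s : F → ℝ) (y a b : F) : ℝ :=
  fderiv ℝ (fderiv ℝ s) y a b + fderiv ℝ s y a * fderiv ℝ s y b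
    - (1 / 2) * inner ℝ (gradient s y) (gradient s y) * inner ℝ a b

theorem confMetric_apply (s : F → ℝ) (y a b : F) :
    confMetric s y a b = Real.exp (-2 * s y) * inner ℝ a b := by
  simp [confMetric]

theorem confMetric_symm (s : F → ℝ) (y a b : F) : confMetric s y a b = confMetric s y b a := by
  simp [confMetric_apply, real_inner_comm]

theorem inner_gradient_left (s : F → ℝ) (y a : F) : inner ℝ (gradient s y) a = fderiv ℝ s y a := by
  simp [gradient]

theorem inner_gradient_right (s : F → ℝ) (y a : F) :
    inner ℝ a (gradient s y) = fderiv ℝ s y a := by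
  rw [real_inner_comm, inner_gradient_left]

theorem confGamma_apply (s : F → ℝ) (y a b : F) :
    confGamma s y a b
      = -(fderiv ℝ s y a • b + fderiv ℝ s y b • a - inner ℝ a b • gradient s y) := by
  simp [confGamma]

theorem confGamma_symm (s : F → ℝ) (y a b : F) : confGamma s y a b = confGamma s y b a := by
  rw [confGamma_apply, confGamma_apply, real_inner_comm, add_comm (fderiv ℝ s y a • b)]

theorem contDiffAt_confMetric {s : F → ℝ} {y : F} (hs : ContDiffAt ℝ ∞ s y) :
    ContDiffAt ℝ ∞ (confMetric s) y :=
  ContDiffAt.smul (F := F →L[ℝ] F →L[ℝ] ℝ)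
    (Real.contDiff_exp.contDiffAt.comp y (contDiffAt_const.mul hs)) contDiffAt_const

theorem contDiffAt_gradient {s : F → ℝ} {y : F} (hs : ContDiffAt ℝ ∞ s y) :
    ContDiffAt ℝ ∞ (gradient s) y :=
  (InnerProductSpace.toDual ℝ F).symm.contDiff.contDiffAt.comp y
    (hs.fderiv_right (m := ∞) (by simp))

theorem contDiffAt_confGamma {s : F → ℝ} {y : F} (hs : ContDiffAt ℝ ∞ s y) :
    ContDiffAt ℝ ∞ (confGamma s) y := by
  have h1 : ContDiffAt ℝ ∞ (fderiv ℝ s) y := hs.fderiv_right (m := ∞) (by simp)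
  have h2 := contDiffAt_gradient hs
  unfold confGamma
  refine ((ContDiffAt.smulRight h1 contDiffAt_const).add ?_).sub ?_ |>.neg
  · exact (ContinuousLinearMap.smulRightL ℝ F F).contDiff.contDiffAt.comp y h1
  · have h3 := ContDiffAt.comp y (ContinuousLinearMap.contDiff
      (ContinuousLinearMap.flip (ContinuousLinearMap.smulRightL ℝ F F))).contDiffAt h2
    exact h3.clm_comp contDiffAt_const

theorem fderiv_confMetric {s : F → ℝ} {y : F} (hs : DifferentiableAt ℝ s y) (a b c : F) :
    fderiv ℝ (confMetric s) y a b c = -2 * fderiv ℝ s y a * confMetric s y b c := by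
  have h : HasFDerivAt (confMetric s)
      ((Real.exp (-2 * s y) • ((-2 : ℝ) • fderiv ℝ s y)).smulRight (innerBilin F)) y :=
    HasFDerivAt.smul_const (F := F →L[ℝ] F →L[ℝ] ℝ) ((hs.hasFDerivAt.const_mul (-2)).exp)
      (innerBilin F)
  rw [h.fderiv, confMetric_apply]
  simp
  ring

theorem confMetric_compatible {s : F → ℝ} {y : F} (hs : DifferentiableAt ℝ s y) (a b c : F) :
    fderiv ℝ (confMetric s) y a b c
      = confMetric s y (confGamma s y a b) c + confMetric s y b (confGamma s y a c) := by
  rw [fderiv_confMetric hs]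
  simp only [confMetric_apply, confGamma_apply, inner_neg_left, inner_neg_right, inner_add_left,
    inner_add_right, inner_sub_left, inner_sub_right, inner_smul_left, inner_smul_right,
    inner_gradient_left, inner_gradient_right, conj_trivial, real_inner_comm a b]
  ring

/-- Pairing with a fixed d turns the connection coefficients into a scalar expression linear in ds,
so only the Hessian of s appears. -/
theorem fderiv_confGamma {s : F → ℝ} {y : F} (hs : ContDiffAt ℝ ∞ s y) (a b c d : F) :
    inner ℝ (fderiv ℝ (confGamma s) y a b c) d
      = -(fderiv ℝ (fderiv ℝ s) y a b * inner ℝ c d + fderiv ℝ (fderiv ℝ s) y a c * inner ℝ b d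
        - inner ℝ b c * fderiv ℝ (fderiv ℝ s) y a d) := by
  have hd : DifferentiableAt ℝ (fderiv ℝ s) y :=
    (hs.fderiv_right (m := ∞) (by simp)).differentiableAt (by simp)
  have hg : DifferentiableAt ℝ (gradient s) y :=
    (contDiffAt_gradient hs).differentiableAt (by simp)
  have hΓ : DifferentiableAt ℝ (confGamma s) y :=
    (contDiffAt_confGamma hs).differentiableAt (by simp)
  have h1 : fderiv ℝ (confGamma s) y a b c = fderiv ℝ (fun y => confGamma s y b c) y a := by
    rw [fderiv_clm_apply (hΓ.clm_apply (by fun_prop)) (by fun_prop),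
      fderiv_clm_apply hΓ (by fun_prop)]
    simp
  have h2 : inner ℝ (fderiv ℝ (fun y => confGamma s y b c) y a) d
      = fderiv ℝ (fun y => inner ℝ (confGamma s y b c) d) y a := by
    rw [fderiv_inner_apply ℝ ((hΓ.clm_apply (by fun_prop)).clm_apply (by fun_prop)) (by fun_prop)]
    simp
  have h3 : (fun y => inner ℝ (confGamma s y b c) d)
      = fun y => -(fderiv ℝ s y b * inner ℝ c d + fderiv ℝ s y c * inner ℝ b d
        - inner ℝ b c * fderiv ℝ s y d) := by
    funext y
    simp only [confGamma_apply, inner_neg_left, inner_add_left, inner_sub_left, inner_smul_left,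
      inner_gradient_left, conj_trivial]
  have h4 : ∀ b, HasFDerivAt (fun y => fderiv ℝ s y b) ((fderiv ℝ (fderiv ℝ s) y).flip b) y :=
    fun b => by simpa using hd.hasFDerivAt.clm_apply (hasFDerivAt_const b y)
  have h5 := ((((h4 b).mul_const (inner ℝ c d)).add ((h4 c).mul_const (inner ℝ b d))).sub
    ((h4 d).const_mul (inner ℝ b c))).neg
  rw [h1, h2, h3]
  erw [h5.fderiv]
  simp
  ring

/-- The derivatives of the connection contribute the Hessian of s; the products of connection
coefficients contribute exactly the first-order terms of `confSchouten`. The result is a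
Kulkarni-Nomizu product, so there is no Weyl part. -/
theorem inner_curvCoord_confGamma {s : F → ℝ} {y : F} (hs : ContDiffAt ℝ ∞ s y) (a b c d : F) :
    inner ℝ (curvCoord (confGamma s) y a b c) d
      = -confSchouten s y a c * inner ℝ b d + confSchouten s y a d * inner ℝ b c
        + confSchouten s y b c * inner ℝ a d - confSchouten s y b d * inner ℝ a c := by
  have hsym := (hs.isSymmSndFDerivAt (by simpa using two_le_infty)).eq
  simp only [curvCoord, inner_add_left, inner_sub_left, fderiv_confGamma hs]
  simp only [confSchouten, confGamma_apply, inner_neg_left, inner_add_left, inner_sub_left,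
    inner_smul_left, inner_gradient_left, inner_gradient_right, conj_trivial, map_neg, map_add,
    map_sub, map_smul, hsym b a, real_inner_comm a b]
  ring

theorem confMetric_curvCoord_skew {s : F → ℝ} {y : F} (hs : ContDiffAt ℝ ∞ s y) (a b c d : F) :
    confMetric s y (curvCoord (confGamma s) y a b c) d
      = -confMetric s y (curvCoord (confGamma s) y a b d) c := by
  simp only [confMetric_apply, inner_curvCoord_confGamma hs]
  ring

/-- This is the Ricci contraction. Of the four terms of the curvature, two contract to
`-confSchouten s y a d` each, one to the dimension times `confSchouten s y a d`, and one to its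
trace. -/
theorem sum_inner_curvCoord_confGamma {s : F → ℝ} {y : F} (hs : ContDiffAt ℝ ∞ s y)
    {ι : Type*} [Fintype ι] (ε : OrthonormalBasis ι ℝ F) (a d : F) :
    ∑ i, inner ℝ (curvCoord (confGamma s) y a (ε i) (ε i)) d
      = ((Fintype.card ι : ℝ) - 2) * confSchouten s y a d
        + (∑ i, confSchouten s y (ε i) (ε i)) * inner ℝ a d := by
  have hS : ∀ a b c, confSchouten s y a (b + c) = confSchouten s y a b + confSchouten s y a c := by
    intro a b c; simp [confSchouten, inner_add_right]; ring
  have hS' : ∀ a b (r : ℝ), confSchouten s y a (r • b) = r * confSchouten s y a b := by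
    intro a b c; simp [confSchouten, inner_smul_right]; ring
  have hsym : ∀ a b, confSchouten s y a b = confSchouten s y b a := by
    intro a b
    simp only [confSchouten, (hs.isSymmSndFDerivAt (by simpa using two_le_infty)).eq a b,
      real_inner_comm a b]
    ring
  let L : F → F →ₗ[ℝ] ℝ := fun a =>
    { toFun := confSchouten s y a, map_add' := hS a, map_smul' := fun r b => hS' a b r }
  have key : ∀ a d, ∑ i, confSchouten s y a (ε i) * inner ℝ (ε i) d = confSchouten s y a d := by
    intro a d
    conv_rhs => rw [← ε.sum_repr' d]
    change _ = L a _
    rw [map_sum]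
    refine Finset.sum_congr rfl fun i _ => ?_
    rw [map_smul, smul_eq_mul, mul_comm]; rfl
  simp only [inner_curvCoord_confGamma hs, Finset.sum_add_distrib, Finset.sum_sub_distrib,
    Finset.sum_mul, neg_mul, Finset.sum_neg_distrib, key a d]
  have h2 : ∑ i, confSchouten s y (ε i) d * inner ℝ a (ε i) = confSchouten s y a d := by
    rw [hsym a d, ← key d a]
    exact Finset.sum_congr rfl fun i _ => by rw [hsym, real_inner_comm]
  rw [h2]
  simp [ε.orthonormal.1]
  ring

end Conformal

/-! ### Hypersurfaces in coordinates: Weingarten, Codazzi and the Laplacian of the normal -/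

section CoordHypersurface

variable {Z F ι : Type*} [NormedAddCommGroup Z] [NormedSpace ℝ Z]
  [NormedAddCommGroup F] [NormedSpace ℝ F] [Fintype ι] [DecidableEq ι]

/-- On the open set `O`, the map `f` is a hypersurface of `(F, B)` with unit normal field `ξ`,
and `gi i j` are the components of the inverse of the induced metric in the directions `e i`;
`Γ` is the Levi-Civita connection of `B`. The trace of the second fundamental form, computed as
the divergence of the differential with density `w`, is `c • H • ξ`. -/
structure CoordHypersurface (Γ : F → F →L[ℝ] F →L[ℝ] F) (B : F → F →L[ℝ] F →L[ℝ] ℝ)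
    (f ξ : Z → F) (H w : Z → ℝ) (gi : ι → ι → Z → ℝ) (e : ι → Z) (c : ℝ) (O : Set Z) : Prop where
  isOpen : IsOpen O
  gamma_smooth : ∀ z ∈ O, ContDiffAt ℝ ∞ Γ (f z)
  gamma_symm : ∀ y a b, Γ y a b = Γ y b a
  metric_symm : ∀ y a b, B y a b = B y b a
  metric_smooth : ∀ z ∈ O, ContDiffAt ℝ ∞ B (f z)
  compatible : ∀ z ∈ O, ∀ a b c,
    fderiv ℝ B (f z) a b c = B (f z) (Γ (f z) a b) c + B (f z) b (Γ (f z) a c)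
  skew : ∀ z ∈ O, ∀ a b c d,
    B (f z) (curvCoord Γ (f z) a b c) d = -B (f z) (curvCoord Γ (f z) a b d) c
  map_smooth : ∀ z ∈ O, ContDiffAt ℝ ∞ f z
  normal_smooth : ∀ z ∈ O, ContDiffAt ℝ ∞ ξ z
  mean_smooth : ∀ z ∈ O, ContDiffAt ℝ ∞ H z
  density_smooth : ∀ z ∈ O, ContDiffAt ℝ ∞ w z
  density_ne_zero : ∀ z ∈ O, w z ≠ 0
  inv_smooth : ∀ z ∈ O, ∀ i j, ContDiffAt ℝ ∞ (gi i j) z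
  inv_symm : ∀ z, ∀ i j, gi i j z = gi j i z
  inv_mul : ∀ z ∈ O, ∀ i k,
    ∑ j, gi i j z * B (f z) (fderiv ℝ f z (e j)) (fderiv ℝ f z (e k)) = if i = k then 1 else 0
  unit : ∀ z ∈ O, B (f z) (ξ z) (ξ z) = 1
  normal : ∀ z ∈ O, ∀ i, B (f z) (ξ z) (fderiv ℝ f z (e i)) = 0
  -- Codimension one enters here: the normal and the partial derivatives resolve the identity of the
  -- whole space F.
  complete : ∀ z ∈ O, ∀ a b, B (f z) a b = B (f z) a (ξ z) * B (f z) (ξ z) b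
    + ∑ k, ∑ l, gi k l z * B (f z) a (fderiv ℝ f z (e k)) * B (f z) (fderiv ℝ f z (e l)) b
  tension : ∀ z ∈ O, ∑ i, covCoord Γ f
      (fun z => ∑ j, (w z * gi i j z) • fderiv ℝ f z (e j)) (e i) z = (w z * (c * H z)) • ξ z

namespace CoordHypersurface

variable {Γ : F → F →L[ℝ] F →L[ℝ] F} {B : F → F →L[ℝ] F →L[ℝ] ℝ} {f ξ : Z → F} {H w : Z → ℝ}
  {gi : ι → ι → Z → ℝ} {e : ι → Z} {c : ℝ} {O : Set Z}

theorem fderiv_metric (S : CoordHypersurface Γ B f ξ H w gi e c O) {z : Z} (hz : z ∈ O)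
    {V W : Z → F} (hV : ContDiffAt ℝ ∞ V z) (hW : ContDiffAt ℝ ∞ W z) (a : Z) :
    fderiv ℝ (fun z => B (f z) (V z) (W z)) z a
      = B (f z) (covCoord Γ f V a z) (W z) + B (f z) (V z) (covCoord Γ f W a z) :=
  fderiv_metric_apply ((S.metric_smooth z hz).differentiableAt (by simp)) (S.compatible z hz)
    ((S.map_smooth z hz).differentiableAt (by simp)) (hV.differentiableAt (by simp))
    (hW.differentiableAt (by simp)) a

theorem contDiffAt_covCoord (S : CoordHypersurface Γ B f ξ H w gi e c O) {z : Z} (hz : z ∈ O)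
    {V : Z → F} (hV : ContDiffAt ℝ ∞ V z) (a : Z) : ContDiffAt ℝ ∞ (covCoord Γ f V a) z :=
  HypersurfaceGeometry.contDiffAt_covCoord (S.gamma_smooth z hz) (S.map_smooth z hz) hV a

theorem contDiffAt_partial (S : CoordHypersurface Γ B f ξ H w gi e c O) {z : Z} (hz : z ∈ O)
    (a : Z) : ContDiffAt ℝ ∞ (fun z => fderiv ℝ f z a) z :=
  contDiffAt_fderiv_apply (S.map_smooth z hz) a

/-- Differentiate the unit length of ξ, which holds on the open set O. -/
theorem metric_cov_normal_normal (S : CoordHypersurface Γ B f ξ H w gi e c O) {z : Z}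
    (hz : z ∈ O) (a : Z) : B (f z) (covCoord Γ f ξ a z) (ξ z) = 0 := by
  have h1 := S.fderiv_metric hz (S.normal_smooth z hz) (S.normal_smooth z hz) a
  have h2 : (fun z => B (f z) (ξ z) (ξ z)) =ᶠ[nhds z] fun _ => 1 :=
    Filter.eventuallyEq_of_mem (S.isOpen.mem_nhds hz) S.unit
  rw [h2.fderiv_eq, S.metric_symm _ (ξ z)] at h1
  simp at h1
  linarith

/-- The Weingarten relation, obtained by differentiating the orthogonality of ξ and ∂_j f. -/
theorem metric_normal_cov_partial (S : CoordHypersurface Γ B f ξ H w gi e c O) {z : Z}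
    (hz : z ∈ O) (a : Z) (j : ι) :
    B (f z) (ξ z) (covCoord Γ f (fun z => fderiv ℝ f z (e j)) a z)
      = -B (f z) (covCoord Γ f ξ a z) (fderiv ℝ f z (e j)) := by
  have h1 := S.fderiv_metric hz (S.normal_smooth z hz) (S.contDiffAt_partial hz (e j)) a
  have h2 : (fun z => B (f z) (ξ z) (fderiv ℝ f z (e j))) =ᶠ[nhds z] fun _ => 0 :=
    Filter.eventuallyEq_of_mem (S.isOpen.mem_nhds hz) fun z hz => S.normal z hz j
  rw [h2.fderiv_eq] at h1
  simp at h1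
  linarith

theorem cov_partial_comm (S : CoordHypersurface Γ B f ξ H w gi e c O) {z : Z} (hz : z ∈ O)
    (a b : Z) : covCoord Γ f (fun z => fderiv ℝ f z b) a z
      = covCoord Γ f (fun z => fderiv ℝ f z a) b z :=
  covCoord_fderiv_comm (S.gamma_symm _) (S.map_smooth z hz) a b

/-- Symmetry of the second fundamental form. -/
theorem metric_cov_normal_symm (S : CoordHypersurface Γ B f ξ H w gi e c O) {z : Z}
    (hz : z ∈ O) (j k : ι) :
    B (f z) (covCoord Γ f ξ (e j) z) (fderiv ℝ f z (e k))
      = B (f z) (covCoord Γ f ξ (e k) z) (fderiv ℝ f z (e j)) := by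
  have h1 := S.metric_normal_cov_partial hz (e j) k
  have h2 := S.metric_normal_cov_partial hz (e k) j
  rw [S.cov_partial_comm hz] at h1
  linarith

/-- The derivative of ξ is tangential, so only the tangential part of `complete` remains. -/
theorem metric_cov_normal (S : CoordHypersurface Γ B f ξ H w gi e c O) {z : Z}
    (hz : z ∈ O) (a : Z) (X : F) :
    B (f z) (covCoord Γ f ξ a z) X = ∑ p, ∑ q, gi p q z
      * B (f z) (covCoord Γ f ξ a z) (fderiv ℝ f z (e p)) * B (f z) (fderiv ℝ f z (e q)) X := by
  rw [S.complete z hz (covCoord Γ f ξ a z) X, S.metric_cov_normal_normal hz, zero_mul, zero_add]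

theorem cov_density (S : CoordHypersurface Γ B f ξ H w gi e c O) {z : Z} (hz : z ∈ O)
    {V : ι → Z → F} (hV : ∀ j, ContDiffAt ℝ ∞ (V j) z) (i : ι) (a : Z) :
    covCoord Γ f (fun z => ∑ j, (w z * gi i j z) • V j z) a z
      = ∑ j, (fderiv ℝ (fun z => w z * gi i j z) z a • V j z
        + (w z * gi i j z) • covCoord Γ f (V j) a z) := by
  have hP : ∀ j, ContDiffAt ℝ ∞ (fun z => w z * gi i j z) z := fun j =>
    (S.density_smooth z hz).mul (S.inv_smooth z hz i j)
  rw [covCoord_sum Γ f Finset.univ (V := fun j z => (w z * gi i j z) • V j z)]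
  · exact Finset.sum_congr rfl fun j _ => covCoord_smul Γ f ((hP j).differentiableAt (by simp))
      ((hV j).differentiableAt (by simp)) a
  · exact fun j _ => ((hP j).smul (hV j)).differentiableAt (by simp)

/-- Pairing the divergence form of the tension field with ξ removes every term in which w g^{ij} is
differentiated, as these are tangential. -/
theorem trace_second_form (S : CoordHypersurface Γ B f ξ H w gi e c O) {z : Z} (hz : z ∈ O) :
    ∑ i, ∑ j, gi i j z * B (f z) (covCoord Γ f ξ (e i) z) (fderiv ℝ f z (e j)) = -(c * H z) := by
  have h := congrArg (B (f z) (ξ z)) (S.tension z hz)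
  simp only [S.cov_density hz (fun j => S.contDiffAt_partial hz (e j)), map_sum, map_add, map_smul,
    S.normal z hz, S.unit z hz, S.metric_normal_cov_partial hz, smul_eq_mul, mul_zero, zero_add,
    mul_one] at h
  apply mul_left_cancel₀ (S.density_ne_zero z hz)
  rw [mul_neg, ← h, Finset.mul_sum, ← Finset.sum_neg_distrib]
  refine Finset.sum_congr rfl fun i _ => ?_
  rw [Finset.mul_sum, ← Finset.sum_neg_distrib]
  exact Finset.sum_congr rfl fun j _ => by ring

/-- The tension field is normal, so its divergence form paired with a tangent vector gives zero.
This controls the divergence of w g^{ij} without any formula for w. -/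
theorem sum_fderiv_density (S : CoordHypersurface Γ B f ξ H w gi e c O) {z : Z} (hz : z ∈ O)
    (k : ι) :
    ∑ i, ∑ j, fderiv ℝ (fun z => w z * gi i j z) z (e i)
        * B (f z) (fderiv ℝ f z (e j)) (fderiv ℝ f z (e k))
      = -∑ i, ∑ j, w z * gi i j z
        * B (f z) (covCoord Γ f (fun z => fderiv ℝ f z (e j)) (e i) z) (fderiv ℝ f z (e k)) := by
  have h := congrArg (fun X => B (f z) X (fderiv ℝ f z (e k))) (S.tension z hz)
  simp only [S.cov_density hz (fun j => S.contDiffAt_partial hz (e j)), map_sum, map_add, map_smul,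
    sum_apply, add_apply, smul_apply, S.normal z hz, smul_eq_mul, mul_zero,
    Finset.sum_add_distrib] at h
  linarith

theorem contDiffAt_second_form (S : CoordHypersurface Γ B f ξ H w gi e c O) {z : Z} (hz : z ∈ O)
    (i j : ι) : ContDiffAt ℝ ∞
      (fun z => B (f z) (covCoord Γ f ξ (e i) z) (fderiv ℝ f z (e j))) z :=
  (((S.metric_smooth z hz).comp z (S.map_smooth z hz)).clm_apply
    (S.contDiffAt_covCoord hz (S.normal_smooth z hz) _)).clm_apply (S.contDiffAt_partial hz _)

theorem fderiv_second_form (S : CoordHypersurface Γ B f ξ H w gi e c O) {z : Z} (hz : z ∈ O)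
    (a : Z) (i j : ι) :
    fderiv ℝ (fun z => B (f z) (covCoord Γ f ξ (e i) z) (fderiv ℝ f z (e j))) z a
      = B (f z) (covCoord Γ f (covCoord Γ f ξ (e i)) a z) (fderiv ℝ f z (e j))
        + B (f z) (covCoord Γ f ξ (e i) z) (covCoord Γ f (fun z => fderiv ℝ f z (e j)) a z) :=
  S.fderiv_metric hz (S.contDiffAt_covCoord hz (S.normal_smooth z hz) _)
    (S.contDiffAt_partial hz _) a

/-- The Codazzi equation. -/
theorem metric_cov_cov_normal (S : CoordHypersurface Γ B f ξ H w gi e c O) {z : Z} (hz : z ∈ O)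
    (i j k : ι) :
    B (f z) (covCoord Γ f (covCoord Γ f ξ (e j)) (e i) z) (fderiv ℝ f z (e k))
      = fderiv ℝ (fun z => B (f z) (covCoord Γ f ξ (e i) z) (fderiv ℝ f z (e j))) z (e k)
        + B (f z) (curvCoord Γ (f z) (fderiv ℝ f z (e k)) (fderiv ℝ f z (e i))
            (fderiv ℝ f z (e j))) (ξ z)
        + B (f z) (covCoord Γ f ξ (e k) z) (covCoord Γ f (fun z => fderiv ℝ f z (e j)) (e i) z)
        - B (f z) (covCoord Γ f ξ (e i) z) (covCoord Γ f (fun z => fderiv ℝ f z (e j)) (e k) z)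
        - B (f z) (covCoord Γ f ξ (e j) z)
            (covCoord Γ f (fun z => fderiv ℝ f z (e i)) (e k) z) := by
  -- With b_{ij} = B(∇_i ξ, ∂_j f), compare ∂_i b_{jk}, ∂_i b_{kj} and ∂_k b_{ij}. The first two
  -- agree by symmetry of b; the last two are linked by commuting ∇_k and ∇_i on ξ, and skewness
  -- moves ξ to the last slot of the curvature.
  have h1 := S.fderiv_second_form hz (e i) j k
  have h2 := S.fderiv_second_form hz (e i) k j
  have h3 := S.fderiv_second_form hz (e k) i j
  have hs : (fun z => B (f z) (covCoord Γ f ξ (e j) z) (fderiv ℝ f z (e k)))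
      =ᶠ[nhds z] fun z => B (f z) (covCoord Γ f ξ (e k) z) (fderiv ℝ f z (e j)) :=
    Filter.eventuallyEq_of_mem (S.isOpen.mem_nhds hz) fun z hz => S.metric_cov_normal_symm hz j k
  rw [hs.fderiv_eq] at h1
  have hc := covCoord_comm (S.gamma_smooth z hz) (S.map_smooth z hz) (S.normal_smooth z hz)
    (e k) (e i)
  rw [hc, map_add, add_apply, S.skew z hz] at h3
  rw [S.cov_partial_comm hz (e k) (e i)]
  linarith

/-- Differentiating g^{ij}g_{jq} = δ expresses the derivative of g^{ij}, contracted with g_{jq},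
through ∇_a ∂_j f. Expanding the second form in the frame produces that contraction. The two
resulting sums coincide by symmetry of the second form, hence the factor 2. -/
theorem sum_fderiv_inv_mul_second_form (S : CoordHypersurface Γ B f ξ H w gi e c O) {z : Z}
    (hz : z ∈ O) (a : Z) :
    ∑ i, ∑ j, fderiv ℝ (gi i j) z a * B (f z) (covCoord Γ f ξ (e i) z) (fderiv ℝ f z (e j))
      = -2 * ∑ i, ∑ j, gi i j z * B (f z) (covCoord Γ f ξ (e i) z)
          (covCoord Γ f (fun z => fderiv ℝ f z (e j)) a z) := by
  have hG : ∀ i q, ∑ j, fderiv ℝ (gi i j) z a * B (f z) (fderiv ℝ f z (e j)) (fderiv ℝ f z (e q))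
      = -∑ j, gi i j z
        * (B (f z) (covCoord Γ f (fun z => fderiv ℝ f z (e j)) a z) (fderiv ℝ f z (e q))
          + B (f z) (covCoord Γ f (fun z => fderiv ℝ f z (e q)) a z) (fderiv ℝ f z (e j))) := by
    intro i q
    have hd : ∀ j, ContDiffAt ℝ ∞
        (fun z => B (f z) (fderiv ℝ f z (e j)) (fderiv ℝ f z (e q))) z := fun j =>
      (((S.metric_smooth z hz).comp z (S.map_smooth z hz)).clm_apply
        (S.contDiffAt_partial hz _)).clm_apply (S.contDiffAt_partial hz _)
    have h0 : (fun z => ∑ j, gi i j z * B (f z) (fderiv ℝ f z (e j)) (fderiv ℝ f z (e q)))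
        =ᶠ[nhds z] fun _ => if i = q then 1 else 0 :=
      Filter.eventuallyEq_of_mem (S.isOpen.mem_nhds hz) fun z hz => S.inv_mul z hz i q
    have h1 := congrArg (fun L => L a) (h0.fderiv_eq (𝕜 := ℝ))
    rw [fderiv_fun_sum fun j _ =>
      ((S.inv_smooth z hz i j).mul (hd j)).differentiableAt (by simp)] at h1
    simp only [fderiv_fun_mul ((S.inv_smooth z hz i _).differentiableAt (by simp))
      ((hd _).differentiableAt (by simp)), sum_apply, add_apply, smul_apply,
      S.fderiv_metric hz (S.contDiffAt_partial hz _) (S.contDiffAt_partial hz _),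
      Finset.sum_add_distrib, smul_eq_mul, fderiv_fun_const, Pi.zero_apply, zero_apply] at h1
    rw [eq_neg_iff_add_eq_zero, ← h1, add_comm]
    congr 1
    · exact Finset.sum_congr rfl fun j _ => by
        rw [S.metric_symm _ _ (covCoord Γ f (fun z => fderiv ℝ f z (e q)) a z)]
    · exact Finset.sum_congr rfl fun j _ => mul_comm _ _
  set b : ι → ι → ℝ := fun i j => B (f z) (covCoord Γ f ξ (e i) z) (fderiv ℝ f z (e j)) with hb
  set C : ι → ι → ℝ := fun i j =>
    B (f z) (covCoord Γ f (fun z => fderiv ℝ f z (e i)) a z) (fderiv ℝ f z (e j)) with hC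
  have hQ : ∀ i j, B (f z) (covCoord Γ f ξ (e i) z) (covCoord Γ f (fun z => fderiv ℝ f z (e j)) a z)
      = ∑ p, ∑ q, gi p q z * b i p * C j q := by
    intro i j
    rw [S.metric_cov_normal hz]
    simp only [hb, hC, S.metric_symm (f z) (fderiv ℝ f z (e _)) (covCoord _ _ _ _ _)]
  have hbb : ∀ i j, b i j = ∑ p, ∑ q, gi p q z * b i p
      * B (f z) (fderiv ℝ f z (e j)) (fderiv ℝ f z (e q)) := by
    intro i j
    simp only [hb]
    rw [S.metric_cov_normal hz]
    simp only [S.metric_symm (f z) (fderiv ℝ f z (e j))]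
  have hbs : ∀ i j, b i j = b j i := fun i j => S.metric_cov_normal_symm hz i j
  have e1 : ∑ i, ∑ j, fderiv ℝ (gi i j) z a * b i j
      = ∑ i, ∑ p, ∑ q, gi p q z * b i p * -∑ j, gi i j z * (C j q + C q j) := by
    refine Finset.sum_congr rfl fun i _ => ?_
    simp only [← hG, hC]
    calc ∑ j, fderiv ℝ (gi i j) z a * b i j
        = ∑ j, ∑ p, ∑ q, gi p q z * b i p * (fderiv ℝ (gi i j) z a
          * B (f z) (fderiv ℝ f z (e j)) (fderiv ℝ f z (e q))) := by
          refine Finset.sum_congr rfl fun j _ => ?_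
          rw [hbb i j, Finset.mul_sum]
          refine Finset.sum_congr rfl fun p _ => ?_
          rw [Finset.mul_sum]
          exact Finset.sum_congr rfl fun q _ => by ring
      _ = _ := by
          rw [Finset.sum_comm]
          refine Finset.sum_congr rfl fun p _ => ?_
          rw [Finset.sum_comm]
          exact Finset.sum_congr rfl fun q _ => by rw [Finset.mul_sum]
  have e2 : ∑ i, ∑ p, ∑ q, gi p q z * b i p * ∑ j, gi i j z * C j q
      = ∑ i, ∑ j, gi i j z * ∑ p, ∑ q, gi p q z * b i p * C j q := by
    refine Finset.sum_congr rfl fun i _ => ?_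
    simp only [Finset.mul_sum]
    rw [Finset.sum_comm_cycle]
    refine Finset.sum_congr rfl fun j _ => Finset.sum_congr rfl fun p _ =>
      Finset.sum_congr rfl fun q _ => by ring
  have e3 : ∑ i, ∑ p, ∑ q, gi p q z * b i p * ∑ j, gi i j z * C q j
      = ∑ i, ∑ j, gi i j z * ∑ p, ∑ q, gi p q z * b i p * C j q := by
    rw [Finset.sum_comm]
    refine Finset.sum_congr rfl fun p _ => ?_
    rw [Finset.sum_comm]
    refine Finset.sum_congr rfl fun q _ => ?_
    rw [Finset.mul_sum]
    refine Finset.sum_congr rfl fun i _ => ?_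
    rw [Finset.mul_sum, Finset.mul_sum]
    exact Finset.sum_congr rfl fun j _ => by rw [hbs i p]; ring
  simp only [hQ]
  rw [e1]
  simp only [mul_add, Finset.sum_add_distrib, neg_add, mul_neg, Finset.sum_neg_distrib]
  rw [e2, e3]
  ring

/-- By symmetry of the second form, ∇_j ξ paired with ∂_k f becomes ∇_k ξ paired with ∂_j f. As ∇_k
ξ is tangential, `swap` reduces the claim to `sum_fderiv_density`, which is known against each ∂_q
f. -/
theorem sum_fderiv_density_mul_second_form (S : CoordHypersurface Γ B f ξ H w gi e c O) {z : Z}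
    (hz : z ∈ O) (k : ι) :
    ∑ i, ∑ j, fderiv ℝ (fun z => w z * gi i j z) z (e i)
        * B (f z) (covCoord Γ f ξ (e j) z) (fderiv ℝ f z (e k))
      = -∑ i, ∑ j, w z * gi i j z * B (f z) (covCoord Γ f ξ (e k) z)
          (covCoord Γ f (fun z => fderiv ℝ f z (e j)) (e i) z) := by
  have hR : ∀ X, B (f z) (covCoord Γ f ξ (e k) z) X = ∑ p, ∑ q, gi p q z
      * B (f z) (covCoord Γ f ξ (e k) z) (fderiv ℝ f z (e p)) * B (f z) X (fderiv ℝ f z (e q)) :=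
    fun X => by
      rw [S.metric_cov_normal hz]
      simp only [S.metric_symm (f z) X]
  have swap : ∀ (u : ι → ι → ℝ) (X : ι → ι → F), ∑ i, ∑ j, u i j
        * B (f z) (covCoord Γ f ξ (e k) z) (X i j)
      = ∑ p, ∑ q, gi p q z * B (f z) (covCoord Γ f ξ (e k) z) (fderiv ℝ f z (e p))
        * ∑ i, ∑ j, u i j * B (f z) (X i j) (fderiv ℝ f z (e q)) := by
    intro u X
    simp only [hR (X _ _)]
    simp only [Finset.mul_sum]
    rw [Finset.sum_congr rfl fun i _ => Finset.sum_comm, Finset.sum_comm]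
    refine Finset.sum_congr rfl fun p _ => ?_
    rw [Finset.sum_congr rfl fun i _ => Finset.sum_comm, Finset.sum_comm]
    exact Finset.sum_congr rfl fun q _ => Finset.sum_congr rfl fun i _ =>
      Finset.sum_congr rfl fun j _ => by ring
  simp only [S.metric_cov_normal_symm hz _ k]
  rw [swap, swap, ← Finset.sum_neg_distrib]
  refine Finset.sum_congr rfl fun p _ => ?_
  rw [← Finset.sum_neg_distrib]
  exact Finset.sum_congr rfl fun q _ => by rw [S.sum_fderiv_density hz q]; ring

/-- The tangential part of the rough Laplacian of the unit normal field. -/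
theorem metric_laplacian_normal_partial (S : CoordHypersurface Γ B f ξ H w gi e c O) {z : Z}
    (hz : z ∈ O) (k : ι) :
    B (f z) (∑ i, covCoord Γ f (fun z => ∑ j, (w z * gi i j z) • covCoord Γ f ξ (e j) z) (e i) z)
        (fderiv ℝ f z (e k))
      = w z * (-(c * fderiv ℝ H z (e k)) + ∑ i, ∑ j, gi i j z * B (f z) (curvCoord Γ (f z)
          (fderiv ℝ f z (e k)) (fderiv ℝ f z (e i)) (fderiv ℝ f z (e j))) (ξ z)) := by
  have htr : (fun z => ∑ i, ∑ j, gi i j z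
        * B (f z) (covCoord Γ f ξ (e i) z) (fderiv ℝ f z (e j)))
      =ᶠ[nhds z] fun z => -(c * H z) :=
    Filter.eventuallyEq_of_mem (S.isOpen.mem_nhds hz) fun z hz => S.trace_second_form hz
  have hd : ∀ i j, DifferentiableAt ℝ (fun z => gi i j z
        * B (f z) (covCoord Γ f ξ (e i) z) (fderiv ℝ f z (e j))) z := fun i j =>
    ((S.inv_smooth z hz i j).mul (S.contDiffAt_second_form hz i j)).differentiableAt (by simp)
  have h1 := congrArg (fun L => L (e k)) (htr.fderiv_eq (𝕜 := ℝ))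
  rw [fderiv_fun_sum fun i _ => DifferentiableAt.fun_sum fun j _ => hd i j, fderiv_fun_neg,
    fderiv_const_mul ((S.mean_smooth z hz).differentiableAt (by simp))] at h1
  simp only [fderiv_fun_sum fun j _ => hd _ j,
    fderiv_fun_mul ((S.inv_smooth z hz _ _).differentiableAt (by simp))
      ((S.contDiffAt_second_form hz _ _).differentiableAt (by simp)), sum_apply, add_apply,
    smul_apply, neg_apply, smul_eq_mul, Finset.sum_add_distrib] at h1
  have h2 := S.sum_fderiv_inv_mul_second_form hz (e k)
  have h3 := S.sum_fderiv_density_mul_second_form hz k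
  have h4 : ∑ i, ∑ j, B (f z) (covCoord Γ f ξ (e i) z) (fderiv ℝ f z (e j))
      * fderiv ℝ (gi i j) z (e k) = ∑ i, ∑ j, fderiv ℝ (gi i j) z (e k)
      * B (f z) (covCoord Γ f ξ (e i) z) (fderiv ℝ f z (e j)) :=
    Finset.sum_congr rfl fun i _ => Finset.sum_congr rfl fun j _ => mul_comm _ _
  have h5 : ∑ i, ∑ j, gi i j z * B (f z) (covCoord Γ f ξ (e j) z)
        (covCoord Γ f (fun z => fderiv ℝ f z (e i)) (e k) z)
      = ∑ i, ∑ j, gi i j z * B (f z) (covCoord Γ f ξ (e i) z)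
        (covCoord Γ f (fun z => fderiv ℝ f z (e j)) (e k) z) := by
    rw [Finset.sum_comm]
    exact Finset.sum_congr rfl fun i _ => Finset.sum_congr rfl fun j _ => by
      rw [S.inv_symm z j i]
  simp only [S.cov_density hz
    (fun j => S.contDiffAt_covCoord hz (S.normal_smooth z hz) (e j)), map_sum, map_add, map_smul,
    sum_apply, add_apply, smul_apply, smul_eq_mul, Finset.sum_add_distrib, h3]
  simp only [S.metric_cov_cov_normal hz, mul_add, mul_sub, Finset.sum_add_distrib,
    Finset.sum_sub_distrib, mul_assoc, ← Finset.mul_sum]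
  rw [h5]
  rw [h4, h2] at h1
  -- The terms pairing ∇_k ξ with ∇_i ∂_j f, from the density and from Codazzi, have cancelled. The
  -- remaining pairings of ∇_i ξ with ∇_k ∂_j f assemble with ∂_k b_{ij} into the derivative of the
  -- trace of the second form, which is `h1`.
  linear_combination (w z) * h1

/-- Differentiate the orthogonality of ∇_j ξ and ξ once more; terms with differentiated coefficients
vanish by that same orthogonality. -/
theorem metric_laplacian_normal_normal (S : CoordHypersurface Γ B f ξ H w gi e c O) {z : Z}
    (hz : z ∈ O) :
    B (f z) (∑ i, covCoord Γ f (fun z => ∑ j, (w z * gi i j z) • covCoord Γ f ξ (e j) z) (e i) z)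
        (ξ z)
      = -(w z * ∑ i, ∑ j, gi i j z
        * B (f z) (covCoord Γ f ξ (e i) z) (covCoord Γ f ξ (e j) z)) := by
  have h1 : ∀ i j, B (f z) (covCoord Γ f (covCoord Γ f ξ (e j)) (e i) z) (ξ z)
      = -B (f z) (covCoord Γ f ξ (e i) z) (covCoord Γ f ξ (e j) z) := by
    intro i j
    have h2 := S.fderiv_metric hz (S.contDiffAt_covCoord hz (S.normal_smooth z hz) (e j))
      (S.normal_smooth z hz) (e i)
    have h3 : (fun z => B (f z) (covCoord Γ f ξ (e j) z) (ξ z)) =ᶠ[nhds z] fun _ => 0 :=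
      Filter.eventuallyEq_of_mem (S.isOpen.mem_nhds hz) fun z hz => S.metric_cov_normal_normal hz _
    rw [h3.fderiv_eq, S.metric_symm _ (covCoord Γ f ξ (e j) z) (covCoord Γ f ξ (e i) z)] at h2
    simp at h2
    linarith
  simp only [S.cov_density hz
    (fun j => S.contDiffAt_covCoord hz (S.normal_smooth z hz) (e j)), map_sum, map_add, map_smul,
    sum_apply, add_apply, smul_apply, smul_eq_mul, S.metric_cov_normal_normal hz, h1, mul_zero,
    zero_add, mul_neg, Finset.sum_neg_distrib, mul_assoc, ← Finset.mul_sum]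

/-- The rough Laplacian of `c • H • ξ`. -/
theorem laplacian_tension (S : CoordHypersurface Γ B f ξ H w gi e c O) {z : Z} (hz : z ∈ O)
    {T : Z → F} (hT : ∀ z ∈ O, T z = (c * H z) • ξ z) :
    ∑ i, covCoord Γ f (fun z => ∑ j, (w z * gi i j z) • covCoord Γ f T (e j) z) (e i) z
      = c • ((∑ i, fderiv ℝ (fun z => ∑ j, w z * gi i j z * fderiv ℝ H z (e j)) z (e i)) • ξ z
        + (2 : ℝ) • ∑ i, ∑ j, (w z * gi i j z * fderiv ℝ H z (e i)) • covCoord Γ f ξ (e j) z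
        + H z • ∑ i, covCoord Γ f
            (fun z => ∑ j, (w z * gi i j z) • covCoord Γ f ξ (e j) z) (e i) z) := by
  have hH := fun z (hz : z ∈ O) => S.mean_smooth z hz
  have hP : ∀ i j, ContDiffAt ℝ ∞ (fun z => w z * gi i j z) z := fun i j =>
    (S.density_smooth z hz).mul (S.inv_smooth z hz i j)
  have hT1 : ∀ z ∈ O, ∀ a, covCoord Γ f T a z
      = c • (fderiv ℝ H z a • ξ z + H z • covCoord Γ f ξ a z) := by
    intro z hz a
    rw [covCoord_congr (Filter.eventuallyEq_of_mem (S.isOpen.mem_nhds hz) hT),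
      covCoord_smul Γ f (((hH z hz).differentiableAt (by simp)).const_mul c)
        ((S.normal_smooth z hz).differentiableAt (by simp)),
      fderiv_const_mul ((hH z hz).differentiableAt (by simp))]
    simp only [smul_apply, smul_eq_mul, smul_add, smul_smul]
  have hu : ∀ i, ContDiffAt ℝ ∞ (fun z => ∑ j, w z * gi i j z * fderiv ℝ H z (e j)) z := fun i =>
    ContDiffAt.sum fun j _ => (hP i j).mul (contDiffAt_fderiv_apply (hH z hz) _)
  have hN : ∀ i, ContDiffAt ℝ ∞
      (fun z => ∑ j, (w z * gi i j z) • covCoord Γ f ξ (e j) z) z := fun i =>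
    ContDiffAt.sum fun j _ => (hP i j).smul (S.contDiffAt_covCoord hz (S.normal_smooth z hz) _)
  have h1 : ∀ i, covCoord Γ f (fun z => ∑ j, (w z * gi i j z) • covCoord Γ f T (e j) z) (e i) z
      = c • (fderiv ℝ (fun z => ∑ j, w z * gi i j z * fderiv ℝ H z (e j)) z (e i) • ξ z
        + (∑ j, w z * gi i j z * fderiv ℝ H z (e j)) • covCoord Γ f ξ (e i) z
        + fderiv ℝ H z (e i) • ∑ j, (w z * gi i j z) • covCoord Γ f ξ (e j) z
        + H z • covCoord Γ f
            (fun z => ∑ j, (w z * gi i j z) • covCoord Γ f ξ (e j) z) (e i) z) := by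
    intro i
    -- The flux of T has one part along ξ and one proportional to the flux of ξ. Writing it as a sum
    -- over `Fin 2` makes `covCoord_sum` applicable.
    have heq : (fun z => ∑ j, (w z * gi i j z) • covCoord Γ f T (e j) z) =ᶠ[nhds z]
        fun z => ∑ l : Fin 2, (![fun z => (c * ∑ j, w z * gi i j z * fderiv ℝ H z (e j)) • ξ z,
          fun z => (c * H z) • ∑ j, (w z * gi i j z) • covCoord Γ f ξ (e j) z] : Fin 2 → Z → F)
            l z := by
      refine Filter.eventuallyEq_of_mem (S.isOpen.mem_nhds hz) fun z hz => ?_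
      simp only [Fin.sum_univ_two, Matrix.cons_val_zero, Matrix.cons_val_one, hT1 z hz,
        Finset.mul_sum, Finset.sum_smul, Finset.smul_sum, ← Finset.sum_add_distrib]
      refine Finset.sum_congr rfl fun j _ => ?_
      simp only [smul_add, smul_smul]
      congr 2 <;> ring
    have d1 : DifferentiableAt ℝ (fun z => c * ∑ j, w z * gi i j z * fderiv ℝ H z (e j)) z :=
      ((hu i).differentiableAt (by simp)).const_mul c
    have d2 : DifferentiableAt ℝ (fun z => c * H z) z :=
      ((hH z hz).differentiableAt (by simp)).const_mul c
    have d3 := (S.normal_smooth z hz).differentiableAt (n := ∞) (by simp)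
    have d4 := (hN i).differentiableAt (n := ∞) (by simp)
    rw [covCoord_congr heq, covCoord_sum]
    · simp only [Fin.sum_univ_two, Matrix.cons_val_zero, Matrix.cons_val_one]
      rw [covCoord_smul Γ f d1 d3, covCoord_smul Γ f d2 d4,
        fderiv_const_mul ((hu i).differentiableAt (by simp)),
        fderiv_const_mul ((hH z hz).differentiableAt (by simp))]
      simp only [smul_apply, smul_eq_mul, smul_add, smul_smul]
      abel
    · intro l _
      fin_cases l
      · exact d1.smul d3
      · exact d2.smul d4
  -- The two cross terms of the Leibniz rule are equal by symmetry of g^{ij}; together they give the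
  -- factor 2.
  have h2 : ∑ i, (∑ j, w z * gi i j z * fderiv ℝ H z (e j)) • covCoord Γ f ξ (e i) z
      = ∑ i, ∑ j, (w z * gi i j z * fderiv ℝ H z (e i)) • covCoord Γ f ξ (e j) z := by
    simp only [Finset.sum_smul]
    rw [Finset.sum_comm]
    exact Finset.sum_congr rfl fun i _ => Finset.sum_congr rfl fun j _ => by
      rw [S.inv_symm z j i]
  have h3 : ∑ i, fderiv ℝ H z (e i) • ∑ j, (w z * gi i j z) • covCoord Γ f ξ (e j) z
      = ∑ i, ∑ j, (w z * gi i j z * fderiv ℝ H z (e i)) • covCoord Γ f ξ (e j) z := by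
    refine Finset.sum_congr rfl fun i _ => ?_
    rw [Finset.smul_sum]
    exact Finset.sum_congr rfl fun j _ => by rw [smul_smul, mul_comm]
  simp only [h1, ← Finset.smul_sum, Finset.sum_add_distrib, h2, h3, ← Finset.sum_smul, two_smul]
  congr 1
  abel

end CoordHypersurface

end CoordHypersurface

/-! ### First variation of the squared tension field in coordinates -/

section Variation

variable {Z F ι : Type*} [NormedAddCommGroup Z] [NormedSpace ℝ Z]
  [NormedAddCommGroup F] [NormedSpace ℝ F] [Fintype ι]

/-- First variation of the square of the tension field `τ = w⁻¹ ∇_i (P^{ij} ∂_j f)` in a direction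
`a` of the parameter space in which the coefficients `P`, `w` are constant. -/
theorem first_variation_tension {Γ : F → F →L[ℝ] F →L[ℝ] F} {B : F → F →L[ℝ] F →L[ℝ] ℝ}
    {f τ : Z → F} {w : Z → ℝ} {P : ι → ι → Z → ℝ} {e : ι → Z} {a : Z} {O : Set Z} (hO : IsOpen O)
    (hΓ : ∀ z ∈ O, ContDiffAt ℝ ∞ Γ (f z)) (hΓs : ∀ y a b, Γ y a b = Γ y b a)
    (hBs : ∀ y a b, B y a b = B y b a) (hB : ∀ z ∈ O, ContDiffAt ℝ ∞ B (f z))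
    (hΓB : ∀ z ∈ O, ∀ a b c,
      fderiv ℝ B (f z) a b c = B (f z) (Γ (f z) a b) c + B (f z) b (Γ (f z) a c))
    (hf : ∀ z ∈ O, ContDiffAt ℝ ∞ f z) (hτ : ∀ z ∈ O, ContDiffAt ℝ ∞ τ z)
    (hw : ∀ z ∈ O, DifferentiableAt ℝ w z) (hP : ∀ z ∈ O, ∀ i j, ContDiffAt ℝ ∞ (P i j) z)
    (hPs : ∀ i j z, P i j z = P j i z) (hwa : ∀ z ∈ O, fderiv ℝ w z a = 0)
    (hPa : ∀ z ∈ O, ∀ i j, fderiv ℝ (P i j) z a = 0)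
    (hwτ : ∀ z ∈ O, w z • τ z
      = ∑ i, covCoord Γ f (fun z => ∑ j, P i j z • fderiv ℝ f z (e j)) (e i) z)
    {z : Z} (hz : z ∈ O) :
    w z * fderiv ℝ (fun z => 1 / 2 * B (f z) (τ z) (τ z)) z a
      = ∑ i, fderiv ℝ (fun z => ∑ j, P i j z
          * (B (f z) (covCoord Γ f (fun z => fderiv ℝ f z a) (e j) z) (τ z)
            - B (f z) (fderiv ℝ f z a) (covCoord Γ f τ (e j) z))) z (e i)
        + (B (f z) (fderiv ℝ f z a)
            (∑ i, covCoord Γ f (fun z => ∑ j, P i j z • covCoord Γ f τ (e j) z) (e i) z)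
          + ∑ i, ∑ j, P i j z * B (f z) (curvCoord Γ (f z) (fderiv ℝ f z a)
            (fderiv ℝ f z (e i)) (fderiv ℝ f z (e j))) (τ z)) := by
  have dcov : ∀ {V : Z → F} {z}, z ∈ O → ContDiffAt ℝ ∞ V z → ∀ b,
      ContDiffAt ℝ ∞ (covCoord Γ f V b) z := fun hz hV b =>
    contDiffAt_covCoord (hΓ _ hz) (hf _ hz) hV b
  have dpar : ∀ {z}, z ∈ O → ∀ b, ContDiffAt ℝ ∞ (fun z => fderiv ℝ f z b) z := fun hz b =>
    contDiffAt_fderiv_apply (hf _ hz) b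
  have dmet : ∀ {V W : Z → F} {z}, z ∈ O → ContDiffAt ℝ ∞ V z → ContDiffAt ℝ ∞ W z →
      ContDiffAt ℝ ∞ (fun z => B (f z) (V z) (W z)) z := fun hz hV hW =>
    ((ContDiffAt.comp (G := F →L[ℝ] F →L[ℝ] ℝ) _ (hB _ hz) (hf _ hz)).clm_apply hV).clm_apply hW
  have fmet : ∀ {V W : Z → F} {z}, z ∈ O → ContDiffAt ℝ ∞ V z → ContDiffAt ℝ ∞ W z → ∀ b,
      fderiv ℝ (fun z => B (f z) (V z) (W z)) z b
        = B (f z) (covCoord Γ f V b z) (W z) + B (f z) (V z) (covCoord Γ f W b z) :=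
    fun hz hV hW b => fderiv_metric_apply ((hB _ hz).differentiableAt (by simp)) (hΓB _ hz)
      ((hf _ hz).differentiableAt (by simp)) (hV.differentiableAt (by simp))
      (hW.differentiableAt (by simp)) b
  have csum : ∀ {V : ι → Z → F} {z}, z ∈ O → (∀ j, ContDiffAt ℝ ∞ (V j) z) → ∀ i b,
      covCoord Γ f (fun z => ∑ j, P i j z • V j z) b z
        = ∑ j, (fderiv ℝ (P i j) z b • V j z + P i j z • covCoord Γ f (V j) b z) := by
    intro V z hz hV i b
    rw [covCoord_sum Γ f Finset.univ (V := fun j z => P i j z • V j z)]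
    · exact Finset.sum_congr rfl fun j _ => covCoord_smul Γ f
        ((hP z hz i j).differentiableAt (by simp)) ((hV j).differentiableAt (by simp)) b
    · exact fun j _ => ((hP z hz i j).smul (hV j)).differentiableAt (by simp)
  have dsum : ∀ {V : ι → Z → F} {z}, z ∈ O → (∀ j, ContDiffAt ℝ ∞ (V j) z) → ∀ i,
      ContDiffAt ℝ ∞ (fun z => ∑ j, P i j z • V j z) z := fun hz hV i =>
    ContDiffAt.sum fun j _ => (hP _ hz i j).smul (hV j)
  -- The variation field is made opaque, so that the rewriting below does not confuse it with the
  -- coordinate derivatives of f.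
  obtain ⟨v, hv⟩ : ∃ v : Z → F, ∀ z, fderiv ℝ f z a = v z := ⟨_, fun _ => rfl⟩
  have hv' : (fun z => fderiv ℝ f z a) = v := funext hv
  simp only [hv]
  -- Apply ∇_a to the divergence form of wτ. The coefficients are constant in the direction a, ∇_a
  -- passes ∇_i at the price of curvature, and ∇_a ∂_j f = ∇_j v.
  have hvar : w z • covCoord Γ f τ a z = ∑ i, (covCoord Γ f
      (fun z => ∑ j, P i j z • covCoord Γ f v (e j) z) (e i) z
      + ∑ j, P i j z • curvCoord Γ (f z) (v z) (fderiv ℝ f z (e i)) (fderiv ℝ f z (e j))) := by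
    have h1 : covCoord Γ f (fun z => w z • τ z) a z = w z • covCoord Γ f τ a z := by
      rw [covCoord_smul Γ f (hw z hz) ((hτ z hz).differentiableAt (by simp)), hwa z hz, zero_smul,
        zero_add]
    rw [← h1, covCoord_congr (Filter.eventuallyEq_of_mem (hO.mem_nhds hz) hwτ),
      covCoord_sum Γ f Finset.univ (V := fun i => covCoord Γ f
        (fun z => ∑ j, P i j z • fderiv ℝ f z (e j)) (e i)) fun i _ =>
        (dcov hz (dsum hz (fun j => dpar hz (e j)) i) (e i)).differentiableAt (by simp)]
    refine Finset.sum_congr rfl fun i _ => ?_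
    rw [covCoord_comm (hΓ z hz) (hf z hz) (dsum hz (fun j => dpar hz (e j)) i)]
    congr 1
    · refine covCoord_congr (Filter.eventuallyEq_of_mem (hO.mem_nhds hz) fun z hz => ?_) _
      simp only [csum hz (fun j => dpar hz (e j)), hPa z hz, zero_smul, zero_add]
      exact Finset.sum_congr rfl fun j _ => by
        rw [covCoord_fderiv_comm (hΓs _) (hf z hz), hv']
    · simp only [curvCoord, hv, map_sum, map_smul, smul_add, smul_sub, Finset.sum_add_distrib,
        Finset.sum_sub_distrib]
  have dv : ∀ {z}, z ∈ O → ContDiffAt ℝ ∞ v z := fun hz => hv' ▸ dpar hz a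
  have hdiv : ∀ i, fderiv ℝ (fun z => ∑ j, P i j z * (B (f z) (covCoord Γ f v (e j) z) (τ z)
        - B (f z) (v z) (covCoord Γ f τ (e j) z))) z (e i)
      = B (f z) (covCoord Γ f (fun z => ∑ j, P i j z • covCoord Γ f v (e j) z) (e i) z) (τ z)
        - B (f z) (v z) (covCoord Γ f (fun z => ∑ j, P i j z • covCoord Γ f τ (e j) z) (e i) z)
        + ∑ j, P i j z * (B (f z) (covCoord Γ f v (e j) z) (covCoord Γ f τ (e i) z)
          - B (f z) (covCoord Γ f v (e i) z) (covCoord Γ f τ (e j) z)) := by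
    intro i
    have h1 : (fun z => ∑ j, P i j z * (B (f z) (covCoord Γ f v (e j) z) (τ z)
        - B (f z) (v z) (covCoord Γ f τ (e j) z)))
        = fun z => B (f z) (∑ j, P i j z • covCoord Γ f v (e j) z) (τ z)
          - B (f z) (v z) (∑ j, P i j z • covCoord Γ f τ (e j) z) := by
      funext z
      simp only [map_sum, map_smul, sum_apply, smul_apply, smul_eq_mul, mul_sub,
        Finset.sum_sub_distrib]
    have d1 := dsum hz (fun j => dcov hz (dv hz) (e j)) i
    have d2 := dsum hz (fun j => dcov hz (hτ z hz) (e j)) i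
    rw [h1, fderiv_fun_sub ((dmet hz d1 (hτ z hz)).differentiableAt (by simp))
      ((dmet hz (dv hz) d2).differentiableAt (by simp)), sub_apply, fmet hz d1 (hτ z hz),
      fmet hz (dv hz) d2]
    simp only [map_sum, map_smul, sum_apply, smul_apply, smul_eq_mul, mul_sub,
        Finset.sum_sub_distrib]
    ring
  -- The products of first derivatives of v and τ are antisymmetric in i and j and are contracted
  -- with the symmetric P.
  have hcancel : ∑ i, ∑ j, P i j z * (B (f z) (covCoord Γ f v (e j) z) (covCoord Γ f τ (e i) z)
      - B (f z) (covCoord Γ f v (e i) z) (covCoord Γ f τ (e j) z)) = 0 := by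
    simp only [mul_sub, Finset.sum_sub_distrib]
    rw [sub_eq_zero, Finset.sum_comm]
    exact Finset.sum_congr rfl fun i _ => Finset.sum_congr rfl fun j _ => by rw [hPs j i]
  have hleft : w z * fderiv ℝ (fun z => 1 / 2 * B (f z) (τ z) (τ z)) z a
      = B (f z) (w z • covCoord Γ f τ a z) (τ z) := by
    rw [fderiv_const_mul ((dmet hz (hτ z hz) (hτ z hz)).differentiableAt (by simp)), smul_apply,
      fmet hz (hτ z hz) (hτ z hz), hBs _ (τ z), map_smul, smul_apply, smul_eq_mul, smul_eq_mul]
    ring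
  rw [hleft, hvar]
  simp only [hdiv, Finset.sum_add_distrib, hcancel, map_sum, map_add, sum_apply, add_apply,
    map_smul, smul_apply, smul_eq_mul, Finset.sum_sub_distrib]
  ring

end Variation

/-! ### Differentials and metrics in charts -/

section Charts

variable {m : ℕ} {M : Type*} [TopologicalSpace M]
  [ChartedSpace (EuclideanSpace ℝ (Fin m)) M] [IsManifold (𝓡 m) ∞ M]
  {W : Type*} [NormedAddCommGroup W] [NormedSpace ℝ W]

theorem coords_eq_mvfderiv {p y : M} (hy : y ∈ (chartAt (EuclideanSpace ℝ (Fin m)) p).source) :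
    coords p y = mvfderiv (𝓡 m) (chartAt (EuclideanSpace ℝ (Fin m)) p) y := by
  have : IsManifold (𝓡 m) 1 M := IsManifold.of_le (n := ∞) (by simp)
  exact TangentBundle.continuousLinearMapAt_trivializationAt (I := 𝓡 m) hy

theorem coords_coordFrame {p y : M} (hy : y ∈ (chartAt (EuclideanSpace ℝ (Fin m)) p).source)
    (a : EuclideanSpace ℝ (Fin m)) : coords p y (coordFrame p y a) = a :=
  Bundle.Trivialization.continuousLinearMapAt_symmL _ (by simpa using hy) a

theorem coordFrame_coords {p y : M} (hy : y ∈ (chartAt (EuclideanSpace ℝ (Fin m)) p).source)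
    (v : TangentSpace (𝓡 m) y) : coordFrame p y (coords p y v) = v :=
  Bundle.Trivialization.symmL_continuousLinearMapAt _ (by simpa using hy) v

variable {e : OpenPartialHomeomorph M (EuclideanSpace ℝ (Fin m))}

theorem mvfderiv_comp_mfderiv {n : ℕ} {N : Type*} [TopologicalSpace N]
    [ChartedSpace (EuclideanSpace ℝ (Fin n)) N] {g : N → W} {f : M → N} {x : M}
    (hg : MDifferentiableAt (𝓡 n) 𝓘(ℝ, W) g (f x)) (hf : MDifferentiableAt (𝓡 m) (𝓡 n) f x)
    (v : TangentSpace (𝓡 m) x) : mvfderiv (𝓡 m) (fun x => g (f x)) x v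
      = mvfderiv (𝓡 n) g (f x) (mfderiv (𝓡 m) (𝓡 n) f x v) :=
  mfderiv_comp_apply (I'' := 𝓘(ℝ, W)) x hg hf v

theorem contMDiffAt_chart_of_mem (he : e ∈ IsManifold.maximalAtlas (𝓡 m) ∞ M) {y : M}
    (hy : y ∈ e.source) : ContMDiffAt (𝓡 m) 𝓘(ℝ, EuclideanSpace ℝ (Fin m)) ∞ e y :=
  contMDiffAt_of_mem_maximalAtlas he hy

theorem contMDiffAt_chart_symm_of_mem (he : e ∈ IsManifold.maximalAtlas (𝓡 m) ∞ M)
    {u : EuclideanSpace ℝ (Fin m)} (hu : u ∈ e.target) :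
    ContMDiffAt 𝓘(ℝ, EuclideanSpace ℝ (Fin m)) (𝓡 m) ∞ e.symm u :=
  contMDiffAt_symm_of_mem_maximalAtlas he hu

/-- Near y the function is its chart expression composed with the chart; differentiability is
demanded of the chart expression only. -/
theorem mvfderiv_eq_fderiv_chart (he : e ∈ IsManifold.maximalAtlas (𝓡 m) ∞ M) {y : M}
    (hy : y ∈ e.source) {f : M → W} (hf : DifferentiableAt ℝ (fun u => f (e.symm u)) (e y))
    (v : TangentSpace (𝓡 m) y) :
    mvfderiv (𝓡 m) f y v = fderiv ℝ (fun u => f (e.symm u)) (e y) (mvfderiv (𝓡 m) e y v) := by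
  have h1 : f =ᶠ[nhds y] (fun u => f (e.symm u)) ∘ e := by
    filter_upwards [e.open_source.mem_nhds hy] with x hx
    simp [e.left_inv hx]
  have h2 : MDifferentiableAt (𝓡 m) 𝓘(ℝ, EuclideanSpace ℝ (Fin m)) e y :=
    (contMDiffAt_chart_of_mem he hy).mdifferentiableAt (by simp)
  have h3 : mvfderiv (𝓡 m) f y = mvfderiv (𝓡 m) ((fun u => f (e.symm u)) ∘ e) y := by
    ext v
    simp only [mvfderiv, h1.mfderiv_eq]
    rfl
  rw [h3]
  have h4 := mfderiv_comp_apply (I' := 𝓘(ℝ, EuclideanSpace ℝ (Fin m))) (I'' := 𝓘(ℝ, W))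
    (g := fun u => f (e.symm u)) y hf.mdifferentiableAt h2 v
  rw [mfderiv_eq_fderiv] at h4
  exact h4

theorem mdifferentiableAt_comp_chart_symm (he : e ∈ IsManifold.maximalAtlas (𝓡 m) ∞ M) {y : M}
    (hy : y ∈ e.source) {f : M → W} (hf : MDifferentiableAt (𝓡 m) 𝓘(ℝ, W) f y) :
    DifferentiableAt ℝ (fun u => f (e.symm u)) (e y) := by
  have h := (contMDiffAt_chart_symm_of_mem he (e.map_source hy)).mdifferentiableAt
    (n := ∞) (by simp)
  rw [← mdifferentiableAt_iff_differentiableAt]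
  refine MDifferentiableAt.comp (I' := 𝓡 m) (e y) ?_ h
  rwa [e.left_inv hy]

theorem contDiffAt_comp_chart_symm (he : e ∈ IsManifold.maximalAtlas (𝓡 m) ∞ M) {y : M}
    (hy : y ∈ e.source) {f : M → W} (hf : ContMDiffAt (𝓡 m) 𝓘(ℝ, W) ∞ f y) :
    ContDiffAt ℝ ∞ (fun u => f (e.symm u)) (e y) := by
  rw [← contMDiffAt_iff_contDiffAt]
  refine ContMDiffAt.comp (I' := 𝓡 m) (e y) ?_
    (contMDiffAt_chart_symm_of_mem he (e.map_source hy))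
  rwa [e.left_inv hy]

/-- The inverse of the differential of a chart. -/
def chartFrame (e : OpenPartialHomeomorph M (EuclideanSpace ℝ (Fin m))) (y : M) :
    EuclideanSpace ℝ (Fin m) →L[ℝ] TangentSpace (𝓡 m) y :=
  (coordFrame y y).comp
    (fderiv ℝ (fun u => chartAt (EuclideanSpace ℝ (Fin m)) y (e.symm u)) (e y))

theorem chart_mem_maximalAtlas (p : M) :
    chartAt (EuclideanSpace ℝ (Fin m)) p ∈ IsManifold.maximalAtlas (𝓡 m) ∞ M :=
  IsManifold.chart_mem_maximalAtlas p

theorem contDiffAt_transition {e' : OpenPartialHomeomorph M (EuclideanSpace ℝ (Fin m))}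
    (he : e ∈ IsManifold.maximalAtlas (𝓡 m) ∞ M)
    (he' : e' ∈ IsManifold.maximalAtlas (𝓡 m) ∞ M) {y : M} (hy : y ∈ e.source)
    (hy' : y ∈ e'.source) : ContDiffAt ℝ ∞ (fun u => e' (e.symm u)) (e y) :=
  contDiffAt_comp_chart_symm he hy (contMDiffAt_chart_of_mem he' hy')

theorem mvfderiv_chart_comp {e' : OpenPartialHomeomorph M (EuclideanSpace ℝ (Fin m))}
    (he : e ∈ IsManifold.maximalAtlas (𝓡 m) ∞ M)
    (he' : e' ∈ IsManifold.maximalAtlas (𝓡 m) ∞ M) {y : M} (hy : y ∈ e.source)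
    (hy' : y ∈ e'.source) (v : TangentSpace (𝓡 m) y) :
    mvfderiv (𝓡 m) e' y v
      = fderiv ℝ (fun u => e' (e.symm u)) (e y) (mvfderiv (𝓡 m) e y v) :=
  mvfderiv_eq_fderiv_chart he hy ((contDiffAt_transition he he' hy hy').differentiableAt (by simp)) v

theorem chartFrame_mvfderiv (he : e ∈ IsManifold.maximalAtlas (𝓡 m) ∞ M) {y : M}
    (hy : y ∈ e.source) (v : TangentSpace (𝓡 m) y) :
    chartFrame e y (mvfderiv (𝓡 m) e y v) = v := by
  rw [chartFrame, ContinuousLinearMap.comp_apply, ← mvfderiv_chart_comp he (chart_mem_maximalAtlas y) hy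
    (mem_chart_source _ y), ← coords_eq_mvfderiv (mem_chart_source _ y),
    coordFrame_coords (mem_chart_source _ y)]

/-- The frame is a left inverse of the differential of the chart, and the dimensions agree, so it is
also a right inverse. -/
theorem mvfderiv_chartFrame (he : e ∈ IsManifold.maximalAtlas (𝓡 m) ∞ M) {y : M}
    (hy : y ∈ e.source) (a : EuclideanSpace ℝ (Fin m)) :
    mvfderiv (𝓡 m) e y (chartFrame e y a) = a := by
  have hinj : Function.Injective (mvfderiv (𝓡 m) e y) :=
    Function.LeftInverse.injective (g := chartFrame e y) (chartFrame_mvfderiv he hy)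
  have hsurj : Function.Surjective (mvfderiv (𝓡 m) e y) :=
    LinearMap.injective_iff_surjective_of_finrank_eq_finrank
      (f := (mvfderiv (𝓡 m) e y).toLinearMap) rfl |>.1 hinj
  obtain ⟨v, rfl⟩ := hsurj a
  rw [chartFrame_mvfderiv he hy]

/-- The coordinate fields are smooth sections because their components in the trivialization are
constant; then g is evaluated on two of them. -/
theorem contMDiffAt_metricInCoords_apply (g : SmoothMetric m M) {p y : M}
    (hy : y ∈ (chartAt (EuclideanSpace ℝ (Fin m)) p).source) (a b : EuclideanSpace ℝ (Fin m)) :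
    ContMDiffAt (𝓡 m) 𝓘(ℝ, ℝ) ∞ (fun y => metricInCoords g p y a b) y := by
  have hs : ∀ a : EuclideanSpace ℝ (Fin m), ContMDiffAt (𝓡 m) (𝓡 m).tangent ∞
      (fun y => (⟨y, coordFrame p y a⟩ : TangentBundle (𝓡 m) M)) y := by
    intro a
    rw [Bundle.Trivialization.contMDiffAt_section_iff
      (trivializationAt (EuclideanSpace ℝ (Fin m)) (TangentSpace (𝓡 m)) p) (by simpa using hy)]
    refine (contMDiffAt_const (c := a)).congr_of_eventuallyEq ?_
    filter_upwards [(chartAt (EuclideanSpace ℝ (Fin m)) p).open_source.mem_nhds hy] with z hz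
    have h := coords_coordFrame hz a
    rw [coords, Bundle.Trivialization.continuousLinearMapAt_apply,
      Bundle.Trivialization.coe_linearMapAt_of_mem _ (by simpa using hz)] at h
    exact h
  have h := ContMDiffAt.clm_bundle_apply₂ (F₁ := EuclideanSpace ℝ (Fin m))
    (F₂ := EuclideanSpace ℝ (Fin m)) (F₃ := ℝ) (E₁ := fun x : M => TangentSpace (𝓡 m) x)
    (E₂ := fun x : M => TangentSpace (𝓡 m) x) (E₃ := Bundle.Trivial M ℝ)
    (b := fun y : M => y) (g.contMDiff y) (hs a) (hs b)
  simp only [Bundle.contMDiffAt_totalSpace] at h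
  exact h.2

/-- The metric in the preferred chart at `p`, as a function on the model space. -/
def chartMetric (g : SmoothMetric m M) (p : M) (u : EuclideanSpace ℝ (Fin m)) :
    EuclideanSpace ℝ (Fin m) →L[ℝ] EuclideanSpace ℝ (Fin m) →L[ℝ] ℝ :=
  metricInCoords g p ((chartAt (EuclideanSpace ℝ (Fin m)) p).symm u)

theorem contDiffOn_chartMetric (g : SmoothMetric m M) (p : M) :
    ContDiffOn ℝ ∞ (chartMetric g p) (chartAt (EuclideanSpace ℝ (Fin m)) p).target := by
  refine contDiffOn_clm_apply.2 fun a => contDiffOn_clm_apply.2 fun b => ?_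
  intro u hu
  have hy := (chartAt (EuclideanSpace ℝ (Fin m)) p).map_target hu
  have h := contDiffAt_comp_chart_symm (chart_mem_maximalAtlas p) hy
    (contMDiffAt_metricInCoords_apply g hy a b)
  rw [(chartAt (EuclideanSpace ℝ (Fin m)) p).right_inv hu] at h
  exact h.contDiffWithinAt

theorem contDiffAt_chartMetric (g : SmoothMetric m M) {p : M} {u : EuclideanSpace ℝ (Fin m)}
    (hu : u ∈ (chartAt (EuclideanSpace ℝ (Fin m)) p).target) :
    ContDiffAt ℝ ∞ (chartMetric g p) u :=
  (contDiffOn_chartMetric g p).contDiffAt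
    ((chartAt (EuclideanSpace ℝ (Fin m)) p).open_target.mem_nhds hu)

theorem inner_eq_chartMetric (g : SmoothMetric m M) {p y : M}
    (hy : y ∈ (chartAt (EuclideanSpace ℝ (Fin m)) p).source) (v w : TangentSpace (𝓡 m) y) :
    g.inner y v w = chartMetric g p (chartAt (EuclideanSpace ℝ (Fin m)) p y)
      (mvfderiv (𝓡 m) (chartAt (EuclideanSpace ℝ (Fin m)) p) y v)
      (mvfderiv (𝓡 m) (chartAt (EuclideanSpace ℝ (Fin m)) p) y w) := by
  -- The base point is generalised: tangent vectors depend on it, so the equality from `left_inv`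
  -- cannot simply be rewritten.
  have h : ∀ z, z = y → ∀ a b, metricInCoords g p z a b = metricInCoords g p y a b := by
    rintro z rfl a b; rfl
  rw [chartMetric, h _ ((chartAt (EuclideanSpace ℝ (Fin m)) p).left_inv hy),
    ← coords_eq_mvfderiv hy]
  change _ = g.inner y (coordFrame p y (coords p y v)) (coordFrame p y (coords p y w))
  rw [coordFrame_coords hy, coordFrame_coords hy]

end Charts

/-- The Christoffel symbols of the first kind of a metric `G` on a vector space. -/
def koszulCoord {F : Type*} [NormedAddCommGroup F] [NormedSpace ℝ F]
    (G : F → F →L[ℝ] F →L[ℝ] ℝ) (y a b c : F) : ℝ :=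
  (1 / 2) * (fderiv ℝ G y a b c + fderiv ℝ G y b a c - fderiv ℝ G y c a b)

/-! ### Transformation law of the Christoffel symbols -/

section Christoffel

variable {n : ℕ} {N : Type*} [TopologicalSpace N]
  [ChartedSpace (EuclideanSpace ℝ (Fin n)) N] [IsManifold (𝓡 n) ∞ N]
  {e : OpenPartialHomeomorph N (EuclideanSpace ℝ (Fin n))}
  {G : EuclideanSpace ℝ (Fin n) → EuclideanSpace ℝ (Fin n) →L[ℝ] EuclideanSpace ℝ (Fin n) →L[ℝ] ℝ}

theorem mvfderiv_coordFrame (he : e ∈ IsManifold.maximalAtlas (𝓡 n) ∞ N) {p y : N}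
    (hp : y ∈ (chartAt (EuclideanSpace ℝ (Fin n)) p).source) (hy : y ∈ e.source)
    (a : EuclideanSpace ℝ (Fin n)) :
    mvfderiv (𝓡 n) e y (coordFrame p y a)
      = fderiv ℝ (fun u => e ((chartAt (EuclideanSpace ℝ (Fin n)) p).symm u))
          (chartAt (EuclideanSpace ℝ (Fin n)) p y) a := by
  rw [mvfderiv_chart_comp (chart_mem_maximalAtlas p) he hp hy, ← coords_eq_mvfderiv hp,
    coords_coordFrame hp]

/-- The derivatives of the metric components in the preferred chart at `q`, in terms of those in
another chart. -/
theorem metricDeriv_eq (h : SmoothMetric n N) {q : N}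
    (he : e ∈ IsManifold.maximalAtlas (𝓡 n) ∞ N) (hq : q ∈ e.source)
    (hG : DifferentiableAt ℝ G (e q))
    (hh : ∀ᶠ y in nhds q, ∀ v w, h.inner y v w
      = G (e y) (mvfderiv (𝓡 n) e y v) (mvfderiv (𝓡 n) e y w))
    {κ : EuclideanSpace ℝ (Fin n) → EuclideanSpace ℝ (Fin n)}
    (hκ : κ = fun u => e ((chartAt (EuclideanSpace ℝ (Fin n)) q).symm u))
    {u₀ : EuclideanSpace ℝ (Fin n)} (hu₀ : u₀ = chartAt (EuclideanSpace ℝ (Fin n)) q q)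
    (v : TangentSpace (𝓡 n) q) (a b : EuclideanSpace ℝ (Fin n)) :
    metricDeriv h q v a b
      = fderiv ℝ G (e q) (fderiv ℝ κ u₀ (coords q q v)) (fderiv ℝ κ u₀ a) (fderiv ℝ κ u₀ b)
        + G (e q) (fderiv ℝ (fderiv ℝ κ) u₀ (coords q q v) a) (fderiv ℝ κ u₀ b)
        + G (e q) (fderiv ℝ κ u₀ a) (fderiv ℝ (fderiv ℝ κ) u₀ (coords q q v) b) := by
  have hqc := mem_chart_source (EuclideanSpace ℝ (Fin n)) q
  have hsm : ContDiffAt ℝ ∞ κ u₀ := by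
    rw [hκ, hu₀]; exact contDiffAt_transition (chart_mem_maximalAtlas q) he hqc hq
  have hu₀t : u₀ ∈ (chartAt (EuclideanSpace ℝ (Fin n)) q).target := by
    rw [hu₀]; exact mem_chart_target _ q
  have hcm := (contDiffAt_chartMetric h hu₀t).differentiableAt (n := ∞) (by simp)
  have hκq : κ u₀ = e q := by
    rw [hκ, hu₀]; simp [(chartAt (EuclideanSpace ℝ (Fin n)) q).left_inv hqc]
  have h1 : metricDeriv h q v = fderiv ℝ (chartMetric h q) u₀ (coords q q v) := by
    rw [coords_eq_mvfderiv hqc, hu₀]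
    exact mvfderiv_eq_fderiv_chart (chart_mem_maximalAtlas q) hqc (hu₀ ▸ hcm) v
  have h2 : fderiv ℝ (chartMetric h q) u₀ (coords q q v) a b
      = fderiv ℝ (fun u => chartMetric h q u a b) u₀ (coords q q v) := by
    rw [fderiv_clm_apply (hcm.clm_apply (by fun_prop)) (by fun_prop),
      fderiv_clm_apply hcm (by fun_prop)]
    simp
  have h3 : (fun u => chartMetric h q u a b) =ᶠ[nhds u₀]
      fun u => G (κ u) (fderiv ℝ κ u a) (fderiv ℝ κ u b) := by
    have hc : Filter.Tendsto (chartAt (EuclideanSpace ℝ (Fin n)) q).symm (nhds u₀) (nhds q) := by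
      have := (chartAt (EuclideanSpace ℝ (Fin n)) q).continuousAt_symm hu₀t
      rw [ContinuousAt, hu₀, (chartAt (EuclideanSpace ℝ (Fin n)) q).left_inv hqc, ← hu₀] at this
      exact this
    -- The metric components in the preferred chart are the pull-back of G by κ. The product rule
    -- then yields one term with the derivative of G and two with the second derivative of κ.
    filter_upwards [hc.eventually hh, hc.eventually (e.open_source.mem_nhds hq),
      (chartAt (EuclideanSpace ℝ (Fin n)) q).open_target.mem_nhds hu₀t] with u hu hue hut
    have hus := (chartAt (EuclideanSpace ℝ (Fin n)) q).map_target hut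
    change h.inner _ (coordFrame q _ a) (coordFrame q _ b) = _
    rw [hu, mvfderiv_coordFrame he hus hue, mvfderiv_coordFrame he hus hue,
      (chartAt (EuclideanSpace ℝ (Fin n)) q).right_inv hut, hκ]
  have hd : DifferentiableAt ℝ (fderiv ℝ κ) u₀ :=
    (hsm.fderiv_right (m := ∞) (by simp)).differentiableAt (by simp)
  have hκd := hsm.differentiableAt (n := ∞) (by simp)
  rw [← hκq] at hG ⊢
  have hGκ : DifferentiableAt ℝ (fun u => G (κ u)) u₀ :=
    DifferentiableAt.comp (G := EuclideanSpace ℝ (Fin n) →L[ℝ] EuclideanSpace ℝ (Fin n) →L[ℝ] ℝ)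
      u₀ hG hκd
  have hGκ' : fderiv ℝ (fun u => G (κ u)) u₀ = (fderiv ℝ G (κ u₀)).comp (fderiv ℝ κ u₀) :=
    fderiv_comp (G := EuclideanSpace ℝ (Fin n) →L[ℝ] EuclideanSpace ℝ (Fin n) →L[ℝ] ℝ)
      u₀ hG hκd
  have hda : ∀ a, DifferentiableAt ℝ (fun u => fderiv ℝ κ u a) u₀ := fun a =>
    hd.clm_apply (by fun_prop)
  rw [h1, h2, h3.fderiv_eq, fderiv_clm_apply (hGκ.clm_apply (hda a)) (hda b),
    fderiv_clm_apply hGκ (hda a), fderiv_clm_apply hd (by fun_prop),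
    fderiv_clm_apply hd (by fun_prop), hGκ']
  simp
  ring

theorem koszulForm_apply (h : SmoothMetric n N) (q : N) (u v w : TangentSpace (𝓡 n) q) :
    koszulForm h q u v w = (1 / 2) * (metricDeriv h q u (coords q q v) (coords q q w)
      + metricDeriv h q v (coords q q u) (coords q q w)
      - metricDeriv h q w (coords q q u) (coords q q v)) := by
  simp [koszulForm]

theorem eq_of_inner_eq (h : SmoothMetric n N) {q : N} {v w : TangentSpace (𝓡 n) q}
    (hvw : ∀ z, h.inner q v z = h.inner q w z) : v = w := by
  by_contra hne
  have h1 := h.pos q (v - w) (sub_ne_zero.2 hne)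
  simp only [map_sub, sub_apply, hvw, sub_self, lt_irrefl] at h1

/-- Transformation law of the Christoffel symbols. -/
theorem mvfderiv_christoffel (h : SmoothMetric n N) {q : N}
    (he : e ∈ IsManifold.maximalAtlas (𝓡 n) ∞ N) (hq : q ∈ e.source)
    (hG : DifferentiableAt ℝ G (e q)) (hGs : ∀ a b, G (e q) a b = G (e q) b a)
    (hh : ∀ᶠ y in nhds q, ∀ v w, h.inner y v w
      = G (e y) (mvfderiv (𝓡 n) e y v) (mvfderiv (𝓡 n) e y w))
    {Γ : EuclideanSpace ℝ (Fin n) → EuclideanSpace ℝ (Fin n) → EuclideanSpace ℝ (Fin n)}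
    (hΓ : ∀ a b c, G (e q) (Γ a b) c = koszulCoord G (e q) a b c)
    (u v : TangentSpace (𝓡 n) q) :
    mvfderiv (𝓡 n) e q (christoffel h q u v)
      = fderiv ℝ (fderiv ℝ (fun u => e ((chartAt (EuclideanSpace ℝ (Fin n)) q).symm u)))
          (chartAt (EuclideanSpace ℝ (Fin n)) q q) (coords q q u) (coords q q v)
        + Γ (mvfderiv (𝓡 n) e q u) (mvfderiv (𝓡 n) e q v) := by
  have hqc := mem_chart_source (EuclideanSpace ℝ (Fin n)) q
  obtain ⟨κ, hκ⟩ : ∃ κ, κ = fun u => e ((chartAt (EuclideanSpace ℝ (Fin n)) q).symm u) := ⟨_, rfl⟩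
  obtain ⟨u₀, hu₀⟩ : ∃ u₀, u₀ = chartAt (EuclideanSpace ℝ (Fin n)) q q := ⟨_, rfl⟩
  rw [← hκ, ← hu₀]
  have hsm : ContDiffAt ℝ ∞ κ u₀ := by
    rw [hκ, hu₀]; exact contDiffAt_transition (chart_mem_maximalAtlas q) he hqc hq
  have hsymm := (hsm.isSymmSndFDerivAt (by simpa using two_le_infty)).eq
  have hd : ∀ w : TangentSpace (𝓡 n) q, mvfderiv (𝓡 n) e q w = fderiv ℝ κ u₀ (coords q q w) := by
    intro w
    rw [mvfderiv_chart_comp (chart_mem_maximalAtlas q) he hqc hq, ← coords_eq_mvfderiv hqc, hκ, hu₀]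
  -- The right side is lifted to a tangent vector at q, so that both sides can be compared by their
  -- inner products. On the left these are given by the Koszul formula, and symmetry of the second
  -- derivative of κ collapses its terms to a single one.
  rw [← mvfderiv_chartFrame he hq (fderiv ℝ (fderiv ℝ κ) u₀ (coords q q u) (coords q q v)
    + Γ (mvfderiv (𝓡 n) e q u) (mvfderiv (𝓡 n) e q v))]
  congr 1
  refine eq_of_inner_eq h fun w => ?_
  rw [christoffel, inner_sharp, koszulForm_apply, hh.self_of_nhds, mvfderiv_chartFrame he hq,
    map_add, add_apply, hΓ, koszulCoord]
  simp only [metricDeriv_eq h he hq hG hh hκ hu₀, hd, hGs (fderiv ℝ κ u₀ _), hsymm _ (coords q q u),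
    hsymm (coords q q w)]
  ring

end Christoffel

/-! ### Chart independence of the covariant derivative along a map -/

section CovariantDerivative

variable {m n : ℕ} {M N : Type*} [TopologicalSpace M] [TopologicalSpace N]
  [ChartedSpace (EuclideanSpace ℝ (Fin m)) M] [IsManifold (𝓡 m) ∞ M]
  [ChartedSpace (EuclideanSpace ℝ (Fin n)) N] [IsManifold (𝓡 n) ∞ N]
  {e : OpenPartialHomeomorph M (EuclideanSpace ℝ (Fin m))}
  {ψ : OpenPartialHomeomorph N (EuclideanSpace ℝ (Fin n))}
  {G : EuclideanSpace ℝ (Fin n) → EuclideanSpace ℝ (Fin n) →L[ℝ] EuclideanSpace ℝ (Fin n) →L[ℝ] ℝ}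

/-- The covariant derivative along a map, computed in arbitrary charts. -/
theorem mvfderiv_covAlong (h : SmoothMetric n N) {φ : M → N}
    {V : (x : M) → TangentSpace (𝓡 n) (φ x)} {x : M}
    (he : e ∈ IsManifold.maximalAtlas (𝓡 m) ∞ M) (hx : x ∈ e.source)
    (hψ : ψ ∈ IsManifold.maximalAtlas (𝓡 n) ∞ N) (hφx : φ x ∈ ψ.source)
    (hG : DifferentiableAt ℝ G (ψ (φ x))) (hGs : ∀ a b, G (ψ (φ x)) a b = G (ψ (φ x)) b a)
    (hh : ∀ᶠ y in nhds (φ x), ∀ v w, h.inner y v w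
      = G (ψ y) (mvfderiv (𝓡 n) ψ y v) (mvfderiv (𝓡 n) ψ y w))
    {Γ : EuclideanSpace ℝ (Fin n) → EuclideanSpace ℝ (Fin n) → EuclideanSpace ℝ (Fin n)}
    (hΓ : ∀ a b c, G (ψ (φ x)) (Γ a b) c = koszulCoord G (ψ (φ x)) a b c)
    (hφ : MDifferentiableAt (𝓡 m) (𝓡 n) φ x)
    (hV : DifferentiableAt ℝ
      (fun u => mvfderiv (𝓡 n) ψ (φ (e.symm u)) (V (e.symm u))) (e x))
    (v : TangentSpace (𝓡 m) x) :
    mvfderiv (𝓡 n) ψ (φ x) (covAlong h φ V x v)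
      = fderiv ℝ (fun u => mvfderiv (𝓡 n) ψ (φ (e.symm u)) (V (e.symm u))) (e x)
          (mvfderiv (𝓡 m) e x v)
        + Γ (fderiv ℝ (fun u => ψ (φ (e.symm u))) (e x) (mvfderiv (𝓡 m) e x v))
          (mvfderiv (𝓡 n) ψ (φ x) (V x)) := by
  obtain ⟨q, hq⟩ : ∃ q, q = φ x := ⟨_, rfl⟩
  have hqc : φ x ∈ (chartAt (EuclideanSpace ℝ (Fin n)) (φ x)).source :=
    mem_chart_source (EuclideanSpace ℝ (Fin n)) (φ x)
  set c := chartAt (EuclideanSpace ℝ (Fin n)) (φ x) with hc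
  have hcat : c ∈ IsManifold.maximalAtlas (𝓡 n) ∞ N := chart_mem_maximalAtlas (φ x)
  set κ : EuclideanSpace ℝ (Fin n) → EuclideanSpace ℝ (Fin n) := fun u => ψ (c.symm u) with hκ
  set κ' : EuclideanSpace ℝ (Fin n) → EuclideanSpace ℝ (Fin n) := fun u => c (ψ.symm u) with hκ'
  have hsm : ContDiffAt ℝ ∞ κ (c (φ x)) := contDiffAt_transition hcat hψ hqc hφx
  have hsm' : ContDiffAt ℝ ∞ κ' (ψ (φ x)) := contDiffAt_transition hψ hcat hφx hqc
  have hψm : MDifferentiableAt (𝓡 n) 𝓘(ℝ, EuclideanSpace ℝ (Fin n)) ψ (φ x) :=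
    (contMDiffAt_chart_of_mem hψ hφx).mdifferentiableAt (by simp)
  have hcm : MDifferentiableAt (𝓡 n) 𝓘(ℝ, EuclideanSpace ℝ (Fin n)) c (φ x) :=
    (contMDiffAt_chart_of_mem hcat hqc).mdifferentiableAt (by simp)
  have hex : e.symm (e x) = x := e.left_inv hx
  have hcφ : DifferentiableAt ℝ (fun u => c (φ (e.symm u))) (e x) :=
    mdifferentiableAt_comp_chart_symm (f := fun y => c (φ y)) he hx (hcm.comp x hφ)
  have hψφ : DifferentiableAt ℝ (fun u => ψ (φ (e.symm u))) (e x) :=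
    mdifferentiableAt_comp_chart_symm (f := fun y => ψ (φ y)) he hx (hψm.comp x hφ)
  have hnear : ∀ᶠ u in nhds (e x), φ (e.symm u) ∈ c.source ∧ φ (e.symm u) ∈ ψ.source := by
    have ht : Filter.Tendsto (fun u => φ (e.symm u)) (nhds (e x)) (nhds (φ x)) := by
      have h1 := e.continuousAt_symm (e.map_source hx)
      have h2 := hφ.continuousAt
      rw [ContinuousAt, hex] at h1
      exact h2.tendsto.comp h1
    exact (ht.eventually (c.open_source.mem_nhds hqc)).and
      (ht.eventually (ψ.open_source.mem_nhds hφx))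
  set b : EuclideanSpace ℝ (Fin m) → EuclideanSpace ℝ (Fin n) :=
    fun u => coords (φ x) (φ (e.symm u)) (V (e.symm u)) with hb
  have hb1 : b =ᶠ[nhds (e x)] fun u => fderiv ℝ κ' (ψ (φ (e.symm u)))
      (mvfderiv (𝓡 n) ψ (φ (e.symm u)) (V (e.symm u))) := by
    filter_upwards [hnear] with u hu
    rw [hb, hκ']
    simp only
    rw [coords_eq_mvfderiv hu.1, mvfderiv_chart_comp hψ hcat hu.2 hu.1]
  have hb2 : (fun u => mvfderiv (𝓡 n) ψ (φ (e.symm u)) (V (e.symm u))) =ᶠ[nhds (e x)]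
      fun u => fderiv ℝ κ (c (φ (e.symm u))) (b u) := by
    filter_upwards [hnear] with u hu
    rw [hb, hκ]
    simp only
    rw [coords_eq_mvfderiv hu.1, mvfderiv_chart_comp hcat hψ hu.1 hu.2]
  have hdκ : DifferentiableAt ℝ (fderiv ℝ κ) (c (φ (e.symm (e x)))) := by
    rw [hex]
    exact (hsm.fderiv_right (m := ∞) (by simp)).differentiableAt (by simp)
  have hdκ' : DifferentiableAt ℝ (fderiv ℝ κ') (ψ (φ (e.symm (e x)))) := by
    rw [hex]
    exact (hsm'.fderiv_right (m := ∞) (by simp)).differentiableAt (by simp)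
  have hbd : DifferentiableAt ℝ b (e x) := by
    refine DifferentiableAt.congr_of_eventuallyEq ?_ hb1
    -- Differentiability is assumed for the components in ψ; the reverse transition transfers it to
    -- the components in the preferred chart.
    exact (hdκ'.comp (e x) hψφ).clm_apply hV
  have hκb : DifferentiableAt ℝ (fun u => fderiv ℝ κ (c (φ (e.symm u)))) (e x) :=
    hdκ.comp (e x) hcφ
  have hκb' : fderiv ℝ (fun u => fderiv ℝ κ (c (φ (e.symm u)))) (e x)
      = (fderiv ℝ (fderiv ℝ κ) (c (φ (e.symm (e x))))).comp
        (fderiv ℝ (fun u => c (φ (e.symm u))) (e x)) := fderiv_comp (e x) hdκ hcφ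
  have hbx : b (e x) = coords (φ x) (φ x) (V x) := by
    have : ∀ z, z = x → coords (φ x) (φ z) (V z) = coords (φ x) (φ x) (V x) := by
      rintro z rfl; rfl
    exact this _ hex
  have hdφ : mvfderiv (𝓡 n) ψ (φ x) (mfderiv (𝓡 m) (𝓡 n) φ x v)
      = fderiv ℝ (fun u => ψ (φ (e.symm u))) (e x) (mvfderiv (𝓡 m) e x v) := by
    rw [← mvfderiv_comp_mfderiv hψm hφ]
    exact mvfderiv_eq_fderiv_chart (f := fun y => ψ (φ y)) he hx hψφ v
  have hdc : coords (φ x) (φ x) (mfderiv (𝓡 m) (𝓡 n) φ x v)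
      = fderiv ℝ (fun u => c (φ (e.symm u))) (e x) (mvfderiv (𝓡 m) e x v) := by
    rw [coords_eq_mvfderiv hqc, ← mvfderiv_comp_mfderiv hcm hφ]
    exact mvfderiv_eq_fderiv_chart (f := fun y => c (φ y)) he hx hcφ v
  have hbv : mvfderiv (𝓡 m) (fun y : M => coords (φ x) (φ y) (V y)) x v
      = fderiv ℝ b (e x) (mvfderiv (𝓡 m) e x v) :=
    mvfderiv_eq_fderiv_chart (f := fun y : M => coords (φ x) (φ y) (V y)) he hx hbd v
  -- The inhomogeneous term of the Christoffel symbols is exactly what differentiating the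
  -- transition matrix produces in the components of V.
  rw [covAlong, map_add, mvfderiv_coordFrame hψ hqc hφx,
    mvfderiv_christoffel h hψ hφx hG hGs hh hΓ, hdφ, hdc, hb2.fderiv_eq, fderiv_clm_apply hκb hbd,
    hκb', hbv, hbx, hex]
  simp only [add_apply, ContinuousLinearMap.comp_apply, ContinuousLinearMap.flip_apply]
  rw [add_assoc]

end CovariantDerivative

/-! ### Derivatives of determinants and inverse matrices -/

section MatrixCalculus

variable {Z ι : Type*} [NormedAddCommGroup Z] [NormedSpace ℝ Z] [Fintype ι] [DecidableEq ι]

theorem contDiffAt_det {A : Z → Matrix ι ι ℝ} {z : Z}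
    (hA : ∀ i j, ContDiffAt ℝ ∞ (fun z => A z i j) z) : ContDiffAt ℝ ∞ (fun z => (A z).det) z := by
  simp only [Matrix.det_apply']
  exact ContDiffAt.sum fun σ _ => contDiffAt_const.mul (contDiffAt_prod fun i _ => hA _ _)

/-- Cramer's rule: each entry of the inverse is a quotient of determinants. -/
theorem contDiffAt_inv_apply {A : Z → Matrix ι ι ℝ} {z : Z}
    (hA : ∀ i j, ContDiffAt ℝ ∞ (fun z => A z i j) z) (hdet : (A z).det ≠ 0) (i j : ι) :
    ContDiffAt ℝ ∞ (fun z => (A z)⁻¹ i j) z := by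
  simp only [Matrix.inv_def, Ring.inverse_eq_inv', Matrix.smul_apply, smul_eq_mul,
    Matrix.adjugate_apply]
  refine ((contDiffAt_det hA).inv hdet).mul (contDiffAt_det fun k l => ?_)
  by_cases hk : k = j
  · subst hk; simpa using contDiffAt_const
  · simpa [Matrix.updateRow_ne hk] using hA k l

/-- Jacobi's formula. The determinant is multilinear in the rows; replacing a row and expanding
gives the adjugate. -/
theorem fderiv_det {A : Z → Matrix ι ι ℝ} {z : Z}
    (hA : ∀ i j, DifferentiableAt ℝ (fun z => A z i j) z) (hdet : (A z).det ≠ 0) (a : Z) :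
    fderiv ℝ (fun z => (A z).det) z a
      = (A z).det * ∑ i, ∑ j, (A z)⁻¹ j i * fderiv ℝ (fun z => A z i j) z a := by
  let D : ContinuousMultilinearMap ℝ (fun _ : ι => ι → ℝ) ℝ :=
    { Matrix.detRowAlternating.toMultilinearMap with
      cont := Continuous.matrix_det (A := fun x : ι → ι → ℝ => (Matrix.of x)) continuous_id }
  have h1 : ∀ i, HasFDerivAt (fun z => A z i)
      (ContinuousLinearMap.pi fun j => fderiv ℝ (fun z => A z i j) z) z := fun i =>
    hasFDerivAt_pi.2 fun j => (hA i j).hasFDerivAt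
  have h2 := HasFDerivAt.multilinear_comp D h1
  have h3 : (fun z => (A z).det) = fun z => D fun i => A z i := rfl
  rw [h3, h2.fderiv, Finset.mul_sum, sum_apply]
  refine Finset.sum_congr rfl fun i _ => ?_
  have h4 : ∀ b : ι → ℝ, D (Function.update (A z) i b) = ∑ j, (A z).adjugate j i * b j := by
    intro b
    change ((A z).updateRow i b).det = _
    rw [← Matrix.cramer_transpose_apply, Matrix.cramer_eq_adjugate_mulVec,
      ← Matrix.adjugate_transpose]
    rfl
  have h5 : ∀ j i, (A z).adjugate j i = (A z).det * (A z)⁻¹ j i := by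
    intro j i
    rw [Matrix.inv_def, Matrix.smul_apply, Ring.inverse_eq_inv', smul_eq_mul,
      mul_inv_cancel_left₀ hdet]
  have h6 := h4 fun j => fderiv ℝ (fun z => A z i j) z a
  simp only [h5] at h6
  rw [Finset.mul_sum]
  refine Eq.trans ?_ (h6.trans (Finset.sum_congr rfl fun j _ => mul_assoc _ _ _))
  rfl

/-- Differentiate A⁻¹A = 1, valid near z, and multiply by A⁻¹ on the right. -/
theorem fderiv_inv_apply {A : Z → Matrix ι ι ℝ} {z : Z}
    (hA : ∀ i j, ContDiffAt ℝ ∞ (fun z => A z i j) z) (hdet : ∀ᶠ z in nhds z, (A z).det ≠ 0)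
    (a : Z) (i j : ι) :
    fderiv ℝ (fun z => (A z)⁻¹ i j) z a
      = -∑ k, ∑ l, (A z)⁻¹ i k * fderiv ℝ (fun z => A z k l) z a * (A z)⁻¹ l j := by
  have hI : ∀ i j, DifferentiableAt ℝ (fun z => (A z)⁻¹ i j) z := fun i j =>
    (contDiffAt_inv_apply hA hdet.self_of_nhds i j).differentiableAt (by simp)
  have hAd : ∀ i j, DifferentiableAt ℝ (fun z => A z i j) z := fun i j =>
    (hA i j).differentiableAt (by simp)
  have h1 : ∀ i l, ∑ k, fderiv ℝ (fun z => (A z)⁻¹ i k) z a * A z k l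
      = -∑ k, (A z)⁻¹ i k * fderiv ℝ (fun z => A z k l) z a := by
    intro i l
    have h2 : (fun z => ∑ k, (A z)⁻¹ i k * A z k l) =ᶠ[nhds z]
        fun _ => (1 : Matrix ι ι ℝ) i l := by
      filter_upwards [hdet] with z hz
      rw [← Matrix.nonsing_inv_mul (A z) (isUnit_iff_ne_zero.2 hz), Matrix.mul_apply]
    have h3 := congrArg (fun L => L a) (h2.fderiv_eq (𝕜 := ℝ))
    rw [fderiv_fun_sum fun k _ => (hI i k).fun_mul (hAd k l)] at h3
    simp only [fderiv_fun_mul (hI _ _) (hAd _ _), sum_apply, add_apply, smul_apply, smul_eq_mul,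
      Finset.sum_add_distrib, fderiv_fun_const, Pi.zero_apply, zero_apply] at h3
    rw [eq_neg_iff_add_eq_zero, ← h3, add_comm]
    congr 1
    exact Finset.sum_congr rfl fun k _ => mul_comm _ _
  have h4 : ∀ k, ∑ l, A z k l * (A z)⁻¹ l j = (1 : Matrix ι ι ℝ) k j := fun k => by
    rw [← Matrix.mul_nonsing_inv (A z) (isUnit_iff_ne_zero.2 hdet.self_of_nhds), Matrix.mul_apply]
  calc fderiv ℝ (fun z => (A z)⁻¹ i j) z a
      = ∑ k, fderiv ℝ (fun z => (A z)⁻¹ i k) z a * (1 : Matrix ι ι ℝ) k j := by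
        simp [Matrix.one_apply]
    _ = ∑ l, (∑ k, fderiv ℝ (fun z => (A z)⁻¹ i k) z a * A z k l) * (A z)⁻¹ l j := by
        simp only [← h4, Finset.mul_sum, Finset.sum_mul]
        rw [Finset.sum_comm]
        exact Finset.sum_congr rfl fun l _ => Finset.sum_congr rfl fun k _ => by ring
    _ = _ := by
        simp only [h1, neg_mul, Finset.sum_neg_distrib, Finset.sum_mul]
        rw [Finset.sum_comm]

/-- The divergence of the rows of `√(det A) A⁻¹`, for a field `A` of symmetric matrices. -/
theorem sum_fderiv_sqrt_det_mul_inv {A : Z → Matrix ι ι ℝ} {z : Z}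
    (hA : ∀ i j, ContDiffAt ℝ ∞ (fun z => A z i j) z) (hdet : ∀ᶠ z in nhds z, 0 < (A z).det)
    (hsymm : ∀ z, (A z).IsSymm) (ε : ι → Z) (l : ι) :
    ∑ i, ∑ j, fderiv ℝ (fun z => √(A z).det * (A z)⁻¹ i j) z (ε i) * A z j l
      = -(√(A z).det * ∑ i, ∑ j, (A z)⁻¹ i j * ((1 / 2)
        * (fderiv ℝ (fun z => A z j l) z (ε i) + fderiv ℝ (fun z => A z i l) z (ε j)
          - fderiv ℝ (fun z => A z i j) z (ε l)))) := by
  have hpos := hdet.self_of_nhds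
  have hdet' : ∀ᶠ z in nhds z, (A z).det ≠ 0 := hdet.mono fun z hz => hz.ne'
  have hI : ∀ i j, DifferentiableAt ℝ (fun z => (A z)⁻¹ i j) z := fun i j =>
    (contDiffAt_inv_apply hA hpos.ne' i j).differentiableAt (by simp)
  have hAd : ∀ i j, DifferentiableAt ℝ (fun z => A z i j) z := fun i j =>
    (hA i j).differentiableAt (by simp)
  have hD : DifferentiableAt ℝ (fun z => (A z).det) z :=
    (contDiffAt_det hA).differentiableAt (by simp)
  have hinvs : ∀ i j, (A z)⁻¹ i j = (A z)⁻¹ j i := fun i j => by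
    rw [← Matrix.transpose_apply (A z)⁻¹, Matrix.transpose_nonsing_inv, (hsymm z).eq]
  have hAs : ∀ i j, (fun z => A z i j) = fun z => A z j i := fun i j =>
    funext fun z => (hsymm z).apply j i
  have hw : ∀ a, fderiv ℝ (fun z => √(A z).det) z a = √(A z).det * ((1 / 2)
      * ∑ i, ∑ j, (A z)⁻¹ i j * fderiv ℝ (fun z => A z i j) z a) := by
    intro a
    rw [fderiv_sqrt hD hpos.ne', smul_apply, fderiv_det hAd hpos.ne', smul_eq_mul]
    simp only [hinvs _ _]
    have : √(A z).det ≠ 0 := (Real.sqrt_pos.2 hpos).ne'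
    have h2 : (A z).det = √(A z).det * √(A z).det := (Real.mul_self_sqrt hpos.le).symm
    -- One factor √det cancels the denominator from the derivative of the square root; the other is
    -- the factor in the claim.
    nth_rewrite 2 [h2]
    field_simp
  have h1 : ∀ i j, fderiv ℝ (fun z => √(A z).det * (A z)⁻¹ i j) z (ε i)
      = √(A z).det * ((1 / 2) * (∑ p, ∑ q, (A z)⁻¹ p q * fderiv ℝ (fun z => A z p q) z (ε i))
          * (A z)⁻¹ i j
        - ∑ p, ∑ q, (A z)⁻¹ i p * fderiv ℝ (fun z => A z p q) z (ε i) * (A z)⁻¹ q j) := by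
    intro i j
    rw [fderiv_fun_mul (hD.sqrt hpos.ne') (hI i j)]
    simp only [add_apply, smul_apply, smul_eq_mul, hw, fderiv_inv_apply hA hdet']
    ring
  have h4 : ∀ i, ∑ j, (A z)⁻¹ i j * A z j l = if i = l then 1 else 0 := fun i => by
    rw [← Matrix.one_apply, ← Matrix.nonsing_inv_mul (A z) (isUnit_iff_ne_zero.2 hpos.ne'),
      Matrix.mul_apply]
  have h5 : ∀ i, ∑ j, fderiv ℝ (fun z => √(A z).det * (A z)⁻¹ i j) z (ε i) * A z j l
      = √(A z).det * ((1 / 2) * (∑ p, ∑ q, (A z)⁻¹ p q * fderiv ℝ (fun z => A z p q) z (ε i))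
          * (if i = l then 1 else 0)
        - ∑ p, (A z)⁻¹ i p * fderiv ℝ (fun z => A z p l) z (ε i)) := by
    intro i
    simp only [h1]
    generalize ∑ p, ∑ q, (A z)⁻¹ p q * fderiv ℝ (fun z => A z p q) z (ε i) = S
    have h6 : ∑ j, (∑ p, ∑ q, (A z)⁻¹ i p * fderiv ℝ (fun z => A z p q) z (ε i) * (A z)⁻¹ q j)
        * A z j l = ∑ p, (A z)⁻¹ i p * fderiv ℝ (fun z => A z p l) z (ε i) := by
      simp only [Finset.sum_mul]
      rw [Finset.sum_comm]
      refine Finset.sum_congr rfl fun p _ => ?_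
      rw [Finset.sum_comm]
      simp only [mul_assoc, ← Finset.mul_sum, h4]
      simp
    rw [← h6, ← h4 i, mul_sub, Finset.mul_sum, Finset.mul_sum, Finset.mul_sum,
      ← Finset.sum_sub_distrib]
    exact Finset.sum_congr rfl fun j _ => by ring
  have h6 : ∑ i, ∑ j, (A z)⁻¹ i j * fderiv ℝ (fun z => A z i l) z (ε j)
      = ∑ i, ∑ j, (A z)⁻¹ i j * fderiv ℝ (fun z => A z j l) z (ε i) := by
    rw [Finset.sum_comm]
    exact Finset.sum_congr rfl fun i _ => Finset.sum_congr rfl fun j _ => by rw [hinvs j i]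
  simp only [h5, ← Finset.mul_sum, Finset.sum_sub_distrib, mul_ite, mul_one, mul_zero,
    Finset.sum_ite_eq', Finset.mem_univ, if_true]
  have h7 : ∑ i, ∑ j, (A z)⁻¹ i j * ((1 / 2)
        * (fderiv ℝ (fun z => A z j l) z (ε i) + fderiv ℝ (fun z => A z i l) z (ε j)
          - fderiv ℝ (fun z => A z i j) z (ε l)))
      = (1 / 2) * (∑ i, ∑ j, (A z)⁻¹ i j * fderiv ℝ (fun z => A z j l) z (ε i)
        + ∑ i, ∑ j, (A z)⁻¹ i j * fderiv ℝ (fun z => A z i l) z (ε j)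
        - ∑ i, ∑ j, (A z)⁻¹ i j * fderiv ℝ (fun z => A z i j) z (ε l)) := by
    simp only [← Finset.sum_add_distrib, ← Finset.sum_sub_distrib, Finset.mul_sum]
    exact Finset.sum_congr rfl fun i _ => Finset.sum_congr rfl fun j _ => by ring
  rw [h7, h6]
  ring

end MatrixCalculus

/-! ### Gram matrix, traces and contracted Christoffel symbols of a metric -/

section Gram

variable {m : ℕ} {M : Type*} [TopologicalSpace M]
  [ChartedSpace (EuclideanSpace ℝ (Fin m)) M] [IsManifold (𝓡 m) ∞ M]

/-- The matrix of the metric in the preferred chart at `p`. -/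
def gram (g : SmoothMetric m M) (p : M) (u : EuclideanSpace ℝ (Fin m)) :
    Matrix (Fin m) (Fin m) ℝ :=
  Matrix.of fun i j => chartMetric g p u (EuclideanSpace.single i 1) (EuclideanSpace.single j 1)

/-- The components `g^{ij}` of the inverse metric in the preferred chart at `p`. -/
def gramInv (g : SmoothMetric m M) (p : M) (i j : Fin m) (u : EuclideanSpace ℝ (Fin m)) : ℝ :=
  (gram g p u)⁻¹ i j

/-- The density `√(det g_{ij})` of the Riemannian volume in the preferred chart at `p`. -/
def volDensity (g : SmoothMetric m M) (p : M) (u : EuclideanSpace ℝ (Fin m)) : ℝ :=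
  √(gram g p u).det

theorem chartMetric_symm (g : SmoothMetric m M) (p : M) (u a b : EuclideanSpace ℝ (Fin m)) :
    chartMetric g p u a b = chartMetric g p u b a :=
  g.symm _ _ _

theorem chartMetric_pos (g : SmoothMetric m M) {p : M} {u : EuclideanSpace ℝ (Fin m)}
    (hu : u ∈ (chartAt (EuclideanSpace ℝ (Fin m)) p).target) {a : EuclideanSpace ℝ (Fin m)}
    (ha : a ≠ 0) : 0 < chartMetric g p u a a := by
  refine g.pos _ _ fun h0 => ha ?_
  have h1 := coords_coordFrame ((chartAt (EuclideanSpace ℝ (Fin m)) p).map_target hu) a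
  exact h1.symm.trans ((congrArg (coords p _) h0).trans (map_zero _))

theorem gram_isSymm (g : SmoothMetric m M) (p : M) (u : EuclideanSpace ℝ (Fin m)) :
    (gram g p u).IsSymm :=
  Matrix.IsSymm.ext fun _ _ => chartMetric_symm g p u _ _

theorem gramInv_symm (g : SmoothMetric m M) (p : M) (i j : Fin m) (u : EuclideanSpace ℝ (Fin m)) :
    gramInv g p i j u = gramInv g p j i u := by
  rw [gramInv, gramInv, ← Matrix.transpose_apply (gram g p u)⁻¹, Matrix.transpose_nonsing_inv,
    (gram_isSymm g p u).eq]

theorem euclidean_sum_single (a : EuclideanSpace ℝ (Fin m)) :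
    ∑ i, a i • EuclideanSpace.single i (1 : ℝ) = a := by
  ext j
  simp [Finset.sum_apply, Pi.single_apply]

theorem gram_det_pos (g : SmoothMetric m M) {p : M} {u : EuclideanSpace ℝ (Fin m)}
    (hu : u ∈ (chartAt (EuclideanSpace ℝ (Fin m)) p).target) : 0 < (gram g p u).det := by
  refine Matrix.PosDef.det_pos (Matrix.PosDef.of_dotProduct_mulVec_pos ?_ fun x hx => ?_)
  · rw [Matrix.IsHermitian, Matrix.conjTranspose_eq_transpose_of_trivial]
    exact gram_isSymm g p u
  · have h1 := chartMetric_pos g hu (a := WithLp.toLp 2 x) (by simpa using hx)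
    rw [← euclidean_sum_single (WithLp.toLp 2 x)] at h1
    simp only [map_sum, map_smul, sum_apply, smul_apply, smul_eq_mul] at h1
    refine h1.trans_eq ?_
    simp only [dotProduct, Matrix.mulVec, gram, Finset.mul_sum, Matrix.of_apply, star_trivial]
    refine Finset.sum_congr rfl fun i _ => Finset.sum_congr rfl fun j _ => ?_
    rw [chartMetric_symm]
    ring

theorem contDiffAt_gram (g : SmoothMetric m M) {p : M} {u : EuclideanSpace ℝ (Fin m)}
    (hu : u ∈ (chartAt (EuclideanSpace ℝ (Fin m)) p).target) (i j : Fin m) :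
    ContDiffAt ℝ ∞ (fun u => gram g p u i j) u :=
  ((contDiffAt_chartMetric g hu).clm_apply contDiffAt_const).clm_apply contDiffAt_const

theorem contDiffAt_gramInv (g : SmoothMetric m M) {p : M} {u : EuclideanSpace ℝ (Fin m)}
    (hu : u ∈ (chartAt (EuclideanSpace ℝ (Fin m)) p).target) (i j : Fin m) :
    ContDiffAt ℝ ∞ (gramInv g p i j) u :=
  contDiffAt_inv_apply (contDiffAt_gram g hu) (gram_det_pos g hu).ne' i j

theorem contDiffAt_volDensity (g : SmoothMetric m M) {p : M} {u : EuclideanSpace ℝ (Fin m)}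
    (hu : u ∈ (chartAt (EuclideanSpace ℝ (Fin m)) p).target) :
    ContDiffAt ℝ ∞ (volDensity g p) u :=
  (contDiffAt_det (contDiffAt_gram g hu)).sqrt (gram_det_pos g hu).ne'

theorem volDensity_pos (g : SmoothMetric m M) {p : M} {u : EuclideanSpace ℝ (Fin m)}
    (hu : u ∈ (chartAt (EuclideanSpace ℝ (Fin m)) p).target) : 0 < volDensity g p u :=
  Real.sqrt_pos.2 (gram_det_pos g hu)

theorem gramInv_mul (g : SmoothMetric m M) {p : M} {u : EuclideanSpace ℝ (Fin m)}
    (hu : u ∈ (chartAt (EuclideanSpace ℝ (Fin m)) p).target) (i k : Fin m) :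
    ∑ j, gramInv g p i j u * chartMetric g p u (EuclideanSpace.single j 1)
      (EuclideanSpace.single k 1) = if i = k then 1 else 0 := by
  rw [← Matrix.one_apply, ← Matrix.nonsing_inv_mul (gram g p u)
    (isUnit_iff_ne_zero.2 (gram_det_pos g hu).ne'), Matrix.mul_apply]
  rfl

/-- Raising an index in the preferred chart at `p`. -/
def raise (g : SmoothMetric m M) (p : M) (u : EuclideanSpace ℝ (Fin m))
    (l : EuclideanSpace ℝ (Fin m) → ℝ) : EuclideanSpace ℝ (Fin m) :=
  ∑ i, ∑ j, (gramInv g p i j u * l (EuclideanSpace.single i 1)) • EuclideanSpace.single j (1 : ℝ)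

theorem chartMetric_raise (g : SmoothMetric m M) {p : M} {u : EuclideanSpace ℝ (Fin m)}
    (hu : u ∈ (chartAt (EuclideanSpace ℝ (Fin m)) p).target)
    (l : EuclideanSpace ℝ (Fin m) →ₗ[ℝ] ℝ) (a : EuclideanSpace ℝ (Fin m)) :
    chartMetric g p u (raise g p u l) a = l a := by
  rw [← euclidean_sum_single a]
  simp only [map_sum, map_smul, smul_eq_mul]
  refine Finset.sum_congr rfl fun k _ => ?_
  congr 1
  simp only [raise, map_sum, map_smul, sum_apply, smul_apply, smul_eq_mul]
  have h : ∀ i, ∑ j, gramInv g p i j u * l (EuclideanSpace.single i 1)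
      * chartMetric g p u (EuclideanSpace.single j 1) (EuclideanSpace.single k 1)
      = l (EuclideanSpace.single i 1) * if i = k then 1 else 0 := by
    intro i
    rw [← gramInv_mul g hu, Finset.mul_sum]
    exact Finset.sum_congr rfl fun j _ => by ring
  simp [h]

theorem eq_of_chartMetric_eq (g : SmoothMetric m M) {p : M} {u : EuclideanSpace ℝ (Fin m)}
    (hu : u ∈ (chartAt (EuclideanSpace ℝ (Fin m)) p).target) {a b : EuclideanSpace ℝ (Fin m)}
    (h : ∀ i, chartMetric g p u a (EuclideanSpace.single i 1)
      = chartMetric g p u b (EuclideanSpace.single i 1)) : a = b := by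
  by_contra hne
  have h1 := chartMetric_pos g hu (sub_ne_zero.2 hne)
  have h2 : ∀ c, chartMetric g p u (a - b) c = 0 := by
    intro c
    rw [← euclidean_sum_single c]
    simp only [map_sum, map_smul, map_sub, sub_apply, h, sub_self, smul_zero, Finset.sum_const_zero]
  exact h1.ne' (h2 _)

theorem mvfderiv_sharp (g : SmoothMetric m M) {p y : M}
    (hy : y ∈ (chartAt (EuclideanSpace ℝ (Fin m)) p).source)
    (l : TangentSpace (𝓡 m) y →L[ℝ] ℝ) :
    mvfderiv (𝓡 m) (chartAt (EuclideanSpace ℝ (Fin m)) p) y (sharp g y l)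
      = raise g p (chartAt (EuclideanSpace ℝ (Fin m)) p y) (fun a => l (coordFrame p y a)) := by
  have hu := (chartAt (EuclideanSpace ℝ (Fin m)) p).map_source hy
  refine eq_of_chartMetric_eq g hu fun i => ?_
  have h1 := chartMetric_raise g hu (l.comp (coordFrame p y)).toLinearMap
    (EuclideanSpace.single i 1)
  have h2 := inner_eq_chartMetric g hy (sharp g y l) (coordFrame p y (EuclideanSpace.single i 1))
  rw [inner_sharp, ← coords_eq_mvfderiv hy, coords_coordFrame hy, coords_eq_mvfderiv hy] at h2
  rw [← h2]
  exact h1.symm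

/-- `metricTrace` uses the preferred chart at the point itself, which changes with the point. The
frame there and the raised coframe transform inversely, so one fixed chart serves all nearby points,
as is needed to differentiate traces. -/
theorem metricTrace_eq (g : SmoothMetric m M) {p y : M}
    (hy : y ∈ (chartAt (EuclideanSpace ℝ (Fin m)) p).source) {W : Type*} [AddCommGroup W]
    [Module ℝ W] (β : EuclideanSpace ℝ (Fin m) →ₗ[ℝ] EuclideanSpace ℝ (Fin m) →ₗ[ℝ] W)
    {B : TangentSpace (𝓡 m) y → TangentSpace (𝓡 m) y → W}
    (hB : ∀ v w, B v w = β (mvfderiv (𝓡 m) (chartAt (EuclideanSpace ℝ (Fin m)) p) y v)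
      (mvfderiv (𝓡 m) (chartAt (EuclideanSpace ℝ (Fin m)) p) y w)) :
    metricTrace g y B = ∑ i, ∑ j, gramInv g p i j (chartAt (EuclideanSpace ℝ (Fin m)) p y)
      • β (EuclideanSpace.single i 1) (EuclideanSpace.single j 1) := by
  have hyy := mem_chart_source (EuclideanSpace ℝ (Fin m)) y
  set d := mvfderiv (𝓡 m) (chartAt (EuclideanSpace ℝ (Fin m)) p) y with hd
  have h1 : ∀ k, ∑ i, (coords y y (coordFrame p y (EuclideanSpace.single k 1))) i
      • d (coordFrame y y (EuclideanSpace.single i 1)) = EuclideanSpace.single k 1 := by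
    intro k
    simp only [← map_smul, ← map_sum]
    rw [euclidean_sum_single, coordFrame_coords hyy, hd, ← coords_eq_mvfderiv hy,
      coords_coordFrame hy]
  have hsh : ∀ l, d (sharp g y l) = raise g p (chartAt (EuclideanSpace ℝ (Fin m)) p y)
      (fun a => l (coordFrame p y a)) := mvfderiv_sharp g hy
  simp only [metricTrace, hB, hsh, raise, map_sum, map_smul]
  rw [Finset.sum_comm]
  refine Finset.sum_congr rfl fun k _ => ?_
  rw [Finset.sum_comm]
  refine Finset.sum_congr rfl fun l _ => ?_
  conv_rhs => rw [← h1 k]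
  simp only [map_sum, map_smul, LinearMap.sum_apply, LinearMap.smul_apply, Finset.smul_sum,
    smul_smul]
  exact Finset.sum_congr rfl fun i _ => rfl

/-- The connection coefficients of the Levi-Civita connection in the preferred chart at `p`. -/
def chartGamma (g : SmoothMetric m M) (p : M) (u : EuclideanSpace ℝ (Fin m)) :
    EuclideanSpace ℝ (Fin m) →ₗ[ℝ] EuclideanSpace ℝ (Fin m) →ₗ[ℝ] EuclideanSpace ℝ (Fin m) :=
  LinearMap.mk₂ ℝ (fun a b => raise g p u (koszulCoord (chartMetric g p) u a b))
    (fun a a' b => by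
      simp only [raise, koszulCoord, map_add, add_apply, ← Finset.sum_add_distrib, ← add_smul]
      refine Finset.sum_congr rfl fun i _ => Finset.sum_congr rfl fun j _ => ?_
      congr 1; ring)
    (fun r a b => by
      simp only [raise, koszulCoord, map_smul, smul_apply, Finset.smul_sum, smul_smul, smul_eq_mul]
      refine Finset.sum_congr rfl fun i _ => Finset.sum_congr rfl fun j _ => ?_
      congr 1; ring)
    (fun a b b' => by
      simp only [raise, koszulCoord, map_add, add_apply, ← Finset.sum_add_distrib, ← add_smul]
      refine Finset.sum_congr rfl fun i _ => Finset.sum_congr rfl fun j _ => ?_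
      congr 1; ring)
    (fun r a b => by
      simp only [raise, koszulCoord, map_smul, smul_apply, Finset.smul_sum, smul_smul, smul_eq_mul]
      refine Finset.sum_congr rfl fun i _ => Finset.sum_congr rfl fun j _ => ?_
      congr 1; ring)

theorem chartMetric_chartGamma (g : SmoothMetric m M) {p : M} {u : EuclideanSpace ℝ (Fin m)}
    (hu : u ∈ (chartAt (EuclideanSpace ℝ (Fin m)) p).target) (a b c : EuclideanSpace ℝ (Fin m)) :
    chartMetric g p u (chartGamma g p u a b) c = koszulCoord (chartMetric g p) u a b c := by
  let l : EuclideanSpace ℝ (Fin m) →ₗ[ℝ] ℝ :=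
    { toFun := koszulCoord (chartMetric g p) u a b
      map_add' := fun c c' => by simp [koszulCoord]; ring
      map_smul' := fun r c => by simp [koszulCoord]; ring }
  exact chartMetric_raise g hu l c

theorem fderiv_gram (g : SmoothMetric m M) {p : M} {u : EuclideanSpace ℝ (Fin m)}
    (hu : u ∈ (chartAt (EuclideanSpace ℝ (Fin m)) p).target) (a : EuclideanSpace ℝ (Fin m))
    (i j : Fin m) : fderiv ℝ (fun u => gram g p u i j) u a
      = fderiv ℝ (chartMetric g p) u a (EuclideanSpace.single i 1) (EuclideanSpace.single j 1) := by
  have h := (contDiffAt_chartMetric g hu).differentiableAt (n := ∞) (by simp)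
  change fderiv ℝ (fun u => chartMetric g p u (EuclideanSpace.single i 1)
    (EuclideanSpace.single j 1)) u a = _
  rw [fderiv_clm_apply (h.clm_apply (by fun_prop)) (by fun_prop),
    fderiv_clm_apply h (by fun_prop)]
  simp

/-- The contracted Christoffel symbols as a divergence. -/
theorem sum_fderiv_density_smul (g : SmoothMetric m M) {p : M} {u : EuclideanSpace ℝ (Fin m)}
    (hu : u ∈ (chartAt (EuclideanSpace ℝ (Fin m)) p).target) :
    ∑ i, ∑ j, fderiv ℝ (fun u => volDensity g p u * gramInv g p i j u) u
        (EuclideanSpace.single i 1) • EuclideanSpace.single j (1 : ℝ)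
      = -(volDensity g p u • ∑ i, ∑ j, gramInv g p i j u
        • chartGamma g p u (EuclideanSpace.single i 1) (EuclideanSpace.single j 1)) := by
  refine eq_of_chartMetric_eq g hu fun l => ?_
  have hdet : ∀ᶠ u in nhds u, 0 < (gram g p u).det := by
    filter_upwards [(chartAt (EuclideanSpace ℝ (Fin m)) p).open_target.mem_nhds hu] with v hv
    exact gram_det_pos g hv
  have h := sum_fderiv_sqrt_det_mul_inv (contDiffAt_gram g hu) hdet (gram_isSymm g p)
    (fun i => EuclideanSpace.single i (1 : ℝ)) l
  simp only [map_neg, map_sum, map_smul, neg_apply, sum_apply, smul_apply, smul_eq_mul,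
    chartMetric_chartGamma g hu, koszulCoord, ← fderiv_gram g hu]
  exact h

end Gram

/-! ### Second fundamental form and tension field of a map in charts -/

section Tension

variable {m n : ℕ} {M N : Type*} [TopologicalSpace M] [TopologicalSpace N]
  [ChartedSpace (EuclideanSpace ℝ (Fin m)) M] [IsManifold (𝓡 m) ∞ M]
  [ChartedSpace (EuclideanSpace ℝ (Fin n)) N] [IsManifold (𝓡 n) ∞ N]
  {e : OpenPartialHomeomorph M (EuclideanSpace ℝ (Fin m))}
  {ψ : OpenPartialHomeomorph N (EuclideanSpace ℝ (Fin n))}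
  {G : EuclideanSpace ℝ (Fin n) → EuclideanSpace ℝ (Fin n) →L[ℝ] EuclideanSpace ℝ (Fin n) →L[ℝ] ℝ}

theorem contDiffAt_comp_charts (he : e ∈ IsManifold.maximalAtlas (𝓡 m) ∞ M) {x : M}
    (hx : x ∈ e.source) (hψ : ψ ∈ IsManifold.maximalAtlas (𝓡 n) ∞ N) {φ : M → N}
    (hφx : φ x ∈ ψ.source) (hφ : ContMDiffAt (𝓡 m) (𝓡 n) ∞ φ x) :
    ContDiffAt ℝ ∞ (fun u => ψ (φ (e.symm u))) (e x) :=
  contDiffAt_comp_chart_symm (f := fun y => ψ (φ y)) he hx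
    ((contMDiffAt_chart_of_mem hψ hφx).comp x hφ)

theorem mvfderiv_mfderiv (he : e ∈ IsManifold.maximalAtlas (𝓡 m) ∞ M) {x : M}
    (hx : x ∈ e.source) (hψ : ψ ∈ IsManifold.maximalAtlas (𝓡 n) ∞ N) {φ : M → N}
    (hφx : φ x ∈ ψ.source) (hφ : MDifferentiableAt (𝓡 m) (𝓡 n) φ x) (v : TangentSpace (𝓡 m) x) :
    mvfderiv (𝓡 n) ψ (φ x) (mfderiv (𝓡 m) (𝓡 n) φ x v)
      = fderiv ℝ (fun u => ψ (φ (e.symm u))) (e x) (mvfderiv (𝓡 m) e x v) := by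
  have hψm : MDifferentiableAt (𝓡 n) 𝓘(ℝ, EuclideanSpace ℝ (Fin n)) ψ (φ x) :=
    (contMDiffAt_chart_of_mem hψ hφx).mdifferentiableAt (by simp)
  rw [← mvfderiv_comp_mfderiv hψm hφ]
  exact mvfderiv_eq_fderiv_chart (f := fun y => ψ (φ y)) he hx
    (mdifferentiableAt_comp_chart_symm (f := fun y => ψ (φ y)) he hx (hψm.comp x hφ)) v

/-- The second fundamental form of a map in charts. -/
theorem mvfderiv_secondFundamentalForm (g : SmoothMetric m M) (h : SmoothMetric n N) {φ : M → N}
    (hφ : ContMDiff (𝓡 m) (𝓡 n) ∞ φ) {p x : M}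
    (hx : x ∈ (chartAt (EuclideanSpace ℝ (Fin m)) p).source)
    (hψ : ψ ∈ IsManifold.maximalAtlas (𝓡 n) ∞ N) (hφx : φ x ∈ ψ.source)
    (hG : DifferentiableAt ℝ G (ψ (φ x))) (hGs : ∀ a b, G (ψ (φ x)) a b = G (ψ (φ x)) b a)
    (hh : ∀ᶠ y in nhds (φ x), ∀ v w, h.inner y v w
      = G (ψ y) (mvfderiv (𝓡 n) ψ y v) (mvfderiv (𝓡 n) ψ y w))
    {Γ : EuclideanSpace ℝ (Fin n) → EuclideanSpace ℝ (Fin n) → EuclideanSpace ℝ (Fin n)}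
    (hΓ : ∀ a b c, G (ψ (φ x)) (Γ a b) c = koszulCoord G (ψ (φ x)) a b c)
    {f : EuclideanSpace ℝ (Fin m) → EuclideanSpace ℝ (Fin n)}
    (hf : f = fun u => ψ (φ ((chartAt (EuclideanSpace ℝ (Fin m)) p).symm u)))
    {u : EuclideanSpace ℝ (Fin m)} (hu : u = chartAt (EuclideanSpace ℝ (Fin m)) p x)
    (v w : TangentSpace (𝓡 m) x) {a b : EuclideanSpace ℝ (Fin m)}
    (ha : a = mvfderiv (𝓡 m) (chartAt (EuclideanSpace ℝ (Fin m)) p) x v)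
    (hb : b = mvfderiv (𝓡 m) (chartAt (EuclideanSpace ℝ (Fin m)) p) x w) :
    mvfderiv (𝓡 n) ψ (φ x) (secondFundamentalForm g h φ x v w)
      = fderiv ℝ (fderiv ℝ f) u a b + Γ (fderiv ℝ f u a) (fderiv ℝ f u b)
        - fderiv ℝ f u (chartGamma g p u a b) := by
  set c := chartAt (EuclideanSpace ℝ (Fin m)) p with hc
  have hcat : c ∈ IsManifold.maximalAtlas (𝓡 m) ∞ M := chart_mem_maximalAtlas p
  set cx := chartAt (EuclideanSpace ℝ (Fin m)) x with hcx
  have hcxat : cx ∈ IsManifold.maximalAtlas (𝓡 m) ∞ M := chart_mem_maximalAtlas x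
  have hxx : x ∈ cx.source := mem_chart_source _ x
  have hxs : c.symm u = x := by rw [hu, c.left_inv hx]
  have hut : u ∈ c.target := hu ▸ c.map_source hx
  set b₀ := coords x x w with hb₀
  -- the field with constant components in the chart at `x`, in the chart at `p`
  set X : EuclideanSpace ℝ (Fin m) → EuclideanSpace ℝ (Fin m) :=
    fun u => mvfderiv (𝓡 m) c (c.symm u) (coordFrame x (c.symm u) b₀) with hX
  have hnear : ∀ᶠ u' in nhds u, u' ∈ c.target ∧ c.symm u' ∈ cx.source ∧ φ (c.symm u') ∈ ψ.source := by
    have ht : Filter.Tendsto c.symm (nhds u) (nhds x) := by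
      have h1 := c.continuousAt_symm hut
      rwa [ContinuousAt, hxs] at h1
    filter_upwards [c.open_target.mem_nhds hut, ht.eventually (cx.open_source.mem_nhds hxx),
      ht.eventually ((hφ.continuous.tendsto x).eventually (ψ.open_source.mem_nhds hφx))]
      with u' h1 h2 h3 using ⟨h1, h2, h3⟩
  have hXd : DifferentiableAt ℝ X u := by
    have h1 : X =ᶠ[nhds u] fun u' => fderiv ℝ (fun z => c (cx.symm z)) (cx (c.symm u')) b₀ := by
      filter_upwards [hnear] with u' hu'
      exact mvfderiv_coordFrame hcat hu'.2.1 (c.map_target hu'.1) b₀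
    refine DifferentiableAt.congr_of_eventuallyEq ?_ h1
    have h2 := contDiffAt_transition hcat hcxat hx hxx
    have h3 := contDiffAt_transition hcxat hcat hxx hx
    rw [← hu] at h2
    have h4 : ContDiffAt ℝ ∞ (fderiv ℝ (fun z => c (cx.symm z))) (cx (c.symm u)) := by
      rw [hxs]; exact h3.fderiv_right (m := ∞) (by simp)
    have h5 := h4.comp u h2
    exact (h5.differentiableAt (by simp)).clm_apply (by fun_prop)
  have hXu : X u = b := by
    have h1 : ∀ z, z = x → mvfderiv (𝓡 m) c z (coordFrame x z b₀)
        = mvfderiv (𝓡 m) c x (coordFrame x x b₀) := by rintro z rfl; rfl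
    rw [hX]
    simp only
    rw [h1 _ hxs, hb₀, coordFrame_coords hxx, hb]
  have hfs : ContDiffAt ℝ ∞ f u := by
    rw [hf, hu]; exact contDiffAt_comp_charts hcat hx hψ hφx (hφ x)
  have hfd : DifferentiableAt ℝ (fderiv ℝ f) u :=
    (hfs.fderiv_right (m := ∞) (by simp)).differentiableAt (by simp)
  have hV : (fun u' => mvfderiv (𝓡 n) ψ (φ (c.symm u'))
      (mfderiv (𝓡 m) (𝓡 n) φ (c.symm u') (coordFrame x (c.symm u') b₀))) =ᶠ[nhds u]
      fun u' => fderiv ℝ f u' (X u') := by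
    filter_upwards [hnear] with u' hu'
    rw [mvfderiv_mfderiv hcat (c.map_target hu'.1) hψ hu'.2.2
      ((hφ _).mdifferentiableAt (by simp)), c.right_inv hu'.1, hf]
  have hVd : DifferentiableAt ℝ (fun u' => fderiv ℝ f u' (X u')) u := hfd.clm_apply hXd
  have h1 := mvfderiv_covAlong h (φ := φ)
    (V := fun y => mfderiv (𝓡 m) (𝓡 n) φ y (coordFrame x y b₀)) hcat hx hψ hφx hG hGs hh hΓ
    ((hφ x).mdifferentiableAt (by simp)) (hu ▸ hVd.congr_of_eventuallyEq hV) v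
  have h2 := mvfderiv_covAlong g (φ := id) (V := fun y => coordFrame x y b₀) hcat hx hcat hx
    (G := chartMetric g p)
    ((contDiffAt_chartMetric g (hu ▸ hut)).differentiableAt (by simp))
    (chartMetric_symm g p _)
    (by filter_upwards [c.open_source.mem_nhds hx] with y hy; exact inner_eq_chartMetric g hy)
    (chartMetric_chartGamma g (hu ▸ hut)) mdifferentiableAt_id (hu ▸ hXd) v
  have hid : fderiv ℝ (fun u' => c (id (c.symm u'))) u = ContinuousLinearMap.id ℝ _ := by
    have h3 : (fun u' => c (id (c.symm u'))) =ᶠ[nhds u] id := by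
      filter_upwards [hnear] with u' hu'
      exact c.right_inv hu'.1
    rw [h3.fderiv_eq, fderiv_id]
  simp only [id] at h2
  rw [← hu] at h1 h2
  simp only [id] at hid
  rw [hV.fderiv_eq, fderiv_clm_apply hfd hXd, mvfderiv_mfderiv hcat hx hψ hφx
    ((hφ x).mdifferentiableAt (by simp)), coordFrame_coords hxx, ← hu, ← hf, ← ha, ← hb, hXu] at h1
  rw [hid, coordFrame_coords hxx, ← ha, ← hb] at h2
  -- The derivative of the auxiliary field X enters both covariant derivatives, each time through
  -- Df, and cancels in the difference.
  rw [secondFundamentalForm, map_sub, h1, mvfderiv_mfderiv hcat hx hψ hφx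
    ((hφ x).mdifferentiableAt (by simp)), leviCivita, ← hu, ← hf]
  erw [h2]
  simp only [add_apply, ContinuousLinearMap.comp_apply, ContinuousLinearMap.flip_apply, map_add,
    ContinuousLinearMap.id_apply]
  abel

/-- The tension field in charts. -/
theorem volDensity_smul_mvfderiv_tension (g : SmoothMetric m M) (h : SmoothMetric n N) {φ : M → N}
    (hφ : ContMDiff (𝓡 m) (𝓡 n) ∞ φ) {p x : M}
    (hx : x ∈ (chartAt (EuclideanSpace ℝ (Fin m)) p).source)
    (hψ : ψ ∈ IsManifold.maximalAtlas (𝓡 n) ∞ N) (hφx : φ x ∈ ψ.source)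
    (hG : DifferentiableAt ℝ G (ψ (φ x))) (hGs : ∀ a b, G (ψ (φ x)) a b = G (ψ (φ x)) b a)
    (hh : ∀ᶠ y in nhds (φ x), ∀ v w, h.inner y v w
      = G (ψ y) (mvfderiv (𝓡 n) ψ y v) (mvfderiv (𝓡 n) ψ y w))
    {Γ : EuclideanSpace ℝ (Fin n) →
      EuclideanSpace ℝ (Fin n) →L[ℝ] EuclideanSpace ℝ (Fin n) →L[ℝ] EuclideanSpace ℝ (Fin n)}
    (hΓ : ∀ a b c, G (ψ (φ x)) (Γ (ψ (φ x)) a b) c = koszulCoord G (ψ (φ x)) a b c)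
    {f : EuclideanSpace ℝ (Fin m) → EuclideanSpace ℝ (Fin n)}
    (hf : f = fun u => ψ (φ ((chartAt (EuclideanSpace ℝ (Fin m)) p).symm u)))
    {u : EuclideanSpace ℝ (Fin m)} (hu : u = chartAt (EuclideanSpace ℝ (Fin m)) p x) :
    volDensity g p u • mvfderiv (𝓡 n) ψ (φ x) (tension g h φ x)
      = ∑ i, covCoord Γ f (fun u => ∑ j, (volDensity g p u * gramInv g p i j u)
          • fderiv ℝ f u (EuclideanSpace.single j 1)) (EuclideanSpace.single i 1) u := by
  have hut : u ∈ (chartAt (EuclideanSpace ℝ (Fin m)) p).target :=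
    hu ▸ (chartAt (EuclideanSpace ℝ (Fin m)) p).map_source hx
  have hfu : f u = ψ (φ x) := by
    rw [hf, hu]; simp [(chartAt (EuclideanSpace ℝ (Fin m)) p).left_inv hx]
  have hfs : ContDiffAt ℝ ∞ f u := by
    rw [hf, hu]; exact contDiffAt_comp_charts (chart_mem_maximalAtlas p) hx hψ hφx (hφ x)
  have hfd : DifferentiableAt ℝ (fderiv ℝ f) u :=
    (hfs.fderiv_right (m := ∞) (by simp)).differentiableAt (by simp)
  let β : EuclideanSpace ℝ (Fin m) →ₗ[ℝ] EuclideanSpace ℝ (Fin m) →ₗ[ℝ] EuclideanSpace ℝ (Fin n) :=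
    LinearMap.mk₂ ℝ (fun a b => fderiv ℝ (fderiv ℝ f) u a b
        + Γ (ψ (φ x)) (fderiv ℝ f u a) (fderiv ℝ f u b) - fderiv ℝ f u (chartGamma g p u a b))
      (fun a a' b => by simp only [map_add, add_apply, LinearMap.add_apply]; abel)
      (fun r a b => by simp only [map_smul, smul_apply, LinearMap.smul_apply, smul_add, smul_sub])
      (fun a b b' => by simp only [map_add]; abel)
      (fun r a b => by simp only [map_smul, smul_add, smul_sub])
  have h1 := metricTrace_eq g hx β (B := fun v w =>
      mvfderiv (𝓡 n) ψ (φ x) (secondFundamentalForm g h φ x v w)) fun v w =>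
    mvfderiv_secondFundamentalForm g h hφ hx hψ hφx hG hGs hh hΓ hf hu v w rfl rfl
  have h2 : mvfderiv (𝓡 n) ψ (φ x) (tension g h φ x) = metricTrace g x (fun v w =>
      mvfderiv (𝓡 n) ψ (φ x) (secondFundamentalForm g h φ x v w)) := by
    simp only [tension, metricTrace, map_sum]
  have hP : ∀ i j, ContDiffAt ℝ ∞ (fun u => volDensity g p u * gramInv g p i j u) u := fun i j =>
    (contDiffAt_volDensity g hut).mul (contDiffAt_gramInv g hut i j)
  have h3 : ∀ i, covCoord Γ f (fun u => ∑ j, (volDensity g p u * gramInv g p i j u)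
      • fderiv ℝ f u (EuclideanSpace.single j 1)) (EuclideanSpace.single i 1) u
      = ∑ j, (fderiv ℝ (fun u => volDensity g p u * gramInv g p i j u) u
          (EuclideanSpace.single i 1) • fderiv ℝ f u (EuclideanSpace.single j 1)
        + (volDensity g p u * gramInv g p i j u) • (fderiv ℝ (fderiv ℝ f) u
          (EuclideanSpace.single i 1) (EuclideanSpace.single j 1)
          + Γ (ψ (φ x)) (fderiv ℝ f u (EuclideanSpace.single i 1))
            (fderiv ℝ f u (EuclideanSpace.single j 1)))) := by
    intro i
    have hd : ∀ j, DifferentiableAt ℝ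
        (fun u => fderiv ℝ f u (EuclideanSpace.single j (1 : ℝ))) u := fun j =>
      hfd.clm_apply (by fun_prop)
    rw [covCoord_sum Γ f Finset.univ (V := fun j u => (volDensity g p u * gramInv g p i j u)
      • fderiv ℝ f u (EuclideanSpace.single j 1)) fun j _ =>
        ((hP i j).differentiableAt (by simp)).smul (hd j)]
    refine Finset.sum_congr rfl fun j _ => ?_
    rw [covCoord_smul Γ f ((hP i j).differentiableAt (by simp)) (hd j), covCoord, hfu,
      fderiv_clm_apply hfd (by fun_prop)]
    simp
  -- Pushed forward by f, the divergence of w g^{ij} equals minus the contracted Christoffel term.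
  -- This turns the trace of the second fundamental form into a divergence.
  have h4 := congrArg (fderiv ℝ f u) (sum_fderiv_density_smul g hut)
  simp only [map_sum, map_smul, map_neg] at h4
  rw [h2, h1, ← hu]
  simp only [h3, Finset.sum_add_distrib, h4, β, LinearMap.mk₂_apply, Finset.smul_sum, smul_sub,
    smul_smul, Finset.sum_sub_distrib]
  abel

end Tension

/-- Since the derivative of e^{-2s}⟨·,·⟩ is -2ds times the metric, the Koszul combination gives
precisely the coefficients `confGamma`. This connects them with the connection defined on the
manifold. -/
theorem koszulCoord_confMetric {F : Type*} [NormedAddCommGroup F] [InnerProductSpace ℝ F]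
    [CompleteSpace F] {s : F → ℝ} {y : F} (hs : DifferentiableAt ℝ s y) (a b c : F) :
    confMetric s y (confGamma s y a b) c = koszulCoord (confMetric s) y a b c := by
  simp only [koszulCoord, fderiv_confMetric hs, confMetric_apply, confGamma_apply, inner_neg_left,
    inner_sub_left, inner_add_left, inner_smul_left, inner_gradient_left, conj_trivial]
  rw [real_inner_comm c a, real_inner_comm c b]
  ring

/-! ### Traces and gradients in a conformally flat chart -/

section ConformalChart

variable {n : ℕ} {N : Type*} [TopologicalSpace N]
  [ChartedSpace (EuclideanSpace ℝ (Fin n)) N] [IsManifold (𝓡 n) ∞ N]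
  {h : SmoothMetric n N} {ψ : OpenPartialHomeomorph N (EuclideanSpace ℝ (Fin n))} {σ : N → ℝ}

/-- The expression of a function in a chart. -/
def inChart (ψ : OpenPartialHomeomorph N (EuclideanSpace ℝ (Fin n))) (σ : N → ℝ)
    (y : EuclideanSpace ℝ (Fin n)) : ℝ :=
  σ (ψ.symm y)

theorem inChart_apply {q : N} (hq : q ∈ ψ.source) : inChart ψ σ (ψ q) = σ q := by
  rw [inChart, ψ.left_inv hq]

/-- The metric trace in terms of an orthonormal basis for a conformally equivalent inner product. -/
theorem metricTrace_of_conformal (h : SmoothMetric n N) {q : N} {k : ℝ} (hk : k ≠ 0)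
    (d : TangentSpace (𝓡 n) q →L[ℝ] EuclideanSpace ℝ (Fin n))
    (d' : EuclideanSpace ℝ (Fin n) →L[ℝ] TangentSpace (𝓡 n) q) (hdd : ∀ a, d (d' a) = a)
    (hd : ∀ v w, h.inner q v w = k * inner ℝ (d v) (d w)) {ι : Type*} [Fintype ι]
    (ε : OrthonormalBasis ι ℝ (EuclideanSpace ℝ (Fin n)))
    (β : EuclideanSpace ℝ (Fin n) →ₗ[ℝ] EuclideanSpace ℝ (Fin n) →ₗ[ℝ] ℝ) :
    metricTrace h q (fun v w => β (d v) (d w)) = k⁻¹ * ∑ i, β (ε i) (ε i) := by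
  have hqq := mem_chart_source (EuclideanSpace ℝ (Fin n)) q
  have hsh : ∀ l : TangentSpace (𝓡 n) q →L[ℝ] ℝ,
      d (sharp h q l) = ∑ j, (k⁻¹ * l (d' (ε j))) • ε j := by
    intro l
    conv_lhs => rw [← ε.sum_repr' (d (sharp h q l))]
    refine Finset.sum_congr rfl fun j _ => ?_
    congr 1
    have h1 := hd (sharp h q l) (d' (ε j))
    rw [inner_sharp, hdd] at h1
    rw [h1, real_inner_comm]
    field_simp
  simp only [metricTrace, hsh, map_sum, map_smul, smul_eq_mul]
  rw [Finset.sum_comm, Finset.mul_sum]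
  refine Finset.sum_congr rfl fun j _ => ?_
  have h2 : ∑ i, (coords q q (d' (ε j))) i • d (coordFrame q q (EuclideanSpace.single i 1))
      = ε j := by
    simp only [← map_smul, ← map_sum]
    rw [euclidean_sum_single, coordFrame_coords hqq, hdd]
  have h3 := congrArg (fun a => β a (ε j)) h2
  simp only [map_sum, map_smul, LinearMap.sum_apply, LinearMap.smul_apply, smul_eq_mul] at h3
  rw [← h3, Finset.mul_sum]
  refine Finset.sum_congr rfl fun i _ => ?_
  exact mul_assoc _ _ _

namespace IsConformallyFlatChart

theorem contDiffAt_factor (hc : IsConformallyFlatChart h ψ σ) {q : N} (hq : q ∈ ψ.source) :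
    ContDiffAt ℝ ∞ (inChart ψ σ) (ψ q) :=
  contDiffAt_comp_chart_symm hc.mem_maximalAtlas hq
    (hc.contMDiffOn.contMDiffAt (ψ.open_source.mem_nhds hq))

theorem differentiableAt_factor (hc : IsConformallyFlatChart h ψ σ) {q : N} (hq : q ∈ ψ.source) :
    DifferentiableAt ℝ (inChart ψ σ) (ψ q) :=
  (hc.contDiffAt_factor hq).differentiableAt (by simp)

theorem inner_eq_confMetric (hc : IsConformallyFlatChart h ψ σ) {q : N} (hq : q ∈ ψ.source)
    (v w : TangentSpace (𝓡 n) q) :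
    h.inner q v w = confMetric (inChart ψ σ) (ψ q) (mvfderiv (𝓡 n) ψ q v)
      (mvfderiv (𝓡 n) ψ q w) := by
  rw [hc.inner_eq q hq, confMetric_apply, inChart_apply hq]

theorem eventually_inner_eq (hc : IsConformallyFlatChart h ψ σ) {q : N} (hq : q ∈ ψ.source) :
    ∀ᶠ y in nhds q, ∀ v w, h.inner y v w = confMetric (inChart ψ σ) (ψ y)
      (mvfderiv (𝓡 n) ψ y v) (mvfderiv (𝓡 n) ψ y w) := by
  filter_upwards [ψ.open_source.mem_nhds hq] with y hy
  exact hc.inner_eq_confMetric hy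

theorem differentiableAt_confMetric (hc : IsConformallyFlatChart h ψ σ) {q : N}
    (hq : q ∈ ψ.source) : DifferentiableAt ℝ (confMetric (inChart ψ σ)) (ψ q) :=
  (contDiffAt_confMetric (hc.contDiffAt_factor hq)).differentiableAt (by simp)

theorem mvfderiv_factor (hc : IsConformallyFlatChart h ψ σ) {q : N} (hq : q ∈ ψ.source)
    (v : TangentSpace (𝓡 n) q) :
    mvfderiv (𝓡 n) σ q v = fderiv ℝ (inChart ψ σ) (ψ q) (mvfderiv (𝓡 n) ψ q v) :=
  mvfderiv_eq_fderiv_chart hc.mem_maximalAtlas hq (hc.differentiableAt_factor hq) v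

/-- Raising an index with h = e^{-2s}⟨·,·⟩ multiplies the Euclidean gradient by e^{2s}. -/
theorem mvfderiv_grad (hc : IsConformallyFlatChart h ψ σ) {q : N} (hq : q ∈ ψ.source) :
    mvfderiv (𝓡 n) ψ q (grad h σ q)
      = Real.exp (2 * inChart ψ σ (ψ q)) • gradient (inChart ψ σ) (ψ q) := by
  refine ext_inner_right ℝ fun b => ?_
  have h1 := hc.inner_eq_confMetric hq (grad h σ q) (chartFrame ψ q b)
  rw [grad, inner_sharp, hc.mvfderiv_factor hq, mvfderiv_chartFrame hc.mem_maximalAtlas hq,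
    confMetric_apply] at h1
  rw [inner_smul_left, inner_gradient_left, h1, grad, conj_trivial, ← mul_assoc, ← Real.exp_add]
  simp

theorem inner_grad (hc : IsConformallyFlatChart h ψ σ) {q : N} (hq : q ∈ ψ.source) :
    h.inner q (grad h σ q) (grad h σ q) = Real.exp (2 * inChart ψ σ (ψ q))
      * fderiv ℝ (inChart ψ σ) (ψ q) (gradient (inChart ψ σ) (ψ q)) := by
  conv_lhs => rw [grad, inner_sharp, ← grad]
  rw [hc.mvfderiv_factor hq, hc.mvfderiv_grad hq, map_smul, smul_eq_mul]

end IsConformallyFlatChart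

end ConformalChart

/-! ### Maps, fields, Hessian and Laplacian in a conformally flat chart -/

section Maps

variable {m n : ℕ} {M N : Type*} [TopologicalSpace M] [TopologicalSpace N]
  [ChartedSpace (EuclideanSpace ℝ (Fin m)) M] [IsManifold (𝓡 m) ∞ M]
  [ChartedSpace (EuclideanSpace ℝ (Fin n)) N] [IsManifold (𝓡 n) ∞ N]
  {e : OpenPartialHomeomorph M (EuclideanSpace ℝ (Fin m))}
  {h : SmoothMetric n N} {ψ : OpenPartialHomeomorph N (EuclideanSpace ℝ (Fin n))} {σ : N → ℝ}

/-- The expression of a map in charts. -/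
def mapInCharts (e : OpenPartialHomeomorph M (EuclideanSpace ℝ (Fin m)))
    (ψ : OpenPartialHomeomorph N (EuclideanSpace ℝ (Fin n))) (φ : M → N)
    (u : EuclideanSpace ℝ (Fin m)) : EuclideanSpace ℝ (Fin n) :=
  ψ (φ (e.symm u))

/-- The components in charts of a vector field along a map. -/
def fieldInCharts (e : OpenPartialHomeomorph M (EuclideanSpace ℝ (Fin m)))
    (ψ : OpenPartialHomeomorph N (EuclideanSpace ℝ (Fin n))) (φ : M → N)
    (V : (x : M) → TangentSpace (𝓡 n) (φ x)) (u : EuclideanSpace ℝ (Fin m)) :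
    EuclideanSpace ℝ (Fin n) :=
  mvfderiv (𝓡 n) ψ (φ (e.symm u)) (V (e.symm u))

theorem mapInCharts_apply {φ : M → N} {x : M} (hx : x ∈ e.source) :
    mapInCharts e ψ φ (e x) = ψ (φ x) := by
  rw [mapInCharts, e.left_inv hx]

theorem fieldInCharts_apply {φ : M → N} (V : (x : M) → TangentSpace (𝓡 n) (φ x)) {x : M}
    (hx : x ∈ e.source) : fieldInCharts e ψ φ V (e x) = mvfderiv (𝓡 n) ψ (φ x) (V x) := by
  have h1 : ∀ z, z = x → mvfderiv (𝓡 n) ψ (φ z) (V z) = mvfderiv (𝓡 n) ψ (φ x) (V x) := by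
    rintro z rfl; rfl
  exact h1 _ (e.left_inv hx)

namespace IsConformallyFlatChart

theorem mvfderiv_covAlong (hc : IsConformallyFlatChart h ψ σ)
    (he : e ∈ IsManifold.maximalAtlas (𝓡 m) ∞ M) {x : M} (hx : x ∈ e.source) {φ : M → N}
    (hφx : φ x ∈ ψ.source) (hφ : MDifferentiableAt (𝓡 m) (𝓡 n) φ x)
    {V : (x : M) → TangentSpace (𝓡 n) (φ x)}
    (hV : DifferentiableAt ℝ (fieldInCharts e ψ φ V) (e x)) (v : TangentSpace (𝓡 m) x) :
    mvfderiv (𝓡 n) ψ (φ x) (covAlong h φ V x v)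
      = covCoord (confGamma (inChart ψ σ)) (mapInCharts e ψ φ) (fieldInCharts e ψ φ V)
          (mvfderiv (𝓡 m) e x v) (e x) := by
  rw [covCoord, mapInCharts_apply hx, fieldInCharts_apply V hx]
  exact HypersurfaceGeometry.mvfderiv_covAlong h he hx hc.mem_maximalAtlas hφx
    (hc.differentiableAt_confMetric hφx) (confMetric_symm _ _) (hc.eventually_inner_eq hφx)
    (koszulCoord_confMetric (hc.differentiableAt_factor hφx)) hφ hV v

/-- The correction to the Euclidean Hessian is -ds applied to `confGamma`. In the proof the
derivative of e^{2s}, contained in the gradient field, is absorbed by the connection terms. -/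
theorem hess_eq (hc : IsConformallyFlatChart h ψ σ) {q : N} (hq : q ∈ ψ.source)
    (v w : TangentSpace (𝓡 n) q) {s : EuclideanSpace ℝ (Fin n) → ℝ} (hs : s = inChart ψ σ)
    {y a b : EuclideanSpace ℝ (Fin n)} (hy : y = ψ q)
    (ha : a = mvfderiv (𝓡 n) ψ q v) (hb : b = mvfderiv (𝓡 n) ψ q w) :
    hess h σ q v w = fderiv ℝ (fderiv ℝ s) y a b + 2 * fderiv ℝ s y a * fderiv ℝ s y b
      - fderiv ℝ s y (gradient s y) * inner ℝ a b := by
  have hsm : ContDiffAt ℝ ∞ s y := by rw [hs, hy]; exact hc.contDiffAt_factor hq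
  have hsd : DifferentiableAt ℝ s y := hsm.differentiableAt (by simp)
  have hgd : DifferentiableAt ℝ (gradient s) y :=
    (contDiffAt_gradient hsm).differentiableAt (by simp)
  have hyt : y ∈ ψ.target := hy ▸ ψ.map_source hq
  have hf : mapInCharts ψ ψ (id : N → N) =ᶠ[nhds y] id := by
    filter_upwards [ψ.open_target.mem_nhds hyt] with z hz using ψ.right_inv hz
  have hV : fieldInCharts ψ ψ (id : N → N) (grad h σ) =ᶠ[nhds y]
      fun z => Real.exp (2 * s z) • gradient s z := by
    filter_upwards [ψ.open_target.mem_nhds hyt] with z hz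
    have h1 := hc.mvfderiv_grad (ψ.map_target hz)
    rw [ψ.right_inv hz, ← hs] at h1
    exact h1
  have hed : DifferentiableAt ℝ (fun z => Real.exp (2 * s z)) y := by fun_prop
  have hVd : DifferentiableAt ℝ (fun z => Real.exp (2 * s z) • gradient s z) y := hed.smul hgd
  have hgr : ∀ a b, inner ℝ (fderiv ℝ (gradient s) y a) b = fderiv ℝ (fderiv ℝ s) y a b := by
    intro a b
    have hsd2 : DifferentiableAt ℝ (fderiv ℝ s) y :=
      (hsm.fderiv_right (m := ∞) (by simp)).differentiableAt (by simp)
    have h1 : (fun z => inner ℝ (gradient s z) b) = fun z => fderiv ℝ s z b := by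
      funext z; exact inner_gradient_left s z b
    have h2 : fderiv ℝ (fun z => inner ℝ (gradient s z) b) y a
        = fderiv ℝ (fun z => fderiv ℝ s z b) y a := by rw [h1]
    rw [fderiv_inner_apply ℝ hgd (by fun_prop), fderiv_clm_apply hsd2 (by fun_prop)] at h2
    simpa using h2
  have h1 := hc.mvfderiv_covAlong (φ := (id : N → N)) (V := grad h σ) hc.mem_maximalAtlas hq hq
    mdifferentiableAt_id (by rw [← hy]; exact hVd.congr_of_eventuallyEq hV) v
  rw [← hy, ← ha, ← hs, covCoord_congr hV, covCoord, hf.fderiv_eq, hf.eq_of_nhds, fderiv_id,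
    fderiv_fun_smul hed hgd] at h1
  have hexp : fderiv ℝ (fun z => Real.exp (2 * s z)) y a
      = 2 * Real.exp (2 * s y) * fderiv ℝ s y a := by
    rw [fderiv_exp (by fun_prop), fderiv_const_mul hsd]
    simp; ring
  rw [hess, hc.inner_eq_confMetric hq, leviCivita, ← hs, ← hy, ← hb]
  erw [h1]
  simp only [add_apply, smul_apply, ContinuousLinearMap.smulRight_apply, hexp, id, map_smul,
    ContinuousLinearMap.id_apply, confMetric_apply, confGamma_apply, inner_add_left,
    inner_smul_left, inner_neg_left, inner_sub_left, inner_gradient_left, inner_gradient_right,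
    hgr, conj_trivial]
  have h3 : Real.exp (-2 * s y) * Real.exp (2 * s y) = 1 := by
    rw [← Real.exp_add]; simp
  linear_combination (2 * fderiv ℝ s y a * fderiv ℝ s y b + fderiv ℝ (fderiv ℝ s) y a b
    - fderiv ℝ s y (gradient s y) * inner ℝ a b) * h3

/-- Trace of the Hessian: the term with 2ds⊗ds contributes 2|∇s|², the term with the metric minus
the dimension times |∇s|². -/
theorem laplacian_eq (hc : IsConformallyFlatChart h ψ σ) {q : N} (hq : q ∈ ψ.source)
    {s : EuclideanSpace ℝ (Fin n) → ℝ} (hs : s = inChart ψ σ)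
    {y : EuclideanSpace ℝ (Fin n)} (hy : y = ψ q) {ι : Type*} [Fintype ι]
    (ε : OrthonormalBasis ι ℝ (EuclideanSpace ℝ (Fin n))) :
    laplacian h σ q = Real.exp (2 * s y) * (∑ i, fderiv ℝ (fderiv ℝ s) y (ε i) (ε i)
      + (2 - (Fintype.card ι : ℝ)) * fderiv ℝ s y (gradient s y)) := by
  let β : EuclideanSpace ℝ (Fin n) →ₗ[ℝ] EuclideanSpace ℝ (Fin n) →ₗ[ℝ] ℝ :=
    LinearMap.mk₂ ℝ (fun a b => fderiv ℝ (fderiv ℝ s) y a b + 2 * fderiv ℝ s y a * fderiv ℝ s y b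
        - fderiv ℝ s y (gradient s y) * inner ℝ a b)
      (fun a a' b => by simp only [map_add, add_apply, inner_add_left]; ring)
      (fun r a b => by simp only [map_smul, smul_apply, inner_smul_left, smul_eq_mul,
        conj_trivial]; ring)
      (fun a b b' => by simp only [map_add, inner_add_right]; ring)
      (fun r a b => by simp only [map_smul, inner_smul_right, smul_eq_mul]; ring)
  have h1 : hess h σ q = fun v w => β (mvfderiv (𝓡 n) ψ q v) (mvfderiv (𝓡 n) ψ q w) := by
    funext v w
    exact hc.hess_eq hq v w hs hy rfl rfl
  have h2 : ∑ i, fderiv ℝ s y (ε i) * fderiv ℝ s y (ε i) = fderiv ℝ s y (gradient s y) := by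
    have := ε.sum_inner_mul_inner (gradient s y) (gradient s y)
    simp only [inner_gradient_left, inner_gradient_right] at this
    exact this
  rw [laplacian, h1, metricTrace_of_conformal h (Real.exp_ne_zero (-2 * s y)) (mvfderiv (𝓡 n) ψ q)
    (chartFrame ψ q) (mvfderiv_chartFrame hc.mem_maximalAtlas hq)
    (fun v w => by rw [hc.inner_eq q hq, hs, hy, inChart_apply hq]) ε β, ← Real.exp_neg]
  congr 1
  · ring_nf
  · simp only [β, LinearMap.mk₂_apply, Finset.sum_add_distrib, Finset.sum_sub_distrib, mul_assoc,
      ← Finset.mul_sum, h2, real_inner_self_eq_norm_sq, ε.norm_eq_one]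
    simp
    ring

theorem volDensity_smul_tension (hc : IsConformallyFlatChart h ψ σ) (g : SmoothMetric m M)
    {φ : M → N} (hφ : ContMDiff (𝓡 m) (𝓡 n) ∞ φ) {p x : M}
    (hx : x ∈ (chartAt (EuclideanSpace ℝ (Fin m)) p).source) (hφx : φ x ∈ ψ.source)
    {f : EuclideanSpace ℝ (Fin m) → EuclideanSpace ℝ (Fin n)}
    (hf : f = mapInCharts (chartAt (EuclideanSpace ℝ (Fin m)) p) ψ φ)
    {u : EuclideanSpace ℝ (Fin m)} (hu : u = chartAt (EuclideanSpace ℝ (Fin m)) p x) :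
    volDensity g p u • mvfderiv (𝓡 n) ψ (φ x) (tension g h φ x)
      = ∑ i, covCoord (confGamma (inChart ψ σ)) f
          (fun u => ∑ j, (volDensity g p u * gramInv g p i j u)
            • fderiv ℝ f u (EuclideanSpace.single j 1)) (EuclideanSpace.single i 1) u :=
  volDensity_smul_mvfderiv_tension g h hφ hx hc.mem_maximalAtlas hφx
    (hc.differentiableAt_confMetric hφx) (confMetric_symm _ _) (hc.eventually_inner_eq hφx)
    (koszulCoord_confMetric (hc.differentiableAt_factor hφx)) hf hu

end IsConformallyFlatChart

end Maps

/-- The Euler-Lagrange form of the bienergy in coordinates: the pairing of `v` with the bitension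
field, for a map `f` with tension field `τ`, where `P i j` is the inverse metric times the volume
density. -/
def bitensionForm {Z F ι : Type*} [NormedAddCommGroup Z] [NormedSpace ℝ Z]
    [NormedAddCommGroup F] [NormedSpace ℝ F] [Fintype ι]
    (Γ : F → F →L[ℝ] F →L[ℝ] F) (B : F → F →L[ℝ] F →L[ℝ] ℝ) (f τ : Z → F)
    (P : ι → ι → Z → ℝ) (e : ι → Z) (z : Z) (v : F) : ℝ :=
  B (f z) v (∑ i, covCoord Γ f (fun z => ∑ j, P i j z • covCoord Γ f τ (e j) z) (e i) z)
    + ∑ i, ∑ j, P i j z * B (f z) (curvCoord Γ (f z) v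
        (fderiv ℝ f z (e i)) (fderiv ℝ f z (e j))) (τ z)

/-! ### Linearity of the Euler-Lagrange form -/

section BitensionForm

variable {Z F ι : Type*} [NormedAddCommGroup Z] [NormedSpace ℝ Z]
  [NormedAddCommGroup F] [NormedSpace ℝ F] [Fintype ι]
  {Γ : F → F →L[ℝ] F →L[ℝ] F} {B : F → F →L[ℝ] F →L[ℝ] ℝ} {f τ : Z → F}
  {P : ι → ι → Z → ℝ} {e : ι → Z}

theorem bitensionForm_add (z : Z) (v v' : F) : bitensionForm Γ B f τ P e z (v + v')
    = bitensionForm Γ B f τ P e z v + bitensionForm Γ B f τ P e z v' := by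
  simp only [bitensionForm, curvCoord, map_add, add_apply, map_sub, sub_apply, mul_add, mul_sub,
    Finset.sum_add_distrib, Finset.sum_sub_distrib]
  ring

theorem bitensionForm_smul (z : Z) (r : ℝ) (v : F) : bitensionForm Γ B f τ P e z (r • v)
    = r * bitensionForm Γ B f τ P e z v := by
  simp only [bitensionForm, curvCoord, map_smul, smul_apply, ← smul_sub, ← smul_add, smul_eq_mul,
    mul_add, Finset.mul_sum]
  congr 1
  refine Finset.sum_congr rfl fun i _ => Finset.sum_congr rfl fun j _ => by ring

theorem bitensionForm_sum (z : Z) {κ : Type*} (t : Finset κ) (v : κ → F) :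
    bitensionForm Γ B f τ P e z (∑ k ∈ t, v k) = ∑ k ∈ t, bitensionForm Γ B f τ P e z (v k) := by
  let l : F →ₗ[ℝ] ℝ := ⟨⟨bitensionForm Γ B f τ P e z, bitensionForm_add z⟩,
    fun r v => bitensionForm_smul z r v⟩
  exact map_sum l v t

end BitensionForm

/-! ### The Euler-Lagrange form of a hypersurface for e^{-2s}⟨·,·⟩ -/

namespace CoordHypersurface

variable {Z F ι : Type*} [NormedAddCommGroup Z] [NormedSpace ℝ Z]
  [NormedAddCommGroup F] [InnerProductSpace ℝ F] [CompleteSpace F] [Fintype ι] [DecidableEq ι]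
  {s : F → ℝ} {f ξ : Z → F} {H w : Z → ℝ} {gi : ι → ι → Z → ℝ} {e : ι → Z} {c : ℝ} {O : Set Z}

/-- The completeness relation is bilinear in a and b; nondegeneracy of the inner product strips off
b. -/
theorem expand (S : CoordHypersurface (confGamma s) (confMetric s) f ξ H w gi e c O) {z : Z}
    (hz : z ∈ O) (a : F) :
    a = confMetric s (f z) a (ξ z) • ξ z
      + ∑ k, ∑ l, (gi k l z * confMetric s (f z) a (fderiv ℝ f z (e k)))
        • fderiv ℝ f z (e l) := by
  refine ext_inner_right ℝ fun b => ?_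
  have h1 := S.complete z hz a b
  have h2 : confMetric s (f z) a b = confMetric s (f z) (confMetric s (f z) a (ξ z) • ξ z
      + ∑ k, ∑ l, (gi k l z * confMetric s (f z) a (fderiv ℝ f z (e k)))
        • fderiv ℝ f z (e l)) b := by
    rw [h1]
    simp only [map_add, map_sum, map_smul, add_apply, sum_apply, smul_apply, smul_eq_mul]
  rw [confMetric_apply s _ _ b, confMetric_apply s _ _ b] at h2
  exact mul_left_cancel₀ (Real.exp_ne_zero _) h2

/-- The trace over the tangent space of the hypersurface. -/
theorem tangential_trace (S : CoordHypersurface (confGamma s) (confMetric s) f ξ H w gi e c O)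
    {z : Z} (hz : z ∈ O) {κ : Type*} [Fintype κ] (ε : OrthonormalBasis κ ℝ F)
    (β : F →ₗ[ℝ] F →ₗ[ℝ] ℝ) :
    ∑ i, ∑ j, gi i j z * β (fderiv ℝ f z (e i)) (fderiv ℝ f z (e j))
      = Real.exp (2 * s (f z)) * ∑ k, β (ε k) (ε k) - β (ξ z) (ξ z) := by
  have hβ : ∀ a b, ∑ k, inner ℝ (ε k) a * β (ε k) b = β a b := by
    intro a b
    conv_rhs => rw [← ε.sum_repr' a]
    simp only [map_sum, map_smul, LinearMap.sum_apply, LinearMap.smul_apply, smul_eq_mul]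
  have h1 : ∀ k, β (ε k) (ε k) = Real.exp (-2 * s (f z)) * (inner ℝ (ε k) (ξ z) * β (ε k) (ξ z)
      + ∑ i, ∑ j, gi i j z * (inner ℝ (ε k) (fderiv ℝ f z (e i))
        * β (ε k) (fderiv ℝ f z (e j)))) := by
    intro k
    -- Only the second argument is expanded in the adapted frame; the sum over the orthonormal basis
    -- then restores the first.
    conv_lhs => enter [2]; rw [S.expand hz (ε k)]
    simp only [map_add, map_sum, map_smul, smul_eq_mul, confMetric_apply, mul_add, Finset.mul_sum]
    congr 1
    · ring
    · refine Finset.sum_congr rfl fun i _ => Finset.sum_congr rfl fun j _ => by ring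
  have h2 : ∑ k, β (ε k) (ε k) = Real.exp (-2 * s (f z)) * (β (ξ z) (ξ z)
      + ∑ i, ∑ j, gi i j z * β (fderiv ℝ f z (e i)) (fderiv ℝ f z (e j))) := by
    rw [Finset.sum_congr rfl fun k _ => h1 k, ← Finset.mul_sum, Finset.sum_add_distrib, hβ,
      Finset.sum_comm]
    congr 2
    refine Finset.sum_congr rfl fun i _ => ?_
    rw [Finset.sum_comm]
    refine Finset.sum_congr rfl fun j _ => ?_
    rw [← Finset.mul_sum, hβ]
  rw [h2, ← mul_assoc, ← Real.exp_add]
  simp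

/-- The normal direction adds nothing, because the curvature is skew in its last two slots and both
would be ξ. The tangential trace is therefore the Ricci contraction; the factors e^{2s} of the trace
and e^{-2s} of the metric cancel. -/
theorem sum_metric_curvCoord
    (S : CoordHypersurface (confGamma s) (confMetric s) f ξ H w gi e c O) {z : Z} (hz : z ∈ O)
    (hs : ContDiffAt ℝ ∞ s (f z)) {κ : Type*} [Fintype κ] (ε : OrthonormalBasis κ ℝ F) (v : F) :
    ∑ i, ∑ j, gi i j z * confMetric s (f z) (curvCoord (confGamma s) (f z) v
        (fderiv ℝ f z (e i)) (fderiv ℝ f z (e j))) (ξ z)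
      = ((Fintype.card κ : ℝ) - 2) * confSchouten s (f z) v (ξ z)
        + (∑ k, confSchouten s (f z) (ε k) (ε k)) * inner ℝ v (ξ z) := by
  let β : F →ₗ[ℝ] F →ₗ[ℝ] ℝ := LinearMap.mk₂ ℝ
    (fun a b => confMetric s (f z) (curvCoord (confGamma s) (f z) v a b) (ξ z))
    (fun a a' b => by
      simp only [curvCoord, map_add, add_apply, map_sub, sub_apply]; ring)
    (fun r a b => by
      simp only [curvCoord, map_smul, smul_apply, ← smul_sub, ← smul_add])
    (fun a b b' => by simp only [curvCoord, map_add, add_apply, map_sub, sub_apply]; ring)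
    (fun r a b => by simp only [curvCoord, map_smul, smul_apply, ← smul_sub, ← smul_add])
  have h1 := S.tangential_trace hz ε β
  have h2 : β (ξ z) (ξ z) = 0 := by
    have := S.skew z hz v (ξ z) (ξ z) (ξ z)
    change confMetric s (f z) (curvCoord (confGamma s) (f z) v (ξ z) (ξ z)) (ξ z) = 0
    linarith
  rw [h2, sub_zero] at h1
  simp only [β, LinearMap.mk₂_apply, confMetric_apply s _ _ (ξ z), ← Finset.mul_sum] at h1
  rw [sum_inner_curvCoord_confGamma hs ε v (ξ z), ← mul_assoc, ← Real.exp_add] at h1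
  simp only [neg_mul, add_neg_cancel, Real.exp_zero, one_mul] at h1
  rw [← h1]
  simp only [confMetric_apply s _ _ (ξ z), neg_mul]

/-- Substitute T = cHξ: the Leibniz rule treats the Laplacian and `sum_metric_curvCoord` the
curvature. -/
theorem bitensionForm_eq (S : CoordHypersurface (confGamma s) (confMetric s) f ξ H w gi e c O)
    {z : Z} (hz : z ∈ O) (hs : ContDiffAt ℝ ∞ s (f z)) {κ : Type*} [Fintype κ]
    (ε : OrthonormalBasis κ ℝ F) {T : Z → F} (hT : ∀ z ∈ O, T z = (c * H z) • ξ z) (v : F) :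
    bitensionForm (confGamma s) (confMetric s) f T (fun i j z => w z * gi i j z) e z v
      = c * ((∑ i, fderiv ℝ (fun z => ∑ j, w z * gi i j z * fderiv ℝ H z (e j)) z (e i))
            * confMetric s (f z) (ξ z) v
          + 2 * ∑ i, ∑ j, w z * gi i j z * fderiv ℝ H z (e i)
            * confMetric s (f z) (covCoord (confGamma s) f ξ (e j) z) v
          + H z * confMetric s (f z) (∑ i, covCoord (confGamma s) f
            (fun z => ∑ j, (w z * gi i j z) • covCoord (confGamma s) f ξ (e j) z) (e i) z) v
          + H z * w z * (((Fintype.card κ : ℝ) - 2) * confSchouten s (f z) v (ξ z)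
            + (∑ k, confSchouten s (f z) (ε k) (ε k)) * inner ℝ v (ξ z))) := by
  rw [bitensionForm, S.laplacian_tension hz hT, confMetric_symm s (f z) v, hT z hz,
    ← S.sum_metric_curvCoord hz hs ε v]
  simp only [map_add, map_sum, map_smul, add_apply, sum_apply, smul_apply, smul_eq_mul, mul_add,
    Finset.mul_sum]
  congr 1
  refine Finset.sum_congr rfl fun i _ => Finset.sum_congr rfl fun j _ => by ring

/-- Against ξ the term with the gradient of H drops out, since ∇ξ is tangential. The Euclidean
square of ξ is e^{2s}, as ξ has unit length for e^{-2s}⟨·,·⟩. -/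
theorem bitensionForm_normal
    (S : CoordHypersurface (confGamma s) (confMetric s) f ξ H w gi e c O)
    {z : Z} (hz : z ∈ O) (hs : ContDiffAt ℝ ∞ s (f z)) {κ : Type*} [Fintype κ]
    (ε : OrthonormalBasis κ ℝ F) {T : Z → F} (hT : ∀ z ∈ O, T z = (c * H z) • ξ z) :
    bitensionForm (confGamma s) (confMetric s) f T (fun i j z => w z * gi i j z) e z (ξ z)
      = c * (∑ i, fderiv ℝ (fun z => ∑ j, w z * gi i j z * fderiv ℝ H z (e j)) z (e i)
          - w z * (H z * ∑ i, ∑ j, gi i j z * confMetric s (f z)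
            (covCoord (confGamma s) f ξ (e i) z) (covCoord (confGamma s) f ξ (e j) z))
          + H z * w z * (((Fintype.card κ : ℝ) - 2) * confSchouten s (f z) (ξ z) (ξ z)
            + (∑ k, confSchouten s (f z) (ε k) (ε k)) * Real.exp (2 * s (f z)))) := by
  have hn : inner ℝ (ξ z) (ξ z) = Real.exp (2 * s (f z)) := by
    have h1 := S.unit z hz
    rw [confMetric_apply] at h1
    have h2 : Real.exp (2 * s (f z)) * Real.exp (-2 * s (f z)) = 1 := by
      rw [← Real.exp_add]; simp
    calc _ = Real.exp (2 * s (f z)) * (Real.exp (-2 * s (f z)) * inner ℝ (ξ z) (ξ z)) := by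
          rw [← mul_assoc, h2, one_mul]
      _ = _ := by rw [h1, mul_one]
  rw [S.bitensionForm_eq hz hs ε hT, S.metric_laplacian_normal_normal hz, S.unit z hz, hn]
  simp only [S.metric_cov_normal_normal hz, mul_zero, Finset.sum_const_zero]
  ring

theorem inner_normal_partial (S : CoordHypersurface (confGamma s) (confMetric s) f ξ H w gi e c O)
    {z : Z} (hz : z ∈ O) (k : ι) : inner ℝ (ξ z) (fderiv ℝ f z (e k)) = 0 := by
  have h1 := S.normal z hz k
  rw [confMetric_apply] at h1
  exact (mul_eq_zero.1 h1).resolve_left (Real.exp_ne_zero _)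

/-- The curvature counts twice: once explicitly in the form, once through the tangential part of the
Laplacian of ξ. Its trace part vanishes because ∂_k f is orthogonal to ξ. -/
theorem bitensionForm_partial
    (S : CoordHypersurface (confGamma s) (confMetric s) f ξ H w gi e c O)
    {z : Z} (hz : z ∈ O) (hs : ContDiffAt ℝ ∞ s (f z)) {κ : Type*} [Fintype κ]
    (ε : OrthonormalBasis κ ℝ F) {T : Z → F} (hT : ∀ z ∈ O, T z = (c * H z) • ξ z) (k : ι) :
    bitensionForm (confGamma s) (confMetric s) f T (fun i j z => w z * gi i j z) e z
        (fderiv ℝ f z (e k))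
      = c * w z * (2 * ∑ i, ∑ j, gi i j z * fderiv ℝ H z (e i) * confMetric s (f z)
            (covCoord (confGamma s) f ξ (e j) z) (fderiv ℝ f z (e k))
          - c * H z * fderiv ℝ H z (e k)
          + 2 * ((Fintype.card κ : ℝ) - 2) * H z
            * confSchouten s (f z) (fderiv ℝ f z (e k)) (ξ z)) := by
  rw [S.bitensionForm_eq hz hs ε hT, S.metric_laplacian_normal_partial hz, S.normal z hz,
    S.sum_metric_curvCoord hz hs ε, real_inner_comm, S.inner_normal_partial hz]
  have h1 : ∑ i, ∑ j, w z * gi i j z * fderiv ℝ H z (e i) * confMetric s (f z)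
      (covCoord (confGamma s) f ξ (e j) z) (fderiv ℝ f z (e k))
      = w z * ∑ i, ∑ j, gi i j z * fderiv ℝ H z (e i) * confMetric s (f z)
      (covCoord (confGamma s) f ξ (e j) z) (fderiv ℝ f z (e k)) := by
    simp only [Finset.mul_sum, mul_assoc]
  rw [h1]
  ring

/-- Differentiate ds(ξ) along the hypersurface. The Euclidean derivative of ξ is ∇_k ξ minus a
connection term; ds of that connection term is -2 ds(∂_k f) ds(ξ), and ds(∇_k ξ) becomes the last
sum by symmetry of the second form. -/
theorem confSchouten_partial_normal
    (S : CoordHypersurface (confGamma s) (confMetric s) f ξ H w gi e c O)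
    {z : Z} (hz : z ∈ O) (hs : ContDiffAt ℝ ∞ s (f z)) (k : ι) :
    confSchouten s (f z) (fderiv ℝ f z (e k)) (ξ z)
      = fderiv ℝ (fun z => fderiv ℝ s (f z) (ξ z)) z (e k)
        - fderiv ℝ s (f z) (ξ z) * fderiv ℝ s (f z) (fderiv ℝ f z (e k))
        - ∑ i, ∑ j, gi i j z * fderiv ℝ s (f z) (fderiv ℝ f z (e i)) * confMetric s (f z)
            (covCoord (confGamma s) f ξ (e j) z) (fderiv ℝ f z (e k)) := by
  have hsd2 : DifferentiableAt ℝ (fderiv ℝ s) (f z) :=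
    (hs.fderiv_right (m := ∞) (by simp)).differentiableAt (by simp)
  have hfd : DifferentiableAt ℝ f z := (S.map_smooth z hz).differentiableAt (by simp)
  have hξd : DifferentiableAt ℝ ξ z := (S.normal_smooth z hz).differentiableAt (by simp)
  have hcomp : DifferentiableAt ℝ (fun z => fderiv ℝ s (f z)) z := hsd2.comp z hfd
  have h1 : fderiv ℝ (fun z => fderiv ℝ s (f z) (ξ z)) z (e k)
      = fderiv ℝ (fderiv ℝ s) (f z) (fderiv ℝ f z (e k)) (ξ z)
        + fderiv ℝ s (f z) (fderiv ℝ ξ z (e k)) := by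
    rw [fderiv_clm_apply hcomp hξd]
    have h2 : fderiv ℝ (fun z => fderiv ℝ s (f z)) z
        = (fderiv ℝ (fderiv ℝ s) (f z)).comp (fderiv ℝ f z) :=
      fderiv_comp (g := fderiv ℝ s) z hsd2 hfd
    rw [h2]
    simp [add_comm]
  have h2 : covCoord (confGamma s) f ξ (e k) z = fderiv ℝ ξ z (e k)
      + confGamma s (f z) (fderiv ℝ f z (e k)) (ξ z) := rfl
  have h3 := congrArg (fderiv ℝ s (f z)) h2
  rw [S.expand hz (covCoord (confGamma s) f ξ (e k) z), S.metric_cov_normal_normal hz] at h3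
  simp only [zero_smul, zero_add, map_sum, map_smul, map_add, smul_eq_mul] at h3
  have hinn : inner ℝ (fderiv ℝ f z (e k)) (ξ z) = 0 := by
    rw [real_inner_comm]; exact S.inner_normal_partial hz k
  rw [confGamma_apply, hinn] at h3
  simp only [zero_smul, sub_zero, map_neg, map_add, map_smul, smul_eq_mul] at h3
  have h4 : ∑ i, ∑ j, gi i j z * fderiv ℝ s (f z) (fderiv ℝ f z (e i)) * confMetric s (f z)
            (covCoord (confGamma s) f ξ (e j) z) (fderiv ℝ f z (e k))
      = ∑ i, ∑ j, gi i j z * confMetric s (f z) (covCoord (confGamma s) f ξ (e k) z)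
          (fderiv ℝ f z (e i)) * fderiv ℝ s (f z) (fderiv ℝ f z (e j)) := by
    rw [Finset.sum_comm]
    refine Finset.sum_congr rfl fun i _ => Finset.sum_congr rfl fun j _ => ?_
    rw [S.inv_symm, S.metric_cov_normal_symm hz i k]
    ring
  rw [h4, h1, h3, confSchouten, hinn]
  ring

end CoordHypersurface

/-! ### Smoothness of chart expressions -/

section SmoothFields

variable {m n : ℕ} {M N : Type*} [TopologicalSpace M] [TopologicalSpace N]
  [ChartedSpace (EuclideanSpace ℝ (Fin m)) M] [IsManifold (𝓡 m) ∞ M]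
  [ChartedSpace (EuclideanSpace ℝ (Fin n)) N] [IsManifold (𝓡 n) ∞ N]
  {e : OpenPartialHomeomorph M (EuclideanSpace ℝ (Fin m))}
  {ψ : OpenPartialHomeomorph N (EuclideanSpace ℝ (Fin n))} {φ : M → N}

theorem contDiffAt_mapInCharts (he : e ∈ IsManifold.maximalAtlas (𝓡 m) ∞ M) {x : M}
    (hx : x ∈ e.source) (hψ : ψ ∈ IsManifold.maximalAtlas (𝓡 n) ∞ N)
    (hφx : φ x ∈ ψ.source) (hφ : ContMDiffAt (𝓡 m) (𝓡 n) ∞ φ x) :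
    ContDiffAt ℝ ∞ (mapInCharts e ψ φ) (e x) :=
  contDiffAt_comp_charts he hx hψ hφx hφ

/-- Smoothness into the tangent bundle means smooth components in the preferred chart at φ x; a
smooth transition matrix carries them to ψ. -/
theorem contDiffAt_fieldInCharts (he : e ∈ IsManifold.maximalAtlas (𝓡 m) ∞ M) {x : M}
    (hx : x ∈ e.source) (hψ : ψ ∈ IsManifold.maximalAtlas (𝓡 n) ∞ N)
    (hφx : φ x ∈ ψ.source) {V : (x : M) → TangentSpace (𝓡 n) (φ x)}
    (hV : ContMDiffAt (𝓡 m) (𝓡 n).tangent ∞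
      (fun x => (⟨φ x, V x⟩ : TangentBundle (𝓡 n) N)) x) :
    ContDiffAt ℝ ∞ (fieldInCharts e ψ φ V) (e x) := by
  set c := chartAt (EuclideanSpace ℝ (Fin n)) (φ x) with hc
  have hcat : c ∈ IsManifold.maximalAtlas (𝓡 n) ∞ N := chart_mem_maximalAtlas (φ x)
  have hcx : φ x ∈ c.source := mem_chart_source _ _
  rw [Bundle.contMDiffAt_totalSpace] at hV
  obtain ⟨hφ, hV2⟩ := hV
  replace hφ : ContMDiffAt (𝓡 m) (𝓡 n) ∞ φ x := hφ
  have hV3 : ContMDiffAt (𝓡 m) 𝓘(ℝ, EuclideanSpace ℝ (Fin n)) ∞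
      (fun y => coords (φ x) (φ y) (V y)) x := by
    refine hV2.congr_of_eventuallyEq ?_
    filter_upwards [hφ.continuousAt.eventually (c.open_source.mem_nhds hcx)] with y hy
    simp only [coords]
    rw [Bundle.Trivialization.continuousLinearMapAt_apply,
      Bundle.Trivialization.linearMapAt_apply, if_pos]
    have hy' : φ y ∈ c.source := hy
    simpa [hc] using hy'
  have h1 := contDiffAt_comp_chart_symm he hx hV3
  have h2 := contDiffAt_comp_charts he hx hcat hcx hφ
  have h3 : ContDiffAt ℝ ∞ (fderiv ℝ (fun z => ψ (c.symm z))) (c (φ (e.symm (e x)))) := by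
    rw [e.left_inv hx]
    exact (contDiffAt_transition hcat hψ hcx hφx).fderiv_right (m := ∞) (by simp)
  have h4 := (h3.comp (e x) h2).clm_apply h1
  refine h4.congr_of_eventuallyEq ?_
  have ht : Filter.Tendsto (fun u => φ (e.symm u)) (nhds (e x)) (nhds (φ x)) := by
    have h5 := e.continuousAt_symm (e.map_source hx)
    rw [ContinuousAt, e.left_inv hx] at h5
    exact hφ.continuousAt.tendsto.comp h5
  filter_upwards [ht.eventually (c.open_source.mem_nhds hcx),
    ht.eventually (ψ.open_source.mem_nhds hφx)] with u hu1 hu2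
  rw [fieldInCharts, mvfderiv_chart_comp hcat hψ hu1 hu2, ← coords_eq_mvfderiv hu1]
  rfl

end SmoothFields

/-! ### Smoothness of the tension field -/

section Tension

variable {m n : ℕ} {M N : Type*} [TopologicalSpace M] [TopologicalSpace N]
  [ChartedSpace (EuclideanSpace ℝ (Fin m)) M] [IsManifold (𝓡 m) ∞ M]
  [ChartedSpace (EuclideanSpace ℝ (Fin n)) N] [IsManifold (𝓡 n) ∞ N]
  {h : SmoothMetric n N} {ψ : OpenPartialHomeomorph N (EuclideanSpace ℝ (Fin n))} {σ : N → ℝ}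
  {φ : M → N}

/-- The part of the target of the preferred chart at `p` that is mapped by `φ` to the domain of
the chart `ψ`. -/
def chartDomain (p : M) (ψ : OpenPartialHomeomorph N (EuclideanSpace ℝ (Fin n))) (φ : M → N) :
    Set (EuclideanSpace ℝ (Fin m)) :=
  {u | u ∈ (chartAt (EuclideanSpace ℝ (Fin m)) p).target
    ∧ φ ((chartAt (EuclideanSpace ℝ (Fin m)) p).symm u) ∈ ψ.source}

theorem isOpen_chartDomain (p : M) (hφ : Continuous φ) : IsOpen (chartDomain (m := m) p ψ φ) :=
  (chartAt (EuclideanSpace ℝ (Fin m)) p).isOpen_inter_preimage_symm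
    (ψ.open_source.preimage hφ)

variable {p : M} {u : EuclideanSpace ℝ (Fin m)}

theorem contDiffAt_mapInCharts_of_mem (hψ : ψ ∈ IsManifold.maximalAtlas (𝓡 n) ∞ N)
    (hφ : ContMDiff (𝓡 m) (𝓡 n) ∞ φ) (hu : u ∈ chartDomain p ψ φ) :
    ContDiffAt ℝ ∞ (mapInCharts (chartAt (EuclideanSpace ℝ (Fin m)) p) ψ φ) u := by
  have h1 := contDiffAt_mapInCharts (chart_mem_maximalAtlas p)
    ((chartAt (EuclideanSpace ℝ (Fin m)) p).map_target hu.1) hψ hu.2 (hφ _)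
  rwa [(chartAt (EuclideanSpace ℝ (Fin m)) p).right_inv hu.1] at h1

theorem IsConformallyFlatChart.contDiffAt_factor_of_mem (hc : IsConformallyFlatChart h ψ σ)
    (hu : u ∈ chartDomain p ψ φ) : ContDiffAt ℝ ∞ (inChart ψ σ)
      (mapInCharts (chartAt (EuclideanSpace ℝ (Fin m)) p) ψ φ u) :=
  hc.contDiffAt_factor hu.2

theorem IsConformallyFlatChart.volDensity_smul_fieldInCharts_tension
    (hc : IsConformallyFlatChart h ψ σ) (g : SmoothMetric m M) (hφ : ContMDiff (𝓡 m) (𝓡 n) ∞ φ)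
    (hu : u ∈ chartDomain p ψ φ) {f : EuclideanSpace ℝ (Fin m) → EuclideanSpace ℝ (Fin n)}
    (hf : f = mapInCharts (chartAt (EuclideanSpace ℝ (Fin m)) p) ψ φ) :
    volDensity g p u
        • fieldInCharts (chartAt (EuclideanSpace ℝ (Fin m)) p) ψ φ (tension g h φ) u
      = ∑ i, covCoord (confGamma (inChart ψ σ)) f
          (fun u => ∑ j, (volDensity g p u * gramInv g p i j u)
            • fderiv ℝ f u (EuclideanSpace.single j 1)) (EuclideanSpace.single i 1) u :=
  hc.volDensity_smul_tension g hφ ((chartAt (EuclideanSpace ℝ (Fin m)) p).map_target hu.1) hu.2 hf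
    ((chartAt (EuclideanSpace ℝ (Fin m)) p).right_inv hu.1).symm

/-- The definition of the tension field changes chart from point to point. Smoothness comes from the
divergence form in one chart, divided by the positive density. -/
theorem IsConformallyFlatChart.contDiffAt_tension
    (hc : IsConformallyFlatChart h ψ σ) (g : SmoothMetric m M) (hφ : ContMDiff (𝓡 m) (𝓡 n) ∞ φ)
    (hu : u ∈ chartDomain p ψ φ) : ContDiffAt ℝ ∞
      (fieldInCharts (chartAt (EuclideanSpace ℝ (Fin m)) p) ψ φ (tension g h φ)) u := by
  set f := mapInCharts (chartAt (EuclideanSpace ℝ (Fin m)) p) ψ φ with hf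
  have hfs : ContDiffAt ℝ ∞ f u := contDiffAt_mapInCharts_of_mem hc.mem_maximalAtlas hφ hu
  have h1 : fieldInCharts (chartAt (EuclideanSpace ℝ (Fin m)) p) ψ φ (tension g h φ)
      =ᶠ[nhds u] fun u => (volDensity g p u)⁻¹ • ∑ i, covCoord (confGamma (inChart ψ σ)) f
          (fun u => ∑ j, (volDensity g p u * gramInv g p i j u)
            • fderiv ℝ f u (EuclideanSpace.single j 1)) (EuclideanSpace.single i 1) u := by
    filter_upwards [(isOpen_chartDomain p hφ.continuous).mem_nhds hu] with z hz
    rw [← hc.volDensity_smul_fieldInCharts_tension g hφ hz hf,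
      inv_smul_smul₀ (volDensity_pos g hz.1).ne']
  refine ContDiffAt.congr_of_eventuallyEq ?_ h1
  refine ((contDiffAt_volDensity g hu.1).inv (volDensity_pos g hu.1).ne').smul
    (ContDiffAt.sum fun i _ => contDiffAt_covCoord
      (contDiffAt_confGamma (hc.contDiffAt_factor_of_mem hu)) hfs
      (ContDiffAt.sum fun j _ => ?_) _)
  exact ((contDiffAt_volDensity g hu.1).mul (contDiffAt_gramInv g hu.1 i j)).smul
    (contDiffAt_fderiv_apply hfs _)

end Tension

/-! ### Isometric immersions as coordinate hypersurfaces -/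

section Hypersurface

variable {m : ℕ} {M N : Type*} [TopologicalSpace M] [TopologicalSpace N]
  [ChartedSpace (EuclideanSpace ℝ (Fin m)) M] [IsManifold (𝓡 m) ∞ M]
  [ChartedSpace (EuclideanSpace ℝ (Fin (m + 1))) N] [IsManifold (𝓡 (m + 1)) ∞ N]
  {g : SmoothMetric m M} {h : SmoothMetric (m + 1) N}
  {ψ : OpenPartialHomeomorph N (EuclideanSpace ℝ (Fin (m + 1)))} {σ : N → ℝ} {φ : M → N}
  {V : Set M} {ξ : (x : M) → TangentSpace (𝓡 (m + 1)) (φ x)} {H : M → ℝ} {p : M}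

theorem IsIsometricImmersion.confMetric_fderiv (hφ : IsIsometricImmersion g h φ)
    (hc : IsConformallyFlatChart h ψ σ) {u : EuclideanSpace ℝ (Fin m)}
    (hu : u ∈ chartDomain p ψ φ) {f : EuclideanSpace ℝ (Fin m) → EuclideanSpace ℝ (Fin (m + 1))}
    (hf : f = mapInCharts (chartAt (EuclideanSpace ℝ (Fin m)) p) ψ φ)
    (a b : EuclideanSpace ℝ (Fin m)) :
    confMetric (inChart ψ σ) (f u) (fderiv ℝ f u a) (fderiv ℝ f u b) = chartMetric g p u a b := by
  set c := chartAt (EuclideanSpace ℝ (Fin m)) p with hcd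
  have hx := c.map_target hu.1
  have h1 := hφ.inner_mfderiv (c.symm u) (coordFrame p (c.symm u) a) (coordFrame p (c.symm u) b)
  have hd : ∀ a, mvfderiv (𝓡 m) c (c.symm u) (coordFrame p (c.symm u) a) = a := fun a => by
    rw [← coords_eq_mvfderiv hx, coords_coordFrame hx]
  have hmd : MDifferentiableAt (𝓡 m) (𝓡 (m + 1)) φ (c.symm u) :=
    (hφ.contMDiff _).mdifferentiableAt (by simp)
  rw [hc.inner_eq_confMetric hu.2, inner_eq_chartMetric g hx,
    mvfderiv_mfderiv (chart_mem_maximalAtlas p) hx hc.mem_maximalAtlas hu.2 hmd,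
    mvfderiv_mfderiv (chart_mem_maximalAtlas p) hx hc.mem_maximalAtlas hu.2 hmd] at h1
  simp only [← hcd, c.right_inv hu.1, hd] at h1
  rw [hf]
  exact h1

theorem sum_gramInv_smul (g : SmoothMetric m M) {u : EuclideanSpace ℝ (Fin m)}
    (hu : u ∈ (chartAt (EuclideanSpace ℝ (Fin m)) p).target) (b : EuclideanSpace ℝ (Fin m)) :
    ∑ k, ∑ l, (gramInv g p k l u * chartMetric g p u b (EuclideanSpace.single k 1))
      • EuclideanSpace.single l (1 : ℝ) = b :=
  eq_of_chartMetric_eq g hu fun i =>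
    chartMetric_raise g hu (chartMetric g p u b).toLinearMap (EuclideanSpace.single i 1)

/-- In charts, an isometric immersion of codimension one into a conformally flat space is a
hypersurface in coordinates. -/
theorem coordHypersurface (hm : 1 ≤ m) (hc : IsConformallyFlatChart h ψ σ)
    (hφ : IsIsometricImmersion g h φ) (hV : IsOpen V) (hξ : IsUnitNormalOn (m := m) h φ V ξ)
    (hH : ∀ x ∈ V, meanCurvatureVector g h φ x = H x • ξ x) (p : M) :
    CoordHypersurface (confGamma (inChart ψ σ)) (confMetric (inChart ψ σ))
      (mapInCharts (chartAt (EuclideanSpace ℝ (Fin m)) p) ψ φ)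
      (fieldInCharts (chartAt (EuclideanSpace ℝ (Fin m)) p) ψ φ ξ)
      (fun u => H ((chartAt (EuclideanSpace ℝ (Fin m)) p).symm u))
      (volDensity g p) (gramInv g p) (fun i : Fin m => EuclideanSpace.single i (1 : ℝ)) m
      (chartDomain p ψ φ ∩ (chartAt (EuclideanSpace ℝ (Fin m)) p).target
        ∩ (chartAt (EuclideanSpace ℝ (Fin m)) p).symm ⁻¹' V) := by
  set c := chartAt (EuclideanSpace ℝ (Fin m)) p with hcd
  set f := mapInCharts c ψ φ with hf
  set s := inChart ψ σ with hs
  set ν := fieldInCharts c ψ φ ξ with hν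
  set O := chartDomain p ψ φ ∩ c.target ∩ c.symm ⁻¹' V with hO
  have hOo : IsOpen O := by
    rw [hO, Set.inter_assoc]
    exact (isOpen_chartDomain p hφ.contMDiff.continuous).inter (c.isOpen_inter_preimage_symm hV)
  have hOm : ∀ u ∈ O, u ∈ chartDomain p ψ φ := fun u hu => hu.1.1
  have hm0 : (m : ℝ) ≠ 0 := by positivity
  have hfs : ∀ u ∈ O, ContDiffAt ℝ ∞ f u := fun u hu =>
    contDiffAt_mapInCharts_of_mem hc.mem_maximalAtlas hφ.contMDiff (hOm u hu)
  have hss : ∀ u ∈ O, ContDiffAt ℝ ∞ s (f u) := fun u hu => hc.contDiffAt_factor_of_mem (hOm u hu)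
  have hνs : ∀ u ∈ O, ContDiffAt ℝ ∞ ν u := by
    intro u hu
    have h1 := contDiffAt_fieldInCharts (chart_mem_maximalAtlas p) (c.map_target hu.1.2)
      hc.mem_maximalAtlas hu.1.1.2 (hξ.contMDiffOn.contMDiffAt (hV.mem_nhds hu.2))
    rwa [← hcd, c.right_inv hu.1.2] at h1
  have hunit : ∀ u ∈ O, confMetric s (f u) (ν u) (ν u) = 1 := by
    intro u hu
    have h1 := hξ.unit _ hu.2
    rwa [hc.inner_eq_confMetric hu.1.1.2] at h1
  have hnormal : ∀ u ∈ O, ∀ a, confMetric s (f u) (ν u) (fderiv ℝ f u a) = 0 := by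
    intro u hu a
    have hx := c.map_target hu.1.2
    have h1 := hξ.normal _ hu.2 (coordFrame p (c.symm u) a)
    rw [hc.inner_eq_confMetric hu.1.1.2, mvfderiv_mfderiv (chart_mem_maximalAtlas p) hx
      hc.mem_maximalAtlas hu.1.1.2 ((hφ.contMDiff _).mdifferentiableAt (by simp)),
      ← coords_eq_mvfderiv hx, coords_coordFrame hx, ← hcd, c.right_inv hu.1.2] at h1
    exact h1
  have hmetric : ∀ u ∈ O, ∀ a b, confMetric s (f u) (fderiv ℝ f u a) (fderiv ℝ f u b)
      = chartMetric g p u a b := fun u hu => hφ.confMetric_fderiv hc (hOm u hu) hf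
  have hten : ∀ u ∈ O, fieldInCharts c ψ φ (tension g h φ) u = (m * H (c.symm u)) • ν u := by
    intro u hu
    have h1 := hH _ hu.2
    have h2 : tension g h φ (c.symm u) = (m * H (c.symm u)) • ξ (c.symm u) := by
      rw [mul_smul, ← h1, meanCurvatureVector, tension, smul_smul, mul_one_div_cancel hm0, one_smul]
    rw [fieldInCharts, h2, map_smul]
    rfl
  refine
    { isOpen := hOo
      gamma_smooth := fun u hu => contDiffAt_confGamma (hss u hu)
      gamma_symm := confGamma_symm s
      metric_symm := confMetric_symm s
      metric_smooth := fun u hu => contDiffAt_confMetric (hss u hu)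
      compatible := fun u hu => confMetric_compatible ((hss u hu).differentiableAt (by simp))
      skew := fun u hu => confMetric_curvCoord_skew (hss u hu)
      map_smooth := hfs
      normal_smooth := hνs
      mean_smooth := ?_
      density_smooth := fun u hu => contDiffAt_volDensity g hu.1.2
      density_ne_zero := fun u hu => (volDensity_pos g hu.1.2).ne'
      inv_smooth := fun u hu => contDiffAt_gramInv g hu.1.2
      inv_symm := fun u i j => gramInv_symm g p i j u
      inv_mul := fun u hu i k => by
        simp only [hmetric u hu]
        exact gramInv_mul g hu.1.2 i k
      unit := hunit
      normal := fun u hu i => hnormal u hu _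
      complete := ?_
      tension := ?_ }
  · intro u hu
    -- Smoothness of H is not a hypothesis: it follows from H = m⁻¹⟨τ, ξ⟩.
    have h1 : (fun u => H (c.symm u)) =ᶠ[nhds u] fun u => (m : ℝ)⁻¹ * confMetric s (f u)
        (fieldInCharts c ψ φ (tension g h φ) u) (ν u) := by
      filter_upwards [hOo.mem_nhds hu] with z hz
      rw [hten z hz, map_smul, smul_apply, hunit z hz, smul_eq_mul, mul_one,
        inv_mul_cancel_left₀ hm0]
    refine ContDiffAt.congr_of_eventuallyEq ?_ h1
    exact contDiffAt_const.mul ((((contDiffAt_confMetric (hss u hu)).comp u (hfs u hu)).clm_apply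
      (hc.contDiffAt_tension g hφ.contMDiff (hOm u hu))).clm_apply (hνs u hu))
  · intro u hu a b
    -- Tangent and normal directions together map injectively into the ambient model space. Its
    -- dimension is m + 1, so they fill it and every vector splits.
    let L : (EuclideanSpace ℝ (Fin m) × ℝ) →ₗ[ℝ] EuclideanSpace ℝ (Fin (m + 1)) :=
      (fderiv ℝ f u).toLinearMap.coprod (LinearMap.toSpanSingleton ℝ _ (ν u))
    have hL : ∀ b t, L (b, t) = fderiv ℝ f u b + t • ν u := fun b t => rfl
    have hinj : Function.Injective L := by
      rw [injective_iff_map_eq_zero]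
      rintro ⟨b, t⟩ h0
      rw [hL] at h0
      have ht : t = 0 := by
        have h1 := congrArg (confMetric s (f u) (ν u)) h0
        rw [map_add, map_smul, hnormal u hu, hunit u hu] at h1
        simpa using h1
      have hb : b = 0 := by
        by_contra hne
        have h1 := chartMetric_pos g hu.1.2 hne
        rw [ht, zero_smul, add_zero] at h0
        rw [← hmetric u hu, h0, map_zero] at h1
        exact lt_irrefl _ h1
      rw [ht, hb]; rfl
    have hsurj : Function.Surjective L := by
      refine (LinearMap.injective_iff_surjective_of_finrank_eq_finrank ?_).1 hinj
      simp
    obtain ⟨⟨a', t⟩, rfl⟩ := hsurj a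
    have h1 := congrArg (fun z => confMetric s (f u) (fderiv ℝ f u z) b)
      (sum_gramInv_smul g hu.1.2 a')
    simp only [map_sum, map_smul, sum_apply, smul_apply, smul_eq_mul] at h1
    rw [hL]
    simp only [map_add, add_apply, map_smul, smul_apply, smul_eq_mul, hnormal u hu, hunit u hu,
      hmetric u hu, confMetric_symm s (f u) (fderiv ℝ f u a') (ν u), mul_zero, add_zero, mul_one,
      zero_add]
    rw [h1, add_comm]
  · intro u hu
    rw [← hc.volDensity_smul_fieldInCharts_tension g hφ.contMDiff (hOm u hu) hf, ← hcd, hten u hu,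
      smul_smul]

end Hypersurface

/-! ### Hessian and Laplacian on the hypersurface -/

section Laplacian

variable {m : ℕ} {M : Type*} [TopologicalSpace M]
  [ChartedSpace (EuclideanSpace ℝ (Fin m)) M] [IsManifold (𝓡 m) ∞ M] (g : SmoothMetric m M)
  {p x : M} {F : M → ℝ} {f : EuclideanSpace ℝ (Fin m) → ℝ} {u : EuclideanSpace ℝ (Fin m)}

theorem mvfderiv_coordFrame_eq (hx : x ∈ (chartAt (EuclideanSpace ℝ (Fin m)) p).source)
    (hu : u = chartAt (EuclideanSpace ℝ (Fin m)) p x)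
    (hf : (fun u => F ((chartAt (EuclideanSpace ℝ (Fin m)) p).symm u)) =ᶠ[nhds u] f)
    (hfd : DifferentiableAt ℝ f u) (a : EuclideanSpace ℝ (Fin m)) :
    mvfderiv (𝓡 m) F x (coordFrame p x a) = fderiv ℝ f u a := by
  rw [mvfderiv_eq_fderiv_chart (chart_mem_maximalAtlas p) hx
    (by rw [← hu]; exact hfd.congr_of_eventuallyEq hf), ← hu, hf.fderiv_eq,
    ← coords_eq_mvfderiv hx, coords_coordFrame hx]

theorem mvfderiv_grad (hx : x ∈ (chartAt (EuclideanSpace ℝ (Fin m)) p).source)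
    (hu : u = chartAt (EuclideanSpace ℝ (Fin m)) p x)
    (hf : (fun u => F ((chartAt (EuclideanSpace ℝ (Fin m)) p).symm u)) =ᶠ[nhds u] f)
    (hfd : DifferentiableAt ℝ f u) :
    mvfderiv (𝓡 m) (chartAt (EuclideanSpace ℝ (Fin m)) p) x (grad g F x)
      = raise g p u (fderiv ℝ f u) := by
  rw [grad, mvfderiv_sharp g hx, hu]
  congr 1
  funext a
  rw [← hu]
  exact mvfderiv_coordFrame_eq hx hu hf hfd a

theorem inner_grad_coordFrame (hx : x ∈ (chartAt (EuclideanSpace ℝ (Fin m)) p).source)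
    (hu : u = chartAt (EuclideanSpace ℝ (Fin m)) p x)
    (hf : (fun u => F ((chartAt (EuclideanSpace ℝ (Fin m)) p).symm u)) =ᶠ[nhds u] f)
    (hfd : DifferentiableAt ℝ f u) (a : EuclideanSpace ℝ (Fin m)) :
    g.inner x (grad g F x) (coordFrame p x a) = fderiv ℝ f u a := by
  rw [grad, inner_sharp]
  exact mvfderiv_coordFrame_eq hx hu hf hfd a

theorem contDiffAt_raise_fderiv (hu : u ∈ (chartAt (EuclideanSpace ℝ (Fin m)) p).target)
    (hf : ContDiffAt ℝ ∞ f u) : ContDiffAt ℝ ∞ (fun u => raise g p u (fderiv ℝ f u)) u :=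
  ContDiffAt.sum fun i _ => ContDiffAt.sum fun j _ =>
    ((contDiffAt_gramInv g hu i j).mul (contDiffAt_fderiv_apply hf _)).smul contDiffAt_const

/-- Differentiating g(X, b) = df(b) for the gradient X gives g(DX(a), b) up to a derivative of g.
Together with the Koszul expression for Γ(a, X), these derivatives combine into -df(Γ(a, b)). -/
theorem hess_eq_chart (hx : x ∈ (chartAt (EuclideanSpace ℝ (Fin m)) p).source)
    (hu : u = chartAt (EuclideanSpace ℝ (Fin m)) p x)
    (hf : (fun u => F ((chartAt (EuclideanSpace ℝ (Fin m)) p).symm u)) =ᶠ[nhds u] f)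
    (hfs : ContDiffAt ℝ ∞ f u) (v w : TangentSpace (𝓡 m) x) {a b : EuclideanSpace ℝ (Fin m)}
    (ha : a = mvfderiv (𝓡 m) (chartAt (EuclideanSpace ℝ (Fin m)) p) x v)
    (hb : b = mvfderiv (𝓡 m) (chartAt (EuclideanSpace ℝ (Fin m)) p) x w) :
    hess g F x v w = fderiv ℝ (fderiv ℝ f) u a b - fderiv ℝ f u (chartGamma g p u a b) := by
  set c := chartAt (EuclideanSpace ℝ (Fin m)) p with hcd
  have hcat : c ∈ IsManifold.maximalAtlas (𝓡 m) ∞ M := chart_mem_maximalAtlas p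
  have hut : u ∈ c.target := hu ▸ c.map_source hx
  set X := fun u => raise g p u (fderiv ℝ f u) with hX
  have hXd : DifferentiableAt ℝ X u := (contDiffAt_raise_fderiv g hut hfs).differentiableAt (by simp)
  have hfd2 : DifferentiableAt ℝ (fderiv ℝ f) u :=
    (hfs.fderiv_right (m := ∞) (by simp)).differentiableAt (by simp)
  have hGd : DifferentiableAt ℝ (chartMetric g p) u :=
    (contDiffAt_chartMetric g hut).differentiableAt (by simp)
  have hfev : ∀ᶠ z in nhds u, ContDiffAt ℝ 1 f z :=
    (hfs.of_le (by exact_mod_cast le_top : (1 : WithTop ℕ∞) ≤ ∞)).eventually (by simp)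
  have hgrad : (fun z => mvfderiv (𝓡 m) c (id (c.symm z)) (grad g F (c.symm z))) =ᶠ[nhds u] X := by
    filter_upwards [c.open_target.mem_nhds hut, hfev, eventually_eventually_nhds.2 hf]
      with z hz hz1 hz2
    exact mvfderiv_grad g (c.map_target hz) (c.right_inv hz).symm hz2
      (hz1.differentiableAt (by simp))
  have hid : (fun z => c (id (c.symm z))) =ᶠ[nhds u] id := by
    filter_upwards [c.open_target.mem_nhds hut] with z hz using c.right_inv hz
  have h1 := mvfderiv_covAlong g (φ := id) (V := grad g F) hcat hx hcat hx
    (G := chartMetric g p) (by rw [id, ← hu]; exact hGd) (chartMetric_symm g p _)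
    (by filter_upwards [c.open_source.mem_nhds hx] with y hy; exact inner_eq_chartMetric g hy)
    (chartMetric_chartGamma g (hu ▸ hut)) mdifferentiableAt_id
    (by rw [← hu]; exact hXd.congr_of_eventuallyEq hgrad) v
  rw [← hu, hgrad.fderiv_eq, hid.fderiv_eq, fderiv_id, ← ha] at h1
  have h2 : ∀ z ∈ c.target, ∀ b, chartMetric g p z (X z) b = fderiv ℝ f z b := fun z hz b =>
    chartMetric_raise g hz (fderiv ℝ f z).toLinearMap b
  have h3 : fderiv ℝ (fun z => chartMetric g p z (X z) b) u a = fderiv ℝ (fderiv ℝ f) u a b := by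
    have h4 : (fun z => chartMetric g p z (X z) b) =ᶠ[nhds u] fun z => fderiv ℝ f z b := by
      filter_upwards [c.open_target.mem_nhds hut] with z hz using h2 z hz b
    rw [h4.fderiv_eq, fderiv_clm_apply hfd2 (by fun_prop)]
    simp
  rw [fderiv_clm_apply (hGd.clm_apply hXd) (by fun_prop), fderiv_clm_apply hGd hXd] at h3
  simp at h3
  have hxg : mvfderiv (𝓡 m) c x (grad g F x) = X u :=
    mvfderiv_grad g hx hu hf (hfs.differentiableAt (by simp))
  rw [hess, inner_eq_chartMetric g hx, leviCivita, ← hcd, ← hu, ← hb]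
  erw [h1]
  erw [hxg]
  have hsym : ∀ r s t, fderiv ℝ (chartMetric g p) u r s t = fderiv ℝ (chartMetric g p) u r t s := by
    intro r s t
    have h5 : (fun z => chartMetric g p z s t) = fun z => chartMetric g p z t s := by
      funext z; exact chartMetric_symm g p z s t
    have h6 : fderiv ℝ (fun z => chartMetric g p z s t) u r
      = fderiv ℝ (fun z => chartMetric g p z t s) u r := by rw [h5]
    rw [fderiv_clm_apply (hGd.clm_apply (by fun_prop)) (by fun_prop), fderiv_clm_apply hGd
      (by fun_prop), fderiv_clm_apply (hGd.clm_apply (by fun_prop)) (by fun_prop),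
      fderiv_clm_apply hGd (by fun_prop)] at h6
    simpa using h6
  have h7 := h2 u hut (chartGamma g p u a b)
  rw [chartMetric_symm, chartMetric_chartGamma g hut] at h7
  rw [map_add, add_apply, ContinuousLinearMap.id_apply, show c (id x) = u from hu.symm,
    chartMetric_chartGamma g hut, ← h7]
  simp only [koszulCoord]
  linarith [hsym a (X u) b]

/-- The contracted Christoffel term of the traced Hessian is the divergence of w g^{ij}, giving the
Laplace-Beltrami form. -/
theorem volDensity_mul_laplacian (hx : x ∈ (chartAt (EuclideanSpace ℝ (Fin m)) p).source)
    (hu : u = chartAt (EuclideanSpace ℝ (Fin m)) p x)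
    (hf : (fun u => F ((chartAt (EuclideanSpace ℝ (Fin m)) p).symm u)) =ᶠ[nhds u] f)
    (hfs : ContDiffAt ℝ ∞ f u) :
    volDensity g p u * laplacian g F x
      = ∑ i, fderiv ℝ (fun z => ∑ j, volDensity g p z * gramInv g p i j z
          * fderiv ℝ f z (EuclideanSpace.single j 1)) u (EuclideanSpace.single i 1) := by
  have hut : u ∈ (chartAt (EuclideanSpace ℝ (Fin m)) p).target :=
    hu ▸ (chartAt (EuclideanSpace ℝ (Fin m)) p).map_source hx
  let β : EuclideanSpace ℝ (Fin m) →ₗ[ℝ] EuclideanSpace ℝ (Fin m) →ₗ[ℝ] ℝ :=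
    LinearMap.mk₂ ℝ (fun a b => fderiv ℝ (fderiv ℝ f) u a b - fderiv ℝ f u (chartGamma g p u a b))
      (fun a a' b => by simp only [map_add, add_apply, LinearMap.add_apply]; ring)
      (fun r a b => by simp only [map_smul, smul_apply, LinearMap.smul_apply, smul_sub])
      (fun a b b' => by simp only [map_add]; ring)
      (fun r a b => by simp only [map_smul, smul_sub])
  have h1 := metricTrace_eq g hx β (B := hess g F x) fun v w =>
    hess_eq_chart g hx hu hf hfs v w rfl rfl
  have hfd2 : DifferentiableAt ℝ (fderiv ℝ f) u :=
    (hfs.fderiv_right (m := ∞) (by simp)).differentiableAt (by simp)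
  have hP : ∀ i j, DifferentiableAt ℝ (fun u => volDensity g p u * gramInv g p i j u) u :=
    fun i j => ((contDiffAt_volDensity g hut).mul (contDiffAt_gramInv g hut i j)).differentiableAt
      (by simp)
  have hd : ∀ j, DifferentiableAt ℝ (fun u => fderiv ℝ f u (EuclideanSpace.single j (1 : ℝ))) u :=
    fun j => hfd2.clm_apply (by fun_prop)
  have h3 : ∀ i, fderiv ℝ (fun z => ∑ j, volDensity g p z * gramInv g p i j z
          * fderiv ℝ f z (EuclideanSpace.single j 1)) u (EuclideanSpace.single i 1)
      = ∑ j, (fderiv ℝ (fun u => volDensity g p u * gramInv g p i j u) u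
          (EuclideanSpace.single i 1) * fderiv ℝ f u (EuclideanSpace.single j 1)
        + volDensity g p u * (gramInv g p i j u * fderiv ℝ (fderiv ℝ f) u
          (EuclideanSpace.single i 1) (EuclideanSpace.single j 1))) := by
    intro i
    rw [fderiv_fun_sum fun j _ => (hP i j).fun_mul (hd j), sum_apply]
    refine Finset.sum_congr rfl fun j _ => ?_
    rw [fderiv_fun_mul (hP i j) (hd j), fderiv_clm_apply hfd2 (by fun_prop)]
    simp
    ring
  have h4 := congrArg (fderiv ℝ f u) (sum_fderiv_density_smul g hut)
  simp only [map_sum, map_smul, map_neg, smul_eq_mul] at h4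
  rw [laplacian, h1, ← hu]
  simp only [h3, Finset.sum_add_distrib, h4, β, LinearMap.mk₂_apply, smul_eq_mul, mul_sub,
    Finset.sum_sub_distrib, ← Finset.mul_sum]
  ring

end Laplacian

/-! ### The normal and tangential components of the bitension field -/

section Equations

variable {m : ℕ} {M N : Type*} [TopologicalSpace M] [TopologicalSpace N]
  [ChartedSpace (EuclideanSpace ℝ (Fin m)) M] [IsManifold (𝓡 m) ∞ M]
  [ChartedSpace (EuclideanSpace ℝ (Fin (m + 1))) N] [IsManifold (𝓡 (m + 1)) ∞ N]

/-- The normal component of the bitension field of a hypersurface, up to the factor `m`. -/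
def normalPart (g : SmoothMetric m M) (h : SmoothMetric (m + 1) N) (σ : N → ℝ) (φ : M → N)
    (ξ : (x : M) → TangentSpace (𝓡 (m + 1)) (φ x)) (H : M → ℝ) (x : M) : ℝ :=
  laplacian g H x - H x * shapeNormSq g h φ ξ x
    + H x * (laplacian h σ (φ x)
      + ((m : ℝ) - 1) * (hess h σ (φ x) (ξ x) (ξ x)
        - normalDeriv φ ξ σ x ^ 2
        + h.inner (φ x) (grad h σ (φ x)) (grad h σ (φ x))))

/-- The tangential component of the bitension field of a hypersurface, up to the factor `-m`. -/
def tangentialPart (g : SmoothMetric m M) (h : SmoothMetric (m + 1) N) (σ : N → ℝ) (φ : M → N)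
    (ξ : (x : M) → TangentSpace (𝓡 (m + 1)) (φ x)) (H : M → ℝ) (x : M) : TangentSpace (𝓡 m) x :=
  (2 : ℝ) • shapeOperator g h φ ξ x (grad g H x)
    + ((m : ℝ) / 2) • grad g (fun y => H y ^ 2) x
    - (2 * ((m : ℝ) - 1) * H x) •
      (grad g (normalDeriv φ ξ σ) x
        - normalDeriv φ ξ σ x • grad g (fun y => σ (φ y)) x
        + shapeOperator g h φ ξ x (grad g (fun y => σ (φ y)) x))

variable {g : SmoothMetric m M} {h : SmoothMetric (m + 1) N}
  {ψ : OpenPartialHomeomorph N (EuclideanSpace ℝ (Fin (m + 1)))} {σ : N → ℝ} {φ : M → N}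
  {V : Set M} {ξ : (x : M) → TangentSpace (𝓡 (m + 1)) (φ x)} {H : M → ℝ} {p x : M}
  {c : OpenPartialHomeomorph M (EuclideanSpace ℝ (Fin m))}
  {f ν : EuclideanSpace ℝ (Fin m) → EuclideanSpace ℝ (Fin (m + 1))}
  {η : EuclideanSpace ℝ (Fin m) → ℝ}
  {s : EuclideanSpace ℝ (Fin (m + 1)) → ℝ} {u : EuclideanSpace ℝ (Fin m)}
  {O : Set (EuclideanSpace ℝ (Fin m))}

theorem inner_shapeOperator (hc : IsConformallyFlatChart h ψ σ) (hφ : IsIsometricImmersion g h φ)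
    (hcp : c = chartAt (EuclideanSpace ℝ (Fin m)) p) (hf : f = mapInCharts c ψ φ)
    (hν : ν = fieldInCharts c ψ φ ξ) (hs : s = inChart ψ σ) (hx : x ∈ c.source)
    (hφx : φ x ∈ ψ.source) (hu : u = c x) (hνd : DifferentiableAt ℝ ν u)
    (v w : TangentSpace (𝓡 m) x) :
    g.inner x (shapeOperator g h φ ξ x v) w
      = -confMetric s (f u) (covCoord (confGamma s) f ν (mvfderiv (𝓡 m) c x v) u)
          (fderiv ℝ f u (mvfderiv (𝓡 m) c x w)) := by
  have hcat : c ∈ IsManifold.maximalAtlas (𝓡 m) ∞ M := hcp ▸ chart_mem_maximalAtlas p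
  have hmd : MDifferentiableAt (𝓡 m) (𝓡 (m + 1)) φ x :=
    (hφ.contMDiff _).mdifferentiableAt (by simp)
  have hfu : f u = ψ (φ x) := by rw [hf, hu, mapInCharts_apply hx]
  rw [shapeOperator, inner_sharp, neg_apply, ContinuousLinearMap.comp_apply,
    hc.inner_eq_confMetric hφx, hc.mvfderiv_covAlong hcat hx hφx hmd (by rw [← hu, ← hν]; exact hνd),
    mvfderiv_mfderiv hcat hx hc.mem_maximalAtlas hφx hmd, ← hu, ← hν, ← hf, ← hs, ← hfu]
  rw [hf]
  rfl

/-- ∇_v ξ has no normal part, so the expansion of ∇_v ξ in the adapted frame has the same components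
as -A v, raised with the induced metric. -/
theorem fderiv_shapeOperator (hc : IsConformallyFlatChart h ψ σ) (hφ : IsIsometricImmersion g h φ)
    (hcp : c = chartAt (EuclideanSpace ℝ (Fin m)) p) (hf : f = mapInCharts c ψ φ)
    (hν : ν = fieldInCharts c ψ φ ξ) (hs : s = inChart ψ σ) (hx : x ∈ c.source)
    (hφx : φ x ∈ ψ.source) (hu : u = c x)
    (S : CoordHypersurface (confGamma s) (confMetric s) f ν η (volDensity g p) (gramInv g p)
      (fun i : Fin m => EuclideanSpace.single i (1 : ℝ)) m O) (huO : u ∈ O)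
    (v : TangentSpace (𝓡 m) x) :
    fderiv ℝ f u (mvfderiv (𝓡 m) c x (shapeOperator g h φ ξ x v))
      = -covCoord (confGamma s) f ν (mvfderiv (𝓡 m) c x v) u := by
  have hνd : DifferentiableAt ℝ ν u := (S.normal_smooth u huO).differentiableAt (by simp)
  have hxp : x ∈ (chartAt (EuclideanSpace ℝ (Fin m)) p).source := hcp ▸ hx
  have hut : u ∈ (chartAt (EuclideanSpace ℝ (Fin m)) p).target := by
    rw [hu, hcp]; exact (chartAt (EuclideanSpace ℝ (Fin m)) p).map_source hxp
  have h1 : ∀ k, chartMetric g p u (mvfderiv (𝓡 m) c x (shapeOperator g h φ ξ x v))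
      (EuclideanSpace.single k 1) = -confMetric s (f u) (covCoord (confGamma s) f ν
        (mvfderiv (𝓡 m) c x v) u) (fderiv ℝ f u (EuclideanSpace.single k 1)) := by
    intro k
    have h2 := inner_shapeOperator hc hφ hcp hf hν hs hx hφx hu hνd v
      (coordFrame p x (EuclideanSpace.single k 1))
    have h3 : mvfderiv (𝓡 m) c x (coordFrame p x (EuclideanSpace.single k 1))
        = EuclideanSpace.single k 1 := by
      rw [hcp, ← coords_eq_mvfderiv hxp, coords_coordFrame hxp]
    rw [inner_eq_chartMetric g hxp, ← hcp, ← hu, h3] at h2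
    exact h2
  rw [S.expand huO (covCoord (confGamma s) f ν (mvfderiv (𝓡 m) c x v) u),
    S.metric_cov_normal_normal huO, ← sum_gramInv_smul g hut (mvfderiv (𝓡 m) c x
      (shapeOperator g h φ ξ x v))]
  simp only [map_neg, map_sum, map_smul, h1, zero_smul, zero_add, mul_neg, neg_smul,
    Finset.sum_neg_distrib]

/-- g(Av, Aw) is the inner product of ∇_v ξ and ∇_w ξ, because dφ(Aw) = -∇_w ξ. -/
theorem shapeNormSq_eq (hc : IsConformallyFlatChart h ψ σ) (hφ : IsIsometricImmersion g h φ)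
    (hcp : c = chartAt (EuclideanSpace ℝ (Fin m)) p) (hf : f = mapInCharts c ψ φ)
    (hν : ν = fieldInCharts c ψ φ ξ) (hs : s = inChart ψ σ) (hx : x ∈ c.source)
    (hφx : φ x ∈ ψ.source) (hu : u = c x)
    (S : CoordHypersurface (confGamma s) (confMetric s) f ν η (volDensity g p) (gramInv g p)
      (fun i : Fin m => EuclideanSpace.single i (1 : ℝ)) m O) (huO : u ∈ O) :
    shapeNormSq g h φ ξ x = ∑ i, ∑ j, gramInv g p i j u * confMetric s (f u)
      (covCoord (confGamma s) f ν (EuclideanSpace.single i 1) u)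
      (covCoord (confGamma s) f ν (EuclideanSpace.single j 1) u) := by
  have hνd : DifferentiableAt ℝ ν u := (S.normal_smooth u huO).differentiableAt (by simp)
  have hxp : x ∈ (chartAt (EuclideanSpace ℝ (Fin m)) p).source := hcp ▸ hx
  have hu' : u = chartAt (EuclideanSpace ℝ (Fin m)) p x := by rw [hu, hcp]
  let D : EuclideanSpace ℝ (Fin m) →ₗ[ℝ] EuclideanSpace ℝ (Fin (m + 1)) :=
    { toFun := fun a => covCoord (confGamma s) f ν a u
      map_add' := fun a b => by simp only [covCoord, map_add, add_apply]; abel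
      map_smul' := fun r a => by simp [covCoord] }
  let β : EuclideanSpace ℝ (Fin m) →ₗ[ℝ] EuclideanSpace ℝ (Fin m) →ₗ[ℝ] ℝ :=
    LinearMap.mk₂ ℝ (fun a b => confMetric s (f u) (D a) (D b))
      (fun a a' b => by simp only [map_add, add_apply])
      (fun r a b => by simp only [map_smul, smul_apply])
      (fun a b b' => by simp only [map_add])
      (fun r a b => by simp only [map_smul])
  rw [shapeNormSq, metricTrace_eq g hxp β, ← hu']
  · rfl
  · intro v w
    rw [inner_shapeOperator hc hφ hcp hf hν hs hx hφx hu hνd,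
      fderiv_shapeOperator hc hφ hcp hf hν hs hx hφx hu S huO, map_neg, neg_neg, ← hcp]
    rfl

theorem fieldInCharts_tension (hm : 1 ≤ m) {x : M}
    (hH : meanCurvatureVector g h φ x = H x • ξ x) (hx : x ∈ c.source) :
    fieldInCharts c ψ φ (tension g h φ) (c x) = (m * H x) • fieldInCharts c ψ φ ξ (c x) := by
  have hm0 : (m : ℝ) ≠ 0 := by positivity
  have h2 : tension g h φ x = (m * H x) • ξ x := by
    rw [mul_smul, ← hH, meanCurvatureVector, tension, smul_smul, mul_one_div_cancel hm0, one_smul]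
  rw [fieldInCharts_apply _ hx, fieldInCharts_apply _ hx, h2, map_smul]

/-- The Euler-Lagrange form in the normal direction. -/
theorem bitensionForm_normalPart (hm : 1 ≤ m) (hc : IsConformallyFlatChart h ψ σ)
    (hφ : IsIsometricImmersion g h φ) (hV : IsOpen V) (hξ : IsUnitNormalOn (m := m) h φ V ξ)
    (hH : ∀ x ∈ V, meanCurvatureVector g h φ x = H x • ξ x)
    (hcp : c = chartAt (EuclideanSpace ℝ (Fin m)) p) (hx : x ∈ c.source)
    (hφx : φ x ∈ ψ.source) (hxV : x ∈ V) :
    bitensionForm (confGamma (inChart ψ σ)) (confMetric (inChart ψ σ)) (mapInCharts c ψ φ)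
        (fieldInCharts c ψ φ (tension g h φ)) (fun i j z => volDensity g p z * gramInv g p i j z)
        (fun i : Fin m => EuclideanSpace.single i (1 : ℝ)) (c x) (fieldInCharts c ψ φ ξ (c x))
      = m * volDensity g p (c x) * normalPart g h σ φ ξ H x := by
  have S := coordHypersurface hm hc hφ hV hξ hH p
  have hxp : x ∈ (chartAt (EuclideanSpace ℝ (Fin m)) p).source := hcp ▸ hx
  rw [← hcp] at S
  set O := chartDomain p ψ φ ∩ c.target ∩ c.symm ⁻¹' V with hO
  set s := inChart ψ σ with hs
  set f := mapInCharts c ψ φ with hf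
  set ν := fieldInCharts c ψ φ ξ with hν
  obtain ⟨u, hu⟩ : ∃ u, u = c x := ⟨_, rfl⟩
  have huO : u ∈ O := by
    have h1 : c.symm u = x := by rw [hu, c.left_inv hx]
    have h2 : u ∈ c.target := hu ▸ c.map_source hx
    refine ⟨⟨⟨hcp ▸ h2, ?_⟩, h2⟩, ?_⟩
    · rw [← hcp, h1]; exact hφx
    · rw [Set.mem_preimage, h1]; exact hxV
  have hT : ∀ z ∈ O, fieldInCharts c ψ φ (tension g h φ) z = (m * H (c.symm z)) • ν z := by
    intro z hz
    have h1 := fieldInCharts_tension (c := c) (ψ := ψ) hm (hH _ hz.2) (c.map_target hz.1.2)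
    rwa [c.right_inv hz.1.2] at h1
  have hfu : f u = ψ (φ x) := by rw [hf, hu, mapInCharts_apply hx]
  have hνu : ν u = mvfderiv (𝓡 (m + 1)) ψ (φ x) (ξ x) := by rw [hν, hu, fieldInCharts_apply _ hx]
  have hss : ContDiffAt ℝ ∞ s (f u) := by rw [hfu]; exact hc.contDiffAt_factor hφx
  have hHu : H x = H (c.symm u) := by rw [hu, c.left_inv hx]
  have hlap := volDensity_mul_laplacian g (p := p) (F := H) (f := fun u => H (c.symm u)) hxp
    (by rw [hu, hcp]) (by rw [hcp]) (S.mean_smooth u huO)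
  have hnn : inner ℝ (ν u) (ν u) = Real.exp (2 * s (f u)) := by
    have h1 := S.unit u huO
    rw [confMetric_apply] at h1
    rw [show 2 * s (f u) = -(-2 * s (f u)) by ring, Real.exp_neg]
    exact eq_inv_of_mul_eq_one_right h1
  let ε := EuclideanSpace.basisFun (Fin (m + 1)) ℝ
  have hsum : ∑ i, fderiv ℝ s (f u) (ε i) * fderiv ℝ s (f u) (ε i)
      = fderiv ℝ s (f u) (gradient s (f u)) := by
    have := ε.sum_inner_mul_inner (gradient s (f u)) (gradient s (f u))
    simp only [inner_gradient_left, inner_gradient_right] at this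
    exact this
  -- ds⊗ds contributes |∇s|² to the trace, and the metric term subtracts half the ambient dimension
  -- m + 1 times it.
  have htr : ∑ k, confSchouten s (f u) (ε k) (ε k)
      = ∑ k, fderiv ℝ (fderiv ℝ s) (f u) (ε k) (ε k)
        + (1 - ((m : ℝ) + 1) / 2) * fderiv ℝ s (f u) (gradient s (f u)) := by
    simp only [confSchouten, Finset.sum_add_distrib, Finset.sum_sub_distrib, hsum,
      ← Finset.mul_sum, real_inner_self_eq_norm_sq, ε.norm_eq_one]
    simp only [← real_inner_self_eq_norm_sq, inner_gradient_left]
    simp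
    ring
  rw [← hu, S.bitensionForm_normal huO hss ε hT, normalPart,
    shapeNormSq_eq hc hφ hcp hf hν hs hx hφx hu S huO, hc.laplacian_eq hφx hs hfu ε,
    hc.hess_eq hφx (ξ x) (ξ x) hs hfu hνu hνu, hc.inner_grad hφx, ← hs, ← hfu, normalDeriv,
    hc.mvfderiv_factor hφx, ← hνu, ← hs, ← hfu, ← hlap, htr, hHu, hnn, confSchouten, hnn,
    inner_gradient_left, Fintype.card_fin]
  push_cast
  ring

/-- The Euler-Lagrange form in tangential directions. -/
theorem bitensionForm_tangentialPart (hm : 1 ≤ m) (hc : IsConformallyFlatChart h ψ σ)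
    (hφ : IsIsometricImmersion g h φ) (hV : IsOpen V) (hξ : IsUnitNormalOn (m := m) h φ V ξ)
    (hH : ∀ x ∈ V, meanCurvatureVector g h φ x = H x • ξ x)
    (hcp : c = chartAt (EuclideanSpace ℝ (Fin m)) p) (hx : x ∈ c.source)
    (hφx : φ x ∈ ψ.source) (hxV : x ∈ V) (k : Fin m) :
    bitensionForm (confGamma (inChart ψ σ)) (confMetric (inChart ψ σ)) (mapInCharts c ψ φ)
        (fieldInCharts c ψ φ (tension g h φ)) (fun i j z => volDensity g p z * gramInv g p i j z)
        (fun i : Fin m => EuclideanSpace.single i (1 : ℝ)) (c x)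
        (fderiv ℝ (mapInCharts c ψ φ) (c x) (EuclideanSpace.single k 1))
      = -(m * volDensity g p (c x) * g.inner x (tangentialPart g h σ φ ξ H x)
          (coordFrame p x (EuclideanSpace.single k 1))) := by
  have S := coordHypersurface hm hc hφ hV hξ hH p
  have hxp : x ∈ (chartAt (EuclideanSpace ℝ (Fin m)) p).source := hcp ▸ hx
  rw [← hcp] at S
  set O := chartDomain p ψ φ ∩ c.target ∩ c.symm ⁻¹' V with hO
  set s := inChart ψ σ with hs
  set f := mapInCharts c ψ φ with hf
  set ν := fieldInCharts c ψ φ ξ with hν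
  obtain ⟨u, hu⟩ : ∃ u, u = c x := ⟨_, rfl⟩
  have hu' : u = chartAt (EuclideanSpace ℝ (Fin m)) p x := by rw [hu, hcp]
  have hcu : c.symm u = x := by rw [hu, c.left_inv hx]
  have huO : u ∈ O := by
    have h2 : u ∈ c.target := hu ▸ c.map_source hx
    refine ⟨⟨⟨hcp ▸ h2, ?_⟩, h2⟩, ?_⟩
    · rw [← hcp, hcu]; exact hφx
    · rw [Set.mem_preimage, hcu]; exact hxV
  have hT : ∀ z ∈ O, fieldInCharts c ψ φ (tension g h φ) z = (m * H (c.symm z)) • ν z := by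
    intro z hz
    have h1 := fieldInCharts_tension (c := c) (ψ := ψ) hm (hH _ hz.2) (c.map_target hz.1.2)
    rwa [c.right_inv hz.1.2] at h1
  have hfu : f u = ψ (φ x) := by rw [hf, hu, mapInCharts_apply hx]
  have hνu : ν u = mvfderiv (𝓡 (m + 1)) ψ (φ x) (ξ x) := by rw [hν, hu, fieldInCharts_apply _ hx]
  have hss : ContDiffAt ℝ ∞ s (f u) := by rw [hfu]; exact hc.contDiffAt_factor hφx
  have hfd : DifferentiableAt ℝ f u := (S.map_smooth u huO).differentiableAt (by simp)
  have hνd : DifferentiableAt ℝ ν u := (S.normal_smooth u huO).differentiableAt (by simp)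
  have hHd : DifferentiableAt ℝ (fun u => H (c.symm u)) u :=
    (S.mean_smooth u huO).differentiableAt (by simp)
  have hsd2 : DifferentiableAt ℝ (fderiv ℝ s) (f u) :=
    (hss.fderiv_right (m := ∞) (by simp)).differentiableAt (by simp)
  have hdsν : DifferentiableAt ℝ (fun z => fderiv ℝ s (f z) (ν z)) u :=
    (hsd2.comp u hfd).clm_apply hνd
  have hsf : DifferentiableAt ℝ (fun z => s (f z)) u := (hss.differentiableAt (by simp)).comp u hfd
  -- the coordinate expressions of the functions whose gradients occur
  have e1 : (fun u => H ((chartAt (EuclideanSpace ℝ (Fin m)) p).symm u))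
      =ᶠ[nhds u] fun u => H (c.symm u) := by rw [hcp]
  have e2 : (fun u => H ((chartAt (EuclideanSpace ℝ (Fin m)) p).symm u) ^ 2)
      =ᶠ[nhds u] fun u => H (c.symm u) ^ 2 := by rw [hcp]
  have e3 : (fun u => normalDeriv φ ξ σ ((chartAt (EuclideanSpace ℝ (Fin m)) p).symm u))
      =ᶠ[nhds u] fun z => fderiv ℝ s (f z) (ν z) := by
    filter_upwards [S.isOpen.mem_nhds huO] with z hz
    rw [← hcp, normalDeriv, hc.mvfderiv_factor (hcp ▸ hz.1.1.2)]
    rfl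
  have e4 : (fun u => σ (φ ((chartAt (EuclideanSpace ℝ (Fin m)) p).symm u)))
      =ᶠ[nhds u] fun z => s (f z) := by
    filter_upwards [S.isOpen.mem_nhds huO] with z hz
    rw [← hcp]
    exact (inChart_apply (σ := σ) (hcp ▸ hz.1.1.2)).symm
  have hframe : mvfderiv (𝓡 m) c x (coordFrame p x (EuclideanSpace.single k 1))
      = EuclideanSpace.single k 1 := by
    rw [hcp, ← coords_eq_mvfderiv hxp, coords_coordFrame hxp]
  have hD : ∀ l : EuclideanSpace ℝ (Fin m) →L[ℝ] ℝ,
      confMetric s (f u) (covCoord (confGamma s) f ν (raise g p u l) u)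
        (fderiv ℝ f u (EuclideanSpace.single k 1))
      = ∑ i, ∑ j, gramInv g p i j u * l (EuclideanSpace.single i 1) * confMetric s (f u)
        (covCoord (confGamma s) f ν (EuclideanSpace.single j 1) u)
        (fderiv ℝ f u (EuclideanSpace.single k 1)) := by
    intro l
    simp only [covCoord, raise, map_sum, map_smul, map_add, sum_apply, smul_apply, add_apply,
      mul_add, Finset.sum_add_distrib, smul_eq_mul]
  have hds : fderiv ℝ (fun z => s (f z)) u = (fderiv ℝ s (f u)).comp (fderiv ℝ f u) :=
    fderiv_comp (g := s) u (hss.differentiableAt (by simp)) hfd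
  have hH2 : fderiv ℝ (fun z => H (c.symm z) ^ 2) u (EuclideanSpace.single k 1)
      = 2 * H (c.symm u) * fderiv ℝ (fun z => H (c.symm z)) u (EuclideanSpace.single k 1) := by
    rw [fderiv_fun_pow 2 hHd]
    simp
  have hg1 : mvfderiv (𝓡 m) c x (grad g H x) = raise g p u (fderiv ℝ (fun u => H (c.symm u)) u) := by
    rw [hcp]; exact mvfderiv_grad g hxp hu' Filter.EventuallyEq.rfl (by rw [← hcp]; exact hHd)
  have hg2 : mvfderiv (𝓡 m) c x (grad g (fun y => σ (φ y)) x)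
      = raise g p u (fderiv ℝ (fun z => s (f z)) u) := by
    rw [hcp]; exact mvfderiv_grad g (F := fun y => σ (φ y)) hxp hu' e4 hsf
  have hnd : normalDeriv φ ξ σ x = fderiv ℝ s (f u) (ν u) := by
    rw [normalDeriv, hc.mvfderiv_factor hφx, ← hνu, ← hs, ← hfu]
  rw [← hu, S.bitensionForm_partial huO hss (EuclideanSpace.basisFun (Fin (m + 1)) ℝ) hT,
    S.confSchouten_partial_normal huO hss, tangentialPart]
  simp only [map_add, map_sub, map_smul, add_apply, sub_apply, smul_apply, smul_eq_mul,
    inner_grad_coordFrame g (F := fun y => H y ^ 2) hxp hu' e2 (hHd.fun_pow 2),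
    inner_grad_coordFrame g hxp hu' e3 hdsν,
    inner_grad_coordFrame g (F := fun y => σ (φ y)) hxp hu' e4 hsf,
    inner_shapeOperator hc hφ hcp hf hν hs hx hφx hu hνd, hframe, hg1, hg2, hD, hH2, hnd]
  rw [hcu, hds, Fintype.card_fin]
  simp only [ContinuousLinearMap.comp_apply]
  push_cast
  ring

/-- The Euler-Lagrange form vanishes if and only if both components of the bitension field do. -/
theorem bitensionForm_eq_zero_iff (hm : 1 ≤ m) (hc : IsConformallyFlatChart h ψ σ)
    (hφ : IsIsometricImmersion g h φ) (hV : IsOpen V) (hξ : IsUnitNormalOn (m := m) h φ V ξ)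
    (hH : ∀ x ∈ V, meanCurvatureVector g h φ x = H x • ξ x)
    (hcp : c = chartAt (EuclideanSpace ℝ (Fin m)) p) (hx : x ∈ c.source)
    (hφx : φ x ∈ ψ.source) (hxV : x ∈ V) :
    (∀ v, bitensionForm (confGamma (inChart ψ σ)) (confMetric (inChart ψ σ)) (mapInCharts c ψ φ)
        (fieldInCharts c ψ φ (tension g h φ)) (fun i j z => volDensity g p z * gramInv g p i j z)
        (fun i : Fin m => EuclideanSpace.single i (1 : ℝ)) (c x) v = 0)
      ↔ normalPart g h σ φ ξ H x = 0 ∧ tangentialPart g h σ φ ξ H x = 0 := by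
  have hxp : x ∈ (chartAt (EuclideanSpace ℝ (Fin m)) p).source := hcp ▸ hx
  have hut : c x ∈ (chartAt (EuclideanSpace ℝ (Fin m)) p).target := by
    rw [hcp]; exact (chartAt (EuclideanSpace ℝ (Fin m)) p).map_source hxp
  have hm0 : (m : ℝ) ≠ 0 := by positivity
  have hmw : (m : ℝ) * volDensity g p (c x) ≠ 0 := mul_ne_zero hm0 (volDensity_pos g hut).ne'
  have h1 := bitensionForm_normalPart hm hc hφ hV hξ hH hcp hx hφx hxV
  have h2 := bitensionForm_tangentialPart hm hc hφ hV hξ hH hcp hx hφx hxV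
  constructor
  · intro h0
    rw [h0] at h1
    refine ⟨(mul_eq_zero.1 h1.symm).resolve_left hmw, ?_⟩
    refine eq_of_inner_eq g fun z => ?_
    rw [map_zero, zero_apply, ← coordFrame_coords hxp z, ← euclidean_sum_single (coords p x z)]
    simp only [map_sum, map_smul, smul_eq_mul]
    refine Finset.sum_eq_zero fun k _ => ?_
    have h3 := h2 k
    rw [h0, eq_comm, neg_eq_zero] at h3
    rw [(mul_eq_zero.1 h3).resolve_left hmw, mul_zero]
  · rintro ⟨h3, h4⟩ v
    have S := coordHypersurface hm hc hφ hV hξ hH p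
    rw [← hcp] at S
    have huO : c x ∈ chartDomain p ψ φ ∩ c.target ∩ c.symm ⁻¹' V := by
      refine ⟨⟨⟨hut, ?_⟩, c.map_source hx⟩, ?_⟩
      · rw [← hcp, c.left_inv hx]; exact hφx
      · rw [Set.mem_preimage, c.left_inv hx]; exact hxV
    rw [h3, mul_zero] at h1
    simp only [h4, map_zero, zero_apply, mul_zero, neg_zero] at h2
    -- By linearity in v it suffices to test ξ and the coordinate vectors.
    rw [S.expand huO v, bitensionForm_add, bitensionForm_smul, h1, bitensionForm_sum]
    simp only [bitensionForm_sum, bitensionForm_smul, h2, mul_zero, Finset.sum_const_zero, add_zero]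

end Equations

/-! ### The Riemannian volume measure -/

section Volume

variable {m : ℕ} {M : Type*} [TopologicalSpace M]
  [ChartedSpace (EuclideanSpace ℝ (Fin m)) M] [IsManifold (𝓡 m) ∞ M] (g : SmoothMetric m M)

theorem continuousOn_volDensity (p : M) :
    ContinuousOn (volDensity g p) (chartAt (EuclideanSpace ℝ (Fin m)) p).target := fun _ hu =>
  (contDiffAt_volDensity g hu).continuousAt.continuousWithinAt

theorem chartMetric_transition {p q x : M} (hp : x ∈ (chartAt (EuclideanSpace ℝ (Fin m)) p).source)
    (hq : x ∈ (chartAt (EuclideanSpace ℝ (Fin m)) q).source) {u v : EuclideanSpace ℝ (Fin m)}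
    (hu : u = chartAt (EuclideanSpace ℝ (Fin m)) p x)
    (hv : v = chartAt (EuclideanSpace ℝ (Fin m)) q x)
    {T : EuclideanSpace ℝ (Fin m) → EuclideanSpace ℝ (Fin m)}
    (hT : T = fun u => chartAt (EuclideanSpace ℝ (Fin m)) q
      ((chartAt (EuclideanSpace ℝ (Fin m)) p).symm u)) (a b : EuclideanSpace ℝ (Fin m)) :
    chartMetric g p u a b = chartMetric g q v (fderiv ℝ T u a) (fderiv ℝ T u b) := by
  have h1 := inner_eq_chartMetric g hp (coordFrame p x a) (coordFrame p x b)
  rw [inner_eq_chartMetric g hq, mvfderiv_coordFrame (chart_mem_maximalAtlas q) hp hq,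
    mvfderiv_coordFrame (chart_mem_maximalAtlas q) hp hq, ← coords_eq_mvfderiv hp,
    coords_coordFrame hp, coords_coordFrame hp, ← hu, ← hv, ← hT] at h1
  exact h1.symm

/-- The Gram matrices are related by G_p = Jᵀ G_q J with the Jacobian J of the transition map; take
the square root of determinants. -/
theorem volDensity_transition {p q x : M} (hp : x ∈ (chartAt (EuclideanSpace ℝ (Fin m)) p).source)
    (hq : x ∈ (chartAt (EuclideanSpace ℝ (Fin m)) q).source) {u v : EuclideanSpace ℝ (Fin m)}
    (hu : u = chartAt (EuclideanSpace ℝ (Fin m)) p x)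
    (hv : v = chartAt (EuclideanSpace ℝ (Fin m)) q x)
    {T : EuclideanSpace ℝ (Fin m) → EuclideanSpace ℝ (Fin m)}
    (hT : T = fun u => chartAt (EuclideanSpace ℝ (Fin m)) q
      ((chartAt (EuclideanSpace ℝ (Fin m)) p).symm u)) :
    volDensity g p u = |(fderiv ℝ T u).det| * volDensity g q v := by
  set b := (EuclideanSpace.basisFun (Fin m) ℝ).toBasis with hb
  set J := LinearMap.toMatrix b b (fderiv ℝ T u).toLinearMap with hJ
  have hJa : ∀ k i, J k i = fderiv ℝ T u (EuclideanSpace.single i 1) k := by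
    intro k i
    rw [hJ, LinearMap.toMatrix_apply]
    simp [hb]
  have hdet : (fderiv ℝ T u).det = J.det := by
    rw [hJ, LinearMap.det_toMatrix]
  have hG : gram g p u = J.transpose * gram g q v * J := by
    ext i j
    simp only [gram, Matrix.of_apply, Matrix.mul_apply, Matrix.transpose_apply]
    rw [chartMetric_transition g hp hq hu hv hT,
      ← euclidean_sum_single (fderiv ℝ T u (EuclideanSpace.single i 1)),
      ← euclidean_sum_single (fderiv ℝ T u (EuclideanSpace.single j 1))]
    simp only [map_sum, map_smul, sum_apply, smul_apply, smul_eq_mul, ← hJa, Finset.mul_sum,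
      Finset.sum_mul]
    refine Finset.sum_congr rfl fun k _ => Finset.sum_congr rfl fun l _ => by ring
  rw [volDensity, hG, Matrix.det_mul, Matrix.det_mul, Matrix.det_transpose, volDensity, hdet,
    show J.det * (gram g q v).det * J.det = J.det ^ 2 * (gram g q v).det by ring,
    Real.sqrt_mul (sq_nonneg _), Real.sqrt_sq_eq_abs]

variable [MeasurableSpace M] [BorelSpace M]

theorem chartVolume_eq (p : M) : chartVolume g p
    = ((volume.restrict (chartAt (EuclideanSpace ℝ (Fin m)) p).target).withDensity
      (fun u => ENNReal.ofReal (volDensity g p u))).map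
        (chartAt (EuclideanSpace ℝ (Fin m)) p).symm :=
  rfl

theorem aemeasurable_chart_symm (p : M) : AEMeasurable (chartAt (EuclideanSpace ℝ (Fin m)) p).symm
    ((volume.restrict (chartAt (EuclideanSpace ℝ (Fin m)) p).target).withDensity
      (fun u => ENNReal.ofReal (volDensity g p u))) :=
  ((chartAt (EuclideanSpace ℝ (Fin m)) p).continuousOn_symm.aemeasurable
    (chartAt (EuclideanSpace ℝ (Fin m)) p).open_target.measurableSet).mono_ac
      (withDensity_absolutelyContinuous _ _)

theorem measurableSet_chart_preimage (p : M) {A : Set M} (hA : MeasurableSet A) :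
    MeasurableSet ((chartAt (EuclideanSpace ℝ (Fin m)) p).symm ⁻¹' A
      ∩ (chartAt (EuclideanSpace ℝ (Fin m)) p).target) := by
  have h1 : Measurable ((chartAt (EuclideanSpace ℝ (Fin m)) p).target.domRestrict
      (chartAt (EuclideanSpace ℝ (Fin m)) p).symm) :=
    (continuousOn_iff_continuous_domRestrict.1
      (chartAt (EuclideanSpace ℝ (Fin m)) p).continuousOn_symm).measurable
  have h2 := MeasurableSet.subtype_image
    (chartAt (EuclideanSpace ℝ (Fin m)) p).open_target.measurableSet (h1 hA)
  convert h2 using 1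
  ext u
  simp [Set.domRestrict, and_comm]

theorem chartVolume_apply (p : M) {A : Set M} (hA : MeasurableSet A) :
    chartVolume g p A = ∫⁻ u in (chartAt (EuclideanSpace ℝ (Fin m)) p).symm ⁻¹' A
      ∩ (chartAt (EuclideanSpace ℝ (Fin m)) p).target, ENNReal.ofReal (volDensity g p u) := by
  rw [chartVolume_eq, Measure.map_apply_of_aemeasurable (aemeasurable_chart_symm g p) hA,
    withDensity_apply', Measure.restrict_restrict'
      (chartAt (EuclideanSpace ℝ (Fin m)) p).open_target.measurableSet]

theorem chartVolume_compl (p : M) :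
    chartVolume g p (chartAt (EuclideanSpace ℝ (Fin m)) p).sourceᶜ = 0 := by
  rw [chartVolume_apply g p (chartAt (EuclideanSpace ℝ (Fin m)) p).open_source.measurableSet.compl]
  have h1 : (chartAt (EuclideanSpace ℝ (Fin m)) p).symm ⁻¹'
      (chartAt (EuclideanSpace ℝ (Fin m)) p).sourceᶜ
      ∩ (chartAt (EuclideanSpace ℝ (Fin m)) p).target = ∅ := by
    ext u
    simp only [Set.mem_inter_iff, Set.mem_preimage, Set.mem_compl_iff, Set.mem_empty_iff_false,
      iff_false, not_and]
    exact fun h1 h2 => h1 ((chartAt (EuclideanSpace ℝ (Fin m)) p).map_target h2)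
  rw [h1]; simp

/-- Change of variables along the transition map, whose Jacobian is absorbed by
`volDensity_transition`. -/
theorem chartVolume_congr (p q : M) {A : Set M} (hA : MeasurableSet A)
    (hp : A ⊆ (chartAt (EuclideanSpace ℝ (Fin m)) p).source)
    (hq : A ⊆ (chartAt (EuclideanSpace ℝ (Fin m)) q).source) :
    chartVolume g p A = chartVolume g q A := by
  set c := chartAt (EuclideanSpace ℝ (Fin m)) p with hc
  set d := chartAt (EuclideanSpace ℝ (Fin m)) q with hd
  set T : EuclideanSpace ℝ (Fin m) → EuclideanSpace ℝ (Fin m) := fun u => d (c.symm u) with hT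
  have himg : T '' (c.symm ⁻¹' A ∩ c.target) = d.symm ⁻¹' A ∩ d.target := by
    ext v
    constructor
    · rintro ⟨u, ⟨hu1, hu2⟩, rfl⟩
      refine ⟨?_, d.map_source (hq hu1)⟩
      simp only [Set.mem_preimage, hT]
      rw [d.left_inv (hq hu1)]
      exact hu1
    · rintro ⟨hv1, hv2⟩
      refine ⟨c (d.symm v), ⟨?_, c.map_source (hp hv1)⟩, ?_⟩
      · simp only [Set.mem_preimage]
        rw [c.left_inv (hp hv1)]
        exact hv1
      · simp only [hT]
        rw [c.left_inv (hp hv1), d.right_inv hv2]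
  have hinj : Set.InjOn T (c.symm ⁻¹' A ∩ c.target) := by
    intro u hu v hv huv
    have h1 : c.symm u = c.symm v := d.injOn (hq hu.1) (hq hv.1) huv
    exact c.symm.injOn hu.2 hv.2 h1
  have hderiv : ∀ u ∈ c.symm ⁻¹' A ∩ c.target,
      HasFDerivWithinAt T (fderiv ℝ T u) (c.symm ⁻¹' A ∩ c.target) u := by
    intro u hu
    have hcat : c ∈ IsManifold.maximalAtlas (𝓡 m) ∞ M := chart_mem_maximalAtlas p
    have hdat : d ∈ IsManifold.maximalAtlas (𝓡 m) ∞ M := chart_mem_maximalAtlas q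
    have h1 := contDiffAt_transition hcat hdat (c.map_target hu.2) (hq hu.1)
    rw [c.right_inv hu.2] at h1
    exact (h1.differentiableAt (by simp)).hasFDerivAt.hasFDerivWithinAt
  have hmeas := measurableSet_chart_preimage (m := m) p hA
  rw [← hc] at hmeas
  rw [chartVolume_apply g p hA, chartVolume_apply g q hA, ← hc, ← hd, ← himg,
    lintegral_image_eq_lintegral_abs_det_fderiv_mul volume hmeas hderiv hinj]
  refine setLIntegral_congr_fun hmeas fun u hu => ?_
  rw [← ENNReal.ofReal_mul (abs_nonneg _), volDensity_transition g (hp hu.1) (hq hu.1)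
    (c.right_inv hu.2).symm rfl hT]

theorem restrict_riemannianVolume (p : M) :
    (riemannianVolume g).restrict (chartAt (EuclideanSpace ℝ (Fin m)) p).source
      = chartVolume g p := by
  set S := (chartAt (EuclideanSpace ℝ (Fin m)) p).source with hS
  have hSm : MeasurableSet S := (chartAt (EuclideanSpace ℝ (Fin m)) p).open_source.measurableSet
  have hself : (chartVolume g p).restrict S = chartVolume g p := by
    exact Measure.restrict_eq_self_of_ae_mem (mem_ae_iff.2 (chartVolume_compl g p))
  refine le_antisymm ?_ ?_
  · have h1 : riemannianVolume g ≤ chartVolume g p + (⊤ : Measure M).restrict Sᶜ := by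
      refine iSup_le fun q => Measure.le_iff.2 fun A hA => ?_
      rw [← measure_inter_add_sdiff A hSm, Measure.add_apply, Measure.restrict_apply hA]
      refine add_le_add ?_ ((le_top : chartVolume g q ≤ ⊤) _)
      have h2 : chartVolume g q (A ∩ S) = chartVolume g q (A ∩ S
          ∩ (chartAt (EuclideanSpace ℝ (Fin m)) q).source) := by
        rw [← measure_inter_add_sdiff (A ∩ S)
          (chartAt (EuclideanSpace ℝ (Fin m)) q).open_source.measurableSet,
          measure_mono_null (s := (A ∩ S) \ (chartAt (EuclideanSpace ℝ (Fin m)) q).source)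
            (fun x hx => hx.2) (chartVolume_compl g q), add_zero]
      rw [h2, chartVolume_congr g q p ((hA.inter hSm).inter
        (chartAt (EuclideanSpace ℝ (Fin m)) q).open_source.measurableSet)
        Set.inter_subset_right fun x hx => hx.1.2]
      exact measure_mono fun x hx => hx.1.1
    have h2 := Measure.restrict_mono (le_refl S) h1
    rw [Measure.restrict_add, Measure.restrict_restrict hSm, Set.inter_compl_self,
      Measure.restrict_empty, add_zero, hself] at h2
    exact h2
  · have h1 := Measure.restrict_mono (le_refl S)
      (le_iSup (fun p => chartVolume g p) p : chartVolume g p ≤ riemannianVolume g)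
    rwa [hself] at h1

theorem setIntegral_riemannianVolume (p : M) {F : M → ℝ} (hF : Measurable F) :
    ∫ x in (chartAt (EuclideanSpace ℝ (Fin m)) p).source, F x ∂(riemannianVolume g)
      = ∫ u in (chartAt (EuclideanSpace ℝ (Fin m)) p).target,
          volDensity g p u * F ((chartAt (EuclideanSpace ℝ (Fin m)) p).symm u) := by
  rw [restrict_riemannianVolume, chartVolume_eq, integral_map (aemeasurable_chart_symm g p)
    hF.aestronglyMeasurable, integral_withDensity_eq_integral_toReal_smul₀]
  · refine integral_congr_ae (Filter.Eventually.of_forall fun u => ?_)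
    simp only [smul_eq_mul]
    rw [ENNReal.toReal_ofReal (show 0 ≤ volDensity g p u from Real.sqrt_nonneg _)]
  · exact ((continuousOn_volDensity g p).aemeasurable
      (chartAt (EuclideanSpace ℝ (Fin m)) p).open_target.measurableSet).ennreal_ofReal
  · exact Filter.Eventually.of_forall fun u => ENNReal.ofReal_lt_top

/-- A closed ball inside a chart target has finite volume, since the density is continuous there.
This makes continuous functions integrable on compact sets. -/
instance isLocallyFiniteMeasure_riemannianVolume :
    IsLocallyFiniteMeasure (riemannianVolume g) := by
  refine ⟨fun x => ?_⟩
  set c := chartAt (EuclideanSpace ℝ (Fin m)) x with hc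
  have hx : x ∈ c.source := mem_chart_source _ x
  obtain ⟨r, hr, hrt⟩ := Metric.nhds_basis_closedBall.mem_iff.1
    (c.open_target.mem_nhds (c.map_source hx))
  have hopen : IsOpen (c.source ∩ c ⁻¹' Metric.ball (c x) r) :=
    c.isOpen_inter_preimage Metric.isOpen_ball
  refine ⟨c.source ∩ c ⁻¹' Metric.ball (c x) r,
    hopen.mem_nhds ⟨hx, Metric.mem_ball_self hr⟩, ?_⟩
  have h1 : riemannianVolume g (c.source ∩ c ⁻¹' Metric.ball (c x) r)
      = chartVolume g x (c.source ∩ c ⁻¹' Metric.ball (c x) r) := by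
    rw [← restrict_riemannianVolume, Measure.restrict_apply hopen.measurableSet]
    congr 1
    ext y
    simp only [Set.mem_inter_iff, ← hc]
    tauto
  rw [h1, chartVolume_apply g x hopen.measurableSet]
  refine (lintegral_mono_set (t := Metric.closedBall (c x) r) ?_).trans_lt ?_
  · rintro u ⟨⟨hu1, hu2⟩, hu3⟩
    rw [Set.mem_preimage, ← hc, c.right_inv hu3] at hu2
    exact Metric.ball_subset_closedBall hu2
  · have h2 : IntegrableOn (volDensity g x) (Metric.closedBall (c x) r) :=
      ((continuousOn_volDensity g x).mono hrt).integrableOn_compact (isCompact_closedBall _ _)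
    exact h2.lintegral_lt_top

end Volume

/-! ### Freezing the time variable -/

section Slices

variable {E F ι : Type*} [NormedAddCommGroup E] [NormedSpace ℝ E]
  [NormedAddCommGroup F] [NormedSpace ℝ F] [Fintype ι]

theorem fderiv_slice {f : ℝ × E → F} {t : ℝ} {u : E} (hf : DifferentiableAt ℝ f (t, u)) (a : E) :
    fderiv ℝ (fun u => f (t, u)) u a = fderiv ℝ f (t, u) (0, a) := by
  have h1 : HasFDerivAt (fun u : E => (t, u)) (ContinuousLinearMap.inr ℝ ℝ E) u :=
    hasFDerivAt_prodMk_right t u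
  have h2 := hf.hasFDerivAt.comp u h1
  have h3 : fderiv ℝ (fun u => f (t, u)) u
      = (fderiv ℝ f (t, u)).comp (ContinuousLinearMap.inr ℝ ℝ E) := h2.fderiv
  rw [h3]
  rfl

theorem contDiffAt_slice {f : ℝ × E → F} {t : ℝ} {u : E} (hf : ContDiffAt ℝ ∞ f (t, u)) :
    ContDiffAt ℝ ∞ (fun u => f (t, u)) u :=
  hf.comp u (contDiffAt_const.prodMk contDiffAt_id)

theorem hasDerivAt_slice {f : ℝ × E → F} {t : ℝ} {u : E} (hf : DifferentiableAt ℝ f (t, u)) :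
    HasDerivAt (fun t => f (t, u)) (fderiv ℝ f (t, u) (1, 0)) t := by
  have h1 : HasDerivAt (fun t : ℝ => (t, u)) ((1 : ℝ), (0 : E)) t :=
    (hasDerivAt_id t).prodMk (hasDerivAt_const t u)
  exact hf.hasFDerivAt.comp_hasDerivAt t h1

theorem covCoord_slice {Γ : F → F →L[ℝ] F →L[ℝ] F} {f V : ℝ × E → F} {t : ℝ} {u : E}
    (hf : DifferentiableAt ℝ f (t, u)) (hV : DifferentiableAt ℝ V (t, u)) (a : E) :
    covCoord Γ (fun u => f (t, u)) (fun u => V (t, u)) a u = covCoord Γ f V (0, a) (t, u) := by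
  rw [covCoord, covCoord, fderiv_slice hf, fderiv_slice hV]

/-- Every derivative in the form is taken in a spatial direction (0, e i), and the coefficients
depend on space alone. -/
theorem bitensionForm_slice {Γ : F → F →L[ℝ] F →L[ℝ] F} {B : F → F →L[ℝ] F →L[ℝ] ℝ}
    {f τ : ℝ × E → F} {P : ι → ι → E → ℝ} {e : ι → E} {O : Set (ℝ × E)} (hO : IsOpen O)
    (hΓ : ∀ z ∈ O, ContDiffAt ℝ ∞ Γ (f z)) (hf : ∀ z ∈ O, ContDiffAt ℝ ∞ f z)
    (hτ : ∀ z ∈ O, ContDiffAt ℝ ∞ τ z) (hP : ∀ z ∈ O, ∀ i j, ContDiffAt ℝ ∞ (P i j) z.2)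
    {t : ℝ} {u : E} (hz : (t, u) ∈ O) (v : F) :
    bitensionForm Γ B (fun u => f (t, u)) (fun u => τ (t, u)) P e u v
      = bitensionForm Γ B f τ (fun i j z => P i j z.2) (fun i => (0, e i)) (t, u) v := by
  have hfd : ∀ z ∈ O, DifferentiableAt ℝ f z := fun z hz => (hf z hz).differentiableAt (by simp)
  have hτd : ∀ z ∈ O, DifferentiableAt ℝ τ z := fun z hz => (hτ z hz).differentiableAt (by simp)
  have hOt : ∀ᶠ u' in nhds u, (t, u') ∈ O :=
    (Continuous.prodMk_right t).continuousAt.eventually (hO.mem_nhds hz)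
  have h1 : ∀ i, covCoord Γ (fun u => f (t, u)) (fun u => ∑ j, P i j u
        • covCoord Γ (fun u => f (t, u)) (fun u => τ (t, u)) (e j) u) (e i) u
      = covCoord Γ f (fun z => ∑ j, P i j z.2 • covCoord Γ f τ (0, e j) z) (0, e i) (t, u) := by
    intro i
    rw [← covCoord_slice (hfd _ hz)]
    · refine covCoord_congr ?_ _
      filter_upwards [hOt] with u' hu'
      simp only [covCoord_slice (hfd _ hu') (hτd _ hu')]
    · refine ContDiffAt.differentiableAt (n := ∞) (ContDiffAt.sum fun j _ => ?_) (by simp)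
      exact ((hP _ hz i j).comp (t, u) contDiffAt_snd).smul
        (contDiffAt_covCoord (hΓ _ hz) (hf _ hz) (hτ _ hz) _)
  simp only [bitensionForm, h1, fderiv_slice (hfd _ hz)]

end Slices

/-! ### Variations in charts -/

section Variation

variable {m n : ℕ} {M N : Type*} [TopologicalSpace M] [TopologicalSpace N]
  [ChartedSpace (EuclideanSpace ℝ (Fin m)) M] [IsManifold (𝓡 m) ∞ M]
  [ChartedSpace (EuclideanSpace ℝ (Fin n)) N] [IsManifold (𝓡 n) ∞ N]

/-- A variation in charts. -/
def varMap (p : M) (ψ : OpenPartialHomeomorph N (EuclideanSpace ℝ (Fin n))) (Φ : ℝ → M → N)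
    (z : ℝ × EuclideanSpace ℝ (Fin m)) : EuclideanSpace ℝ (Fin n) :=
  mapInCharts (chartAt (EuclideanSpace ℝ (Fin m)) p) ψ (Φ z.1) z.2

/-- The tension fields of a variation in charts. -/
def varTension (g : SmoothMetric m M) (h : SmoothMetric n N) (p : M)
    (ψ : OpenPartialHomeomorph N (EuclideanSpace ℝ (Fin n))) (Φ : ℝ → M → N)
    (z : ℝ × EuclideanSpace ℝ (Fin m)) : EuclideanSpace ℝ (Fin n) :=
  fieldInCharts (chartAt (EuclideanSpace ℝ (Fin m)) p) ψ (Φ z.1) (tension g h (Φ z.1)) z.2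

/-- The domain of a variation in charts. -/
def varDomain (p : M) (ψ : OpenPartialHomeomorph N (EuclideanSpace ℝ (Fin n))) (Φ : ℝ → M → N) :
    Set (ℝ × EuclideanSpace ℝ (Fin m)) :=
  {z | z.2 ∈ chartDomain p ψ (Φ z.1)}

/-- The bienergy density of a variation. -/
def varDensity (g : SmoothMetric m M) (h : SmoothMetric n N) (Φ : ℝ → M → N) (t : ℝ) (x : M) : ℝ :=
  1 / 2 * h.inner (Φ t x) (tension g h (Φ t) x) (tension g h (Φ t) x)

variable {g : SmoothMetric m M} {h : SmoothMetric n N}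
  {ψ : OpenPartialHomeomorph N (EuclideanSpace ℝ (Fin n))} {σ : N → ℝ} {Φ : ℝ → M → N} {p : M}
  {z : ℝ × EuclideanSpace ℝ (Fin m)}

theorem contMDiff_variation_slice
    (hΦ : ContMDiff (𝓘(ℝ, ℝ).prod (𝓡 m)) (𝓡 n) ∞ (fun p : ℝ × M => Φ p.1 p.2)) (t : ℝ) :
    ContMDiff (𝓡 m) (𝓡 n) ∞ (Φ t) :=
  hΦ.comp (contMDiff_const.prodMk contMDiff_id)

theorem isOpen_varDomain
    (hΦ : ContMDiff (𝓘(ℝ, ℝ).prod (𝓡 m)) (𝓡 n) ∞ (fun p : ℝ × M => Φ p.1 p.2)) :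
    IsOpen (varDomain (m := m) p ψ Φ) := by
  set c := chartAt (EuclideanSpace ℝ (Fin m)) p
  have h1 : ContinuousOn (fun z : ℝ × EuclideanSpace ℝ (Fin m) => Φ z.1 (c.symm z.2))
      (Prod.snd ⁻¹' c.target) := by
    refine hΦ.continuous.comp_continuousOn (f := fun z : ℝ × EuclideanSpace ℝ (Fin m) =>
      (z.1, c.symm z.2)) (continuousOn_fst.prodMk ?_)
    exact c.continuousOn_symm.comp continuousOn_snd fun z hz => hz
  exact h1.isOpen_inter_preimage (c.open_target.preimage continuous_snd) ψ.open_source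

theorem contDiffAt_varMap
    (hΦ : ContMDiff (𝓘(ℝ, ℝ).prod (𝓡 m)) (𝓡 n) ∞ (fun p : ℝ × M => Φ p.1 p.2))
    (hψ : ψ ∈ IsManifold.maximalAtlas (𝓡 n) ∞ N) (hz : z ∈ varDomain p ψ Φ) :
    ContDiffAt ℝ ∞ (varMap p ψ Φ) z := by
  rw [← contMDiffAt_iff_contDiffAt]
  set c := chartAt (EuclideanSpace ℝ (Fin m)) p
  have h1 : ContMDiffAt 𝓘(ℝ, ℝ × EuclideanSpace ℝ (Fin m)) (𝓡 m) ∞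
      (fun z : ℝ × EuclideanSpace ℝ (Fin m) => c.symm z.2) z :=
    (contMDiffAt_chart_symm_of_mem (chart_mem_maximalAtlas p) hz.1).comp z
      contDiffAt_snd.contMDiffAt
  have h2 : ContMDiffAt 𝓘(ℝ, ℝ × EuclideanSpace ℝ (Fin m)) (𝓘(ℝ, ℝ).prod (𝓡 m)) ∞
      (fun z : ℝ × EuclideanSpace ℝ (Fin m) => (z.1, c.symm z.2)) z :=
    (contDiffAt_fst.contMDiffAt).prodMk h1
  have h3 := (hΦ.contMDiffAt (x := (z.1, c.symm z.2))).comp z h2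
  exact (contMDiffAt_chart_of_mem hψ hz.2).comp z h3

theorem contDiffAt_density_snd (g : SmoothMetric m M) {z : ℝ × EuclideanSpace ℝ (Fin m)}
    (hz : z.2 ∈ (chartAt (EuclideanSpace ℝ (Fin m)) p).target) (i j : Fin m) :
    ContDiffAt ℝ ∞ (fun z : ℝ × EuclideanSpace ℝ (Fin m) =>
      volDensity g p z.2 * gramInv g p i j z.2) z :=
  ((contDiffAt_volDensity g hz).mul (contDiffAt_gramInv g hz i j)).comp z contDiffAt_snd

theorem contDiffAt_density_smul_fderiv (g : SmoothMetric m M)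
    {f : ℝ × EuclideanSpace ℝ (Fin m) → EuclideanSpace ℝ (Fin n)}
    {z : ℝ × EuclideanSpace ℝ (Fin m)}
    (hz : z.2 ∈ (chartAt (EuclideanSpace ℝ (Fin m)) p).target) (hf : ContDiffAt ℝ ∞ f z)
    (i : Fin m) : ContDiffAt ℝ ∞ (fun z => ∑ j, (volDensity g p z.2 * gramInv g p i j z.2)
      • fderiv ℝ f z (0, EuclideanSpace.single j 1)) z :=
  ContDiffAt.sum fun j _ => (contDiffAt_density_snd g hz i j).smul (contDiffAt_fderiv_apply hf _)

namespace IsConformallyFlatChart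

/-- The slice formula, rewritten with spatial derivatives on the product with the time axis, so that
time derivatives can be taken of it. -/
theorem volDensity_smul_varTension (hc : IsConformallyFlatChart h ψ σ)
    (hΦ : ContMDiff (𝓘(ℝ, ℝ).prod (𝓡 m)) (𝓡 n) ∞ (fun p : ℝ × M => Φ p.1 p.2))
    (hz : z ∈ varDomain p ψ Φ) :
    volDensity g p z.2 • varTension g h p ψ Φ z
      = ∑ i, covCoord (confGamma (inChart ψ σ)) (varMap p ψ Φ)
          (fun z => ∑ j, (volDensity g p z.2 * gramInv g p i j z.2)
            • fderiv ℝ (varMap p ψ Φ) z (0, EuclideanSpace.single j 1))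
          (0, EuclideanSpace.single i 1) z := by
  obtain ⟨t, u⟩ := z
  have hO := isOpen_varDomain (p := p) (ψ := ψ) hΦ
  have hfd : ∀ z ∈ varDomain p ψ Φ, DifferentiableAt ℝ (varMap p ψ Φ) z := fun z hz =>
    (contDiffAt_varMap hΦ hc.mem_maximalAtlas hz).differentiableAt (by simp)
  have hOt : ∀ᶠ u' in nhds u, (t, u') ∈ varDomain p ψ Φ :=
    (Continuous.prodMk_right t).continuousAt.eventually (hO.mem_nhds hz)
  refine (hc.volDensity_smul_fieldInCharts_tension g (contMDiff_variation_slice hΦ t) hz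
    (f := fun u => varMap p ψ Φ (t, u)) rfl).trans ?_
  refine Finset.sum_congr rfl fun i _ => ?_
  rw [← covCoord_slice (hfd _ hz) ((contDiffAt_density_smul_fderiv g hz.1
    (contDiffAt_varMap hΦ hc.mem_maximalAtlas hz) i).differentiableAt (by simp))]
  refine covCoord_congr ?_ _
  filter_upwards [hOt] with u' hu'
  simp only [fderiv_slice (hfd _ hu')]

theorem contDiffAt_factor_varMap (hc : IsConformallyFlatChart h ψ σ) (hz : z ∈ varDomain p ψ Φ) :
    ContDiffAt ℝ ∞ (inChart ψ σ) (varMap p ψ Φ z) :=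
  hc.contDiffAt_factor hz.2

/-- Joint smoothness in time and space, again by dividing the divergence form by the density. -/
theorem contDiffAt_varTension (hc : IsConformallyFlatChart h ψ σ)
    (hΦ : ContMDiff (𝓘(ℝ, ℝ).prod (𝓡 m)) (𝓡 n) ∞ (fun p : ℝ × M => Φ p.1 p.2))
    (hz : z ∈ varDomain p ψ Φ) : ContDiffAt ℝ ∞ (varTension g h p ψ Φ) z := by
  have h1 : varTension g h p ψ Φ =ᶠ[nhds z] fun z => (volDensity g p z.2)⁻¹
      • ∑ i, covCoord (confGamma (inChart ψ σ)) (varMap p ψ Φ)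
          (fun z => ∑ j, (volDensity g p z.2 * gramInv g p i j z.2)
            • fderiv ℝ (varMap p ψ Φ) z (0, EuclideanSpace.single j 1))
          (0, EuclideanSpace.single i 1) z := by
    filter_upwards [(isOpen_varDomain hΦ).mem_nhds hz] with z hz
    rw [← hc.volDensity_smul_varTension hΦ hz, inv_smul_smul₀ (volDensity_pos g hz.1).ne']
  refine ContDiffAt.congr_of_eventuallyEq ?_ h1
  have hf := contDiffAt_varMap hΦ hc.mem_maximalAtlas hz
  exact (((contDiffAt_volDensity g hz.1).comp z contDiffAt_snd).inv
    (volDensity_pos g hz.1).ne').smul (ContDiffAt.sum fun i _ => contDiffAt_covCoord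
      (contDiffAt_confGamma (hc.contDiffAt_factor_varMap hz)) hf
      (contDiffAt_density_smul_fderiv g hz.1 hf i) _)

theorem varDensity_eq (hc : IsConformallyFlatChart h ψ σ) (hz : z ∈ varDomain p ψ Φ) :
    varDensity g h Φ z.1 ((chartAt (EuclideanSpace ℝ (Fin m)) p).symm z.2)
      = 1 / 2 * confMetric (inChart ψ σ) (varMap p ψ Φ z) (varTension g h p ψ Φ z)
        (varTension g h p ψ Φ z) := by
  rw [varDensity, hc.inner_eq_confMetric hz.2]
  rfl

theorem contDiffAt_confMetric_varMap (hc : IsConformallyFlatChart h ψ σ)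
    (hΦ : ContMDiff (𝓘(ℝ, ℝ).prod (𝓡 m)) (𝓡 n) ∞ (fun p : ℝ × M => Φ p.1 p.2))
    (hz : z ∈ varDomain p ψ Φ) {V W : ℝ × EuclideanSpace ℝ (Fin m) → EuclideanSpace ℝ (Fin n)}
    (hV : ContDiffAt ℝ ∞ V z) (hW : ContDiffAt ℝ ∞ W z) :
    ContDiffAt ℝ ∞ (fun z => confMetric (inChart ψ σ) (varMap p ψ Φ z) (V z) (W z)) z :=
  ((((contDiffAt_confMetric (hc.contDiffAt_factor_varMap hz)).comp z
    (contDiffAt_varMap hΦ hc.mem_maximalAtlas hz)).clm_apply hV).clm_apply hW)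

end IsConformallyFlatChart

/-- The boundary current of the first variation of the bienergy in charts. -/
def varCurrent (g : SmoothMetric m M) (h : SmoothMetric n N) (p : M)
    (ψ : OpenPartialHomeomorph N (EuclideanSpace ℝ (Fin n))) (σ : N → ℝ) (Φ : ℝ → M → N)
    (i : Fin m) (z : ℝ × EuclideanSpace ℝ (Fin m)) : ℝ :=
  ∑ j, (volDensity g p z.2 * gramInv g p i j z.2)
    * (confMetric (inChart ψ σ) (varMap p ψ Φ z) (covCoord (confGamma (inChart ψ σ))
          (varMap p ψ Φ) (fun z => fderiv ℝ (varMap p ψ Φ) z (1, 0))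
          (0, EuclideanSpace.single j 1) z) (varTension g h p ψ Φ z)
      - confMetric (inChart ψ σ) (varMap p ψ Φ z) (fderiv ℝ (varMap p ψ Φ) z (1, 0))
        (covCoord (confGamma (inChart ψ σ)) (varMap p ψ Φ) (varTension g h p ψ Φ)
          (0, EuclideanSpace.single j 1) z))

/-- The Euler-Lagrange form of the bienergy in charts. -/
def chartBitension (g : SmoothMetric m M) (h : SmoothMetric n N) (p : M)
    (ψ : OpenPartialHomeomorph N (EuclideanSpace ℝ (Fin n))) (σ : N → ℝ) (φ : M → N)
    (u : EuclideanSpace ℝ (Fin m)) (v : EuclideanSpace ℝ (Fin n)) : ℝ :=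
  bitensionForm (confGamma (inChart ψ σ)) (confMetric (inChart ψ σ))
    (mapInCharts (chartAt (EuclideanSpace ℝ (Fin m)) p) ψ φ)
    (fieldInCharts (chartAt (EuclideanSpace ℝ (Fin m)) p) ψ φ (tension g h φ))
    (fun i j z => volDensity g p z * gramInv g p i j z)
    (fun i : Fin m => EuclideanSpace.single i (1 : ℝ)) u v

namespace IsConformallyFlatChart

theorem contDiffAt_varCurrent (hc : IsConformallyFlatChart h ψ σ)
    (hΦ : ContMDiff (𝓘(ℝ, ℝ).prod (𝓡 m)) (𝓡 n) ∞ (fun p : ℝ × M => Φ p.1 p.2))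
    (hz : z ∈ varDomain p ψ Φ) (i : Fin m) : ContDiffAt ℝ ∞ (varCurrent g h p ψ σ Φ i) z := by
  have hf := contDiffAt_varMap hΦ hc.mem_maximalAtlas hz
  have hτ : ContDiffAt ℝ ∞ (varTension g h p ψ Φ) z := hc.contDiffAt_varTension hΦ hz
  have hv := contDiffAt_fderiv_apply hf ((1 : ℝ), (0 : EuclideanSpace ℝ (Fin m)))
  have hΓ := contDiffAt_confGamma (hc.contDiffAt_factor_varMap hz)
  exact ContDiffAt.sum fun j _ => (contDiffAt_density_snd g hz.1 i j).mul
    ((hc.contDiffAt_confMetric_varMap hΦ hz (contDiffAt_covCoord hΓ hf hv _) hτ).sub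
      (hc.contDiffAt_confMetric_varMap hΦ hz hv (contDiffAt_covCoord hΓ hf hτ _)))

/-- The first variation of the bienergy density in charts. -/
theorem volDensity_mul_fderiv_varDensity (hc : IsConformallyFlatChart h ψ σ)
    (hΦ : ContMDiff (𝓘(ℝ, ℝ).prod (𝓡 m)) (𝓡 n) ∞ (fun p : ℝ × M => Φ p.1 p.2))
    {t : ℝ} {u : EuclideanSpace ℝ (Fin m)} (hz : (t, u) ∈ varDomain p ψ Φ) :
    volDensity g p u * fderiv ℝ (fun z => 1 / 2 * confMetric (inChart ψ σ) (varMap p ψ Φ z)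
        (varTension g h p ψ Φ z) (varTension g h p ψ Φ z)) (t, u) (1, 0)
      = ∑ i, fderiv ℝ (fun u => varCurrent g h p ψ σ Φ i (t, u)) u (EuclideanSpace.single i 1)
        + chartBitension g h p ψ σ (Φ t) u (fderiv ℝ (varMap p ψ Φ) (t, u) (1, 0)) := by
  -- The density and the inverse metric do not depend on time, as `first_variation_tension` requires
  -- in the direction (1, 0).
  have hsnd : ∀ {F : EuclideanSpace ℝ (Fin m) → ℝ} {z : ℝ × EuclideanSpace ℝ (Fin m)},
      DifferentiableAt ℝ F z.2 → fderiv ℝ (fun z : ℝ × EuclideanSpace ℝ (Fin m) => F z.2) z (1, 0)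
        = 0 := by
    intro F z hF
    have h1 : fderiv ℝ (fun z : ℝ × EuclideanSpace ℝ (Fin m) => F z.2) z
        = (fderiv ℝ F z.2).comp (ContinuousLinearMap.snd ℝ ℝ (EuclideanSpace ℝ (Fin m))) :=
      (hF.hasFDerivAt.comp z hasFDerivAt_snd).fderiv
    rw [h1]
    simp
  have hP : ∀ z ∈ varDomain p ψ Φ, ∀ i j, ContDiffAt ℝ ∞
      (fun u => volDensity g p u * gramInv g p i j u) z.2 := fun z hz i j =>
    (contDiffAt_volDensity g hz.1).mul (contDiffAt_gramInv g hz.1 i j)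
  have h1 := first_variation_tension (Γ := confGamma (inChart ψ σ))
    (B := confMetric (inChart ψ σ)) (f := varMap p ψ Φ) (τ := varTension g h p ψ Φ)
    (w := fun z => volDensity g p z.2)
    (P := fun i j z => volDensity g p z.2 * gramInv g p i j z.2)
    (e := fun i : Fin m => ((0 : ℝ), EuclideanSpace.single i (1 : ℝ))) (a := (1, 0))
    (isOpen_varDomain hΦ)
    (fun z hz => contDiffAt_confGamma (hc.contDiffAt_factor_varMap hz)) (confGamma_symm _)
    (confMetric_symm _) (fun z hz => contDiffAt_confMetric (hc.contDiffAt_factor_varMap hz))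
    (fun z hz => confMetric_compatible
      ((hc.contDiffAt_factor_varMap hz).differentiableAt (by simp)))
    (fun z hz => contDiffAt_varMap hΦ hc.mem_maximalAtlas hz)
    (fun z hz => hc.contDiffAt_varTension hΦ hz)
    (fun z hz => ((contDiffAt_volDensity g hz.1).comp z contDiffAt_snd).differentiableAt (by simp))
    (fun z hz i j => contDiffAt_density_snd g hz.1 i j)
    (fun i j z => by rw [gramInv_symm])
    (fun z hz => hsnd ((contDiffAt_volDensity g hz.1).differentiableAt (by simp)))
    (fun z hz i j => hsnd (F := fun u => volDensity g p u * gramInv g p i j u)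
      ((hP z hz i j).differentiableAt (by simp)))
    (fun z hz => hc.volDensity_smul_varTension hΦ hz) hz
  refine h1.trans ?_
  congr 1
  · refine Finset.sum_congr rfl fun i _ => ?_
    exact (fderiv_slice ((hc.contDiffAt_varCurrent hΦ hz i).differentiableAt (by simp)) _).symm
  · exact (bitensionForm_slice (f := varMap p ψ Φ) (τ := varTension g h p ψ Φ)
      (isOpen_varDomain hΦ)
      (fun z hz => contDiffAt_confGamma (hc.contDiffAt_factor_varMap hz))
      (fun z hz => contDiffAt_varMap hΦ hc.mem_maximalAtlas hz)
      (fun z hz => hc.contDiffAt_varTension hΦ hz) hP hz _).symm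

end IsConformallyFlatChart

end Variation

/-! ### Differentiating the bienergy in time -/

section Density

variable {m n : ℕ} {M N : Type*} [TopologicalSpace M] [TopologicalSpace N]
  [ChartedSpace (EuclideanSpace ℝ (Fin m)) M] [IsManifold (𝓡 m) ∞ M]
  [ChartedSpace (EuclideanSpace ℝ (Fin n)) N] [IsManifold (𝓡 n) ∞ N]

/-- The bienergy density of a variation in charts. -/
def varDensityInCharts (g : SmoothMetric m M) (h : SmoothMetric n N) (p : M)
    (ψ : OpenPartialHomeomorph N (EuclideanSpace ℝ (Fin n))) (σ : N → ℝ) (Φ : ℝ → M → N)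
    (z : ℝ × EuclideanSpace ℝ (Fin m)) : ℝ :=
  1 / 2 * confMetric (inChart ψ σ) (varMap p ψ Φ z) (varTension g h p ψ Φ z)
    (varTension g h p ψ Φ z)

variable {g : SmoothMetric m M} {h : SmoothMetric n N}
  {ψ : OpenPartialHomeomorph N (EuclideanSpace ℝ (Fin n))} {σ : N → ℝ} {Φ : ℝ → M → N} {p : M}
  {z : ℝ × EuclideanSpace ℝ (Fin m)}

theorem mem_varDomain {t : ℝ} {x : M} (hx : x ∈ (chartAt (EuclideanSpace ℝ (Fin m)) p).source)
    (hφx : Φ t x ∈ ψ.source) :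
    (t, chartAt (EuclideanSpace ℝ (Fin m)) p x) ∈ varDomain p ψ Φ := by
  refine ⟨(chartAt (EuclideanSpace ℝ (Fin m)) p).map_source hx, ?_⟩
  simp only
  rw [(chartAt (EuclideanSpace ℝ (Fin m)) p).left_inv hx]
  exact hφx

namespace IsConformallyFlatChart

theorem contDiffAt_varDensityInCharts (hc : IsConformallyFlatChart h ψ σ)
    (hΦ : ContMDiff (𝓘(ℝ, ℝ).prod (𝓡 m)) (𝓡 n) ∞ (fun p : ℝ × M => Φ p.1 p.2))
    (hz : z ∈ varDomain p ψ Φ) : ContDiffAt ℝ ∞ (varDensityInCharts g h p ψ σ Φ) z :=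
  contDiffAt_const.mul (hc.contDiffAt_confMetric_varMap hΦ hz (hc.contDiffAt_varTension hΦ hz)
    (hc.contDiffAt_varTension hΦ hz))

theorem varDensity_eq_chart (hc : IsConformallyFlatChart h ψ σ) {t : ℝ} {x : M}
    (hx : x ∈ (chartAt (EuclideanSpace ℝ (Fin m)) p).source) (hφx : Φ t x ∈ ψ.source) :
    varDensity g h Φ t x
      = varDensityInCharts g h p ψ σ Φ (t, chartAt (EuclideanSpace ℝ (Fin m)) p x) := by
  have h1 := hc.varDensity_eq (g := g) (mem_varDomain (p := p) hx hφx)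
  simp only at h1
  rw [(chartAt (EuclideanSpace ℝ (Fin m)) p).left_inv hx] at h1
  exact h1

theorem hasDerivAt_varDensity (hc : IsConformallyFlatChart h ψ σ)
    (hΦ : ContMDiff (𝓘(ℝ, ℝ).prod (𝓡 m)) (𝓡 n) ∞ (fun p : ℝ × M => Φ p.1 p.2)) {t : ℝ} {x : M}
    (hx : x ∈ (chartAt (EuclideanSpace ℝ (Fin m)) p).source) (hφx : Φ t x ∈ ψ.source) :
    HasDerivAt (fun t => varDensity g h Φ t x) (fderiv ℝ (varDensityInCharts g h p ψ σ Φ)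
      (t, chartAt (EuclideanSpace ℝ (Fin m)) p x) (1, 0)) t := by
  have h1 := hasDerivAt_slice ((hc.contDiffAt_varDensityInCharts (g := g) hΦ
    (mem_varDomain (p := p) hx hφx)).differentiableAt (by simp))
  refine h1.congr_of_eventuallyEq ?_
  have hcont : Continuous fun t => Φ t x :=
    hΦ.continuous.comp (Continuous.prodMk_left x)
  filter_upwards [hcont.continuousAt.eventually (ψ.open_source.mem_nhds hφx)] with t' ht'
  exact hc.varDensity_eq_chart hx ht'

end IsConformallyFlatChart

theorem hasDerivAt_varDensity
    (hcov : ∀ q : N, ∃ (ψ : OpenPartialHomeomorph N (EuclideanSpace ℝ (Fin n))) (σ : N → ℝ),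
      IsConformallyFlatChart h ψ σ ∧ q ∈ ψ.source)
    (hΦ : ContMDiff (𝓘(ℝ, ℝ).prod (𝓡 m)) (𝓡 n) ∞ (fun p : ℝ × M => Φ p.1 p.2))
    (t : ℝ) (x : M) :
    HasDerivAt (fun t => varDensity g h Φ t x) (deriv (fun t => varDensity g h Φ t x) t) t := by
  obtain ⟨ψ, σ, hc, hq⟩ := hcov (Φ t x)
  exact (hc.hasDerivAt_varDensity hΦ (mem_chart_source _ x) hq).differentiableAt.hasDerivAt

theorem continuous_varDensity
    (hcov : ∀ q : N, ∃ (ψ : OpenPartialHomeomorph N (EuclideanSpace ℝ (Fin n))) (σ : N → ℝ),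
      IsConformallyFlatChart h ψ σ ∧ q ∈ ψ.source)
    (hΦ : ContMDiff (𝓘(ℝ, ℝ).prod (𝓡 m)) (𝓡 n) ∞ (fun p : ℝ × M => Φ p.1 p.2)) :
    Continuous fun q : ℝ × M => varDensity g h Φ q.1 q.2 := by
  rw [continuous_iff_continuousAt]
  rintro ⟨t, x⟩
  obtain ⟨ψ, σ, hc, hq⟩ := hcov (Φ t x)
  have hx := mem_chart_source (EuclideanSpace ℝ (Fin m)) x
  have hp : ContinuousAt (fun q : ℝ × M => (q.1, chartAt (EuclideanSpace ℝ (Fin m)) x q.2))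
      (t, x) :=
    continuousAt_fst.prodMk (ContinuousAt.comp (x := (t, x)) (f := Prod.snd)
      ((chartAt (EuclideanSpace ℝ (Fin m)) x).continuousAt hx) continuousAt_snd)
  have h1 : ContinuousAt (fun q : ℝ × M => varDensityInCharts g h x ψ σ Φ
      (q.1, chartAt (EuclideanSpace ℝ (Fin m)) x q.2)) (t, x) :=
    ContinuousAt.comp (g := varDensityInCharts g h x ψ σ Φ) (x := (t, x))
      (hc.contDiffAt_varDensityInCharts hΦ (mem_varDomain hx hq)).continuousAt hp
  refine h1.congr_of_eventuallyEq ?_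
  filter_upwards [continuousAt_snd.eventually
    ((chartAt (EuclideanSpace ℝ (Fin m)) x).open_source.mem_nhds hx),
    hΦ.continuous.continuousAt.eventually (ψ.open_source.mem_nhds hq)] with q hq1 hq2
  exact hc.varDensity_eq_chart hq1 hq2

/-- Joint continuity bounds the time derivative on a compact time interval times Ω and so provides
the dominating constant. -/
theorem continuous_deriv_varDensity
    (hcov : ∀ q : N, ∃ (ψ : OpenPartialHomeomorph N (EuclideanSpace ℝ (Fin n))) (σ : N → ℝ),
      IsConformallyFlatChart h ψ σ ∧ q ∈ ψ.source)
    (hΦ : ContMDiff (𝓘(ℝ, ℝ).prod (𝓡 m)) (𝓡 n) ∞ (fun p : ℝ × M => Φ p.1 p.2)) :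
    Continuous fun q : ℝ × M => deriv (fun t => varDensity g h Φ t q.2) q.1 := by
  rw [continuous_iff_continuousAt]
  rintro ⟨t, x⟩
  obtain ⟨ψ, σ, hc, hq⟩ := hcov (Φ t x)
  have hx := mem_chart_source (EuclideanSpace ℝ (Fin m)) x
  have hp : ContinuousAt (fun q : ℝ × M => (q.1, chartAt (EuclideanSpace ℝ (Fin m)) x q.2))
      (t, x) :=
    continuousAt_fst.prodMk (ContinuousAt.comp (x := (t, x)) (f := Prod.snd)
      ((chartAt (EuclideanSpace ℝ (Fin m)) x).continuousAt hx) continuousAt_snd)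
  have h1 : ContinuousAt (fun q : ℝ × M => fderiv ℝ (varDensityInCharts g h x ψ σ Φ)
      (q.1, chartAt (EuclideanSpace ℝ (Fin m)) x q.2) (1, 0)) (t, x) :=
    ContinuousAt.comp (g := fun z => fderiv ℝ (varDensityInCharts g h x ψ σ Φ) z (1, 0))
      (x := (t, x))
      (contDiffAt_fderiv_apply (hc.contDiffAt_varDensityInCharts hΦ (mem_varDomain hx hq))
        (1, 0)).continuousAt hp
  refine h1.congr_of_eventuallyEq ?_
  filter_upwards [continuousAt_snd.eventually
    ((chartAt (EuclideanSpace ℝ (Fin m)) x).open_source.mem_nhds hx),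
    hΦ.continuous.continuousAt.eventually (ψ.open_source.mem_nhds hq)] with q hq1 hq2
  exact (hc.hasDerivAt_varDensity hΦ hq1 hq2).deriv

variable [T2Space M] [MeasurableSpace M] [BorelSpace M]

/-- Differentiation of the bienergy under the integral sign. -/
theorem hasDerivAt_bienergy
    (hcov : ∀ q : N, ∃ (ψ : OpenPartialHomeomorph N (EuclideanSpace ℝ (Fin n))) (σ : N → ℝ),
      IsConformallyFlatChart h ψ σ ∧ q ∈ ψ.source)
    (hΦ : ContMDiff (𝓘(ℝ, ℝ).prod (𝓡 m)) (𝓡 n) ∞ (fun p : ℝ × M => Φ p.1 p.2))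
    {Ω : Set M} (hΩ : IsCompact Ω) :
    HasDerivAt (fun t => bienergy g h (Φ t) Ω)
      (∫ x in Ω, deriv (fun t => varDensity g h Φ t x) 0 ∂(riemannianVolume g)) 0 := by
  have hF := continuous_varDensity (g := g) hcov hΦ
  have hF' := continuous_deriv_varDensity (g := g) hcov hΦ
  have hFt : ∀ t, Continuous (varDensity g h Φ t) := fun t => hF.comp (Continuous.prodMk_right t)
  have hbd : ∃ K, ∀ q ∈ Set.Icc (-1 : ℝ) 1 ×ˢ Ω,
      ‖deriv (fun t => varDensity g h Φ t q.2) q.1‖ ≤ K :=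
    (isCompact_Icc.prod hΩ).exists_bound_of_continuousOn hF'.continuousOn
  obtain ⟨K, hK⟩ := hbd
  have h1 : (fun t => bienergy g h (Φ t) Ω)
      = fun t => ∫ x in Ω, varDensity g h Φ t x ∂(riemannianVolume g) := by
    funext t
    rw [bienergy, ← integral_const_mul]
    rfl
  rw [h1]
  refine (hasDerivAt_integral_of_dominated_loc_of_deriv_le (s := Metric.ball 0 1)
    (bound := fun _ => K) (F' := fun t x => deriv (fun t => varDensity g h Φ t x) t)
    (Metric.ball_mem_nhds 0 one_pos) ?_ ?_ ?_ ?_ ?_ ?_).2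
  · exact Filter.Eventually.of_forall fun t => (hFt t).measurable.aestronglyMeasurable
  · exact (hFt 0).continuousOn.integrableOn_compact hΩ
  · exact (hF'.comp (Continuous.prodMk_right 0)).measurable.aestronglyMeasurable
  -- The ball of radius 1 in time lies inside [-1, 1], where `K` bounds the derivative.
  · filter_upwards [ae_restrict_mem hΩ.isClosed.measurableSet] with x hx t ht
    refine hK (t, x) ⟨?_, hx⟩
    rw [Metric.mem_ball, dist_zero_right, Real.norm_eq_abs, abs_lt] at ht
    exact ⟨ht.1.le, ht.2.le⟩
  · have : IsFiniteMeasure ((riemannianVolume g).restrict Ω) :=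
      ⟨by rw [Measure.restrict_apply_univ]; exact hΩ.measure_lt_top⟩
    exact integrable_const K
  · exact Filter.Eventually.of_forall fun x t _ => hasDerivAt_varDensity hcov hΦ t x

end Density

/-! ### Extension by zero and vanishing integrals of derivatives -/

section Cutoff

variable {E : Type*} [NormedAddCommGroup E] [NormedSpace ℝ E]

/-- O and the complement of K are open and cover the space; on the latter the extension is zero. -/
theorem contDiff_indicator {O K : Set E} {X : E → ℝ} (hO : IsOpen O) (hK : IsCompact K)
    (hKO : K ⊆ O) (hX : ∀ u ∈ O, ContDiffAt ℝ ∞ X u) (hX0 : ∀ u ∈ O, u ∉ K → X u = 0) :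
    ContDiff ℝ ∞ (O.indicator X) ∧ HasCompactSupport (O.indicator X) := by
  have h0 : ∀ u, u ∉ K → O.indicator X u = 0 := by
    intro u hu
    by_cases huO : u ∈ O
    · rw [Set.indicator_of_mem huO, hX0 u huO hu]
    · exact Set.indicator_of_notMem huO _
  refine ⟨contDiff_iff_contDiffAt.2 fun u => ?_, HasCompactSupport.intro hK h0⟩
  by_cases hu : u ∈ K
  · refine (hX u (hKO hu)).congr_of_eventuallyEq ?_
    filter_upwards [hO.mem_nhds (hKO hu)] with v hv using Set.indicator_of_mem hv _
  · refine (contDiffAt_const (c := (0 : ℝ))).congr_of_eventuallyEq ?_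
    filter_upwards [hK.isClosed.isOpen_compl.mem_nhds hu] with v hv using h0 v hv

variable [FiniteDimensional ℝ E] [MeasurableSpace E] [BorelSpace E] {μ : Measure E}
  [μ.IsAddHaarMeasure]

/-- Integration by parts against the constant function 1. -/
theorem integral_fderiv_eq_zero {Y : E → ℝ} (hY : ContDiff ℝ ∞ Y) (hYc : HasCompactSupport Y)
    (a : E) : Integrable (fun u => fderiv ℝ Y u a) μ ∧ ∫ u, fderiv ℝ Y u a ∂μ = 0 := by
  have h1 : Integrable (fun u => fderiv ℝ Y u a) μ := by
    refine Continuous.integrable_of_hasCompactSupport ?_ (hYc.fderiv_apply ℝ a)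
    exact (hY.continuous_fderiv (by simp)).clm_apply continuous_const
  refine ⟨h1, ?_⟩
  have h2 := integral_bilinear_hasLineDerivAt_right_eq_neg_left_of_integrable (μ := μ)
    (B := ContinuousLinearMap.mul ℝ ℝ) (f := Y) (f' := fun u => fderiv ℝ Y u a)
    (g := fun _ : E => (1 : ℝ)) (g' := fun _ => 0) (v := a) (by simpa using h1) (by simp)
    (by simpa using hY.continuous.integrable_of_hasCompactSupport hYc)
    (fun u _ => ((hY.differentiable (by simp)) u).hasFDerivAt.hasLineDerivAt a)
    (fun u _ => by simpa using (hasFDerivAt_const (1 : ℝ) u).hasLineDerivAt a)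
  simpa using h2.symm

end Cutoff

/-! ### Additivity of the covariant derivative in its direction -/

section Linear

variable {m n : ℕ} {M N : Type*} [TopologicalSpace M] [TopologicalSpace N]
  [ChartedSpace (EuclideanSpace ℝ (Fin m)) M] [IsManifold (𝓡 m) ∞ M]
  [ChartedSpace (EuclideanSpace ℝ (Fin n)) N] [IsManifold (𝓡 n) ∞ N]

theorem sharp_add (g : SmoothMetric m M) (p : M) (l l' : TangentSpace (𝓡 m) p →L[ℝ] ℝ) :
    sharp g p (l + l') = sharp g p l + sharp g p l' :=
  eq_of_inner_eq g fun z => by simp only [map_add, add_apply, inner_sharp]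

theorem covAlong_add (h : SmoothMetric n N) (φ : M → N) (V : (x : M) → TangentSpace (𝓡 n) (φ x))
    (x : M) (v v' : TangentSpace (𝓡 m) x) :
    covAlong h φ V x (v + v') = covAlong h φ V x v + covAlong h φ V x v' := by
  have h1 : ∀ a a' b : TangentSpace (𝓡 n) (φ x), koszulForm h (φ x) (a + a') b
      = koszulForm h (φ x) a b + koszulForm h (φ x) a' b := by
    intro a a' b
    ext w
    simp only [koszulForm_apply, map_add, add_apply]
    ring
  simp only [covAlong, christoffel, map_add, h1, sharp_add]
  abel

end Linear

/-! ### The boundary current tested against the gradient of a cutoff -/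

section Pairing

variable {m n : ℕ} {M N : Type*} [TopologicalSpace M] [TopologicalSpace N]
  [ChartedSpace (EuclideanSpace ℝ (Fin m)) M] [IsManifold (𝓡 m) ∞ M]
  [ChartedSpace (EuclideanSpace ℝ (Fin n)) N] [IsManifold (𝓡 n) ∞ N]

/-- The variation field at time `0`. -/
def varField (Φ : ℝ → M → N) (x : M) : TangentSpace (𝓡 n) (Φ 0 x) :=
  mfderiv 𝓘(ℝ, ℝ) (𝓡 n) (fun t => Φ t x) 0 (1 : ℝ)

/-- The boundary current of the first variation of the bienergy, as a linear form. -/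
def varPairing (g : SmoothMetric m M) (h : SmoothMetric n N) (Φ : ℝ → M → N) (x : M)
    (v : TangentSpace (𝓡 m) x) : ℝ :=
  h.inner (Φ 0 x) (covAlong h (Φ 0) (varField Φ) x v) (tension g h (Φ 0) x)
    - h.inner (Φ 0 x) (varField Φ x) (covAlong h (Φ 0) (tension g h (Φ 0)) x v)

/-- The bienergy density, tested against a function. -/
def weakDensity (g : SmoothMetric m M) (h : SmoothMetric n N) (Φ : ℝ → M → N) (ρ : M → ℝ)
    (x : M) : ℝ :=
  ρ x * deriv (fun t => varDensity g h Φ t x) 0 + varPairing g h Φ x (grad g ρ x)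

variable {g : SmoothMetric m M} {h : SmoothMetric n N}
  {ψ : OpenPartialHomeomorph N (EuclideanSpace ℝ (Fin n))} {σ : N → ℝ} {Φ : ℝ → M → N} {p : M}

theorem varPairing_add (x : M) (v v' : TangentSpace (𝓡 m) x) :
    varPairing g h Φ x (v + v') = varPairing g h Φ x v + varPairing g h Φ x v' := by
  simp only [varPairing, covAlong_add, map_add, add_apply]
  ring

theorem varPairing_zero (x : M) : varPairing g h Φ x 0 = 0 := by
  have h1 := varPairing_add (g := g) (h := h) (Φ := Φ) x 0 0
  rw [add_zero] at h1
  linarith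

theorem varPairing_sum {ι : Type*} (t : Finset ι) (x : M) (v : ι → TangentSpace (𝓡 m) x) :
    varPairing g h Φ x (∑ j ∈ t, v j) = ∑ j ∈ t, varPairing g h Φ x (v j) :=
  map_sum (⟨⟨varPairing g h Φ x, varPairing_zero x⟩, varPairing_add x⟩ :
    TangentSpace (𝓡 m) x →+ ℝ) v t

/-- Chain rule for the curve t ↦ Φ t x followed by ψ. This identifies the coordinate-free variation
field with the time derivative in charts. -/
theorem fieldInCharts_varField
    (hΦ : ContMDiff (𝓘(ℝ, ℝ).prod (𝓡 m)) (𝓡 n) ∞ (fun p : ℝ × M => Φ p.1 p.2))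
    (hψ : ψ ∈ IsManifold.maximalAtlas (𝓡 n) ∞ N) {u : EuclideanSpace ℝ (Fin m)}
    (hz : ((0 : ℝ), u) ∈ varDomain p ψ Φ) :
    fieldInCharts (chartAt (EuclideanSpace ℝ (Fin m)) p) ψ (Φ 0) (varField Φ) u
      = fderiv ℝ (varMap p ψ Φ) (0, u) (1, 0) := by
  set x := (chartAt (EuclideanSpace ℝ (Fin m)) p).symm u with hx
  have hγ : MDifferentiableAt 𝓘(ℝ, ℝ) (𝓡 n) (fun t => Φ t x) 0 := by
    have h1 : ContMDiff 𝓘(ℝ, ℝ) (𝓡 n) ∞ (fun t => Φ t x) :=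
      hΦ.comp (contMDiff_id.prodMk contMDiff_const)
    exact (h1 0).mdifferentiableAt (by simp)
  have hψm : MDifferentiableAt (𝓡 n) 𝓘(ℝ, EuclideanSpace ℝ (Fin n)) ψ (Φ 0 x) :=
    (contMDiffAt_chart_of_mem hψ hz.2).mdifferentiableAt (by simp)
  have h2 := hasDerivAt_slice ((contDiffAt_varMap hΦ hψ hz).differentiableAt (by simp))
  have h3 := mfderiv_comp_apply (0 : ℝ) hψm hγ (1 : ℝ)
  rw [mfderiv_eq_fderiv] at h3
  have h4 : fderiv ℝ (ψ ∘ fun t => Φ t x) 0 1 = fderiv ℝ (varMap p ψ Φ) (0, u) (1, 0) :=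
    h2.deriv ▸ (fderiv_apply_one_eq_deriv (f := fun t => varMap p ψ Φ (t, u)) (x := (0 : ℝ)))
  exact h3.symm.trans h4

theorem covCoord_raise {F : Type*} [NormedAddCommGroup F] [NormedSpace ℝ F]
    (Γ : F → F →L[ℝ] F →L[ℝ] F) (f V : EuclideanSpace ℝ (Fin m) → F)
    (u : EuclideanSpace ℝ (Fin m)) (l : EuclideanSpace ℝ (Fin m) → ℝ) :
    covCoord Γ f V (raise g p u l) u = ∑ i, ∑ j, (gramInv g p i j u
      * l (EuclideanSpace.single i 1)) • covCoord Γ f V (EuclideanSpace.single j 1) u := by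
  simp only [covCoord, raise, map_sum, map_smul, sum_apply, smul_apply, smul_add,
    Finset.sum_add_distrib]

namespace IsConformallyFlatChart

/-- `varPairing` is defined without charts, so it can be summed over a partition of unity. In a
chart, raising the index of dρ contracts it with g^{ij} and gives the current paired with dρ. -/
theorem volDensity_mul_varPairing (hc : IsConformallyFlatChart h ψ σ)
    (hΦ : ContMDiff (𝓘(ℝ, ℝ).prod (𝓡 m)) (𝓡 n) ∞ (fun p : ℝ × M => Φ p.1 p.2))
    {x : M} (hx : x ∈ (chartAt (EuclideanSpace ℝ (Fin m)) p).source) (hφx : Φ 0 x ∈ ψ.source)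
    {ρ : M → ℝ} (hρ : ContMDiff (𝓡 m) 𝓘(ℝ, ℝ) ∞ ρ) {u : EuclideanSpace ℝ (Fin m)}
    (hu : u = chartAt (EuclideanSpace ℝ (Fin m)) p x) :
    volDensity g p u * varPairing g h Φ x (grad g ρ x)
      = ∑ i, fderiv ℝ (fun u => ρ ((chartAt (EuclideanSpace ℝ (Fin m)) p).symm u)) u
          (EuclideanSpace.single i 1) * varCurrent g h p ψ σ Φ i (0, u) := by
  set c := chartAt (EuclideanSpace ℝ (Fin m)) p with hcd
  have hz : ((0 : ℝ), u) ∈ varDomain p ψ Φ := hu ▸ mem_varDomain hx hφx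
  have hO := isOpen_varDomain (p := p) (ψ := ψ) hΦ
  have hOt : ∀ᶠ u' in nhds u, ((0 : ℝ), u') ∈ varDomain p ψ Φ :=
    (Continuous.prodMk_right 0).continuousAt.eventually (hO.mem_nhds hz)
  have hcat : c ∈ IsManifold.maximalAtlas (𝓡 m) ∞ M := chart_mem_maximalAtlas p
  have hf := contDiffAt_varMap hΦ hc.mem_maximalAtlas hz
  have hfd := hf.differentiableAt (by simp)
  have hV := (contDiffAt_fderiv_apply hf ((1 : ℝ), (0 : EuclideanSpace ℝ (Fin m))))
  have hVd := hV.differentiableAt (by simp)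
  have hτd : DifferentiableAt ℝ (varTension g h p ψ Φ) (0, u) :=
    (hc.contDiffAt_varTension hΦ hz).differentiableAt (by simp)
  have hmd : MDifferentiableAt (𝓡 m) (𝓡 n) (Φ 0) x :=
    (contMDiff_variation_slice hΦ 0 x).mdifferentiableAt (by simp)
  have hVe : fieldInCharts c ψ (Φ 0) (varField Φ) =ᶠ[nhds u]
      fun u => fderiv ℝ (varMap p ψ Φ) (0, u) (1, 0) := by
    filter_upwards [hOt] with u' hu' using fieldInCharts_varField hΦ hc.mem_maximalAtlas hu'
  have hVs : DifferentiableAt ℝ (fun u => fderiv ℝ (varMap p ψ Φ) (0, u) (1, 0)) u :=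
    (contDiffAt_slice hV).differentiableAt (by simp)
  have hτs : DifferentiableAt ℝ (fun u => varTension g h p ψ Φ (0, u)) u :=
    (contDiffAt_slice (hc.contDiffAt_varTension hΦ hz)).differentiableAt (by simp)
  have h1 := hc.mvfderiv_covAlong (φ := Φ 0) (V := varField Φ) hcat hx hφx hmd
    (by rw [← hu]; exact hVs.congr_of_eventuallyEq hVe) (grad g ρ x)
  have h2 := hc.mvfderiv_covAlong (φ := Φ 0) (V := tension g h (Φ 0)) hcat hx hφx hmd
    (by rw [← hu]; exact hτs) (grad g ρ x)
  have hg : mvfderiv (𝓡 m) c x (grad g ρ x) = raise g p u (fderiv ℝ (fun u => ρ (c.symm u)) u) :=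
    HypersurfaceGeometry.mvfderiv_grad g hx hu Filter.EventuallyEq.rfl
      (by rw [hu]; exact (contDiffAt_comp_chart_symm hcat hx (hρ x)).differentiableAt (by simp))
  have h3 : ∀ a, covCoord (confGamma (inChart ψ σ)) (mapInCharts c ψ (Φ 0))
      (fieldInCharts c ψ (Φ 0) (varField Φ)) a u = covCoord (confGamma (inChart ψ σ))
        (varMap p ψ Φ) (fun z => fderiv ℝ (varMap p ψ Φ) z (1, 0)) (0, a) (0, u) := fun a => by
    rw [covCoord_congr hVe, ← covCoord_slice hfd hVd]
    rfl
  have h4 : ∀ a, covCoord (confGamma (inChart ψ σ)) (mapInCharts c ψ (Φ 0))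
      (fieldInCharts c ψ (Φ 0) (tension g h (Φ 0))) a u = covCoord (confGamma (inChart ψ σ))
        (varMap p ψ Φ) (varTension g h p ψ Φ) (0, a) (0, u) := fun a => by
    rw [← covCoord_slice hfd hτd]
    rfl
  have hfu : ψ (Φ 0 x) = varMap p ψ Φ (0, u) := by
    rw [hu]; exact (mapInCharts_apply hx).symm
  have hτu : mvfderiv (𝓡 n) ψ (Φ 0 x) (tension g h (Φ 0) x) = varTension g h p ψ Φ (0, u) := by
    rw [hu]; exact (fieldInCharts_apply _ hx).symm
  have hVu : mvfderiv (𝓡 n) ψ (Φ 0 x) (varField Φ x) = fderiv ℝ (varMap p ψ Φ) (0, u) (1, 0) := by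
    rw [← hVe.eq_of_nhds, hu]; exact (fieldInCharts_apply _ hx).symm
  rw [varPairing, hc.inner_eq_confMetric hφx, hc.inner_eq_confMetric hφx, h1, h2, ← hu, hg,
    covCoord_raise, covCoord_raise, hfu, hτu, hVu]
  simp only [h3, h4, varCurrent, map_sum, map_smul, sum_apply, smul_apply, smul_eq_mul,
    Finset.mul_sum, ← Finset.sum_sub_distrib, mul_sub]
  refine Finset.sum_congr rfl fun i _ => Finset.sum_congr rfl fun j _ => by ring

/-- By the product rule div(ρX) is ρ div X plus X paired with dρ. The first variation formula
supplies ρ div X, and `varPairing` the other term. -/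
theorem volDensity_mul_weakDensity (hc : IsConformallyFlatChart h ψ σ)
    (hΦ : ContMDiff (𝓘(ℝ, ℝ).prod (𝓡 m)) (𝓡 n) ∞ (fun p : ℝ × M => Φ p.1 p.2))
    {x : M} (hx : x ∈ (chartAt (EuclideanSpace ℝ (Fin m)) p).source) (hφx : Φ 0 x ∈ ψ.source)
    {ρ : M → ℝ} (hρ : ContMDiff (𝓡 m) 𝓘(ℝ, ℝ) ∞ ρ) {u : EuclideanSpace ℝ (Fin m)}
    (hu : u = chartAt (EuclideanSpace ℝ (Fin m)) p x) :
    volDensity g p u * weakDensity g h Φ ρ x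
      = ∑ i, fderiv ℝ (fun u => ρ ((chartAt (EuclideanSpace ℝ (Fin m)) p).symm u)
          * varCurrent g h p ψ σ Φ i (0, u)) u (EuclideanSpace.single i 1)
        + ρ x * chartBitension g h p ψ σ (Φ 0) u (fderiv ℝ (varMap p ψ Φ) (0, u) (1, 0)) := by
  have hz : ((0 : ℝ), u) ∈ varDomain p ψ Φ := hu ▸ mem_varDomain hx hφx
  have h1 : volDensity g p u * fderiv ℝ (varDensityInCharts g h p ψ σ Φ) (0, u) (1, 0)
      = ∑ i, fderiv ℝ (fun u => varCurrent g h p ψ σ Φ i (0, u)) u (EuclideanSpace.single i 1)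
        + chartBitension g h p ψ σ (Φ 0) u (fderiv ℝ (varMap p ψ Φ) (0, u) (1, 0)) :=
    hc.volDensity_mul_fderiv_varDensity hΦ hz
  have h2 := hc.volDensity_mul_varPairing (g := g) hΦ hx hφx hρ hu
  have h3 := (hc.hasDerivAt_varDensity (g := g) hΦ hx hφx).deriv
  have hρd : DifferentiableAt ℝ
      (fun u => ρ ((chartAt (EuclideanSpace ℝ (Fin m)) p).symm u)) u := by
    rw [hu]
    exact (contDiffAt_comp_chart_symm (chart_mem_maximalAtlas p) hx (hρ x)).differentiableAt
      (by simp)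
  have hρu : ρ ((chartAt (EuclideanSpace ℝ (Fin m)) p).symm u) = ρ x := by
    rw [hu, (chartAt (EuclideanSpace ℝ (Fin m)) p).left_inv hx]
  have h4 : ∀ i, fderiv ℝ (fun u => ρ ((chartAt (EuclideanSpace ℝ (Fin m)) p).symm u)
      * varCurrent g h p ψ σ Φ i (0, u)) u (EuclideanSpace.single i 1)
      = ρ x * fderiv ℝ (fun u => varCurrent g h p ψ σ Φ i (0, u)) u (EuclideanSpace.single i 1)
        + fderiv ℝ (fun u => ρ ((chartAt (EuclideanSpace ℝ (Fin m)) p).symm u)) u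
          (EuclideanSpace.single i 1) * varCurrent g h p ψ σ Φ i (0, u) := by
    intro i
    have hXd : DifferentiableAt ℝ (fun u => varCurrent g h p ψ σ Φ i (0, u)) u :=
      (contDiffAt_slice (hc.contDiffAt_varCurrent hΦ hz i)).differentiableAt (by simp)
    rw [fderiv_fun_mul hρd hXd, hρu]
    simp only [add_apply, smul_apply, smul_eq_mul]
    ring
  rw [weakDensity, h3, mul_add, h2, Finset.sum_congr rfl fun i _ => h4 i, Finset.sum_add_distrib,
    ← Finset.mul_sum, ← hu]
  linear_combination ρ x * h1

end IsConformallyFlatChart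

theorem weakDensity_of_notMem {ρ : M → ℝ} {x : M} (hx : x ∉ tsupport ρ) :
    weakDensity g h Φ ρ x = 0 := by
  have h1 : ρ =ᶠ[nhds x] fun _ => 0 := notMem_tsupport_iff_eventuallyEq.1 hx
  have h2 : grad g ρ x = 0 := by
    refine eq_of_inner_eq g fun z => ?_
    have h3 : mvfderiv (𝓡 m) ρ x = 0 := by
      rw [mvfderiv, h1.mfderiv_eq]
      exact mvfderiv_const (0 : ℝ)
    rw [grad, inner_sharp, h3, map_zero]
  rw [weakDensity, h1.eq_of_nhds, h2, varPairing_zero]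
  ring

/-- Continuity gives the measurability and the integrability over Ω used when integrals are split.
-/
theorem continuous_weakDensity
    (hcov : ∀ q : N, ∃ (ψ : OpenPartialHomeomorph N (EuclideanSpace ℝ (Fin n))) (σ : N → ℝ),
      IsConformallyFlatChart h ψ σ ∧ q ∈ ψ.source)
    (hΦ : ContMDiff (𝓘(ℝ, ℝ).prod (𝓡 m)) (𝓡 n) ∞ (fun p : ℝ × M => Φ p.1 p.2))
    {ρ : M → ℝ} (hρ : ContMDiff (𝓡 m) 𝓘(ℝ, ℝ) ∞ ρ) : Continuous (weakDensity g h Φ ρ) := by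
  refine (hρ.continuous.mul ((continuous_deriv_varDensity hcov hΦ).comp
    (Continuous.prodMk_right 0))).add ?_
  rw [continuous_iff_continuousAt]
  intro x
  obtain ⟨ψ, σ, hc, hq⟩ := hcov (Φ 0 x)
  set c := chartAt (EuclideanSpace ℝ (Fin m)) x with hcd
  have hx : x ∈ c.source := mem_chart_source _ x
  have hz : ((0 : ℝ), c x) ∈ varDomain x ψ Φ := mem_varDomain hx hq
  have h1 : ContinuousAt (fun u => (volDensity g x u)⁻¹ * ∑ i, fderiv ℝ
      (fun u => ρ (c.symm u)) u (EuclideanSpace.single i 1) * varCurrent g h x ψ σ Φ i (0, u))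
      (c x) := by
    refine ContDiffAt.continuousAt (𝕜 := ℝ) (n := ∞) ?_
    refine ((contDiffAt_volDensity g (c.map_source hx)).inv
      (volDensity_pos g (c.map_source hx)).ne').mul (ContDiffAt.sum fun i _ => ?_)
    exact (contDiffAt_fderiv_apply (contDiffAt_comp_chart_symm (chart_mem_maximalAtlas x) hx
      (hρ x)) _).mul (contDiffAt_slice (hc.contDiffAt_varCurrent hΦ hz i))
  refine (ContinuousAt.comp (f := c) h1 (c.continuousAt hx)).congr_of_eventuallyEq ?_
  filter_upwards [c.open_source.mem_nhds hx,
    (contMDiff_variation_slice hΦ 0).continuous.continuousAt.eventually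
      (ψ.open_source.mem_nhds hq)] with y hy1 hy2
  have h2 := hc.volDensity_mul_varPairing (g := g) hΦ hy1 hy2 hρ rfl
  simp only [Function.comp]
  rw [← h2, inv_mul_cancel_left₀ (volDensity_pos g (c.map_source hy1)).ne']

end Pairing

/-! ### The integrated first variation formula -/

section FirstVariation

variable {m n : ℕ} {M N : Type*} [TopologicalSpace M] [TopologicalSpace N]
  [ChartedSpace (EuclideanSpace ℝ (Fin m)) M] [IsManifold (𝓡 m) ∞ M]
  [ChartedSpace (EuclideanSpace ℝ (Fin n)) N] [IsManifold (𝓡 n) ∞ N]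
  {g : SmoothMetric m M} {h : SmoothMetric n N}
  {ψ : OpenPartialHomeomorph N (EuclideanSpace ℝ (Fin n))} {σ : N → ℝ} {Φ : ℝ → M → N} {p : M}

/-- The Euler-Lagrange form of the bienergy applied to the variation field, in charts. -/
def varBitension (g : SmoothMetric m M) (h : SmoothMetric n N) (p : M)
    (ψ : OpenPartialHomeomorph N (EuclideanSpace ℝ (Fin n))) (σ : N → ℝ) (Φ : ℝ → M → N)
    (u : EuclideanSpace ℝ (Fin m)) : ℝ :=
  chartBitension g h p ψ σ (Φ 0) u (fderiv ℝ (varMap p ψ Φ) (0, u) (1, 0))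

theorem chartBitension_smul (φ : M → N) (u : EuclideanSpace ℝ (Fin m)) (r : ℝ)
    (v : EuclideanSpace ℝ (Fin n)) :
    chartBitension g h p ψ σ φ u (r • v) = r * chartBitension g h p ψ σ φ u v :=
  bitensionForm_smul _ _ _

theorem chartBitension_zero (φ : M → N) (u : EuclideanSpace ℝ (Fin m)) :
    chartBitension g h p ψ σ φ u 0 = 0 := by
  have h1 := chartBitension_smul (g := g) (h := h) (p := p) (ψ := ψ) (σ := σ) φ u 0 0
  rwa [zero_smul, zero_mul] at h1

theorem fderiv_varMap_eq_zero
    (hΦ : ContMDiff (𝓘(ℝ, ℝ).prod (𝓡 m)) (𝓡 n) ∞ (fun p : ℝ × M => Φ p.1 p.2))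
    (hψ : ψ ∈ IsManifold.maximalAtlas (𝓡 n) ∞ N) {z : ℝ × EuclideanSpace ℝ (Fin m)}
    (hz : z ∈ varDomain p ψ Φ)
    (hoff : ∀ t, Φ t ((chartAt (EuclideanSpace ℝ (Fin m)) p).symm z.2)
      = Φ 0 ((chartAt (EuclideanSpace ℝ (Fin m)) p).symm z.2)) :
    fderiv ℝ (varMap p ψ Φ) z (1, 0) = 0 := by
  obtain ⟨t, u⟩ := z
  have h1 := hasDerivAt_slice ((contDiffAt_varMap hΦ hψ hz).differentiableAt (by simp))
  have h2 : (fun t => varMap p ψ Φ (t, u)) = fun _ => varMap p ψ Φ (0, u) := by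
    funext t
    simp only [varMap, mapInCharts]
    rw [hoff t]
  rw [h2] at h1
  exact h1.unique (hasDerivAt_const t _)

/-- The complement of Ω is open, so the variation field vanishes near the point and not just at it.
Hence its covariant derivatives in the current vanish as well. -/
theorem eventually_fderiv_varMap_eq_zero
    (hΦ : ContMDiff (𝓘(ℝ, ℝ).prod (𝓡 m)) (𝓡 n) ∞ (fun p : ℝ × M => Φ p.1 p.2))
    (hψ : ψ ∈ IsManifold.maximalAtlas (𝓡 n) ∞ N) {u : EuclideanSpace ℝ (Fin m)}
    (hz : ((0 : ℝ), u) ∈ varDomain p ψ Φ) {Ω : Set M} (hΩ : IsClosed Ω)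
    (hoff : ∀ t, ∀ x ∉ Ω, Φ t x = Φ 0 x)
    (hu : (chartAt (EuclideanSpace ℝ (Fin m)) p).symm u ∉ Ω) :
    (fun z => fderiv ℝ (varMap p ψ Φ) z (1, 0)) =ᶠ[nhds ((0 : ℝ), u)] fun _ => 0 := by
  have h1 : ContinuousAt (fun z : ℝ × EuclideanSpace ℝ (Fin m) =>
      (chartAt (EuclideanSpace ℝ (Fin m)) p).symm z.2) ((0 : ℝ), u) :=
    ContinuousAt.comp (f := Prod.snd) (x := ((0 : ℝ), u))
      ((chartAt (EuclideanSpace ℝ (Fin m)) p).continuousAt_symm hz.1) continuousAt_snd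
  filter_upwards [(isOpen_varDomain hΦ).mem_nhds hz,
    h1.eventually (hΩ.isOpen_compl.mem_nhds hu)] with z hz1 hz2
  exact fderiv_varMap_eq_zero hΦ hψ hz1 fun t => hoff t _ hz2

theorem varCurrent_eq_zero {u : EuclideanSpace ℝ (Fin m)}
    (hV : (fun z => fderiv ℝ (varMap p ψ Φ) z (1, 0)) =ᶠ[nhds ((0 : ℝ), u)] fun _ => 0)
    (i : Fin m) : varCurrent g h p ψ σ Φ i (0, u) = 0 := by
  refine Finset.sum_eq_zero fun j _ => ?_
  rw [covCoord_congr hV, hV.eq_of_nhds]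
  simp [covCoord]

theorem varBitension_eq_zero {u : EuclideanSpace ℝ (Fin m)}
    (hV : (fun z => fderiv ℝ (varMap p ψ Φ) z (1, 0)) =ᶠ[nhds ((0 : ℝ), u)] fun _ => 0) :
    varBitension g h p ψ σ Φ u = 0 := by
  rw [varBitension, hV.eq_of_nhds, chartBitension_zero]

/-- By the first variation formula this function is the derivative of the density minus a
divergence, both visibly smooth. -/
theorem IsConformallyFlatChart.contDiffAt_varBitension (hc : IsConformallyFlatChart h ψ σ)
    (hΦ : ContMDiff (𝓘(ℝ, ℝ).prod (𝓡 m)) (𝓡 n) ∞ (fun p : ℝ × M => Φ p.1 p.2))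
    {u : EuclideanSpace ℝ (Fin m)} (hz : ((0 : ℝ), u) ∈ varDomain p ψ Φ) :
    ContDiffAt ℝ ∞ (varBitension g h p ψ σ Φ) u := by
  have hOt : ∀ᶠ u' in nhds u, ((0 : ℝ), u') ∈ varDomain p ψ Φ :=
    (Continuous.prodMk_right 0).continuousAt.eventually ((isOpen_varDomain hΦ).mem_nhds hz)
  have h1 : varBitension g h p ψ σ Φ =ᶠ[nhds u] fun u => volDensity g p u
        * fderiv ℝ (varDensityInCharts g h p ψ σ Φ) (0, u) (1, 0)
      - ∑ i, fderiv ℝ (fun u => varCurrent g h p ψ σ Φ i (0, u)) u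
          (EuclideanSpace.single i 1) := by
    filter_upwards [hOt] with u hu
    have h2 : volDensity g p u * fderiv ℝ (varDensityInCharts g h p ψ σ Φ) (0, u) (1, 0) = _ :=
      hc.volDensity_mul_fderiv_varDensity hΦ hu
    rw [h2, add_sub_cancel_left]
    rfl
  refine ContDiffAt.congr_of_eventuallyEq ?_ h1
  refine ((contDiffAt_volDensity g hz.1).mul (contDiffAt_slice (contDiffAt_fderiv_apply
    (hc.contDiffAt_varDensityInCharts hΦ hz) _))).sub (ContDiffAt.sum fun i _ => ?_)
  exact contDiffAt_fderiv_apply (contDiffAt_slice (hc.contDiffAt_varCurrent hΦ hz i)) _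

/-- The sum has a critical point at a local maximum. -/
theorem sum_grad_eq_zero {J : Type*} [Fintype J] {ρ : J → M → ℝ}
    (hρ : ∀ j, ContMDiff (𝓡 m) 𝓘(ℝ, ℝ) ∞ (ρ j)) {x : M}
    (hmax : IsLocalMax (fun y => ∑ j, ρ j y) x) : ∑ j, grad g (ρ j) x = 0 := by
  set c := chartAt (EuclideanSpace ℝ (Fin m)) x
  have hx : x ∈ c.source := mem_chart_source _ x
  have hcat : c ∈ IsManifold.maximalAtlas (𝓡 m) ∞ M := chart_mem_maximalAtlas x
  have hd : ∀ j, DifferentiableAt ℝ (fun u => ρ j (c.symm u)) (c x) := fun j =>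
    (contDiffAt_comp_chart_symm hcat hx (hρ j x)).differentiableAt (by simp)
  have h1 : IsLocalMax (fun u => ∑ j, ρ j (c.symm u)) (c x) := by
    have h2 : Filter.Tendsto c.symm (nhds (c x)) (nhds x) := by
      have h3 := c.continuousAt_symm (c.map_source hx)
      rwa [ContinuousAt, c.left_inv hx] at h3
    filter_upwards [h2.eventually hmax] with u hu
    rwa [c.left_inv hx]
  have h4 := h1.fderiv_eq_zero
  rw [fderiv_fun_sum fun j _ => hd j] at h4
  refine eq_of_inner_eq g fun z => ?_
  rw [map_sum, map_zero, sum_apply, zero_apply]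
  have h5 : ∀ j, g.inner x (grad g (ρ j) x) z
      = fderiv ℝ (fun u => ρ j (c.symm u)) (c x) (mvfderiv (𝓡 m) c x z) := fun j => by
    rw [grad, inner_sharp, mvfderiv_eq_fderiv_chart hcat hx (hd j)]
  rw [Finset.sum_congr rfl fun j _ => h5 j, ← sum_apply, h4, zero_apply]

variable [T2Space M] [SecondCountableTopology M] [MeasurableSpace M] [BorelSpace M]

/-- Integration by parts of the tested first variation of the bienergy density. -/
theorem IsConformallyFlatChart.setIntegral_weakDensity (hc : IsConformallyFlatChart h ψ σ)
    (hcov : ∀ q : N, ∃ (ψ : OpenPartialHomeomorph N (EuclideanSpace ℝ (Fin n))) (σ : N → ℝ),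
      IsConformallyFlatChart h ψ σ ∧ q ∈ ψ.source)
    (hΦ : ContMDiff (𝓘(ℝ, ℝ).prod (𝓡 m)) (𝓡 n) ∞ (fun p : ℝ × M => Φ p.1 p.2))
    {Ω : Set M} (hΩ : IsCompact Ω) (hoff : ∀ t, ∀ x ∉ Ω, Φ t x = Φ 0 x)
    {ρ : M → ℝ} (hρ : ContMDiff (𝓡 m) 𝓘(ℝ, ℝ) ∞ ρ)
    (hsub : tsupport ρ ⊆ (chartAt (EuclideanSpace ℝ (Fin m)) p).source ∩ Φ 0 ⁻¹' ψ.source) :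
    ∫ x in Ω, weakDensity g h Φ ρ x ∂(riemannianVolume g)
      = ∫ u, (chartDomain p ψ (Φ 0)).indicator (fun u =>
          ρ ((chartAt (EuclideanSpace ℝ (Fin m)) p).symm u) * varBitension g h p ψ σ Φ u) u := by
  set c := chartAt (EuclideanSpace ℝ (Fin m)) p with hcd
  set O := chartDomain (m := m) p ψ (Φ 0) with hOd
  have hO : IsOpen O := isOpen_chartDomain p (contMDiff_variation_slice hΦ 0).continuous
  have hOz : ∀ u ∈ O, ((0 : ℝ), u) ∈ varDomain p ψ Φ := fun u hu => hu
  -- Only the part of Ω in the support of ρ matters: off Ω the variation is constant, off the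
  -- support the cutoff is zero. Its image K is compact inside the chart domain, so both products
  -- below extend smoothly by zero.
  set K := c '' (tsupport ρ ∩ Ω) with hKd
  have hK : IsCompact K := (hΩ.inter_left (isClosed_tsupport ρ)).image_of_continuousOn
    (c.continuousOn.mono fun x hx => (hsub hx.1).1)
  have hKO : K ⊆ O := by
    rintro _ ⟨x, hx, rfl⟩
    refine ⟨c.map_source (hsub hx.1).1, ?_⟩
    rw [← hcd, c.left_inv (hsub hx.1).1]
    exact (hsub hx.1).2
  have hout : ∀ u ∈ O, u ∉ K → c.symm u ∉ tsupport ρ ∨ c.symm u ∉ Ω := by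
    intro u hu huK
    by_contra hcon
    rw [not_or, not_not, not_not] at hcon
    exact huK ⟨c.symm u, hcon, c.right_inv hu.1⟩
  have hρs : ∀ u ∈ O, ContDiffAt ℝ ∞ (fun u => ρ (c.symm u)) u := by
    intro u hu
    have h1 := contDiffAt_comp_chart_symm (chart_mem_maximalAtlas p) (c.map_target hu.1)
      (hρ (c.symm u))
    rwa [← hcd, c.right_inv hu.1] at h1
  have hV0 : ∀ u ∈ O, c.symm u ∉ Ω →
      (fun z => fderiv ℝ (varMap p ψ Φ) z (1, 0)) =ᶠ[nhds ((0 : ℝ), u)] fun _ => 0 :=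
    fun u hu huΩ => eventually_fderiv_varMap_eq_zero hΦ hc.mem_maximalAtlas (hOz u hu)
      hΩ.isClosed hoff huΩ
  have hY : ∀ i, ContDiff ℝ ∞
        (O.indicator fun u => ρ (c.symm u) * varCurrent g h p ψ σ Φ i (0, u))
      ∧ HasCompactSupport
        (O.indicator fun u => ρ (c.symm u) * varCurrent g h p ψ σ Φ i (0, u)) := by
    refine fun i => contDiff_indicator hO hK hKO (fun u hu => (hρs u hu).mul
      (contDiffAt_slice (hc.contDiffAt_varCurrent hΦ (hOz u hu) i))) fun u hu huK => ?_
    rcases hout u hu huK with h1 | h1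
    · rw [image_eq_zero_of_notMem_tsupport h1, zero_mul]
    · rw [varCurrent_eq_zero (hV0 u hu h1), mul_zero]
  have hQ : ContDiff ℝ ∞ (O.indicator fun u => ρ (c.symm u) * varBitension g h p ψ σ Φ u)
      ∧ HasCompactSupport (O.indicator fun u => ρ (c.symm u) * varBitension g h p ψ σ Φ u) := by
    refine contDiff_indicator hO hK hKO (fun u hu => (hρs u hu).mul
      (hc.contDiffAt_varBitension hΦ (hOz u hu))) fun u hu huK => ?_
    rcases hout u hu huK with h1 | h1
    · rw [image_eq_zero_of_notMem_tsupport h1, zero_mul]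
    · rw [varBitension_eq_zero (hV0 u hu h1), mul_zero]
  -- The identity must hold at all points, including the boundary of Ω, which may have positive
  -- measure. On K it is the chart formula for the tested density; off K every term vanishes in a
  -- neighbourhood or through an indicator.
  have hpt : ∀ u, c.target.indicator
        (fun u => volDensity g p u * Ω.indicator (weakDensity g h Φ ρ) (c.symm u)) u
      = ∑ i, fderiv ℝ (O.indicator fun u => ρ (c.symm u) * varCurrent g h p ψ σ Φ i (0, u)) u
          (EuclideanSpace.single i 1)
        + O.indicator (fun u => ρ (c.symm u) * varBitension g h p ψ σ Φ u) u := by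
    intro u
    by_cases huK : u ∈ K
    · have huO := hKO huK
      have hxΩ : c.symm u ∈ Ω := by
        obtain ⟨x, hx, rfl⟩ := huK
        rw [c.left_inv (hsub hx.1).1]
        exact hx.2
      rw [Set.indicator_of_mem huO.1, Set.indicator_of_mem huO, Set.indicator_of_mem hxΩ]
      have h1 : ∀ i, (O.indicator fun u => ρ (c.symm u) * varCurrent g h p ψ σ Φ i (0, u))
          =ᶠ[nhds u] fun u => ρ (c.symm u) * varCurrent g h p ψ σ Φ i (0, u) := by
        intro i
        filter_upwards [hO.mem_nhds huO] with v hv using Set.indicator_of_mem hv _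
      rw [Finset.sum_congr rfl fun i _ => show fderiv ℝ (O.indicator fun u => ρ (c.symm u)
          * varCurrent g h p ψ σ Φ i (0, u)) u (EuclideanSpace.single i 1) = _ by
        rw [(h1 i).fderiv_eq]]
      exact hc.volDensity_mul_weakDensity hΦ (c.map_target huO.1) huO.2 hρ
        (c.right_inv huO.1).symm
    · have h0 : ∀ X : EuclideanSpace ℝ (Fin m) → ℝ, (∀ v ∈ O, v ∉ K → X v = 0) →
          O.indicator X =ᶠ[nhds u] fun _ => 0 := by
        intro X hX
        filter_upwards [hK.isClosed.isOpen_compl.mem_nhds huK] with v hv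
        by_cases hvO : v ∈ O
        · rw [Set.indicator_of_mem hvO, hX v hvO hv]
        · exact Set.indicator_of_notMem hvO _
      have h1 : ∀ i, (O.indicator fun u => ρ (c.symm u) * varCurrent g h p ψ σ Φ i (0, u))
          =ᶠ[nhds u] fun _ => 0 := by
        refine fun i => h0 _ fun v hv hvK => ?_
        rcases hout v hv hvK with h1 | h1
        · rw [image_eq_zero_of_notMem_tsupport h1, zero_mul]
        · rw [varCurrent_eq_zero (hV0 v hv h1), mul_zero]
      have h2 : (O.indicator fun u => ρ (c.symm u) * varBitension g h p ψ σ Φ u)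
          =ᶠ[nhds u] fun _ => 0 := by
        refine h0 _ fun v hv hvK => ?_
        rcases hout v hv hvK with h1 | h1
        · rw [image_eq_zero_of_notMem_tsupport h1, zero_mul]
        · rw [varBitension_eq_zero (hV0 v hv h1), mul_zero]
      rw [h2.eq_of_nhds, Finset.sum_eq_zero fun i _ => show fderiv ℝ (O.indicator fun u =>
          ρ (c.symm u) * varCurrent g h p ψ σ Φ i (0, u)) u (EuclideanSpace.single i 1) = 0 by
        rw [(h1 i).fderiv_eq]; simp]
      by_cases hut : u ∈ c.target
      · rw [Set.indicator_of_mem hut]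
        by_cases hxΩ : c.symm u ∈ Ω
        · have h3 : c.symm u ∉ tsupport ρ := fun h3 =>
            huK ⟨c.symm u, ⟨h3, hxΩ⟩, c.right_inv hut⟩
          rw [Set.indicator_of_mem hxΩ, weakDensity_of_notMem h3]
          simp
        · rw [Set.indicator_of_notMem hxΩ]
          simp
      · rw [Set.indicator_of_notMem hut]
        simp
  have hmeas : Measurable (Ω.indicator (weakDensity g h Φ ρ)) :=
    (continuous_weakDensity hcov hΦ hρ).measurable.indicator hΩ.isClosed.measurableSet
  calc ∫ x in Ω, weakDensity g h Φ ρ x ∂(riemannianVolume g)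
      = ∫ x, Ω.indicator (weakDensity g h Φ ρ) x ∂(riemannianVolume g) :=
        (integral_indicator hΩ.isClosed.measurableSet).symm
    _ = ∫ x in c.source, Ω.indicator (weakDensity g h Φ ρ) x ∂(riemannianVolume g) := by
        refine (setIntegral_eq_integral_of_forall_compl_eq_zero fun x hx => ?_).symm
        by_cases hxΩ : x ∈ Ω
        · rw [Set.indicator_of_mem hxΩ]
          exact weakDensity_of_notMem fun h1 => hx (hsub h1).1
        · exact Set.indicator_of_notMem hxΩ _
    _ = ∫ u in c.target, volDensity g p u
          * Ω.indicator (weakDensity g h Φ ρ) (c.symm u) := setIntegral_riemannianVolume g p hmeas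
    _ = ∫ u, (∑ i, fderiv ℝ (O.indicator fun u => ρ (c.symm u)
          * varCurrent g h p ψ σ Φ i (0, u)) u (EuclideanSpace.single i 1)
        + O.indicator (fun u => ρ (c.symm u) * varBitension g h p ψ σ Φ u) u) := by
        rw [← integral_indicator c.open_target.measurableSet]
        exact integral_congr_ae (Filter.Eventually.of_forall hpt)
    _ = _ := by
        rw [integral_add (integrable_finsetSum _ fun i _ =>
          (integral_fderiv_eq_zero (hY i).1 (hY i).2 _).1)
          (hQ.1.continuous.integrable_of_hasCompactSupport hQ.2),
          integral_finsetSum _ fun i _ => (integral_fderiv_eq_zero (hY i).1 (hY i).2 _).1,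
          Finset.sum_eq_zero fun i _ => (integral_fderiv_eq_zero (hY i).1 (hY i).2 _).2, zero_add]

/-- The first variation of the bienergy, localised by a finite partition of unity. -/
theorem setIntegral_deriv_varDensity {J : Type*} [Fintype J] {p : J → M}
    {ψ : J → OpenPartialHomeomorph N (EuclideanSpace ℝ (Fin n))} {σ : J → N → ℝ}
    (hc : ∀ j, IsConformallyFlatChart h (ψ j) (σ j))
    (hcov : ∀ q : N, ∃ (ψ : OpenPartialHomeomorph N (EuclideanSpace ℝ (Fin n))) (σ : N → ℝ),
      IsConformallyFlatChart h ψ σ ∧ q ∈ ψ.source)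
    (hΦ : ContMDiff (𝓘(ℝ, ℝ).prod (𝓡 m)) (𝓡 n) ∞ (fun p : ℝ × M => Φ p.1 p.2))
    {Ω : Set M} (hΩ : IsCompact Ω) (hoff : ∀ t, ∀ x ∉ Ω, Φ t x = Φ 0 x)
    {ρ : J → M → ℝ} (hρ : ∀ j, ContMDiff (𝓡 m) 𝓘(ℝ, ℝ) ∞ (ρ j))
    (hsub : ∀ j, tsupport (ρ j)
      ⊆ (chartAt (EuclideanSpace ℝ (Fin m)) (p j)).source ∩ Φ 0 ⁻¹' (ψ j).source)
    (hone : ∀ x ∈ Ω, ∑ j, ρ j x = 1) (hle : ∀ x, ∑ j, ρ j x ≤ 1) :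
    ∫ x in Ω, deriv (fun t => varDensity g h Φ t x) 0 ∂(riemannianVolume g)
      = ∑ j, ∫ u, (chartDomain (p j) (ψ j) (Φ 0)).indicator (fun u =>
          ρ j ((chartAt (EuclideanSpace ℝ (Fin m)) (p j)).symm u)
            * varBitension g h (p j) (ψ j) (σ j) Φ u) u := by
  simp only [← (hc _).setIntegral_weakDensity (g := g) hcov hΦ hΩ hoff (hρ _) (hsub _)]
  rw [← integral_finsetSum _ fun j _ =>
    (continuous_weakDensity hcov hΦ (hρ j)).continuousOn.integrableOn_compact hΩ]
  refine setIntegral_congr_fun hΩ.isClosed.measurableSet fun x hx => ?_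
  -- The sum of the cutoffs is 1 at each point of Ω, which is its maximum, so the gradients cancel
  -- even at boundary points of Ω.
  have hmax : IsLocalMax (fun y => ∑ j, ρ j y) x :=
    Filter.Eventually.of_forall fun y => (hle y).trans (hone x hx).ge
  simp only [weakDensity]
  rw [Finset.sum_add_distrib, ← Finset.sum_mul, hone x hx, ← varPairing_sum,
    sum_grad_eq_zero hρ hmax, varPairing_zero, one_mul, add_zero]

end FirstVariation

theorem contDiffAt_bitensionForm {Z F ι : Type*} [NormedAddCommGroup Z] [NormedSpace ℝ Z]
    [NormedAddCommGroup F] [NormedSpace ℝ F] [Fintype ι] {Γ : F → F →L[ℝ] F →L[ℝ] F}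
    {B : F → F →L[ℝ] F →L[ℝ] ℝ} {f τ : Z → F} {P : ι → ι → Z → ℝ} {e : ι → Z} {z : Z}
    (hΓ : ContDiffAt ℝ ∞ Γ (f z)) (hB : ContDiffAt ℝ ∞ B (f z)) (hf : ContDiffAt ℝ ∞ f z)
    (hτ : ContDiffAt ℝ ∞ τ z) (hP : ∀ i j, ContDiffAt ℝ ∞ (P i j) z) (v : F) :
    ContDiffAt ℝ ∞ (fun z => bitensionForm Γ B f τ P e z v) z := by
  have hBf := hB.comp z hf
  have hΓf := hΓ.comp z hf
  have hdΓ : ContDiffAt ℝ ∞ (fun z => fderiv ℝ Γ (f z)) z :=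
    (hΓ.fderiv_right (m := ∞) (by simp)).comp z hf
  have hv : ContDiffAt ℝ ∞ (fun _ : Z => v) z := contDiffAt_const
  refine ((hBf.clm_apply hv).clm_apply (ContDiffAt.sum fun i _ => contDiffAt_covCoord hΓ hf
    (ContDiffAt.sum fun j _ => (hP i j).smul (contDiffAt_covCoord hΓ hf hτ _)) _)).add
    (ContDiffAt.sum fun i _ => ContDiffAt.sum fun j _ => (hP i j).mul
      ((hBf.clm_apply ?_).clm_apply hτ))
  have hi := contDiffAt_fderiv_apply hf (e i)
  have hj := contDiffAt_fderiv_apply hf (e j)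
  exact ((((((hdΓ.clm_apply hv).clm_apply hi).clm_apply hj).sub
    (((hdΓ.clm_apply hi).clm_apply hv).clm_apply hj)).add
    ((hΓf.clm_apply hv).clm_apply ((hΓf.clm_apply hi).clm_apply hj))).sub
    ((hΓf.clm_apply hi).clm_apply ((hΓf.clm_apply hv).clm_apply hj)))

/-! ### Biharmonicity and vanishing of the Euler-Lagrange form -/

section Biharmonic

variable {m n : ℕ} {M N : Type*} [TopologicalSpace M] [TopologicalSpace N]
  [ChartedSpace (EuclideanSpace ℝ (Fin m)) M] [IsManifold (𝓡 m) ∞ M]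
  [ChartedSpace (EuclideanSpace ℝ (Fin n)) N] [IsManifold (𝓡 n) ∞ N]
  {g : SmoothMetric m M} {h : SmoothMetric n N}
  {ψ : OpenPartialHomeomorph N (EuclideanSpace ℝ (Fin n))} {σ : N → ℝ} {φ : M → N} {p : M}

theorem IsConformallyFlatChart.contDiffAt_chartBitension (hc : IsConformallyFlatChart h ψ σ)
    (hφ : ContMDiff (𝓡 m) (𝓡 n) ∞ φ) {u : EuclideanSpace ℝ (Fin m)}
    (hu : u ∈ chartDomain p ψ φ) (a : EuclideanSpace ℝ (Fin n)) :
    ContDiffAt ℝ ∞ (fun u => chartBitension g h p ψ σ φ u a) u :=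
  contDiffAt_bitensionForm (contDiffAt_confGamma (hc.contDiffAt_factor_of_mem hu))
    (contDiffAt_confMetric (hc.contDiffAt_factor_of_mem hu))
    (contDiffAt_mapInCharts_of_mem hc.mem_maximalAtlas hφ hu)
    (hc.contDiffAt_tension g hφ hu)
    (fun i j => (contDiffAt_volDensity g hu.1).mul (contDiffAt_gramInv g hu.1 i j)) a

/-- Within the chart ψ the map is moved by δ sin(t) χ a. Variations are indexed by all real t, so
sin is used in place of t to keep the displacement bounded, while its derivative at 0 is still 1. -/
theorem exists_variation [T2Space M] (hψ : ψ ∈ IsManifold.maximalAtlas (𝓡 n) ∞ N)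
    (hφ : ContMDiff (𝓡 m) (𝓡 n) ∞ φ) {χ : EuclideanSpace ℝ (Fin m) → ℝ} (hχ : ContDiff ℝ ∞ χ)
    (hχc : HasCompactSupport χ) (hχs : tsupport χ ⊆ chartDomain p ψ φ)
    (a : EuclideanSpace ℝ (Fin n)) :
    ∃ δ : ℝ, 0 < δ ∧ ∃ Φ : ℝ → M → N,
      ContMDiff (𝓘(ℝ, ℝ).prod (𝓡 m)) (𝓡 n) ∞ (fun p : ℝ × M => Φ p.1 p.2) ∧ Φ 0 = φ
      ∧ (∀ t, ∀ x ∉ (chartAt (EuclideanSpace ℝ (Fin m)) p).symm '' tsupport χ, Φ t x = φ x)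
      ∧ ∀ u ∈ chartDomain p ψ φ, fderiv ℝ (varMap p ψ Φ) (0, u) (1, 0) = (δ * χ u) • a := by
  classical
  set c := chartAt (EuclideanSpace ℝ (Fin m)) p with hcd
  set f := mapInCharts c ψ φ with hfd
  have hcat : c ∈ IsManifold.maximalAtlas (𝓡 m) ∞ M := chart_mem_maximalAtlas p
  have hfs : ∀ u ∈ chartDomain p ψ φ, ContDiffAt ℝ ∞ f u := fun u hu =>
    contDiffAt_mapInCharts_of_mem hψ hφ hu
  have hft : f '' tsupport χ ⊆ ψ.target := by
    rintro _ ⟨u, hu, rfl⟩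
    exact ψ.map_source (hχs hu).2
  have hfK : IsCompact (f '' tsupport χ) := hχc.isCompact.image_of_continuousOn fun u hu =>
    (hfs u (hχs hu)).continuousAt.continuousWithinAt
  obtain ⟨ε, hε, hεt⟩ := hfK.exists_cthickening_subset_open ψ.open_target hft
  obtain ⟨B, hB⟩ := hχc.exists_bound_of_continuous hχ.continuous
  have hB0 : 0 ≤ B := (norm_nonneg _).trans (hB 0)
  -- With |sin| ≤ 1 and |χ| ≤ B the displacement is at most δB‖a‖ ≤ ε, so it stays in the
  -- ε-thickening, which lies in the target of ψ. The summand 1 keeps the denominator positive.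
  set δ := ε / (B * ‖a‖ + 1) with hδd
  have hδ : 0 < δ := by positivity
  have hδε : δ * (B * ‖a‖) ≤ ε := by
    have h1 : δ * (B * ‖a‖ + 1) = ε := by rw [hδd]; field_simp
    nlinarith
  set Ω := c.symm '' tsupport χ with hΩd
  have hct : tsupport χ ⊆ c.target := fun u hu => (hχs hu).1
  have hΩ : IsCompact Ω := hχc.isCompact.image_of_continuousOn (c.continuousOn_symm.mono hct)
  set W := c.source ∩ φ ⁻¹' ψ.source with hWd
  have hW : IsOpen W := c.open_source.inter (ψ.open_source.preimage hφ.continuous)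
  have hΩW : Ω ⊆ W := by
    rintro _ ⟨u, hu, rfl⟩
    exact ⟨c.map_target (hct hu), (hχs hu).2⟩
  have hχ0 : ∀ x ∈ W, x ∉ Ω → χ (c x) = 0 := by
    intro x hx hxΩ
    refine image_eq_zero_of_notMem_tsupport fun h1 => hxΩ ⟨c x, h1, c.left_inv hx.1⟩
  set Ψ : ℝ → M → N := fun t x => ψ.symm (ψ (φ x) + (δ * Real.sin t * χ (c x)) • a) with hΨd
  set Φ : ℝ → M → N := fun t x => if x ∈ Ω then Ψ t x else φ x with hΦd
  -- The two branches agree on the whole open set W, since χ vanishes on W outside Ω; hence gluing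
  -- preserves smoothness.
  have hΦW : ∀ t, ∀ x ∈ W, Φ t x = Ψ t x := by
    intro t x hx
    by_cases hxΩ : x ∈ Ω
    · simp only [hΦd, if_pos hxΩ]
    · simp only [hΦd, if_neg hxΩ, hΨd, hχ0 x hx hxΩ, mul_zero, zero_smul, add_zero,
        ψ.left_inv hx.2]
  have hΦo : ∀ t, ∀ x ∉ Ω, Φ t x = φ x := fun t x hx => by simp only [hΦd, if_neg hx]
  have htar : ∀ t, ∀ x ∈ W, ψ (φ x) + (δ * Real.sin t * χ (c x)) • a ∈ ψ.target := by
    intro t x hx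
    by_cases hxΩ : x ∈ Ω
    · refine hεt (Metric.mem_cthickening_of_dist_le _ (ψ (φ x)) ε _ ?_ ?_)
      · obtain ⟨u, hu, rfl⟩ := hxΩ
        exact ⟨u, hu, rfl⟩
      · rw [dist_self_add_left, norm_smul, norm_mul, norm_mul, Real.norm_of_nonneg hδ.le]
        calc δ * ‖Real.sin t‖ * ‖χ (c x)‖ * ‖a‖ ≤ δ * 1 * B * ‖a‖ := by
              gcongr
              · exact Real.abs_sin_le_one t
              · exact hB _
          _ ≤ ε := by linarith
    · rw [hχ0 x hx hxΩ, mul_zero, zero_smul, add_zero]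
      exact ψ.map_source hx.2
  have hΦs : ContMDiff (𝓘(ℝ, ℝ).prod (𝓡 m)) (𝓡 n) ∞ (fun p : ℝ × M => Φ p.1 p.2) := by
    rintro ⟨t, x⟩
    by_cases hxΩ : x ∈ Ω
    · have hxW := hΩW hxΩ
      have h1 : ContMDiffAt (𝓘(ℝ, ℝ).prod (𝓡 m)) (𝓡 n) ∞ (fun q : ℝ × M => Ψ q.1 q.2) (t, x) := by
        have hsnd : ContMDiffAt (𝓘(ℝ, ℝ).prod (𝓡 m)) (𝓡 m) ∞ (Prod.snd : ℝ × M → M) (t, x) :=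
          contMDiffAt_snd
        have hfst : ContMDiffAt (𝓘(ℝ, ℝ).prod (𝓡 m)) 𝓘(ℝ, ℝ) ∞ (Prod.fst : ℝ × M → ℝ) (t, x) :=
          contMDiffAt_fst
        have h2 : ContMDiffAt (𝓘(ℝ, ℝ).prod (𝓡 m)) 𝓘(ℝ, EuclideanSpace ℝ (Fin n)) ∞
            (fun q : ℝ × M => ψ (φ q.2)) (t, x) :=
          ContMDiffAt.comp (t, x) (g := fun y => ψ (φ y))
            ((contMDiffAt_chart_of_mem hψ hxW.2).comp x (hφ x)) hsnd
        have h3 : ContMDiffAt (𝓘(ℝ, ℝ).prod (𝓡 m)) 𝓘(ℝ, ℝ) ∞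
            (fun q : ℝ × M => χ (c q.2)) (t, x) :=
          ContMDiffAt.comp (t, x) (g := fun y => χ (c y))
            (hχ.contMDiff.contMDiffAt.comp x (contMDiffAt_chart_of_mem hcat hxW.1)) hsnd
        have h4 : ContMDiffAt (𝓘(ℝ, ℝ).prod (𝓡 m)) 𝓘(ℝ, ℝ) ∞
            (fun q : ℝ × M => δ * Real.sin q.1) (t, x) :=
          ContMDiffAt.comp (t, x) (g := fun t => δ * Real.sin t)
            (contDiff_const.mul Real.contDiff_sin).contMDiff.contMDiffAt hfst
        have h5 : ContMDiffAt (𝓘(ℝ, ℝ).prod (𝓡 m)) 𝓘(ℝ, EuclideanSpace ℝ (Fin n)) ∞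
            (fun q : ℝ × M => ψ (φ q.2) + (δ * Real.sin q.1 * χ (c q.2)) • a) (t, x) :=
          h2.add ((h4.mul h3).smul contMDiffAt_const)
        exact ContMDiffAt.comp (t, x)
          (g := ψ.symm) (contMDiffAt_chart_symm_of_mem hψ (htar t x hxW)) h5
      refine h1.congr_of_eventuallyEq ?_
      filter_upwards [continuousAt_snd.eventually (hW.mem_nhds hxW)] with q hq
      exact hΦW q.1 q.2 hq
    · have h1 : ContMDiffAt (𝓘(ℝ, ℝ).prod (𝓡 m)) (𝓡 n) ∞ (fun q : ℝ × M => φ q.2) (t, x) :=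
        (hφ x).comp (t, x) contMDiffAt_snd
      refine h1.congr_of_eventuallyEq ?_
      filter_upwards [continuousAt_snd.eventually (hΩ.isClosed.isOpen_compl.mem_nhds hxΩ)] with q hq
      exact hΦo q.1 q.2 hq
  refine ⟨δ, hδ, Φ, hΦs, ?_, hΦo, ?_⟩
  · funext x
    by_cases hxΩ : x ∈ Ω
    · rw [hΦW 0 x (hΩW hxΩ)]
      simp only [hΨd, Real.sin_zero, mul_zero, zero_mul, zero_smul, add_zero]
      exact ψ.left_inv (hΩW hxΩ).2
    · exact hΦo 0 x hxΩ
  · intro u hu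
    have hΦ0 : Φ 0 (c.symm u) ∈ ψ.source := by
      rw [hΦW 0 _ ⟨c.map_target hu.1, hu.2⟩]
      exact ψ.map_target (htar 0 _ ⟨c.map_target hu.1, hu.2⟩)
    have h1 := hasDerivAt_slice ((contDiffAt_varMap hΦs hψ (z := ((0 : ℝ), u))
      ⟨hu.1, hΦ0⟩).differentiableAt (by simp))
    have h2 : (fun t => varMap p ψ Φ (t, u))
        = fun t => f u + (δ * Real.sin t * χ u) • a := by
      funext t
      have h3 : Φ t (c.symm u) = ψ.symm (f u + (δ * Real.sin t * χ u) • a) := by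
        rw [hΦW t _ ⟨c.map_target hu.1, hu.2⟩]
        simp only [hΨd, c.right_inv hu.1]
        rfl
      have h4 := htar t _ ⟨c.map_target hu.1, hu.2⟩
      rw [c.right_inv hu.1] at h4
      change ψ (Φ t (c.symm u)) = _
      rw [h3]
      exact ψ.right_inv h4
    rw [h2] at h1
    have h5 : HasDerivAt (fun t => f u + (δ * Real.sin t * χ u) • a)
        ((δ * Real.cos 0 * χ u) • a) 0 :=
      ((((Real.hasDerivAt_sin 0).const_mul δ).mul_const (χ u)).smul_const a).const_add (f u)
    rw [h1.unique h5, Real.cos_zero, mul_one]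

theorem exists_finite_partition [T2Space M] [SecondCountableTopology M] {J : Type*} [Fintype J]
    {Ω : Set M} (hΩ : IsClosed Ω) {U : J → Set M} (hU : ∀ j, IsOpen (U j)) (hΩU : Ω ⊆ ⋃ j, U j) :
    ∃ ρ : J → M → ℝ, (∀ j, ContMDiff (𝓡 m) 𝓘(ℝ, ℝ) ∞ (ρ j)) ∧ (∀ j, tsupport (ρ j) ⊆ U j)
      ∧ (∀ x ∈ Ω, ∑ j, ρ j x = 1) ∧ ∀ x, ∑ j, ρ j x ≤ 1 := by
  have : LocallyCompactSpace M := ChartedSpace.locallyCompactSpace (EuclideanSpace ℝ (Fin m)) M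
  obtain ⟨P, hP⟩ := SmoothPartitionOfUnity.exists_isSubordinate (𝓡 m) hΩ U hU hΩU
  refine ⟨fun j => P j, fun j => (P j).contMDiff, hP, fun x hx => ?_, fun x => ?_⟩
  · rw [← finsum_eq_sum_of_fintype]
    exact P.sum_eq_one hx
  · rw [← finsum_eq_sum_of_fintype]
    exact P.sum_le_one x

variable [T2Space M] [SecondCountableTopology M] [MeasurableSpace M] [BorelSpace M]

/-- The variation of `exists_variation` lives in one chart, so the first variation formula is a
single integral; dividing by δ > 0 leaves the claim. -/
theorem IsConformallyFlatChart.integral_mul_chartBitension_eq_zero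
    (hc : IsConformallyFlatChart h ψ σ)
    (hcov : ∀ q : N, ∃ (ψ : OpenPartialHomeomorph N (EuclideanSpace ℝ (Fin n))) (σ : N → ℝ),
      IsConformallyFlatChart h ψ σ ∧ q ∈ ψ.source)
    (hφ : ContMDiff (𝓡 m) (𝓡 n) ∞ φ) (hbi : IsBiharmonic g h φ)
    {χ : EuclideanSpace ℝ (Fin m) → ℝ} (hχ : ContDiff ℝ ∞ χ)
    (hχc : HasCompactSupport χ) (hχs : tsupport χ ⊆ chartDomain p ψ φ)
    (a : EuclideanSpace ℝ (Fin n)) :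
    ∫ u, χ u * chartBitension g h p ψ σ φ u a = 0 := by
  obtain ⟨δ, hδ, Φ, hΦ, rfl, hoff, hV⟩ :=
    exists_variation hc.mem_maximalAtlas hφ hχ hχc hχs a
  set c := chartAt (EuclideanSpace ℝ (Fin m)) p with hcd
  have hΩ : IsCompact (c.symm '' tsupport χ) := hχc.isCompact.image_of_continuousOn
    (c.continuousOn_symm.mono fun u hu => (hχs hu).1)
  -- A partition indexed by `Unit`: one cutoff that is 1 on the support of the variation.
  obtain ⟨ρ, hρ, hsub, hone, hle⟩ := exists_finite_partition (m := m) (J := Unit) hΩ.isClosed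
    (U := fun _ => c.source ∩ Φ 0 ⁻¹' ψ.source)
    (fun _ => c.open_source.inter (ψ.open_source.preimage hφ.continuous)) (by
      rintro _ ⟨u, hu, rfl⟩
      exact Set.mem_iUnion.2 ⟨(), c.map_target (hχs hu).1, (hχs hu).2⟩)
  have h1 := (hasDerivAt_bienergy (g := g) hcov hΦ hΩ).unique (hbi _ Φ hΩ hΦ rfl hoff)
  rw [setIntegral_deriv_varDensity (fun _ : Unit => hc) hcov hΦ hΩ hoff hρ hsub hone hle,
    Fintype.sum_unique] at h1
  have h2 : ∀ u, (chartDomain p ψ (Φ 0)).indicator (fun u => ρ default (c.symm u)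
      * varBitension g h p ψ σ Φ u) u
      = δ * (χ u * chartBitension g h p ψ σ (Φ 0) u a) := by
    intro u
    by_cases hu : u ∈ tsupport χ
    · have h3 := hone _ ⟨u, hu, rfl⟩
      rw [Fintype.sum_unique] at h3
      rw [Set.indicator_of_mem (hχs hu), h3, varBitension, hV u (hχs hu), chartBitension_smul]
      ring
    · rw [image_eq_zero_of_notMem_tsupport hu]
      by_cases huO : u ∈ chartDomain p ψ (Φ 0)
      · rw [Set.indicator_of_mem huO, varBitension, hV u huO,
          image_eq_zero_of_notMem_tsupport hu, mul_zero, zero_smul, chartBitension_zero]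
        ring
      · rw [Set.indicator_of_notMem huO]
        ring
  rw [integral_congr_ae (Filter.Eventually.of_forall h2), integral_const_mul] at h1
  exact (mul_eq_zero.1 h1).resolve_left hδ.ne'

/-- The fundamental lemma of the calculus of variations gives vanishing almost everywhere;
continuity upgrades it to every point. -/
theorem IsConformallyFlatChart.chartBitension_eq_zero_of_isBiharmonic
    (hc : IsConformallyFlatChart h ψ σ)
    (hcov : ∀ q : N, ∃ (ψ : OpenPartialHomeomorph N (EuclideanSpace ℝ (Fin n))) (σ : N → ℝ),
      IsConformallyFlatChart h ψ σ ∧ q ∈ ψ.source)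
    (hφ : ContMDiff (𝓡 m) (𝓡 n) ∞ φ) (hbi : IsBiharmonic g h φ)
    {u : EuclideanSpace ℝ (Fin m)} (hu : u ∈ chartDomain p ψ φ) (a : EuclideanSpace ℝ (Fin n)) :
    chartBitension g h p ψ σ φ u a = 0 := by
  have hO : IsOpen (chartDomain (m := m) p ψ φ) := isOpen_chartDomain p hφ.continuous
  have hcont : ContinuousOn (fun u => chartBitension g h p ψ σ φ u a) (chartDomain p ψ φ) :=
    fun u hu => (hc.contDiffAt_chartBitension hφ hu a).continuousAt.continuousWithinAt
  have h1 := hO.ae_eq_zero_of_integral_contDiff_smul_eq_zero (μ := volume)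
    (hcont.locallyIntegrableOn hO.measurableSet) fun χ hχ hχc hχs =>
      hc.integral_mul_chartBitension_eq_zero hcov hφ hbi hχ hχc hχs a
  exact Measure.eqOn_open_of_ae_eq ((ae_restrict_iff' hO.measurableSet).2 h1) hO hcont
    continuousOn_const hu

/-- Finitely many chart domains cover Ω; with a subordinate partition each integrand of the first
variation formula is zero. -/
theorem isBiharmonic_of_chartBitension_eq_zero
    (hcov : ∀ q : N, ∃ (ψ : OpenPartialHomeomorph N (EuclideanSpace ℝ (Fin n))) (σ : N → ℝ),
      IsConformallyFlatChart h ψ σ ∧ q ∈ ψ.source)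
    (hφ : ContMDiff (𝓡 m) (𝓡 n) ∞ φ)
    (h0 : ∀ p : M, ∃ (ψ : OpenPartialHomeomorph N (EuclideanSpace ℝ (Fin n))) (σ : N → ℝ),
      IsConformallyFlatChart h ψ σ ∧ φ p ∈ ψ.source
        ∧ ∀ u ∈ chartDomain p ψ φ, ∀ a, chartBitension g h p ψ σ φ u a = 0) :
    IsBiharmonic g h φ := by
  rintro Ω Φ hΩ hΦ rfl hoff
  choose ψ σ hc hs h0 using h0
  set W : M → Set M := fun x => (chartAt (EuclideanSpace ℝ (Fin m)) x).source
    ∩ Φ 0 ⁻¹' (ψ x).source with hWd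
  have hW : ∀ x, IsOpen (W x) := fun x => (chartAt (EuclideanSpace ℝ (Fin m)) x).open_source.inter
    ((ψ x).open_source.preimage hφ.continuous)
  obtain ⟨t, -, ht⟩ := hΩ.elim_nhds_subcover W fun x _ =>
    (hW x).mem_nhds ⟨mem_chart_source _ x, hs x⟩
  obtain ⟨ρ, hρ, hsub, hone, hle⟩ := exists_finite_partition (m := m) (J := t) hΩ.isClosed
    (U := fun j => W j) (fun j => hW j) (by
      refine ht.trans fun x hx => ?_
      obtain ⟨y, hy, hxy⟩ := Set.mem_iUnion₂.1 hx
      exact Set.mem_iUnion.2 ⟨⟨y, hy⟩, hxy⟩)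
  have h1 := hasDerivAt_bienergy (g := g) hcov hΦ hΩ
  rw [setIntegral_deriv_varDensity (fun j : t => hc j) hcov hΦ hΩ hoff hρ hsub hone hle,
    Finset.sum_eq_zero] at h1
  · exact h1
  · intro j _
    refine (integral_congr_ae (Filter.Eventually.of_forall fun u => ?_)).trans
      (integral_zero _ ℝ)
    refine Set.indicator_apply_eq_zero.2 fun hu => ?_
    rw [varBitension, h0 j u hu, mul_zero]

end Biharmonic

/-! ### The equivalence for hypersurfaces -/

section Main

variable {m : ℕ} {M N : Type*} [TopologicalSpace M] [T2Space M] [SecondCountableTopology M]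
  [ChartedSpace (EuclideanSpace ℝ (Fin m)) M] [IsManifold (𝓡 m) ∞ M]
  [MeasurableSpace M] [BorelSpace M] [TopologicalSpace N]
  [ChartedSpace (EuclideanSpace ℝ (Fin (m + 1))) N] [IsManifold (𝓡 (m + 1)) ∞ N]

/-- A hypersurface of a conformally flat space is biharmonic if and only if the normal and the
tangential component of its bitension field vanish. -/
theorem isBiharmonic_iff (hm : 1 ≤ m) (g : SmoothMetric m M) (h : SmoothMetric (m + 1) N)
    {κ : Type*} (ψ : κ → OpenPartialHomeomorph N (EuclideanSpace ℝ (Fin (m + 1))))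
    (σ : κ → N → ℝ) (hψ : ∀ k, IsConformallyFlatChart h (ψ k) (σ k))
    (hψ_cover : ∀ q : N, ∃ k, q ∈ (ψ k).source)
    (φ : M → N) (hφ : IsIsometricImmersion g h φ)
    {ι : Type*} (V : ι → Set M) (hV : ∀ i, IsOpen (V i)) (hV_cover : ∀ x : M, ∃ i, x ∈ V i)
    (ξ : ι → (x : M) → TangentSpace (𝓡 (m + 1)) (φ x))
    (hξ : ∀ i, IsUnitNormalOn (m := m) h φ (V i) (ξ i))
    (H : ι → M → ℝ) (hH : ∀ i, ∀ x ∈ V i, meanCurvatureVector g h φ x = H i x • ξ i x) :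
    IsBiharmonic g h φ ↔ ∀ (i : ι) (k : κ) (x : M), x ∈ V i → φ x ∈ (ψ k).source →
      normalPart g h (σ k) φ (ξ i) (H i) x = 0
        ∧ tangentialPart g h (σ k) φ (ξ i) (H i) x = 0 := by
  have hcov : ∀ q : N, ∃ (ψ : OpenPartialHomeomorph N (EuclideanSpace ℝ (Fin (m + 1))))
      (σ : N → ℝ), IsConformallyFlatChart h ψ σ ∧ q ∈ ψ.source := fun q => by
    obtain ⟨k, hk⟩ := hψ_cover q
    exact ⟨ψ k, σ k, hψ k, hk⟩
  constructor
  · intro hbi i k x hxV hφx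
    have hx := mem_chart_source (EuclideanSpace ℝ (Fin m)) x
    refine (bitensionForm_eq_zero_iff hm (hψ k) hφ (hV i) (hξ i) (hH i) rfl hx hφx hxV).1 fun v =>
      (hψ k).chartBitension_eq_zero_of_isBiharmonic hcov hφ.contMDiff hbi
        ⟨(chartAt (EuclideanSpace ℝ (Fin m)) x).map_source hx, ?_⟩ v
    rw [(chartAt (EuclideanSpace ℝ (Fin m)) x).left_inv hx]
    exact hφx
  · intro h0
    refine isBiharmonic_of_chartBitension_eq_zero hcov hφ.contMDiff fun p => ?_
    obtain ⟨k, hk⟩ := hψ_cover (φ p)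
    refine ⟨ψ k, σ k, hψ k, hk, fun u hu a => ?_⟩
    -- The ambient chart is fixed by p, while the member of the cover carrying ξ is chosen anew at
    -- each point. This is harmless because `chartBitension` does not involve ξ.
    obtain ⟨i, hi⟩ := hV_cover ((chartAt (EuclideanSpace ℝ (Fin m)) p).symm u)
    have h1 := (bitensionForm_eq_zero_iff hm (hψ k) hφ (hV i) (hξ i) (hH i) rfl
      ((chartAt (EuclideanSpace ℝ (Fin m)) p).map_target hu.1) hu.2 hi).2 (h0 i k _ hi hu.2) a
    rw [(chartAt (EuclideanSpace ℝ (Fin m)) p).right_inv hu.1] at h1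
    exact h1

end Main

end HypersurfaceGeometry

end

open HypersurfaceGeometry in
/-- The unit normal fields `ξ i`, with `η = H i • ξ i`, live on the members `V i` of an open cover
of the hypersurface, and the conformal factors `σ k` on the domains of conformally flat charts
`ψ k` covering the ambient space. A globally defined `ξ` or `σ` is the case of a constant family. -/
theorem theorem2p2 {m : ℕ} (hm : 1 ≤ m) {M C : Type*}
    [TopologicalSpace M] [T2Space M] [SecondCountableTopology M]
    [ChartedSpace (EuclideanSpace ℝ (Fin m)) M] [IsManifold (𝓡 m) ∞ M]
    [MeasurableSpace M] [BorelSpace M]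
    [TopologicalSpace C] [T2Space C] [SecondCountableTopology C]
    [ChartedSpace (EuclideanSpace ℝ (Fin (m + 1))) C] [IsManifold (𝓡 (m + 1)) ∞ C]
    (g : SmoothMetric m M) (h : SmoothMetric (m + 1) C)
    {κ : Type*} (ψ : κ → OpenPartialHomeomorph C (EuclideanSpace ℝ (Fin (m + 1))))
    (σ : κ → C → ℝ) (hψ : ∀ k, IsConformallyFlatChart h (ψ k) (σ k))
    (hψ_cover : ∀ q : C, ∃ k, q ∈ (ψ k).source)
    (φ : M → C) (hφ : IsIsometricImmersion g h φ)
    {ι : Type*} (V : ι → Set M) (hV : ∀ i, IsOpen (V i)) (hV_cover : ∀ x : M, ∃ i, x ∈ V i)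
    (ξ : ι → (x : M) → TangentSpace (𝓡 (m + 1)) (φ x))
    (hξ : ∀ i, IsUnitNormalOn (m := m) h φ (V i) (ξ i))
    (H : ι → M → ℝ) (hH : ∀ i, ∀ x ∈ V i, meanCurvatureVector g h φ x = H i x • ξ i x) :
    IsBiharmonic g h φ ↔
      ∀ (i : ι) (k : κ) (x : M), x ∈ V i → φ x ∈ (ψ k).source →
        laplacian g (H i) x - H i x * shapeNormSq g h φ (ξ i) x
            + H i x * (laplacian h (σ k) (φ x)
              + ((m : ℝ) - 1) * (hess h (σ k) (φ x) (ξ i x) (ξ i x)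
                - normalDeriv φ (ξ i) (σ k) x ^ 2
                + h.inner (φ x) (grad h (σ k) (φ x)) (grad h (σ k) (φ x)))) = 0
        ∧ (2 : ℝ) • shapeOperator g h φ (ξ i) x (grad g (H i) x)
            + ((m : ℝ) / 2) • grad g (fun y => H i y ^ 2) x
            - (2 * ((m : ℝ) - 1) * H i x) •
              (grad g (normalDeriv φ (ξ i) (σ k)) x
                - normalDeriv φ (ξ i) (σ k) x • grad g (fun y => σ k (φ y)) x
                + shapeOperator g h φ (ξ i) x (grad g (fun y => σ k (φ y)) x)) = 0 := by
  -- `normalPart` and `tangentialPart` unfold to the displayed left-hand sides.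
  exact isBiharmonic_iff hm g h ψ σ hψ hψ_cover φ hφ V hV hV_cover ξ hξ H hH
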